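/- **Corollary.** If the Negative Weight Triangle Parity problem is subcubic-equivalent to the Negative Weight Triangle problem, then the All-Pairs Shortest Paths problem (APSP) is 3SUM-hard. Here the notions are as follows. *Problems.* A weighted graph is a directed graph on $n\ge 1$ nodes without self-loops, with integer edge weights; its size is $n$. A triangle is a directed cycle $u\to v\to x\to u$ on three distinct nodes (counted once, irrespective of its starting node), and its weight is the sum of its three edge weights. *Negative Weight Triangle*: decide whether there is a triangle of negative weight. *Negative Weight Triangle Parity*: compute the parity of the number of triangles of negative weight. *APSP*: given a weighted graph without negative cycles, compute the distance $d(u,v)$ for all ordered pairs of nodes (reporting which $v$ are not reachable from $u$). *3SUM*: given $n\ge 1$ integers (size $n$), decide whether there are three of them, at distinct positions, that sum to zero. All weights and numbers are bounded in absolute value by a polynomial in the size: for $c\in\mathbb N$, the problem $A_c$ is $A$ restricted to instances whose numbers are in $[-n^c,n^c]$, where $n$ is the size. *Reductions.* Algorithms are programs for a random access machine with fair coin flips and with logarithmic cost (which agrees, up to factors polylogarithmic in $n$, with unit cost on words of $O(\log n)$ bits for polynomial running times); an oracle call takes unit time. For real $a,b$, an $(a,b)$-*fine-grained reduction* from $A$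 to $B$ consists of, for every $c\in\mathbb N$, some $d\in\mathbb N$ and a randomized algorithm with an oracle for $B_d$ such that on every instance of $A_c$, of size $n$, 1. the algorithm outputs the correct answer with probability at least $2/3$, and for every outcome of the coin flips it halts within time $O(n^{a-\gamma})$, for some constant $\gamma>0$; 2. for every $\varepsilon>0$ there is $\varepsilon'>0$ such that, for every outcome of the coin flips, the sizes $n_1,\dots,n_t$ of the instances of $B_d$ on which the oracle is called satisfy $\sum_{i=1}^t n_i^{\,b-\varepsilon}=O(n^{a-\varepsilon'})$. The constants in the $O$-notation do not depend on the instance. Two problems are *subcubic-equivalent* if there are $(3,3)$-fine-grained reductions from each of them to the other. *APSP is 3SUM-hard* means that there is a $(2,3)$-fine-grained reduction from 3SUM to APSP. -/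

import Mathlib

namespace FineGrained

/-! ## Computational problems -/

/-- A computational problem on integer data with a unique answer. An instance `I` has a size
`size I` (the parameter `n` in which running times are measured), a promise, and a list of words
`enc I` encoding it; the answer is the list of words `ans I`. `Within I M` says that all the numbers
(weights) of the instance lie in `[-M, M]`. -/
structure Problem where
  Inst : Type
  size : Inst → ℕ
  Within : Inst → ℕ → Prop
  Promise : Inst → Prop
  enc : Inst → List ℤ
  ans : Inst → List ℤ

/-- The admissible instances when the polynomial bound on the weights is `M = n ^ c`. -/
def Problem.Admissible (A : Problem) (c : ℕ) (I : A.Inst) : Prop :=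
  1 ≤ A.size I ∧ A.Promise I ∧ A.Within I (A.size I ^ c)

/-! ## Randomized oracle random access machines with logarithmic cost -/

/-- Arithmetic and comparison instructions (comparisons return `0` or `1`). -/
inductive Op
  | add | sub | mul | div | mod | lt | eq

def Op.eval : Op → ℤ → ℤ → ℤ
  | .add, x, y => x + y
  | .sub, x, y => x - y
  | .mul, x, y => x * y
  | .div, x, y => x / y
  | .mod, x, y => x % y
  | .lt, x, y => if x < y then 1 else 0
  | .eq, x, y => if x = y then 1 else 0

/-- Expressions: constants, registers, operations, and memory access `arr a [e]`. The memory is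
split into finitely many arrays with fixed names; the index into an array is computed. -/
inductive Expr
  | lit (z : ℤ)
  | var (x : ℕ)
  | op (o : Op) (e f : Expr)
  | get (a : ℕ) (e : Expr)

/-- Programs. `flip x` puts a fair random bit into register `x`; `query a b` calls the oracle on the
instance stored in array `a` and has the answer written to array `b`. -/
inductive Cmd
  | skip
  | assign (x : ℕ) (e : Expr)
  | store (a : ℕ) (i e : Expr)
  | flip (x : ℕ)
  | query (a b : ℕ)
  | seq (p q : Cmd)
  | cond (e : Expr) (p q : Cmd)
  | loop (e : Expr) (p : Cmd)

/-- Contents of the registers and of the memory, the time used so far, and the sizes of the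
oracle queries made so far. -/
structure State where
  var : ℕ → ℤ
  arr : ℕ → ℤ → ℤ
  time : ℕ
  queries : List ℕ

/-- The bit length of an integer. -/
def bits (z : ℤ) : ℕ := z.natAbs.size

def Expr.eval (s : State) : Expr → ℤ
  | .lit z => z
  | .var x => s.var x
  | .op o e f => o.eval (e.eval s) (f.eval s)
  | .get a e => s.arr a (e.eval s)

/-- Logarithmic cost: handling a number or an address costs its bit length, an operation costs at
most the product of the bit lengths of the operands (schoolbook multiplication and division). -/
def Expr.cost (s : State) : Expr → ℕ
  | .lit z => 1 + bits z
  | .var x => 1 + bits (s.var x)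
  | .op _ e f => e.cost s + f.cost s + (1 + bits (e.eval s)) * (1 + bits (f.eval s))
  | .get a e => e.cost s + 1 + bits (s.arr a (e.eval s))

def State.tick (s : State) (k : ℕ) : State := { s with time := s.time + k }

def State.setVar (s : State) (x : ℕ) (z : ℤ) : State :=
  { s with var := Function.update s.var x z }

def State.setCell (s : State) (a : ℕ) (i z : ℤ) : State :=
  { s with arr := Function.update s.arr a (Function.update (s.arr a) i z) }

/-- The cells `0, 1, 2, …` of `m` contain the words of `l`. -/
def Holds (m : ℤ → ℤ) (l : List ℤ) : Prop :=
  ∀ (i : ℕ) (h : i < l.length), m i = l[i]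

/-- Overwrite the cells `0, 1, 2, …` of `m` by the words of `l`. -/
def overwrite (m : ℤ → ℤ) (l : List ℤ) : ℤ → ℤ :=
  fun k => if 0 ≤ k then l.getD k.toNat (m k) else m k

def State.answer (s : State) (b : ℕ) (l : List ℤ) (n : ℕ) : State :=
  { s with
    arr := Function.update s.arr b (overwrite (s.arr b) l)
    queries := n :: s.queries }

/-- `Exec B c p s μ`: started in state `s` and equipped with an oracle that solves `B`, the program
`p` halts for every outcome of its coin flips, and the final state has distribution `μ`. Every
oracle query made must be an instance of `B` satisfying the promise, with weights bounded by the
`c`-th power of its size; a call of the oracle takes one unit of time. -/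
inductive Exec (B : Problem) (c : ℕ) : Cmd → State → PMF State → Prop
  | skip (s : State) : Exec B c .skip s (PMF.pure (s.tick 1))
  | assign (s : State) (x : ℕ) (e : Expr) :
      Exec B c (.assign x e) s (PMF.pure ((s.tick (1 + e.cost s)).setVar x (e.eval s)))
  | store (s : State) (a : ℕ) (i e : Expr) :
      Exec B c (.store a i e) s
        (PMF.pure ((s.tick (1 + i.cost s + e.cost s)).setCell a (i.eval s) (e.eval s)))
  | flip (s : State) (x : ℕ) :
      Exec B c (.flip x) s
        ((PMF.uniformOfFintype Bool).map fun r => (s.tick 1).setVar x (if r then 1 else 0))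
  | query (s : State) (a b : ℕ) (I : B.Inst) (hI : B.Admissible c I)
      (h : Holds (s.arr a) (B.enc I)) :
      Exec B c (.query a b) s (PMF.pure ((s.tick 1).answer b (B.ans I) (B.size I)))
  | seq (s : State) (p q : Cmd) (μ : PMF State) (ν : State → PMF State)
      (hp : Exec B c p s μ) (hq : ∀ t ∈ μ.support, Exec B c q t (ν t)) :
      Exec B c (.seq p q) s (μ.bind ν)
  | condTrue (s : State) (e : Expr) (p q : Cmd) (μ : PMF State) (he : e.eval s ≠ 0)
      (hp : Exec B c p (s.tick (1 + e.cost s)) μ) : Exec B c (.cond e p q) s μ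
  | condFalse (s : State) (e : Expr) (p q : Cmd) (μ : PMF State) (he : e.eval s = 0)
      (hq : Exec B c q (s.tick (1 + e.cost s)) μ) : Exec B c (.cond e p q) s μ
  | loopDone (s : State) (e : Expr) (p : Cmd) (he : e.eval s = 0) :
      Exec B c (.loop e p) s (PMF.pure (s.tick (1 + e.cost s)))
  | loopStep (s : State) (e : Expr) (p : Cmd) (μ : PMF State) (ν : State → PMF State)
      (he : e.eval s ≠ 0) (hp : Exec B c p (s.tick (1 + e.cost s)) μ)
      (hq : ∀ t ∈ μ.support, Exec B c (.loop e p) t (ν t)) :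
      Exec B c (.loop e p) s (μ.bind ν)

/-- The initial state: array `0` contains the input, everything else is zero. -/
def start (l : List ℤ) : State where
  var := fun _ => 0
  arr := Function.update (fun _ _ => 0) 0 (overwrite (fun _ => 0) l)
  time := 0
  queries := []

/-! ## Fine-grained reductions -/

/-- An `(a, b)`-fine-grained (randomized) reduction from `A` to `B`. The weights of the instances
are polynomially bounded: for every exponent `c` for `A` there are an exponent `d` for `B` and a
program `p` with oracle `B` that
* on every instance of `A` of size `n`, returns in array `1` the correct answer with probability
  at least `2/3`, and always runs in time `O(n ^ (a - γ))` for some `γ > 0`;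
* for every `ε > 0` there is `ε' > 0` such that the sizes `n₁, …, n_t` of the queries always
  satisfy `∑ nᵢ ^ (b - ε) = O(n ^ (a - ε'))`. -/
def FGReduction (a b : ℝ) (A B : Problem) : Prop :=
  ∀ c : ℕ, ∃ (d : ℕ) (p : Cmd),
    (∃ γ > (0 : ℝ), ∃ C : ℝ, ∀ I : A.Inst, A.Admissible c I →
      ∃ μ : PMF State, Exec B d p (start (A.enc I)) μ ∧
        2 / 3 ≤ μ.toOuterMeasure {s | Holds (s.arr 1) (A.ans I)} ∧
        ∀ s ∈ μ.support, (s.time : ℝ) ≤ C * (A.size I : ℝ) ^ (a - γ)) ∧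
    (∀ ε > (0 : ℝ), ∃ ε' > (0 : ℝ), ∃ C : ℝ, ∀ I : A.Inst, A.Admissible c I →
      ∀ μ : PMF State, Exec B d p (start (A.enc I)) μ → ∀ s ∈ μ.support,
        (s.queries.map fun m => (m : ℝ) ^ (b - ε)).sum ≤ C * (A.size I : ℝ) ^ (a - ε'))

/-- Subcubic reductions in both directions. -/
def SubcubicEquivalent (A B : Problem) : Prop :=
  FGReduction 3 3 A B ∧ FGReduction 3 3 B A

/-! ## Weighted graphs -/

/-- A directed graph with vertex set `Fin n` and integer edge weights; `w u v = none` means that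
there is no edge from `u` to `v`. -/
structure WGraph where
  n : ℕ
  w : Fin n → Fin n → Option ℤ
  loopless : ∀ u, w u u = none

/-- All edge weights are in `[-M, M]`. -/
def WGraph.Within (G : WGraph) (M : ℕ) : Prop :=
  ∀ u v a, G.w u v = some a → |a| ≤ (M : ℤ)

/-- `u → v → x → u` is a directed triangle of total weight `a`. -/
def WGraph.Triangle (G : WGraph) (u v x : Fin G.n) (a : ℤ) : Prop :=
  ∃ p q r, G.w u v = some p ∧ G.w v x = some q ∧ G.w x u = some r ∧ a = p + q + r

/-- The number of triangles of negative weight; each triangle is counted once, as a cyclic triple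
starting at its smallest vertex. -/
noncomputable def WGraph.numNegTriangles (G : WGraph) : ℕ :=
  {t : Fin G.n × Fin G.n × Fin G.n |
    t.1 < t.2.1 ∧ t.1 < t.2.2 ∧ ∃ a < 0, G.Triangle t.1 t.2.1 t.2.2 a}.ncard

/-- There is a walk from `u` to `v` of total weight `a`. -/
inductive WGraph.Walk (G : WGraph) : Fin G.n → Fin G.n → ℤ → Prop
  | nil (u : Fin G.n) : G.Walk u u 0
  | cons (u v x : Fin G.n) (a b : ℤ) (h : G.w u v = some a) (t : G.Walk v x b) :
      G.Walk u x (a + b)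

def WGraph.NoNegCycle (G : WGraph) : Prop := ∀ u a, G.Walk u u a → 0 ≤ a

open Classical in
/-- The distance from `u` to `v`; `none` if `v` cannot be reached from `u`. -/
noncomputable def WGraph.dist (G : WGraph) (u v : Fin G.n) : Option ℤ :=
  if ∃ a, G.Walk u v a then some (sInf {a | G.Walk u v a}) else none

/-- Row by row, each entry of the matrix takes two words: `0, 0` for `none` and `1, a` for
`some a`. -/
def encMatrix (n : ℕ) (f : Fin n → Fin n → Option ℤ) : List ℤ :=
  List.ofFn fun k : Fin (n * n * 2) =>
    match f k.divNat.divNat k.divNat.modNat with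
    | none => 0
    | some a => if k.modNat = 0 then 1 else a

def WGraph.enc (G : WGraph) : List ℤ := (G.n : ℤ) :: encMatrix G.n G.w

/-! ## The problems -/

open Classical in
/-- Negative Weight Triangle: is there a triangle of negative weight? -/
noncomputable def NWT : Problem where
  Inst := WGraph
  size := WGraph.n
  Within := WGraph.Within
  Promise := fun _ => True
  enc := WGraph.enc
  ans := fun G => [if ∃ u v x, ∃ a < 0, G.Triangle u v x a then 1 else 0]

/-- Negative Weight Triangle Parity: the parity of the number of triangles of negative weight. -/
noncomputable def NWTParity : Problem where
  Inst := WGraph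
  size := WGraph.n
  Within := WGraph.Within
  Promise := fun _ => True
  enc := WGraph.enc
  ans := fun G => [((G.numNegTriangles % 2 : ℕ) : ℤ)]

/-- All-Pairs Shortest Paths in directed graphs without negative cycles: all distances. -/
noncomputable def APSP : Problem where
  Inst := WGraph
  size := WGraph.n
  Within := WGraph.Within
  Promise := WGraph.NoNegCycle
  enc := WGraph.enc
  ans := fun G => encMatrix G.n G.dist

/-- A sequence of `n` integers. -/
structure Numbers where
  n : ℕ
  x : Fin n → ℤ

open Classical in
/-- 3SUM: are there three of the `n` given numbers that sum to zero? -/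
noncomputable def ThreeSUM : Problem where
  Inst := Numbers
  size := Numbers.n
  Within := fun X M => ∀ i, |X.x i| ≤ (M : ℤ)
  Promise := fun _ => True
  enc := fun X => (X.n : ℤ) :: List.ofFn X.x
  ans := fun X => [if ∃ i j k, i < j ∧ j < k ∧ X.x i + X.x j + X.x k = 0 then 1 else 0]

/-- A problem with conjectured running time `n ^ b` is 3SUM-hard if there is a
`(2, b)`-fine-grained reduction from 3SUM to it. -/
def ThreeSUMHard (b : ℝ) (B : Problem) : Prop := FGReduction 2 b ThreeSUM B

end FineGrained

/-!
A subcubic reduction from the parity of the number of negative triangles to Negative Weight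
Triangle makes that parity computable in subcubic time with shortest path queries, and a parity
oracle suffices for 3SUM: with random restrictions it detects triangles of weight zero, which encode
zero sums.

**From sums to triangles.** The `n` numbers are hashed by a random linear function into
`S * S ≥ 12 * n` values, where `S` is a power of two of order `√n`, and are coloured randomly with
four colours, of which three are used. A bucket for each colour and hash value holds one number. If
`x + y + z = 0`, the hash values of `x`, `y`, `z` add up to zero modulo `S * S` up to a carry
`o < 3` (`exists_carry`), and with constant probability `x`, `y`, `z` have the colours `0`, `1`, `2`
and share their buckets only with equal numbers (`card_good`, `card_colour`). Split the hash values
of colour `0` into `S` blocks of length `S`. For each block `r` and carry `o` there is a graph on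
`4 * S` nodes in three layers, `bucketGraph`, whose edge weights are the contents of buckets and
whose triangles run through all triples of buckets with hash values that are compatible with `r` and
`o`. Hence a zero sum yields a triangle of weight zero in one of the `3 * S` graphs
(`exists_zeroFamily_nonempty`), while every such triangle comes from a zero sum
(`exists_sum_of_succeeds`).

**From triangles to parities.** If only a random subset `s` of the nodes is kept, the parity of the
number of triangles of weight zero is the value at `s` of a polynomial over the field with two
elements, of degree at most `3`, whose monomials are these triangles. If there is one at all, the
parity is odd with probability at least `1 / 8` (`two_pow_le_card_odd`). As the weights are integers,
this parity is the difference of the parities of negative triangles before and after all triangles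
have been made lighter by one (`numNegTriangles_shift`). One trial detects a zero sum with
probability at least `1 / 1024` (`avg_trial_le`), and constantly many trials suffice
(`trials_error`).

**From parities to shortest paths.** The program given by the reduction is simulated (`sim`); a query
for negative triangles of `G` becomes a shortest path query on four copies of the vertex set of `G`,
with edges from each copy to the next: negative triangles through `u` correspond to walks of negative
weight from the first to the last copy of `u` (`value_dist_neg_iff`), and closed walks are trivial.
Stores are logged so that the memory can be cleaned after a run in time proportional to its use
(`cleanup`), as the same cells serve for all runs. The majority of logarithmically many runs is
wrong with inverse polynomial probability (`wp_call`).

**Cost.** A subcubic cost `m ^ (3 - γ)` on the graphs of size `m = 4 * S` adds up to about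
`m ^ (4 - γ) ≈ n ^ (2 - γ / 2)` for `O(m)` graphs. The statement `WP` bounds, for one program,
the expectation of a potential at the end together with the running time plus the sum of `f q` over
the sizes `q` of the queries, for an arbitrary weight function `f`. With `f = 0` this gives the
running time, and with `f q = ⌈q ^ (3 - ε)⌉` the condition on the queries (`exists_solve_le`). A
program has only one output distribution (`exec_unique`), so both bounds concern the same runs.
-/

namespace FineGrained
open scoped ENNReal

/-! ### Expressions over a memory -/

/-- The part of a state that a program can read. -/
structure Mem where
  var : ℕ → ℤ
  arr : ℕ → ℤ → ℤ

/-- The memory of a state. -/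
def State.mem (s : State) : Mem := ⟨s.var, s.arr⟩

/-- Register `x` is set to `z`. -/
def Mem.set (σ : Mem) (x : ℕ) (z : ℤ) : Mem := ⟨Function.update σ.var x z, σ.arr⟩

/-- Cell `i` of array `a` is set to `z`. -/
def Mem.put (σ : Mem) (a : ℕ) (i z : ℤ) : Mem :=
  ⟨σ.var, Function.update σ.arr a (Function.update (σ.arr a) i z)⟩

@[simp] theorem Mem.set_var (σ : Mem) (x y : ℕ) (z : ℤ) :
    (σ.set x z).var y = if y = x then z else σ.var y := by
  simp [Mem.set, Function.update_apply]

@[simp] theorem Mem.set_arr (σ : Mem) (x : ℕ) (z : ℤ) : (σ.set x z).arr = σ.arr := rfl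

@[simp] theorem Mem.put_var (σ : Mem) (a : ℕ) (i z : ℤ) : (σ.put a i z).var = σ.var := rfl

@[simp] theorem Mem.put_arr (σ : Mem) (a b : ℕ) (i j z : ℤ) :
    (σ.put a i z).arr b j = if b = a ∧ j = i then z else σ.arr b j := by
  by_cases h : b = a
  · subst h; simp [Mem.put, Function.update_apply]
  · simp [Mem.put, h]

theorem Mem.put_arr_ne (σ : Mem) {a b : ℕ} (i z : ℤ) (h : b ≠ a) :
    (σ.put a i z).arr b = σ.arr b := by simp [Mem.put, h]

@[simp] theorem State.mem_var (s : State) : s.mem.var = s.var := rfl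
@[simp] theorem State.mem_arr (s : State) : s.mem.arr = s.arr := rfl

/-- The value of an expression, as a function of the memory only. -/
def Expr.ev (σ : Mem) : Expr → ℤ
  | .lit z => z
  | .var x => σ.var x
  | .op o e f => o.eval (e.ev σ) (f.ev σ)
  | .get a e => σ.arr a (e.ev σ)

/-- The cost of an expression, as a function of the memory only. -/
def Expr.co (σ : Mem) : Expr → ℕ
  | .lit z => 1 + bits z
  | .var x => 1 + bits (σ.var x)
  | .op _ e f => e.co σ + f.co σ + (1 + bits (e.ev σ)) * (1 + bits (f.ev σ))
  | .get a e => e.co σ + 1 + bits (σ.arr a (e.ev σ))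

theorem Expr.eval_eq (s : State) (e : Expr) : e.eval s = e.ev s.mem := by
  induction e with
  | lit z => rfl
  | var x => rfl
  | op o e f he hf => simp [Expr.eval, Expr.ev, he, hf]
  | get a e he => simp [Expr.eval, Expr.ev, he]

theorem Expr.cost_eq (s : State) (e : Expr) : e.cost s = e.co s.mem := by
  induction e with
  | lit z => rfl
  | var x => rfl
  | op o e f he hf => simp [Expr.cost, Expr.co, he, hf, Expr.eval_eq]
  | get a e he => simp [Expr.cost, Expr.co, he, Expr.eval_eq]

instance : Add Expr := ⟨.op .add⟩
instance : Sub Expr := ⟨.op .sub⟩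
instance : Mul Expr := ⟨.op .mul⟩
instance : Div Expr := ⟨.op .div⟩
instance : Mod Expr := ⟨.op .mod⟩
instance (n : ℕ) : OfNat Expr n := ⟨.lit n⟩

@[simp] theorem Expr.ev_add (σ : Mem) (e f : Expr) : (e + f).ev σ = e.ev σ + f.ev σ := rfl
@[simp] theorem Expr.ev_sub (σ : Mem) (e f : Expr) : (e - f).ev σ = e.ev σ - f.ev σ := rfl
@[simp] theorem Expr.ev_mul (σ : Mem) (e f : Expr) : (e * f).ev σ = e.ev σ * f.ev σ := rfl
@[simp] theorem Expr.ev_div (σ : Mem) (e f : Expr) : (e / f).ev σ = e.ev σ / f.ev σ := rfl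
@[simp] theorem Expr.ev_mod (σ : Mem) (e f : Expr) : (e % f).ev σ = e.ev σ % f.ev σ := rfl
@[simp] theorem Expr.ev_lt (σ : Mem) (e f : Expr) :
    (Expr.op .lt e f).ev σ = if e.ev σ < f.ev σ then 1 else 0 := rfl
@[simp] theorem Expr.ev_eq (σ : Mem) (e f : Expr) :
    (Expr.op .eq e f).ev σ = if e.ev σ = f.ev σ then 1 else 0 := rfl
@[simp] theorem Expr.ev_ofNat (σ : Mem) (n : ℕ) [n.AtLeastTwo] :
    (ofNat(n) : Expr).ev σ = (ofNat(n) : ℤ) := rfl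
@[simp] theorem Expr.ev_zero (σ : Mem) : (0 : Expr).ev σ = 0 := rfl
@[simp] theorem Expr.ev_one (σ : Mem) : (1 : Expr).ev σ = 1 := rfl
@[simp] theorem Expr.ev_var (σ : Mem) (x : ℕ) : (Expr.var x).ev σ = σ.var x := rfl
@[simp] theorem Expr.ev_get (σ : Mem) (a : ℕ) (e : Expr) :
    (Expr.get a e).ev σ = σ.arr a (e.ev σ) := rfl

/-! ### Bit lengths and the cost of expressions -/

theorem bits_le_iff {z : ℤ} {k : ℕ} : bits z ≤ k ↔ z.natAbs < 2 ^ k := Nat.size_le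

theorem natAbs_lt_two_pow_bits (z : ℤ) : z.natAbs < 2 ^ bits z := bits_le_iff.1 le_rfl

theorem bits_mono {z : ℤ} {b : ℕ} (h : |z| ≤ b) : bits z ≤ b.size := by
  apply Nat.size_le_size
  have := Int.natCast_natAbs z
  omega

theorem bits_op (o : Op) (x y : ℤ) : bits (o.eval x y) ≤ bits x + bits y + 1 := by
  rw [bits_le_iff]
  have hx := natAbs_lt_two_pow_bits x
  have hy := natAbs_lt_two_pow_bits y
  have h1 : 2 ^ bits x ≤ 2 ^ (bits x + bits y) := Nat.pow_le_pow_right (by norm_num) (by omega)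
  have h2 : 2 ^ bits y ≤ 2 ^ (bits x + bits y) := Nat.pow_le_pow_right (by norm_num) (by omega)
  have h0 : 1 ≤ 2 ^ (bits x + bits y) := Nat.one_le_two_pow
  rw [pow_succ]
  cases o with
  | add => simp only [Op.eval]; omega
  | sub => simp only [Op.eval]; omega
  | mul =>
    simp only [Op.eval, Int.natAbs_mul]
    have := Nat.mul_lt_mul'' hx hy
    rw [← pow_add] at this
    omega
  | div =>
    simp only [Op.eval]
    have := Int.natAbs_ediv_le_natAbs x y
    omega
  | mod =>
    simp only [Op.eval]
    by_cases h : y = 0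
    · subst h; simp only [Int.emod_zero]; omega
    · have h3 := Int.emod_nonneg x h
      have h4 := Int.emod_lt_abs x h
      rw [Int.abs_eq_natAbs] at h4
      omega
  | lt => simp only [Op.eval]; split <;> simp <;> omega
  | eq => simp only [Op.eval]; split <;> simp <;> omega

theorem Expr.bits_ev_lt_co (σ : Mem) (e : Expr) : 1 + bits (e.ev σ) ≤ e.co σ := by
  induction e with
  | lit z => exact le_rfl
  | var x => exact le_rfl
  | op o e f he hf =>
    have := bits_op o (e.ev σ) (f.ev σ)
    simp only [Expr.ev, Expr.co]
    nlinarith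
  | get a e he => simp only [Expr.ev, Expr.co]; omega

/-- Number of symbols of an expression, a literal `z` counting `1 + |z|`. -/
def Expr.sz : Expr → ℕ
  | .lit z => 1 + z.natAbs
  | .var _ => 1
  | .op _ e f => e.sz + f.sz + 1
  | .get _ e => e.sz + 1

/-- All registers and memory cells that are read in the evaluation of `e` lie in `[-b, b]`. -/
def Expr.Ok (b : ℕ) (σ : Mem) : Expr → Prop
  | .lit _ => True
  | .var x => |σ.var x| ≤ b
  | .op _ e f => e.Ok b σ ∧ f.Ok b σ
  | .get a e => e.Ok b σ ∧ |σ.arr a (e.ev σ)| ≤ b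

section
variable (b : ℕ) (σ : Mem) (e f : Expr)
@[simp] theorem Expr.ok_add : (e + f).Ok b σ ↔ e.Ok b σ ∧ f.Ok b σ := Iff.rfl
@[simp] theorem Expr.ok_mul : (e * f).Ok b σ ↔ e.Ok b σ ∧ f.Ok b σ := Iff.rfl
@[simp] theorem Expr.ok_div : (e / f).Ok b σ ↔ e.Ok b σ ∧ f.Ok b σ := Iff.rfl
@[simp] theorem Expr.ok_mod : (e % f).Ok b σ ↔ e.Ok b σ ∧ f.Ok b σ := Iff.rfl
@[simp] theorem Expr.ok_op (o : Op) : (Expr.op o e f).Ok b σ ↔ e.Ok b σ ∧ f.Ok b σ := Iff.rfl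
@[simp] theorem Expr.ok_ofNat (n : ℕ) : (ofNat(n) : Expr).Ok b σ := trivial
@[simp] theorem Expr.ok_zero : (0 : Expr).Ok b σ := trivial
@[simp] theorem Expr.ok_one : (1 : Expr).Ok b σ := trivial
@[simp] theorem Expr.ok_var (x : ℕ) : (Expr.var x).Ok b σ ↔ |σ.var x| ≤ b := Iff.rfl
@[simp] theorem Expr.ok_get (a : ℕ) :
  (Expr.get a e).Ok b σ ↔ e.Ok b σ ∧ |σ.arr a (e.ev σ)| ≤ b := Iff.rfl
end

theorem size_le_self (m : ℕ) : m.size ≤ m := Nat.size_le.2 Nat.lt_two_pow_self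

/-- The cost of an expression is at most quadratic in the product of its number of symbols and the bit
length of its operands. -/
theorem Expr.Ok.co_le {b : ℕ} {σ : Mem} {e : Expr} (h : e.Ok b σ) :
    1 + bits (e.ev σ) ≤ e.sz * (b.size + 1) ∧ e.co σ ≤ (e.sz * (b.size + 1)) ^ 2 := by
  induction e with
  | lit z =>
    have : bits z ≤ z.natAbs := size_le_self _
    have h1 : 1 + bits z ≤ (1 + z.natAbs) * (b.size + 1) := by nlinarith
    exact ⟨h1, h1.trans (Nat.le_self_pow (by norm_num) _)⟩
  | var x =>
    have h1 : 1 + bits (σ.var x) ≤ 1 * (b.size + 1) := by have := bits_mono h; omega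
    exact ⟨h1, h1.trans (Nat.le_self_pow (by norm_num) _)⟩
  | op o e f he hf =>
    obtain ⟨h1, h2⟩ := he h.1
    obtain ⟨h3, h4⟩ := hf h.2
    have h5 := bits_op o (e.ev σ) (f.ev σ)
    simp only [Expr.ev, Expr.co, Expr.sz]
    have h6 := Nat.mul_le_mul h1 h3
    constructor
    · nlinarith
    · nlinarith
  | get a e he =>
    obtain ⟨h1, h2⟩ := he h.1
    have h3 := bits_mono h.2
    simp only [Expr.ev, Expr.co, Expr.sz]
    constructor
    · nlinarith
    · nlinarith [Nat.zero_le (e.sz * b.size), Nat.zero_le b.size]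

/-! ### Expectations -/

/-- Expected value of a nonnegative function under a distribution on states. -/
noncomputable def expect (μ : PMF State) (F : State → ℝ≥0∞) : ℝ≥0∞ := ∑' t, μ t * F t

theorem expect_pure (s : State) (F : State → ℝ≥0∞) : expect (PMF.pure s) F = F s := by
  unfold expect
  rw [tsum_eq_single s]
  · simp
  · intro t ht; simp [PMF.pure_apply, ht]

theorem expect_bind (μ : PMF State) (ν : State → PMF State) (F : State → ℝ≥0∞) :
    expect (μ.bind ν) F = expect μ fun t => expect (ν t) F := by
  unfold expect
  simp only [PMF.bind_apply, ← ENNReal.tsum_mul_right, ← ENNReal.tsum_mul_left]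
  rw [ENNReal.tsum_comm]
  simp only [mul_assoc]

theorem expect_mono {μ : PMF State} {F G : State → ℝ≥0∞} (h : ∀ t ∈ μ.support, F t ≤ G t) :
    expect μ F ≤ expect μ G := by
  refine ENNReal.tsum_le_tsum fun t => ?_
  by_cases ht : μ t = 0
  · simp [ht]
  · exact mul_le_mul_right (h t ((PMF.mem_support_iff _ _).2 ht)) _

theorem expect_const (μ : PMF State) (c : ℝ≥0∞) : expect μ (fun _ => c) = c := by
  unfold expect
  rw [ENNReal.tsum_mul_right, μ.tsum_coe, one_mul]

theorem expect_add (μ : PMF State) (F G : State → ℝ≥0∞) :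
    expect μ (fun t => F t + G t) = expect μ F + expect μ G := by
  unfold expect
  simp only [mul_add]
  exact ENNReal.tsum_add

theorem expect_mul (μ : PMF State) (c : ℝ≥0∞) (F : State → ℝ≥0∞) :
    expect μ (fun t => c * F t) = c * expect μ F := by
  unfold expect
  rw [← ENNReal.tsum_mul_left]
  simp only [mul_left_comm]

theorem ne_top_of_expect {μ : PMF State} {F : State → ℝ≥0∞} (h : expect μ F ≠ ⊤) {t : State}
    (ht : t ∈ μ.support) : F t ≠ ⊤ := by
  intro hF
  have := ENNReal.ne_top_of_tsum_ne_top h t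
  rw [hF, ENNReal.mul_top ((PMF.mem_support_iff _ _).1 ht)] at this
  exact this rfl

theorem expect_coin (F : State → ℝ≥0∞) (g : Bool → State) :
    expect ((PMF.uniformOfFintype Bool).map g) F = (F (g false) + F (g true)) / 2 := by
  unfold PMF.map
  have : expect ((PMF.uniformOfFintype Bool).bind (PMF.pure ∘ g)) F
      = ∑' b, PMF.uniformOfFintype Bool b * expect (PMF.pure (g b)) F := by
    unfold expect
    simp only [PMF.bind_apply, ← ENNReal.tsum_mul_right, ← ENNReal.tsum_mul_left]
    rw [ENNReal.tsum_comm]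
    simp only [mul_assoc, Function.comp]
  rw [this]
  simp only [expect_pure, tsum_fintype, Fintype.sum_bool, PMF.uniformOfFintype_apply,
    Fintype.card_bool]
  rw [← mul_add, mul_comm, add_comm, ENNReal.div_eq_inv_mul, mul_comm]
  norm_num

theorem holds_overwrite (m : ℤ → ℤ) (l : List ℤ) : Holds (overwrite m l) l := by
  intro i hi
  simp [overwrite, List.getD_eq_getElem?_getD, hi]

theorem overwrite_of_ge (m : ℤ → ℤ) (l : List ℤ) {i : ℤ} (h : i < 0 ∨ (l.length : ℤ) ≤ i) :
    overwrite m l i = m i := by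
  unfold overwrite
  split_ifs with h0
  · have : l.length ≤ i.toNat := by omega
    simp [List.getD_eq_getElem?_getD, this]
  · rfl

/-! ### A calculus for expectations and running costs -/

/-- Running time plus the total weight of the oracle queries. -/
def State.res (f : ℕ → ℕ) (s : State) : ℕ := s.time + (s.queries.map f).sum

/-- Started with memory `σ`, the program `p` (with oracle `APSP`) halts, always increases `res f` by
at most `k`, and the expected value of `φ` at the end is at most `v`. A value `⊤` of `φ` marks
memories that must not be reached. -/
def WP (d : ℕ) (f : ℕ → ℕ) (p : Cmd) (σ : Mem) (k : ℕ) (φ : Mem → ℝ≥0∞) (v : ℝ≥0∞) : Prop :=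
  ∀ s : State, s.mem = σ → ∃ μ, Exec APSP d p s μ ∧ (∀ t ∈ μ.support, t.res f ≤ s.res f + k) ∧
    expect μ (fun t => φ t.mem) ≤ v

open Classical in
/-- `0` where `Q` holds and `⊤` elsewhere. -/
noncomputable def ind (Q : Mem → Prop) (σ : Mem) : ℝ≥0∞ := if Q σ then 0 else ⊤

theorem ind_of {Q : Mem → Prop} {σ : Mem} (h : Q σ) : ind Q σ = 0 := by simp [ind, h]

theorem ind_ne_top {Q : Mem → Prop} {σ : Mem} (h : ind Q σ ≠ ⊤) : Q σ := by
  by_contra hh; exact h (by simp [ind, hh])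

/-- Sure termination in a memory satisfying `Q`, at cost at most `k`. -/
def Sure (d : ℕ) (f : ℕ → ℕ) (p : Cmd) (σ : Mem) (k : ℕ) (Q : Mem → Prop) : Prop :=
  WP d f p σ k (ind Q) 0

variable {d : ℕ} {f : ℕ → ℕ}

theorem WP.mono {p : Cmd} {σ : Mem} {k k' : ℕ} {φ φ' : Mem → ℝ≥0∞} {v v' : ℝ≥0∞}
    (h : WP d f p σ k φ v) (hk : k ≤ k') (hφ : ∀ τ, φ' τ ≤ φ τ) (hv : v ≤ v') :
    WP d f p σ k' φ' v' := by
  intro s hs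
  obtain ⟨μ, h1, h2, h3⟩ := h s hs
  exact ⟨μ, h1, fun t ht => (h2 t ht).trans (by omega),
    (expect_mono fun t _ => hφ _).trans (h3.trans hv)⟩

theorem WP.cost {p : Cmd} {σ : Mem} {k k' : ℕ} {φ : Mem → ℝ≥0∞} {v : ℝ≥0∞}
    (h : WP d f p σ k φ v) (hk : k ≤ k') : WP d f p σ k' φ v :=
  h.mono hk (fun _ => le_rfl) le_rfl

theorem Sure.mono {p : Cmd} {σ : Mem} {k k' : ℕ} {Q Q' : Mem → Prop}
    (h : Sure d f p σ k Q) (hk : k ≤ k') (hQ : ∀ τ, Q τ → Q' τ) : Sure d f p σ k' Q' := by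
  refine WP.mono h hk (fun τ => ?_) le_rfl
  by_cases hτ : Q τ
  · simp [ind, hτ, hQ τ hτ]
  · simp [ind, hτ]

/-- The intermediate potential `χ` is the value that `q` has to guarantee. As `v` is finite, only
memories with finite `χ` are reached. -/
theorem WP.seq {p q : Cmd} {σ : Mem} {k l : ℕ} {χ φ : Mem → ℝ≥0∞} {v : ℝ≥0∞} (hv : v ≠ ⊤)
    (hp : WP d f p σ k χ v) (hq : ∀ τ, χ τ ≠ ⊤ → WP d f q τ l φ (χ τ)) :
    WP d f (.seq p q) σ (k + l) φ v := by
  classical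
  intro s hs
  obtain ⟨μ, h1, h2, h3⟩ := hp s hs
  have key : ∀ t ∈ μ.support, ∃ ν, Exec APSP d q t ν ∧
      (∀ r ∈ ν.support, r.res f ≤ t.res f + l) ∧ expect ν (fun r => φ r.mem) ≤ χ t.mem :=
    fun t ht => hq t.mem (ne_top_of_expect (ne_top_of_le_ne_top hv h3) ht) t rfl
  choose! ν hν using key
  refine ⟨μ.bind ν, Exec.seq s p q μ ν h1 fun t ht => (hν t ht).1, ?_, ?_⟩
  · intro r hr
    obtain ⟨t, ht, hr⟩ := (PMF.mem_support_bind_iff _ _ _).1 hr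
    have := h2 t ht
    have := (hν t ht).2.1 r hr
    omega
  · rw [expect_bind]
    exact (expect_mono fun t ht => (hν t ht).2.2).trans h3

theorem Sure.seq {p q : Cmd} {σ : Mem} {k l : ℕ} {Q : Mem → Prop} {φ : Mem → ℝ≥0∞} {v : ℝ≥0∞}
    (hp : Sure d f p σ k Q) (hq : ∀ τ, Q τ → WP d f q τ l φ v) :
    WP d f (.seq p q) σ (k + l) φ v := by
  classical
  intro s hs
  obtain ⟨μ, h1, h2, h3⟩ := hp s hs
  have key : ∀ t ∈ μ.support, ∃ ν, Exec APSP d q t ν ∧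
      (∀ r ∈ ν.support, r.res f ≤ t.res f + l) ∧ expect ν (fun r => φ r.mem) ≤ v :=
    fun t ht => hq t.mem
      (ind_ne_top (ne_top_of_expect (ne_top_of_le_ne_top ENNReal.zero_ne_top h3) ht)) t rfl
  choose! ν hν using key
  refine ⟨μ.bind ν, Exec.seq s p q μ ν h1 fun t ht => (hν t ht).1, ?_, ?_⟩
  · intro r hr
    obtain ⟨t, ht, hr⟩ := (PMF.mem_support_bind_iff _ _ _).1 hr
    have := h2 t ht
    have := (hν t ht).2.1 r hr
    omega
  · rw [expect_bind]
    refine (expect_mono fun t ht => (hν t ht).2.2).trans ?_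
    rw [expect_const]

/-- Sequential composition of a list of programs. -/
def Cmd.block : List Cmd → Cmd
  | [] => .skip
  | p :: l => .seq p (Cmd.block l)

theorem res_tick (s : State) (k : ℕ) : (s.tick k).res f = s.res f + k := by
  simp [State.res, State.tick]; omega

theorem WP.nil {σ : Mem} {k : ℕ} {φ : Mem → ℝ≥0∞} {v : ℝ≥0∞} (hk : 1 ≤ k) (h : φ σ ≤ v) :
    WP d f (Cmd.block []) σ k φ v := by
  intro s hs
  refine ⟨_, Exec.skip s, ?_, ?_⟩
  · intro t ht
    rw [PMF.support_pure, Set.mem_singleton_iff] at ht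
    rw [ht, res_tick]; omega
  · rw [expect_pure]
    subst hs; exact h

theorem Sure.nil {σ : Mem} {k : ℕ} {Q : Mem → Prop} (hk : 1 ≤ k) (h : Q σ) :
    Sure d f (Cmd.block []) σ k Q := WP.nil hk (by rw [ind_of h])

theorem WP.assign {x : ℕ} {e : Expr} {σ : Mem} {k : ℕ} {φ : Mem → ℝ≥0∞} (hk : 1 + e.co σ ≤ k) :
    WP d f (.assign x e) σ k φ (φ (σ.set x (e.ev σ))) := by
  intro s hs
  refine ⟨_, Exec.assign s x e, ?_, ?_⟩
  · intro t ht
    rw [PMF.support_pure, Set.mem_singleton_iff] at ht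
    have : t.res f = (s.tick (1 + e.cost s)).res f := by rw [ht]; rfl
    rw [this, res_tick, Expr.cost_eq, hs]; omega
  · rw [expect_pure, Expr.eval_eq, hs]
    subst hs; exact le_rfl

theorem WP.store {a : ℕ} {i e : Expr} {σ : Mem} {k : ℕ} {φ : Mem → ℝ≥0∞}
    (hk : 1 + i.co σ + e.co σ ≤ k) :
    WP d f (.store a i e) σ k φ (φ (σ.put a (i.ev σ) (e.ev σ))) := by
  intro s hs
  refine ⟨_, Exec.store s a i e, ?_, ?_⟩
  · intro t ht
    rw [PMF.support_pure, Set.mem_singleton_iff] at ht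
    have : t.res f = (s.tick (1 + i.cost s + e.cost s)).res f := by rw [ht]; rfl
    rw [this, res_tick, Expr.cost_eq, Expr.cost_eq, hs]; omega
  · rw [expect_pure, Expr.eval_eq, Expr.eval_eq, hs]
    subst hs; exact le_rfl

theorem WP.flip {x : ℕ} {σ : Mem} {k : ℕ} {φ : Mem → ℝ≥0∞} (hk : 1 ≤ k) :
    WP d f (.flip x) σ k φ ((φ (σ.set x 0) + φ (σ.set x 1)) / 2) := by
  intro s hs
  refine ⟨_, Exec.flip s x, ?_, ?_⟩
  · intro t ht
    rw [PMF.mem_support_map_iff] at ht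
    obtain ⟨r, _, rfl⟩ := ht
    have : ((s.tick 1).setVar x (if r then 1 else 0)).res f = (s.tick 1).res f := rfl
    rw [this, res_tick]; omega
  · rw [expect_coin]
    subst hs; exact le_rfl

theorem Sure.assign {x : ℕ} {e : Expr} {σ : Mem} {k : ℕ} {Q : Mem → Prop} (hk : 1 + e.co σ ≤ k)
    (h : Q (σ.set x (e.ev σ))) : Sure d f (.assign x e) σ k Q :=
  (WP.assign hk).mono le_rfl (fun _ => le_rfl) (by rw [ind_of h])

theorem Sure.store {a : ℕ} {i e : Expr} {σ : Mem} {k : ℕ} {Q : Mem → Prop}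
    (hk : 1 + i.co σ + e.co σ ≤ k)
    (h : Q (σ.put a (i.ev σ) (e.ev σ))) : Sure d f (.store a i e) σ k Q :=
  (WP.store hk).mono le_rfl (fun _ => le_rfl) (by rw [ind_of h])

/-- Loops with a potential `φ i` before the `i`-th of `n` rounds. -/
theorem WP.loop {e : Expr} {p : Cmd} {n : ℕ} {φ : ℕ → Mem → ℝ≥0∞} {κ : ℕ → ℕ} {g : ℕ}
    (hg : ∀ i ≤ n, ∀ σ, φ i σ ≠ ⊤ → 1 + e.co σ ≤ g ∧ (e.ev σ ≠ 0 ↔ i < n))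
    (hp : ∀ i < n, ∀ σ, φ i σ ≠ ⊤ → WP d f p σ (κ i) (φ (i + 1)) (φ i σ)) {σ : Mem}
    (hσ : φ 0 σ ≠ ⊤) :
    WP d f (.loop e p) σ (∑ i ∈ Finset.range n, (g + κ i) + g) (φ n) (φ 0 σ) := by
  have main : ∀ r i, i + r = n → ∀ σ, φ i σ ≠ ⊤ →
      WP d f (.loop e p) σ (∑ j ∈ Finset.Ico i n, (g + κ j) + g) (φ n) (φ i σ) := by
    intro r
    induction r with
    | zero =>
      intro i hi σ hσ s hs
      obtain rfl : i = n := by omega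
      obtain ⟨hc, he⟩ := hg i le_rfl σ hσ
      refine ⟨_, Exec.loopDone s e p ?_, ?_, ?_⟩
      · rw [Expr.eval_eq, hs]; by_contra h; exact lt_irrefl _ (he.1 h)
      · intro t ht
        rw [PMF.support_pure, Set.mem_singleton_iff] at ht
        rw [ht, res_tick, Expr.cost_eq, hs]; omega
      · rw [expect_pure]; subst hs; exact le_rfl
    | succ r ih =>
      intro i hi σ hσ s hs
      have hin : i < n := by omega
      obtain ⟨hc, he⟩ := hg i hin.le σ hσ
      -- A round followed by the rest of the loop is analysed as a sequence; its execution is then taken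
      -- apart again to form the execution of the loop.
      have hloop := WP.seq (q := .loop e p) hσ (hp i hin σ hσ)
        (fun τ hτ => ih (i + 1) (by omega) τ hτ)
      obtain ⟨μ, h1, h2, h3⟩ := hloop (s.tick (1 + e.cost s)) hs
      cases h1 with
      | seq _ _ _ μ ν h4 h5 =>
        refine ⟨_, Exec.loopStep s e p μ ν ?_ h4 h5, ?_, h3⟩
        · rw [Expr.eval_eq, hs]; exact he.2 hin
        · intro t ht
          have := h2 t ht
          rw [res_tick, Expr.cost_eq, hs] at this
          rw [Finset.sum_eq_sum_Ico_succ_bot hin]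
          omega
  have := main n 0 (by omega) σ hσ
  rwa [← Finset.range_eq_Ico] at this

theorem WP.loop_const {e : Expr} {p : Cmd} (n : ℕ) (φ : ℕ → Mem → ℝ≥0∞) (κ : ℕ) (g : ℕ)
    (hg : ∀ i ≤ n, ∀ σ, φ i σ ≠ ⊤ → 1 + e.co σ ≤ g ∧ (e.ev σ ≠ 0 ↔ i < n))
    (hp : ∀ i < n, ∀ σ, φ i σ ≠ ⊤ → WP d f p σ κ (φ (i + 1)) (φ i σ)) {σ : Mem}
    (hσ : φ 0 σ ≠ ⊤) :
    WP d f (.loop e p) σ (n * (g + κ) + g) (φ n) (φ 0 σ) := by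
  have := WP.loop (κ := fun _ => κ) hg hp hσ
  simpa using this

/-- Loops with an invariant `I i` before the `i`-th of `n` rounds. -/
theorem Sure.loop {e : Expr} {p : Cmd} (n : ℕ) (I : ℕ → Mem → Prop) (κ : ℕ → ℕ) (g : ℕ)
    (hg : ∀ i ≤ n, ∀ σ, I i σ → 1 + e.co σ ≤ g ∧ (e.ev σ ≠ 0 ↔ i < n))
    (hp : ∀ i < n, ∀ σ, I i σ → Sure d f p σ (κ i) (I (i + 1))) {σ : Mem} (hσ : I 0 σ) :
    Sure d f (.loop e p) σ (∑ i ∈ Finset.range n, (g + κ i) + g) (I n) := by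
  have h := WP.loop (d := d) (f := f) (e := e) (p := p) (n := n) (φ := fun i => ind (I i)) (κ := κ)
    (g := g) (fun i hi σ h => hg i hi σ (ind_ne_top h))
    (fun i hi σ h => by
      have h' := ind_ne_top h
      rw [ind_of h']; exact hp i hi σ h') (σ := σ) (by rw [ind_of hσ]; simp)
  rwa [ind_of hσ] at h

theorem Sure.loop_const {e : Expr} {p : Cmd} (n : ℕ) (I : ℕ → Mem → Prop) (κ : ℕ) (g : ℕ)
    (hg : ∀ i ≤ n, ∀ σ, I i σ → 1 + e.co σ ≤ g ∧ (e.ev σ ≠ 0 ↔ i < n))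
    (hp : ∀ i < n, ∀ σ, I i σ → Sure d f p σ κ (I (i + 1))) {σ : Mem} (hσ : I 0 σ) :
    Sure d f (.loop e p) σ (n * (g + κ) + g) (I n) := by
  have := Sure.loop n I (fun _ => κ) g hg hp hσ
  simpa using this

/-- A bound for the cost of any single instruction with expressions of at most `200` symbols, all of
whose operands are bounded by `b`. -/
def unit (b : ℕ) : ℕ := 1 + 2 * (200 * (b.size + 1)) ^ 2

theorem Expr.Ok.co_le_unit {b : ℕ} {σ : Mem} {e : Expr} (h : e.Ok b σ) (hs : e.sz ≤ 200) :
    2 * e.co σ + 1 ≤ unit b := by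
  have h1 := h.co_le.2
  have h2 : (e.sz * (b.size + 1)) ^ 2 ≤ (200 * (b.size + 1)) ^ 2 :=
    Nat.pow_le_pow_left (Nat.mul_le_mul_right _ hs) _
  unfold unit; omega

theorem one_le_unit (b : ℕ) : 1 ≤ unit b := by unfold unit; omega

section Block
variable {b n : ℕ} {σ : Mem} {l : List Cmd} {φ : Mem → ℝ≥0∞} {v : ℝ≥0∞}

theorem WP.cons {p : Cmd} {k k' : ℕ} {Q : Mem → Prop} (hp : Sure d f p σ k Q)
    (hq : ∀ τ, Q τ → WP d f (Cmd.block l) τ k' φ v) : WP d f (Cmd.block (p :: l)) σ (k + k') φ v :=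
  Sure.seq hp hq

theorem WP.assign_step {x k : ℕ} {e : Expr} (z : ℤ) (hsz : e.sz ≤ 200) (hok : e.Ok b σ)
    (hz : e.ev σ = z) (h : WP d f (Cmd.block l) (σ.set x z) k φ v) :
    WP d f (Cmd.block (.assign x e :: l)) σ (unit b + k) φ v := by
  have := hok.co_le_unit hsz
  exact WP.cons (Q := fun τ => τ = σ.set x z) (k := unit b)
    (Sure.assign (by omega) (by rw [hz])) fun τ hτ => hτ ▸ h

theorem WP.assign_cons {x : ℕ} {e : Expr} (z : ℤ) (hsz : e.sz ≤ 200) (hok : e.Ok b σ)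
    (hz : e.ev σ = z) (h : WP d f (Cmd.block l) (σ.set x z) (n * unit b) φ v) :
    WP d f (Cmd.block (.assign x e :: l)) σ ((n + 1) * unit b) φ v :=
  (WP.assign_step z hsz hok hz h).cost (by rw [add_mul, one_mul, add_comm])

theorem WP.store_step {a k : ℕ} {i e : Expr} (j z : ℤ) (hsi : i.sz ≤ 200) (hsz : e.sz ≤ 200)
    (hoi : i.Ok b σ) (hok : e.Ok b σ) (hj : i.ev σ = j) (hz : e.ev σ = z)
    (h : WP d f (Cmd.block l) (σ.put a j z) k φ v) :
    WP d f (Cmd.block (.store a i e :: l)) σ (unit b + k) φ v := by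
  have := hok.co_le_unit hsz
  have := hoi.co_le_unit hsi
  exact WP.cons (Q := fun τ => τ = σ.put a j z) (k := unit b)
    (Sure.store (by omega) (by rw [hz, hj])) fun τ hτ => hτ ▸ h

theorem WP.store_cons {a : ℕ} {i e : Expr} (j z : ℤ) (hsi : i.sz ≤ 200) (hsz : e.sz ≤ 200)
    (hoi : i.Ok b σ) (hok : e.Ok b σ) (hj : i.ev σ = j) (hz : e.ev σ = z)
    (h : WP d f (Cmd.block l) (σ.put a j z) (n * unit b) φ v) :
    WP d f (Cmd.block (.store a i e :: l)) σ ((n + 1) * unit b) φ v :=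
  (WP.store_step j z hsi hsz hoi hok hj hz h).cost (by rw [add_mul, one_mul, add_comm])

theorem WP.nil_unit (h : φ σ ≤ v) : WP d f (Cmd.block []) σ ((n + 1) * unit b) φ v :=
  WP.nil (by have := one_le_unit b; nlinarith) h

theorem Sure.nil_unit {Q : Mem → Prop} (h : Q σ) :
    Sure d f (Cmd.block []) σ ((n + 1) * unit b) Q := WP.nil_unit (by rw [ind_of h])

theorem Sure.cons {p : Cmd} {k k' : ℕ} {Q P : Mem → Prop} (hp : Sure d f p σ k Q)
    (hq : ∀ τ, Q τ → Sure d f (Cmd.block l) τ k' P) :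
    Sure d f (Cmd.block (p :: l)) σ (k + k') P :=
  WP.cons hp hq

/-- A shortest path query writes the distance matrix to array `c` and is charged with its weight. -/
theorem Sure.query {a c : ℕ} {I : WGraph} (hI : APSP.Admissible d I)
    (h : Holds (σ.arr a) I.enc) :
    Sure d f (.query a c) σ (1 + f I.n) fun τ => τ.var = σ.var ∧
      (∀ a', a' ≠ c → τ.arr a' = σ.arr a') ∧ Holds (τ.arr c) (encMatrix I.n I.dist) := by
  intro s hs
  subst hs
  refine ⟨_, Exec.query (B := APSP) (c := d) s a c (show APSP.Inst from I) hI h, ?_, ?_⟩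
  · intro t ht
    rw [PMF.support_pure, Set.mem_singleton_iff] at ht
    subst ht
    simp only [State.res, State.answer, State.tick, List.map_cons, List.sum_cons]
    change s.time + 1 + (f I.n + _) ≤ _
    omega
  · rw [expect_pure, ind_of]
    refine ⟨rfl, fun a' ha' => ?_, ?_⟩
    · simp [State.answer, State.tick, ha']
    · have := holds_overwrite (s.arr c) (encMatrix I.n I.dist)
      simpa [State.answer, State.tick, APSP] using this

end Block

end FineGrained

namespace FineGrained
open scoped ENNReal

/-! ### Encodings of graphs -/

/-- First word of the encoding of a matrix entry: is it present? -/
def flag : Option ℤ → ℤ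
  | none => 0
  | some _ => 1

/-- Second word of the encoding of a matrix entry: its value, and `0` if there is none. -/
def value : Option ℤ → ℤ
  | none => 0
  | some a => a

theorem flag_value_inj {o o' : Option ℤ} (h : flag o = flag o') (h' : value o = value o') :
    o = o' := by
  cases o <;> cases o' <;> simp_all [flag, value]

theorem encMatrix_length (n : ℕ) (w : Fin n → Fin n → Option ℤ) :
    (encMatrix n w).length = n * n * 2 := by simp [encMatrix]

theorem matrix_index_lt {n : ℕ} (u v : Fin n) : (u : ℕ) * n + v < n * n := by
  have h1 : ((u : ℕ) + 1) * n ≤ n * n := Nat.mul_le_mul_right _ u.2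
  have h2 := v.2
  nlinarith

theorem matrix_index_div {n : ℕ} (u v : Fin n) : ((u : ℕ) * n + v) / n = u := by
  rw [mul_comm, Nat.mul_add_div (by have := v.2; omega), Nat.div_eq_of_lt v.2, add_zero]

theorem matrix_index_mod {n : ℕ} (u v : Fin n) : ((u : ℕ) * n + v) % n = v := by
  rw [mul_comm, Nat.mul_add_mod, Nat.mod_eq_of_lt v.2]

theorem encMatrix_flag (n : ℕ) (w : Fin n → Fin n → Option ℤ) (u v : Fin n)
    (h : 2 * ((u : ℕ) * n + v) < (encMatrix n w).length) :
    (encMatrix n w)[2 * ((u : ℕ) * n + v)] = flag (w u v) := by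
  have hu : (⟨2 * ((u : ℕ) * n + v), by rwa [encMatrix_length] at h⟩ :
      Fin (n * n * 2)).divNat.divNat = u := by
    ext; simp [matrix_index_div]
  have hv : (⟨2 * ((u : ℕ) * n + v), by rwa [encMatrix_length] at h⟩ :
      Fin (n * n * 2)).divNat.modNat = v := by
    ext; simp [Nat.mod_eq_of_lt v.2]
  have hm : (⟨2 * ((u : ℕ) * n + v), by rwa [encMatrix_length] at h⟩ :
      Fin (n * n * 2)).modNat = 0 := by
    ext; simp
  simp only [encMatrix, List.getElem_ofFn, hu, hv, hm]
  cases w u v <;> simp [flag]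

theorem encMatrix_value (n : ℕ) (w : Fin n → Fin n → Option ℤ) (u v : Fin n)
    (h : 2 * ((u : ℕ) * n + v) + 1 < (encMatrix n w).length) :
    (encMatrix n w)[2 * ((u : ℕ) * n + v) + 1] = value (w u v) := by
  have hu : (⟨2 * ((u : ℕ) * n + v) + 1, by rwa [encMatrix_length] at h⟩ :
      Fin (n * n * 2)).divNat.divNat = u := by
    ext; simp [Nat.mul_add_div, matrix_index_div]
  have hv : (⟨2 * ((u : ℕ) * n + v) + 1, by rwa [encMatrix_length] at h⟩ :
      Fin (n * n * 2)).divNat.modNat = v := by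
    ext; simp [Nat.mul_add_div, Nat.mod_eq_of_lt v.2]
  have hm : (⟨2 * ((u : ℕ) * n + v) + 1, by rwa [encMatrix_length] at h⟩ :
      Fin (n * n * 2)).modNat = 1 := by
    ext; simp
  simp only [encMatrix, List.getElem_ofFn, hu, hv, hm]
  cases w u v <;> simp [value]

theorem holds_encMatrix (m : ℤ → ℤ) (n : ℕ) (w : Fin n → Fin n → Option ℤ) :
    Holds m (encMatrix n w) ↔ ∀ u v : Fin n,
      m (2 * ((u : ℤ) * n + v)) = flag (w u v) ∧
      m (2 * ((u : ℤ) * n + v) + 1) = value (w u v) := by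
  constructor
  · intro h u v
    have hl := encMatrix_length n w
    have hi := matrix_index_lt u v
    have h1 := h (2 * ((u : ℕ) * n + v)) (by omega)
    have h2 := h (2 * ((u : ℕ) * n + v) + 1) (by omega)
    rw [encMatrix_flag] at h1
    rw [encMatrix_value] at h2
    push_cast at h1 h2
    exact ⟨h1, h2⟩
  · intro h i hi
    rw [encMatrix_length] at hi
    have hn : 0 < n := by
      rcases Nat.eq_zero_or_pos n with rfl | hn
      · simp at hi
      · exact hn
    have hlt : i / 2 < n * n := by omega
    let u : Fin n := ⟨i / 2 / n, Nat.div_lt_of_lt_mul hlt⟩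
    let v : Fin n := ⟨i / 2 % n, Nat.mod_lt _ hn⟩
    have huv : (u : ℕ) * n + v = i / 2 := Nat.div_add_mod' (i / 2) n
    obtain ⟨h1, h2⟩ := h u v
    have huv' : (u : ℤ) * n + v = ((i / 2 : ℕ) : ℤ) := by rw [← huv]; push_cast; rfl
    rw [huv'] at h1 h2
    rcases Nat.mod_two_eq_zero_or_one i with h0 | h0
    · have e : i = 2 * ((u : ℕ) * n + v) := by omega
      have e' : (i : ℤ) = 2 * ((i / 2 : ℕ) : ℤ) := by omega
      simp only [e]
      rw [encMatrix_flag, ← h1, ← e, e']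
    · have e : i = 2 * ((u : ℕ) * n + v) + 1 := by omega
      have e' : (i : ℤ) = 2 * ((i / 2 : ℕ) : ℤ) + 1 := by omega
      simp only [e]
      rw [encMatrix_value, ← h2, ← e, e']

theorem holds_cons (m : ℤ → ℤ) (z : ℤ) (l : List ℤ) :
    Holds m (z :: l) ↔ m 0 = z ∧ Holds (fun i => m (i + 1)) l := by
  constructor
  · intro h
    refine ⟨h 0 (by simp), fun i hi => ?_⟩
    have := h (i + 1) (by simpa using hi)
    simpa using this
  · rintro ⟨h0, h⟩ i hi
    cases i with
    | zero => simpa using h0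
    | succ i =>
      have := h i (by simpa using hi)
      simpa using this

theorem holds_singleton (m : ℤ → ℤ) (z : ℤ) : Holds m [z] ↔ m 0 = z := by
  rw [holds_cons]; simp [Holds]

theorem holds_enc (m : ℤ → ℤ) (G : WGraph) :
    Holds m G.enc ↔ m 0 = G.n ∧ ∀ u v : Fin G.n,
      m (2 * ((u : ℤ) * G.n + v) + 1) = flag (G.w u v) ∧
      m (2 * ((u : ℤ) * G.n + v) + 2) = value (G.w u v) := by
  unfold WGraph.enc
  rw [holds_cons, holds_encMatrix]
  simp only [add_assoc, one_add_one_eq_two]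

/-- A graph is determined by any memory that contains its encoding. -/
theorem graph_eq_of_holds {m : ℤ → ℤ} {G H : WGraph} (hG : Holds m G.enc) (hH : Holds m H.enc) :
    G = H := by
  rw [holds_enc] at hG hH
  obtain ⟨n, w, hw⟩ := G
  obtain ⟨n', w', hw'⟩ := H
  obtain ⟨h1, h2⟩ := hG
  obtain ⟨h3, h4⟩ := hH
  obtain rfl : n = n' := by
    have := h1.symm.trans h3
    exact_mod_cast this
  congr
  funext u v
  exact flag_value_inj ((h2 u v).1.symm.trans (h4 u v).1) ((h2 u v).2.symm.trans (h4 u v).2)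

/-! ### Programs have a unique output distribution -/

theorem bind_congr_support {μ : PMF State} {ν ν' : State → PMF State}
    (h : ∀ t ∈ μ.support, ν t = ν' t) : μ.bind ν = μ.bind ν' := by
  ext b
  simp only [PMF.bind_apply]
  refine tsum_congr fun a => ?_
  by_cases ha : μ a = 0
  · simp [ha]
  · rw [h a ((PMF.mem_support_iff _ _).2 ha)]

/-- The queried instance is determined by its encoding, and hence so is the answer of the oracle. -/
theorem exec_unique {d : ℕ} {p : Cmd} {s : State} {μ μ' : PMF State} (h : Exec APSP d p s μ)
    (h' : Exec APSP d p s μ') : μ = μ' := by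
  induction h generalizing μ' with
  | skip s => cases h'; rfl
  | assign s x e => cases h'; rfl
  | store s a i e => cases h'; rfl
  | flip s x => cases h'; rfl
  | query s a b I hI hh =>
    cases h' with
    | query _ _ _ J hJ hh' =>
      obtain rfl : I = J := graph_eq_of_holds hh hh'
      rfl
  | seq s p q μ ν hp hq ihp ihq =>
    cases h' with
    | seq _ _ _ μ₁ ν₁ hp₁ hq₁ =>
      obtain rfl := ihp hp₁
      exact bind_congr_support fun t ht => ihq t ht (hq₁ t ht)
  | condTrue s e p q μ he hp ih =>
    cases h' with
    | condTrue _ _ _ _ _ _ hp₁ => exact ih hp₁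
    | condFalse _ _ _ _ _ he₁ _ => exact absurd he₁ he
  | condFalse s e p q μ he hp ih =>
    cases h' with
    | condTrue _ _ _ _ _ he₁ _ => exact absurd he he₁
    | condFalse _ _ _ _ _ _ hp₁ => exact ih hp₁
  | loopDone s e p he =>
    cases h' with
    | loopDone => rfl
    | loopStep _ _ _ _ _ he₁ _ _ => exact absurd he he₁
  | loopStep s e p μ ν he hp hq ihp ihq =>
    cases h' with
    | loopDone _ _ _ he₁ => exact absurd he₁ he
    | loopStep _ _ _ μ₁ ν₁ he₁ hp₁ hq₁ =>
      obtain rfl := ihp hp₁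
      exact bind_congr_support fun t ht => ihq t ht (hq₁ t ht)

/-! ### Negative triangles through shortest paths -/

namespace WGraph

/-- Four copies of the vertex set, with an edge from `u` in each copy to `v` in the next one for each
edge `u → v` of `G`. The vertex `u` of copy `l` has number `l * n + u`. -/
def layered (G : WGraph) : WGraph where
  n := 4 * G.n
  w x y := if y.divNat.val = x.divNat.val + 1 then G.w x.modNat y.modNat else none
  loopless x := by simp

/-- Walks lead to later copies, unless they are trivial. -/
theorem Walk.layer {G : WGraph} {x y : Fin G.layered.n} {a : ℤ} (h : G.layered.Walk x y a) :
    (x = y ∧ a = 0) ∨ (Fin.divNat (m := 4) x).val < (Fin.divNat (m := 4) y).val := by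
  induction h with
  | nil u => exact Or.inl ⟨rfl, rfl⟩
  | cons u v x a b h t ih =>
    right
    simp only [layered] at h
    split_ifs at h with h1
    rcases ih with ⟨rfl, _⟩ | ih <;> omega

theorem layered_noNegCycle (G : WGraph) : G.layered.NoNegCycle := by
  intro u a h
  rcases h.layer with ⟨_, rfl⟩ | h
  · exact le_rfl
  · exact absurd h (lt_irrefl _)

theorem layered_within {G : WGraph} {d : ℕ} (h : G.Within (G.n ^ d)) :
    G.layered.Within (G.layered.n ^ d) := by
  intro u v a ha
  simp only [layered] at ha
  split_ifs at ha
  refine (h _ _ _ ha).trans ?_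
  have : G.n ^ d ≤ (4 * G.n) ^ d := Nat.pow_le_pow_left (by omega) _
  exact_mod_cast this

/-- The vertex `u` in copy `l`. -/
def copy (G : WGraph) (l : Fin 4) (u : Fin G.n) : Fin G.layered.n := Fin.mkDivMod l u

theorem exists_copy (G : WGraph) (x : Fin G.layered.n) : ∃ l u, x = G.copy l u :=
  ⟨Fin.divNat (m := 4) x, Fin.modNat (m := 4) x, (Fin.divNat_mkDivMod_modNat (m := 4) x).symm⟩

@[simp] theorem divNat_copy (G : WGraph) (l : Fin 4) (u : Fin G.n) :
    Fin.divNat (m := 4) (G.copy l u) = l := Fin.divNat_mkDivMod l u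

@[simp] theorem modNat_copy (G : WGraph) (l : Fin 4) (u : Fin G.n) :
    Fin.modNat (m := 4) (G.copy l u) = u := Fin.modNat_mkDivMod l u

theorem copy_val (G : WGraph) (l : Fin 4) (u : Fin G.n) :
    (G.copy l u : ℕ) = l * G.n + u := by
  simp [copy, mul_comm]

theorem layered_w_copy (G : WGraph) (l l' : Fin 4) (u v : Fin G.n) :
    G.layered.w (G.copy l u) (G.copy l' v) = if l'.val = l.val + 1 then G.w u v else none := by
  unfold layered
  simp only [divNat_copy, modNat_copy]

theorem Walk.succ {G : WGraph} {l : Fin 4} {u : Fin G.n} {y : Fin G.layered.n} {a : ℤ}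
    (h : G.layered.Walk (G.copy l u) y a) (hy : l.val < (Fin.divNat (m := 4) y).val) :
    ∃ (l' : Fin 4) (v : Fin G.n) (p b : ℤ), l'.val = l.val + 1 ∧ G.w u v = some p ∧
      G.layered.Walk (G.copy l' v) y b ∧ a = p + b := by
  cases h with
  | nil => simp at hy
  | cons _ v _ a b h t =>
    obtain ⟨l', v, rfl⟩ := G.exists_copy v
    rw [layered_w_copy] at h
    split_ifs at h with h1
    exact ⟨l', v, a, b, h1, h, t, rfl⟩

/-- Walks from the first to the last copy of `u` are the triangles through `u`. -/
theorem layered_walk_iff (G : WGraph) (u : Fin G.n) (a : ℤ) :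
    G.layered.Walk (G.copy 0 u) (G.copy 3 u) a ↔ ∃ v x, G.Triangle u v x a := by
  constructor
  · intro h
    obtain ⟨l1, v, p, b, hl1, hp, hb, rfl⟩ := h.succ (by simp)
    obtain ⟨l2, x, q, c, hl2, hq, hc, rfl⟩ := hb.succ (by simp; omega)
    obtain ⟨l3, y, r, e, hl3, hr, he, rfl⟩ := hc.succ (by simp; omega)
    rcases he.layer with ⟨h1, rfl⟩ | h1
    · have : y = u := by
        have := congrArg (Fin.modNat (m := 4)) h1
        simpa using this
      subst this
      exact ⟨v, x, p, q, r, hp, hq, hr, by ring⟩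
    · simp at *; omega
  · rintro ⟨v, x, p, q, r, hp, hq, hr, rfl⟩
    have h3 : G.layered.Walk (G.copy 2 x) (G.copy 3 u) (r + 0) :=
      .cons _ _ _ _ _ (by rw [layered_w_copy]; simpa using hr) (.nil _)
    have h2 : G.layered.Walk (G.copy 1 v) (G.copy 3 u) (q + (r + 0)) :=
      .cons _ _ _ _ _ (by rw [layered_w_copy]; simpa using hq) h3
    have h1 : G.layered.Walk (G.copy 0 u) (G.copy 3 u) (p + (q + (r + 0))) :=
      .cons _ _ _ _ _ (by rw [layered_w_copy]; simpa using hp) h2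
    convert h1 using 1
    ring

theorem Triangle.abs_le {G : WGraph} {M : ℕ} (h : G.Within M) {u v x : Fin G.n} {a : ℤ}
    (ht : G.Triangle u v x a) : |a| ≤ 3 * M := by
  obtain ⟨p, q, r, hp, hq, hr, rfl⟩ := ht
  have h1 := _root_.abs_le.1 (h _ _ _ hp)
  have h2 := _root_.abs_le.1 (h _ _ _ hq)
  have h3 := _root_.abs_le.1 (h _ _ _ hr)
  rw [_root_.abs_le]; constructor <;> linarith

/-- The shortest path distance from the first to the last copy of `u` tells whether there is a negative
triangle through `u`; if the last copy is not reachable, the entry reads `0`. -/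
theorem value_dist_neg_iff {G : WGraph} {M : ℕ} (h : G.Within M) (u : Fin G.n) :
    value (G.layered.dist (G.copy 0 u) (G.copy 3 u)) < 0 ↔ ∃ v x, ∃ a < 0, G.Triangle u v x a := by
  have hbdd : BddBelow {a | G.layered.Walk (G.copy 0 u) (G.copy 3 u) a} := by
    refine ⟨-(3 * M), fun a ha => ?_⟩
    obtain ⟨v, x, ht⟩ := (layered_walk_iff G u a).1 ha
    exact (abs_le.1 (ht.abs_le h)).1
  unfold dist
  split_ifs with hw
  · simp only [value]
    constructor
    · intro hlt
      have := Int.csInf_mem (s := {a | G.layered.Walk (G.copy 0 u) (G.copy 3 u) a}) hw hbdd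
      obtain ⟨v, x, ht⟩ := (layered_walk_iff G u _).1 this
      exact ⟨v, x, _, hlt, ht⟩
    · rintro ⟨v, x, a, ha, ht⟩
      exact (csInf_le hbdd ((layered_walk_iff G u a).2 ⟨v, x, ht⟩)).trans_lt ha
  · simp only [value, lt_irrefl, false_iff]
    rintro ⟨v, x, a, ha, ht⟩
    exact hw ⟨a, (layered_walk_iff G u a).2 ⟨v, x, ht⟩⟩

theorem abs_value_dist_le {G : WGraph} {M : ℕ} (h : G.Within M) (u : Fin G.n) :
    |value (G.layered.dist (G.copy 0 u) (G.copy 3 u))| ≤ 3 * M := by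
  unfold dist
  split_ifs with hw
  · simp only [value]
    have hbdd : BddBelow {a | G.layered.Walk (G.copy 0 u) (G.copy 3 u) a} := by
      refine ⟨-(3 * M), fun a ha => ?_⟩
      obtain ⟨v, x, ht⟩ := (layered_walk_iff G u a).1 ha
      exact (abs_le.1 (ht.abs_le h)).1
    have := Int.csInf_mem (s := {a | G.layered.Walk (G.copy 0 u) (G.copy 3 u) a}) hw hbdd
    obtain ⟨v, x, ht⟩ := (layered_walk_iff G u _).1 this
    exact ht.abs_le h
  · simp [value]

end WGraph

end FineGrained

namespace FineGrained
open scoped ENNReal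
open FineGrained.Expr

/-! ### A query for negative triangles, answered by shortest paths -/

/-- Answers the `NWT` instance stored in array `a` by a shortest path query on its layered graph. The
registers `N + 1, …, N + 9` and the arrays `N + 1`, `N + 2` are used as work space; at the end
register `N + 6` contains the answer.

The size of the graph is in register `N + 1`. In the first loop register `N + 2` runs through the
entries of the layered adjacency matrix, with row `N + 3` and column `N + 4`; register `N + 5` is the
position of the corresponding entry for `G`, and `N + 6` indicates whether the column belongs to the
copy after that of the row. The second loop counts in `N + 6` the negative distances from first to
last copies. -/
def triangleQuery (N a : ℕ) : Cmd := .block [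
  .assign (N + 1) (get a 0),
  .assign (N + 2) 0,
  .store (N + 1) 0 (4 * var (N + 1)),
  .loop (.op .lt (var (N + 2)) (16 * var (N + 1) * var (N + 1))) (.block [
    .assign (N + 3) (var (N + 2) / (4 * var (N + 1))),
    .assign (N + 4) (var (N + 2) % (4 * var (N + 1))),
    .assign (N + 5) (2 * ((var (N + 3) % var (N + 1)) * var (N + 1)
      + var (N + 4) % var (N + 1)) + 1),
    .assign (N + 6) (.op .eq (var (N + 4) / var (N + 1)) (var (N + 3) / var (N + 1) + 1)),
    .store (N + 1) (2 * var (N + 2) + 1) (var (N + 6) * get a (var (N + 5))),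
    .store (N + 1) (2 * var (N + 2) + 2) (var (N + 6) * get a (var (N + 5) + 1)),
    .assign (N + 2) (var (N + 2) + 1)]),
  .query (N + 1) (N + 2),
  .assign (N + 2) 0,
  .assign (N + 6) 0,
  .loop (.op .lt (var (N + 2)) (var (N + 1))) (.block [
    .assign (N + 6) (var (N + 6) + .op .lt (get (N + 2)
      (2 * (var (N + 2) * (4 * var (N + 1)) + (3 * var (N + 1) + var (N + 2))) + 1)) 0),
    .assign (N + 2) (var (N + 2) + 1)]),
  .assign (N + 6) (.op .lt 0 (var (N + 6)))]

/-- `τ` differs from `σ` at most in the work space of `triangleQuery N`. -/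
def QueryFrame (N : ℕ) (σ τ : Mem) : Prop :=
  (∀ x, x < N + 1 ∨ N + 10 ≤ x → τ.var x = σ.var x) ∧
  (∀ a, a < N + 1 ∨ N + 3 ≤ a → τ.arr a = σ.arr a)

theorem QueryFrame.set {N : ℕ} {σ τ : Mem} (h : QueryFrame N σ τ) {x : ℕ} {z : ℤ}
    (hx : N + 1 ≤ x) (hx' : x < N + 10) : QueryFrame N σ (τ.set x z) := by
  refine ⟨fun y hy => ?_, h.2⟩
  rw [Mem.set_var, if_neg (by omega), h.1 y hy]

theorem QueryFrame.put {N : ℕ} {σ τ : Mem} (h : QueryFrame N σ τ) {a : ℕ} {i z : ℤ}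
    (hx : N + 1 ≤ a) (hx' : a < N + 3) : QueryFrame N σ (τ.put a i z) := by
  refine ⟨h.1, fun y hy => ?_⟩
  rw [Mem.put_arr_ne _ _ _ (by omega), h.2 y hy]

/-- The bound on the numbers handled by `triangleQuery` on a graph with `n` vertices and weights at
most `n ^ d`. -/
def queryBound (d n : ℕ) : ℕ := 40 * n ^ (d + 2)

theorem queryBound_spec {d n : ℕ} (hn : 1 ≤ n) :
    32 * (n * n) + 8 ≤ queryBound d n ∧ 3 * n ^ d ≤ queryBound d n ∧ 40 * n ≤ queryBound d n := by
  unfold queryBound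
  have h1 : n ^ 2 ≤ n ^ (d + 2) := Nat.pow_le_pow_right hn (by omega)
  have h2 : n ^ d ≤ n ^ (d + 2) := Nat.pow_le_pow_right hn (by omega)
  have h3 : 1 ≤ n ^ (d + 2) := Nat.one_le_pow _ _ hn
  have h4 : n ^ 1 ≤ n ^ (d + 2) := Nat.pow_le_pow_right hn (by omega)
  refine ⟨?_, ?_, ?_⟩ <;> nlinarith

theorem flag_ite (c : Prop) [Decidable c] (o : Option ℤ) :
    flag (if c then o else none) = (if c then 1 else 0) * flag o := by
  split_ifs <;> simp [flag]

theorem value_ite (c : Prop) [Decidable c] (o : Option ℤ) :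
    value (if c then o else none) = (if c then 1 else 0) * value o := by
  split_ifs <;> simp [value]

theorem abs_flag_le (o : Option ℤ) : |flag o| ≤ 1 := by
  cases o <;> simp [flag]

theorem WGraph.Within.abs_value_le {G : WGraph} {M : ℕ} (h : G.Within M) (u v : Fin G.n) :
    |value (G.w u v)| ≤ M := by
  rcases hw : G.w u v with _ | a
  · simp [value]
  · exact h u v a hw

variable {d : ℕ} {f : ℕ → ℕ}

/-- One entry of the layered graph is written. -/
theorem sure_layered_entry {N a : ℕ} (ha : a < N) {G : WGraph} (hG : NWT.Admissible d G)
    {σ : Mem} {i : ℕ} (hi : i < 4 * G.n * (4 * G.n)) (h1 : σ.var (N + 1) = G.n)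
    (h2 : σ.var (N + 2) = i) (hσ : Holds (σ.arr a) G.enc) :
    Sure d f (.block [
      .assign (N + 3) (var (N + 2) / (4 * var (N + 1))),
      .assign (N + 4) (var (N + 2) % (4 * var (N + 1))),
      .assign (N + 5) (2 * ((var (N + 3) % var (N + 1)) * var (N + 1)
        + var (N + 4) % var (N + 1)) + 1),
      .assign (N + 6) (.op .eq (var (N + 4) / var (N + 1)) (var (N + 3) / var (N + 1) + 1)),
      .store (N + 1) (2 * var (N + 2) + 1) (var (N + 6) * get a (var (N + 5))),
      .store (N + 1) (2 * var (N + 2) + 2) (var (N + 6) * get a (var (N + 5) + 1)),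
      .assign (N + 2) (var (N + 2) + 1)]) σ (8 * unit (queryBound d G.n)) fun τ =>
      QueryFrame N σ τ ∧ τ.var (N + 1) = G.n ∧ τ.var (N + 2) = i + 1 ∧
      (∀ j : ℤ, j < 2 * i + 1 → τ.arr (N + 1) j = σ.arr (N + 1) j) ∧
      ∀ x y : Fin (4 * G.n), (x : ℕ) * (4 * G.n) + y = i →
        τ.arr (N + 1) (2 * i + 1) = flag (G.layered.w x y) ∧
        τ.arr (N + 1) (2 * i + 2) = value (G.layered.w x y) := by
  obtain ⟨hn, -, hw⟩ := hG
  change 1 ≤ G.n at hn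
  change G.Within (G.n ^ d) at hw
  rw [holds_enc] at hσ
  obtain ⟨hb1, hb2, hb3⟩ := queryBound_spec (d := d) hn
  generalize queryBound d G.n = b at *
  have hx : i / (4 * G.n) < 4 * G.n := Nat.div_lt_of_lt_mul hi
  have hy : i % (4 * G.n) < 4 * G.n := Nat.mod_lt _ (by omega)
  set X := i / (4 * G.n) with hX
  set Y := i % (4 * G.n) with hY
  have hu : X % G.n < G.n := Nat.mod_lt _ (by omega)
  have hv : Y % G.n < G.n := Nat.mod_lt _ (by omega)
  obtain ⟨hc1, hc2⟩ := hσ.2 ⟨X % G.n, hu⟩ ⟨Y % G.n, hv⟩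
  have hwb := hw.abs_value_le ⟨X % G.n, hu⟩ ⟨Y % G.n, hv⟩
  have hfb := abs_flag_le (G.w ⟨X % G.n, hu⟩ ⟨Y % G.n, hv⟩)
  have hXZ : (i : ℤ) / (4 * (G.n : ℤ)) = (X : ℤ) := by rw [hX]; push_cast; rfl
  have hYZ : (i : ℤ) % (4 * (G.n : ℤ)) = (Y : ℤ) := by rw [hY]; push_cast; rfl
  have hidx : (X % G.n) * G.n + Y % G.n < G.n * G.n := matrix_index_lt ⟨X % G.n, hu⟩ ⟨Y % G.n, hv⟩
  have hkb : 2 * ((X % G.n) * G.n + Y % G.n) + 1 ≤ b := by omega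
  have hib : 2 * i + 2 ≤ b := by nlinarith
  have hXb : X ≤ b := by omega
  have hYb : Y ≤ b := by omega
  have hnb : G.n ≤ b := by omega
  have hNa : a ≠ N + 1 := by omega
  have hi' : i ≤ b := by omega
  set K := 2 * ((X % G.n) * G.n + Y % G.n) + 1 with hK
  have hc1' : σ.arr a (K : ℤ) = flag (G.w ⟨X % G.n, hu⟩ ⟨Y % G.n, hv⟩) := by
    rw [← hc1, hK]; push_cast; rfl
  have hc2' : σ.arr a ((K : ℤ) + 1) = value (G.w ⟨X % G.n, hu⟩ ⟨Y % G.n, hv⟩) := by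
    rw [← hc2, hK]; push_cast; congr 1
  set c : ℤ := if Y / G.n = X / G.n + 1 then 1 else 0 with hc
  have hcb : |c| ≤ b := by
    rw [hc]; split_ifs <;> simp; omega
  have hf' : |flag (G.w ⟨X % G.n, hu⟩ ⟨Y % G.n, hv⟩)| ≤ b := hfb.trans (by exact_mod_cast by omega)
  have hv' : |value (G.w ⟨X % G.n, hu⟩ ⟨Y % G.n, hv⟩)| ≤ b := by
    refine hwb.trans ?_; exact_mod_cast by omega
  refine WP.assign_cons X (Nat.le_of_ble_eq_true rfl) (by simp [h1, h2, hi', hnb])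
    (by simp [h1, h2, hXZ]) ?_
  refine WP.assign_cons Y (Nat.le_of_ble_eq_true rfl) (by simp [h1, h2, hi', hnb])
    (by simp [h1, h2, hYZ]) ?_
  refine WP.assign_cons K (Nat.le_of_ble_eq_true rfl) (by simp [h1, hXb, hYb, hnb])
    (by simp [h1, hK]) ?_
  refine WP.assign_cons c (Nat.le_of_ble_eq_true rfl) (by simp [h1, hXb, hYb, hnb])
    (by simp only [ev_eq, ev_div, ev_add, ev_var, ev_one]; simp [h1, hc]; norm_cast) ?_
  refine WP.store_cons (2 * i + 1) _ (Nat.le_of_ble_eq_true rfl) (Nat.le_of_ble_eq_true rfl)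
    (by simp [h2, hi']) (by simp [hcb, hkb, hc1', hf']) (by simp [h2]) rfl ?_
  refine WP.store_cons (2 * i + 2) _ (Nat.le_of_ble_eq_true rfl) (Nat.le_of_ble_eq_true rfl)
    (by simp [h2, hi']) (by simp [hNa, hcb, hkb, hc2', hv']) (by simp [h2]) rfl ?_
  refine WP.assign_cons (i + 1) (Nat.le_of_ble_eq_true rfl) (by simp [h2, hi']) (by simp [h2]) ?_
  refine Sure.nil_unit ⟨?_, ?_, ?_, ?_, ?_⟩
  · refine QueryFrame.set (.put (.put (.set (.set (.set (.set ⟨fun _ _ => rfl, fun _ _ => rfl⟩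
      ?_ ?_) ?_ ?_) ?_ ?_) ?_ ?_) ?_ ?_) ?_ ?_) ?_ ?_ <;> omega
  · simp [h1]
  · simp
  · intro j hj
    simp [show j ≠ 2 * i + 1 by omega, show j ≠ 2 * i + 2 by omega]
  · intro x y hxy
    have ex : (x : ℕ) = X := by rw [hX, ← hxy, matrix_index_div]
    have ey : (y : ℕ) = Y := by rw [hY, ← hxy, matrix_index_mod]
    have ew : G.layered.w x y = if Y / G.n = X / G.n + 1 then
        G.w ⟨X % G.n, hu⟩ ⟨Y % G.n, hv⟩ else none := by
      simp only [WGraph.layered, Fin.coe_divNat, ex, ey]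
      congr 1
      congr 1 <;> (ext; simp [ex, ey])
    rw [ew, flag_ite, value_ite]
    simp [hNa, hc1', hc2', hc]

/-- The cost of `triangleQuery` on a graph with `n` vertices, without the weight of the query. -/
def queryCost (d n : ℕ) : ℕ := (144 * (n * n) + 4 * n + 20) * unit (queryBound d n)

theorem QueryFrame.trans {N : ℕ} {σ τ ρ : Mem} (h : QueryFrame N σ τ) (h' : QueryFrame N τ ρ) :
    QueryFrame N σ ρ :=
  ⟨fun x hx => (h'.1 x hx).trans (h.1 x hx), fun a ha => (h'.2 a ha).trans (h.2 a ha)⟩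

/-- The layered graph is written. -/
theorem sure_layered {N a : ℕ} (ha : a < N) {G : WGraph} (hG : NWT.Admissible d G)
    {σ : Mem} (h1 : σ.var (N + 1) = G.n)
    (h2 : σ.var (N + 2) = 0) (hσ : Holds (σ.arr a) G.enc) (hQ : σ.arr (N + 1) 0 = 4 * G.n) :
    Sure d f (.loop (.op .lt (var (N + 2)) (16 * var (N + 1) * var (N + 1))) (.block [
      .assign (N + 3) (var (N + 2) / (4 * var (N + 1))),
      .assign (N + 4) (var (N + 2) % (4 * var (N + 1))),
      .assign (N + 5) (2 * ((var (N + 3) % var (N + 1)) * var (N + 1)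
        + var (N + 4) % var (N + 1)) + 1),
      .assign (N + 6) (.op .eq (var (N + 4) / var (N + 1)) (var (N + 3) / var (N + 1) + 1)),
      .store (N + 1) (2 * var (N + 2) + 1) (var (N + 6) * get a (var (N + 5))),
      .store (N + 1) (2 * var (N + 2) + 2) (var (N + 6) * get a (var (N + 5) + 1)),
      .assign (N + 2) (var (N + 2) + 1)])) σ
      ((144 * (G.n * G.n) + 1) * unit (queryBound d G.n)) fun τ =>
      QueryFrame N σ τ ∧ τ.var (N + 1) = G.n ∧ Holds (τ.arr (N + 1)) G.layered.enc := by
  have hn : 1 ≤ G.n := hG.1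
  obtain ⟨hb1, hb2, hb3⟩ := queryBound_spec (d := d) hn
  refine (Sure.loop_const (4 * G.n * (4 * G.n)) (fun i τ => QueryFrame N σ τ ∧
    τ.var (N + 1) = G.n ∧ τ.var (N + 2) = i ∧ τ.arr (N + 1) 0 = 4 * G.n ∧
    ∀ x y : Fin (4 * G.n), (x : ℕ) * (4 * G.n) + y < i →
        τ.arr (N + 1) (2 * ((x : ℤ) * (4 * G.n : ℕ) + y) + 1) = flag (G.layered.w x y) ∧
        τ.arr (N + 1) (2 * ((x : ℤ) * (4 * G.n : ℕ) + y) + 2) = value (G.layered.w x y))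
    (8 * unit (queryBound d G.n)) (unit (queryBound d G.n)) ?_ ?_ ?_).mono ?_ ?_
  · rintro i hi τ ⟨hf, hv1, hv2, -, -⟩
    constructor
    · have := Expr.Ok.co_le_unit (b := queryBound d G.n) (σ := τ)
        (e := .op .lt (var (N + 2)) (16 * var (N + 1) * var (N + 1)))
        (by simp [hv1, hv2]; constructor <;> nlinarith) (Nat.le_of_ble_eq_true rfl)
      omega
    · have : (16 * (G.n : ℤ) * G.n) = ((4 * G.n * (4 * G.n) : ℕ) : ℤ) := by push_cast; ring
      simp only [ev_lt, ev_var, ev_mul, ev_ofNat, hv1, hv2, this, Nat.cast_lt]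
      simp
  · rintro i hi τ ⟨hf, hv1, hv2, h0, hrec⟩
    have hτ : Holds (τ.arr a) G.enc := by rw [hf.2 a (by omega)]; exact hσ
    refine (sure_layered_entry ha hG hi hv1 hv2 hτ).mono le_rfl ?_
    rintro ρ ⟨hf', hv1', hv2', hold, hnew⟩
    refine ⟨hf.trans hf', hv1', by exact_mod_cast hv2', by rw [hold _ (by omega), h0], ?_⟩
    intro x y hxy
    rcases Nat.lt_succ_iff_lt_or_eq.1 hxy with hlt | heq
    · have e : ((x : ℤ) * (4 * G.n : ℕ) + y) = (((x : ℕ) * (4 * G.n) + y : ℕ) : ℤ) := by push_cast; ring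
      rw [hold _ (by rw [e]; omega), hold _ (by rw [e]; omega)]
      exact hrec x y hlt
    · have e : ((x : ℤ) * (4 * G.n : ℕ) + y) = i := by rw [← heq]; push_cast; ring
      rw [e]; exact hnew x y heq
  · exact ⟨⟨fun _ _ => rfl, fun _ _ => rfl⟩, h1, by simpa using h2, hQ, fun x y h => by omega⟩
  · nlinarith
  · rintro τ ⟨hf, hv1, -, h0, hrec⟩
    refine ⟨hf, hv1, (holds_enc _ _).2 ⟨by rw [h0]; simp [WGraph.layered], fun x y => ?_⟩⟩
    exact hrec x y (matrix_index_lt x y)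

open Classical in
/-- The distances from first to last copies are scanned. -/
theorem sure_scan {N : ℕ} {G : WGraph} (hG : NWT.Admissible d G)
    {σ : Mem} (h1 : σ.var (N + 1) = G.n) (h2 : σ.var (N + 2) = 0) (h6 : σ.var (N + 6) = 0)
    (hσ : Holds (σ.arr (N + 2)) (encMatrix G.layered.n G.layered.dist)) :
    Sure d f (.loop (.op .lt (var (N + 2)) (var (N + 1))) (.block [
    .assign (N + 6) (var (N + 6) + .op .lt (get (N + 2)
      (2 * (var (N + 2) * (4 * var (N + 1)) + (3 * var (N + 1) + var (N + 2))) + 1)) 0),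
    .assign (N + 2) (var (N + 2) + 1)])) σ
      ((4 * G.n + 1) * unit (queryBound d G.n)) fun τ =>
      QueryFrame N σ τ ∧ ∃ r : ℕ, r ≤ G.n ∧ τ.var (N + 6) = r ∧
        (0 < r ↔ ∃ u v x, ∃ a < 0, G.Triangle u v x a) := by
  have hn : 1 ≤ G.n := hG.1
  obtain ⟨hb1, hb2, hb3⟩ := queryBound_spec (d := d) hn
  have hw : G.Within (G.n ^ d) := hG.2.2
  have hU := one_le_unit (queryBound d G.n)
  generalize queryBound d G.n = b at *
  refine (Sure.loop_const G.n (fun i τ => QueryFrame N σ τ ∧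
    τ.var (N + 1) = G.n ∧ τ.var (N + 2) = i ∧ τ.arr (N + 2) = σ.arr (N + 2) ∧
    ∃ r : ℕ, r ≤ i ∧ τ.var (N + 6) = r ∧
      (0 < r ↔ ∃ u : Fin G.n, u < i ∧ ∃ v x, ∃ a < 0, G.Triangle u v x a))
    (3 * unit b) (unit b) ?_ ?_ ?_).mono ?_ ?_
  · rintro i hi τ ⟨hf, hv1, hv2, -, -⟩
    constructor
    · have := Expr.Ok.co_le_unit (b := b) (σ := τ)
        (e := .op .lt (var (N + 2)) (var (N + 1)))
        (by simp [hv1, hv2]; constructor <;> omega) (Nat.le_of_ble_eq_true rfl)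
      omega
    · simp [hv1, hv2]
  · rintro i hi τ ⟨hf, hv1, hv2, harr, r, hr, hv6, hiff⟩
    have hcell := ((holds_encMatrix _ _ _).1 hσ (G.copy 0 ⟨i, hi⟩) (G.copy 3 ⟨i, hi⟩)).2
    have hneg := WGraph.value_dist_neg_iff hw ⟨i, hi⟩
    have habs := WGraph.abs_value_dist_le hw ⟨i, hi⟩
    rw [WGraph.copy_val, WGraph.copy_val] at hcell
    set D := value (G.layered.dist (G.copy 0 ⟨i, hi⟩) (G.copy 3 ⟨i, hi⟩)) with hD
    have hcell' : σ.arr (N + 2) (2 * ((i : ℤ) * (4 * G.n) + (3 * G.n + i)) + 1) = D := by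
      rw [← hcell]; simp [WGraph.layered]
    have hDb : |D| ≤ b := habs.trans (by exact_mod_cast hb2)
    refine WP.assign_cons ((r + if D < 0 then 1 else 0 : ℕ) : ℤ) (Nat.le_of_ble_eq_true rfl) ?_ ?_ ?_
    · simp only [ok_add, ok_op, ok_var, ok_get, ok_mul, ok_ofNat, hv1, hv2, hv6,
        ev_add, ev_mul, ev_var, ev_ofNat, ev_one, Nat.abs_cast, Nat.cast_le, harr, hcell', hDb]
      simp only [true_and, and_true]
      omega
    · simp only [hv1, hv2, hv6, ev_add, ev_mul, ev_var, ev_ofNat, ev_one, harr, hcell', ev_lt,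
        ev_get, ev_zero]
      split_ifs <;> simp
    refine WP.assign_cons (i + 1) (Nat.le_of_ble_eq_true rfl) (by simp [hv2]; omega)
      (by simp [hv2]) ?_
    refine Sure.nil_unit ⟨hf.trans ?_, by simp [hv1], by simp, by simpa using harr,
      r + if D < 0 then 1 else 0, ?_, by simp, ?_⟩
    · refine QueryFrame.set (.set ⟨fun _ _ => rfl, fun _ _ => rfl⟩ ?_ ?_) ?_ ?_ <;> omega
    · split_ifs <;> omega
    · rw [Nat.add_pos_iff_pos_or_pos, hiff]
      constructor
      · rintro (⟨u, hu, h⟩ | h)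
        · exact ⟨u, by omega, h⟩
        · refine ⟨⟨i, hi⟩, by simp, hneg.1 ?_⟩
          by_contra hc
          simp [hc] at h
      · rintro ⟨u, hu, h⟩
        rcases Nat.lt_succ_iff_lt_or_eq.1 hu with hlt | heq
        · exact Or.inl ⟨u, hlt, h⟩
        · right
          obtain rfl : u = ⟨i, hi⟩ := Fin.ext heq
          simp [hneg.2 h]
  · exact ⟨⟨fun _ _ => rfl, fun _ _ => rfl⟩, h1, by simpa using h2, rfl, 0, by simp,
      by simpa using h6, by simp⟩
  · nlinarith
  · rintro τ ⟨hf, -, -, -, r, hr, hv6, hiff⟩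
    refine ⟨hf, r, hr, hv6, hiff.trans ?_⟩
    simp

open Classical in
/-- The query has `4 * n` nodes, which accounts for the weight `f (4 * n)`. -/
theorem sure_triangleQuery {N a : ℕ} (ha : a < N) {G : WGraph} (hG : NWT.Admissible d G) {σ : Mem}
    (hσ : Holds (σ.arr a) G.enc) :
    Sure d f (triangleQuery N a) σ (queryCost d G.n + f (4 * G.n)) fun τ => QueryFrame N σ τ ∧
      τ.var (N + 6) = if ∃ u v x, ∃ a < 0, G.Triangle u v x a then 1 else 0 := by
  have hn : 1 ≤ G.n := hG.1
  obtain ⟨hb1, hb2, hb3⟩ := queryBound_spec (d := d) hn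
  have h0 : σ.arr a 0 = G.n := ((holds_enc _ _).1 hσ).1
  have hU := one_le_unit (queryBound d G.n)
  unfold queryCost
  have h8 : NWT.Admissible d G → APSP.Admissible d G.layered := fun h =>
    ⟨by change 1 ≤ 4 * G.n; omega, G.layered_noNegCycle, WGraph.layered_within h.2.2⟩
  refine WP.cost (k := unit (queryBound d G.n) + (unit (queryBound d G.n) + (unit (queryBound d G.n)
    + ((144 * (G.n * G.n) + 1) * unit (queryBound d G.n) + (1 + f (4 * G.n) +
    (unit (queryBound d G.n) + (unit (queryBound d G.n) + ((4 * G.n + 1) * unit (queryBound d G.n)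
    + (2 * unit (queryBound d G.n)))))))))) ?_ (by nlinarith)
  refine WP.assign_step G.n (Nat.le_of_ble_eq_true rfl) (by simp [h0]; omega) (by simp [h0]) ?_
  refine WP.assign_step 0 (Nat.le_of_ble_eq_true rfl) (by simp) (by simp) ?_
  refine WP.store_step 0 (4 * G.n) (Nat.le_of_ble_eq_true rfl) (Nat.le_of_ble_eq_true rfl)
    (by simp) (by simp; omega) (by simp) (by simp) ?_
  have hNa : a ≠ N + 1 := by omega
  refine WP.cons (sure_layered ha hG (by simp) (by simp) (by rw [Mem.put_arr_ne _ _ _ hNa]; exact hσ)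
    (by simp)) ?_
  rintro τ ⟨hf, hv1, hQ⟩
  replace hf : QueryFrame N σ τ := by
    refine .trans (.put (.set (.set ⟨fun _ _ => rfl, fun _ _ => rfl⟩ ?_ ?_) ?_ ?_) ?_ ?_) hf <;> omega
  refine WP.cons (Sure.query (h8 hG) hQ) ?_
  rintro τ₁ ⟨hv, harr, hR⟩
  refine WP.assign_step 0 (Nat.le_of_ble_eq_true rfl) (by simp) (by simp) ?_
  refine WP.assign_step 0 (Nat.le_of_ble_eq_true rfl) (by simp) (by simp) ?_
  refine WP.cons (sure_scan hG (by simp [hv, hv1]) (by simp) (by simp) (by simpa using hR)) ?_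
  rintro τ₂ ⟨hf₂, r, hr, hv6, hiff⟩
  refine WP.assign_cons (if ∃ u v x, ∃ a < 0, G.Triangle u v x a then 1 else 0)
    (Nat.le_of_ble_eq_true rfl) (by simp [hv6]; omega) (by simp [hv6, ← hiff]) ?_
  refine Sure.nil_unit (n := 0) ⟨?_, by simp⟩
  refine hf.trans ⟨fun x hx => ?_, fun a ha => ?_⟩
  · rw [Mem.set_var, if_neg (by omega), hf₂.1 x hx, Mem.set_var, if_neg (by omega), Mem.set_var,
      if_neg (by omega), hv]
  · rw [Mem.set_arr, hf₂.2 a ha, Mem.set_arr, Mem.set_arr, harr a (by omega)]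

end FineGrained

namespace FineGrained
open scoped ENNReal
open FineGrained.Expr

/-! ### Simulating programs with an `NWT` oracle -/

/-- Only registers and arrays with names below `N` occur. -/
def Expr.NamesLt (N : ℕ) : Expr → Prop
  | .lit _ => True
  | .var x => x < N
  | .op _ e f => e.NamesLt N ∧ f.NamesLt N
  | .get a e => a < N ∧ e.NamesLt N

/-- Only registers and arrays with names below `N` occur. -/
def Cmd.NamesLt (N : ℕ) : Cmd → Prop
  | .skip => True
  | .assign x e => x < N ∧ e.NamesLt N
  | .store a i e => a < N ∧ i.NamesLt N ∧ e.NamesLt N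
  | .flip x => x < N
  | .query a b => a < N ∧ b < N
  | .seq p q => p.NamesLt N ∧ q.NamesLt N
  | .cond e p q => e.NamesLt N ∧ p.NamesLt N ∧ q.NamesLt N
  | .loop e p => e.NamesLt N ∧ p.NamesLt N

theorem Expr.NamesLt.mono {N M : ℕ} (h : N ≤ M) {e : Expr} (he : e.NamesLt N) : e.NamesLt M := by
  induction e with
  | lit z => trivial
  | var x => exact lt_of_lt_of_le he h
  | op o e f he' hf' => exact ⟨he' he.1, hf' he.2⟩
  | get a e he' => exact ⟨lt_of_lt_of_le he.1 h, he' he.2⟩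

theorem Cmd.NamesLt.mono {N M : ℕ} (h : N ≤ M) {p : Cmd} (hp : p.NamesLt N) : p.NamesLt M := by
  induction p with
  | skip => trivial
  | assign x e => exact ⟨lt_of_lt_of_le hp.1 h, hp.2.mono h⟩
  | store a i e => exact ⟨lt_of_lt_of_le hp.1 h, hp.2.1.mono h, hp.2.2.mono h⟩
  | flip x => exact lt_of_lt_of_le hp h
  | query a b => exact ⟨lt_of_lt_of_le hp.1 h, lt_of_lt_of_le hp.2 h⟩
  | seq p q ihp ihq => exact ⟨ihp hp.1, ihq hp.2⟩
  | cond e p q ihp ihq => exact ⟨hp.1.mono h, ihp hp.2.1, ihq hp.2.2⟩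
  | loop e p ih => exact ⟨hp.1.mono h, ih hp.2⟩

theorem Expr.exists_namesLt (e : Expr) : ∃ N, e.NamesLt N := by
  induction e with
  | lit z => exact ⟨0, trivial⟩
  | var x => exact ⟨x + 1, Nat.lt_succ_self x⟩
  | op o e f he hf =>
    obtain ⟨N, hN⟩ := he
    obtain ⟨M, hM⟩ := hf
    exact ⟨max N M, hN.mono (le_max_left _ _), hM.mono (le_max_right _ _)⟩
  | get a e he =>
    obtain ⟨N, hN⟩ := he
    exact ⟨max (a + 1) N, by omega, hN.mono (le_max_right _ _)⟩

theorem Cmd.exists_namesLt (p : Cmd) : ∃ N, p.NamesLt N := by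
  induction p with
  | skip => exact ⟨0, trivial⟩
  | assign x e =>
    obtain ⟨N, hN⟩ := e.exists_namesLt
    exact ⟨max (x + 1) N, by omega, hN.mono (le_max_right _ _)⟩
  | store a i e =>
    obtain ⟨N, hN⟩ := e.exists_namesLt
    obtain ⟨M, hM⟩ := i.exists_namesLt
    exact ⟨max (a + 1) (max N M), by omega,
      hM.mono ((le_max_right _ _).trans (le_max_right _ _)),
      hN.mono ((le_max_left _ _).trans (le_max_right _ _))⟩
  | flip x => exact ⟨x + 1, Nat.lt_succ_self x⟩
  | query a b => exact ⟨max (a + 1) (b + 1), by omega, by omega⟩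
  | seq p q ihp ihq =>
    obtain ⟨N, hN⟩ := ihp
    obtain ⟨M, hM⟩ := ihq
    exact ⟨max N M, hN.mono (le_max_left _ _), hM.mono (le_max_right _ _)⟩
  | cond e p q ihp ihq =>
    obtain ⟨K, hK⟩ := e.exists_namesLt
    obtain ⟨N, hN⟩ := ihp
    obtain ⟨M, hM⟩ := ihq
    exact ⟨max K (max N M), hK.mono (le_max_left _ _),
      hN.mono ((le_max_left _ _).trans (le_max_right _ _)),
      hM.mono ((le_max_right _ _).trans (le_max_right _ _))⟩
  | loop e p ih =>
    obtain ⟨N, hN⟩ := e.exists_namesLt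
    obtain ⟨M, hM⟩ := ih
    exact ⟨max N M, hN.mono (le_max_left _ _), hM.mono (le_max_right _ _)⟩

theorem Expr.NamesLt.congr {N : ℕ} {σ τ : Mem} (hv : ∀ x < N, τ.var x = σ.var x)
    (ha : ∀ a < N, τ.arr a = σ.arr a) {e : Expr} (he : e.NamesLt N) :
    e.ev τ = e.ev σ ∧ e.co τ = e.co σ := by
  induction e with
  | lit z => exact ⟨rfl, rfl⟩
  | var x => simp only [Expr.ev, Expr.co, hv x he, and_self]
  | op o e f he' hf' =>
    obtain ⟨h1, h2⟩ := he' he.1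
    obtain ⟨h3, h4⟩ := hf' he.2
    simp only [Expr.ev, Expr.co, h1, h2, h3, h4, and_self]
  | get a e he' =>
    obtain ⟨h1, h2⟩ := he' he.2
    simp only [Expr.ev, Expr.co, h1, h2, ha a he.1, and_self]

/-- A store that also appends the address to the log kept in array `N`; register `N` contains the
length of the log. The name of the array is not recorded: addresses are cleared in all arrays. -/
def logged (N a : ℕ) (i e : Expr) : Cmd :=
  .seq (.store N (var N) i) (.seq (.assign N (var N + 1)) (.store a i e))

/-- The program `p`, with all stores logged and the queries answered by shortest paths. -/
def sim (N : ℕ) : Cmd → Cmd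
  | .skip => .skip
  | .assign x e => .assign x e
  | .store a i e => logged N a i e
  | .flip x => .flip x
  | .query a b => .seq (triangleQuery N a) (logged N b 0 (var (N + 6)))
  | .seq p q => .seq (sim N p) (sim N q)
  | .cond e p q => .cond e (sim N p) (sim N q)
  | .loop e p => .loop e (sim N p)

/-- The log contains the addresses of all nonzero cells in arrays below `N`, and its total bit length
is at most `B`. -/
def LogInv (N B : ℕ) (σ : Mem) : Prop :=
  ∃ c : ℕ, σ.var N = c ∧ (∀ a < N, ∀ i, σ.arr a i ≠ 0 → ∃ k < c, σ.arr N k = i) ∧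
    (∀ i, σ.arr N i ≠ 0 → 0 ≤ i ∧ i < c) ∧
    ∑ k ∈ Finset.range c, (1 + bits (σ.arr N k)) ≤ B

theorem LogInv.mono {N B B' : ℕ} {σ : Mem} (h : LogInv N B σ) (hB : B ≤ B') : LogInv N B' σ := by
  obtain ⟨c, h1, h2, h3, h4⟩ := h
  exact ⟨c, h1, h2, h3, h4.trans hB⟩

theorem LogInv.congr {N B : ℕ} {σ τ : Mem} (h : LogInv N B σ) (hv : τ.var N = σ.var N)
    (ha : ∀ a < N + 1, τ.arr a = σ.arr a) : LogInv N B τ := by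
  obtain ⟨c, h1, h2, h3, h4⟩ := h
  refine ⟨c, hv.trans h1, fun a haN i hi => ?_, fun i hi => ?_, ?_⟩
  · rw [ha a (by omega)] at hi
    rw [ha N (by omega)]
    exact h2 a haN i hi
  · rw [ha N (by omega)] at hi
    exact h3 i hi
  · rw [ha N (by omega)]; exact h4

theorem LogInv.var_le {N B : ℕ} {σ : Mem} (h : LogInv N B σ) : ∃ c : ℕ, σ.var N = c ∧ c ≤ B := by
  obtain ⟨c, h1, h2, h3, h4⟩ := h
  refine ⟨c, h1, le_trans ?_ h4⟩
  calc c = ∑ k ∈ Finset.range c, 1 := by simp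
    _ ≤ _ := Finset.sum_le_sum fun k _ => by omega

theorem LogInv.put {N B : ℕ} {σ : Mem} (h : LogInv N B σ) {a : ℕ} (ha : a < N) (j z : ℤ) :
    LogInv N (B + (1 + bits j)) (((σ.put N (σ.var N) j).set N (σ.var N + 1)).put a j z) := by
  obtain ⟨c, h1, h2, h3, h4⟩ := h
  have hNa : N ≠ a := by omega
  refine ⟨c + 1, by simp [h1], fun b hb i hi => ?_, fun i hi => ?_, ?_⟩
  · have hbN : b ≠ N := by omega
    by_cases hij : b = a ∧ i = j
    · refine ⟨c, by omega, ?_⟩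
      simp [hNa, h1, hij.2]
    · have : σ.arr b i ≠ 0 := by simpa [hij, hbN] using hi
      obtain ⟨k, hk, hki⟩ := h2 b hb i this
      refine ⟨k, by omega, ?_⟩
      have hkc : (k : ℤ) ≠ c := by omega
      simp [hNa, h1, hkc, hki]
  · push_cast
    by_cases hic : i = c
    · omega
    · have : σ.arr N i ≠ 0 := by simpa [hNa, h1, hic] using hi
      have := h3 i this
      omega
  · rw [Finset.sum_range_succ]
    refine add_le_add (le_trans (Finset.sum_le_sum fun k hk => ?_) h4) ?_
    · have hkc : (k : ℤ) ≠ c := by have := Finset.mem_range.1 hk; omega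
      simp [hNa, h1, hkc]
    · simp [hNa, h1]

variable {d : ℕ} {f : ℕ → ℕ}

theorem sure_logged {N a : ℕ} {i e : Expr} {σ : Mem}
    (hi : ∀ τ : Mem, (∀ x ≠ N, τ.var x = σ.var x) → (∀ b ≠ N, τ.arr b = σ.arr b) →
      i.ev τ = i.ev σ ∧ i.co τ = i.co σ)
    (he : ∀ τ : Mem, (∀ x ≠ N, τ.var x = σ.var x) → (∀ b ≠ N, τ.arr b = σ.arr b) →
      e.ev τ = e.ev σ ∧ e.co τ = e.co σ) :
    Sure d f (logged N a i e) σ (9 + 4 * bits (σ.var N) + 2 * i.co σ + e.co σ) fun τ =>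
      τ = ((σ.put N (σ.var N) (i.ev σ)).set N (σ.var N + 1)).put a (i.ev σ) (e.ev σ) := by
  set τ := (σ.put N (σ.var N) (i.ev σ)).set N (σ.var N + 1) with hτ
  have hv : ∀ x ≠ N, τ.var x = σ.var x := fun x hx => by simp [hτ, hx]
  have ha : ∀ b ≠ N, τ.arr b = σ.arr b := fun b hb => by
    rw [hτ, Mem.set_arr, Mem.put_arr_ne _ _ _ hb]
  obtain ⟨hi1, hi2⟩ := hi τ hv ha
  obtain ⟨he1, he2⟩ := he τ hv ha
  have h1 : bits 1 = 1 := rfl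
  refine WP.cost (k := (2 + bits (σ.var N) + i.co σ) + ((6 + 3 * bits (σ.var N)) +
    (1 + i.co σ + e.co σ))) (Sure.seq
    (Q := fun τ => τ = σ.put N (σ.var N) (i.ev σ)) (Sure.store ?_ rfl) ?_) (by omega)
  · simp only [Expr.co]; omega
  rintro _ rfl
  refine Sure.seq (Q := fun ρ => ρ = τ) (Sure.assign ?_ rfl) ?_
  · change 1 + ((1 + bits (σ.var N)) + (1 + bits 1) + (1 + bits (σ.var N)) * (1 + bits 1)) ≤ _
    rw [h1]; omega
  rintro _ rfl
  exact Sure.store (by rw [hi2, he2]) (by rw [hi1, he1])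

/-- The total weight of the simulation of one query. -/
def simCost (d : ℕ) (f : ℕ → ℕ) (n : ℕ) : ℕ := queryCost d n + f (4 * n)

/-- The part of the simulation relation that concerns the memory `σ` of the simulating machine: it
agrees with the simulated state `t`, and with the initial memory `σ₀` outside the work space. -/
structure SimMem (N M : ℕ) (σ₀ : Mem) (t : State) (σ : Mem) : Prop where
  var_eq : ∀ x < N, σ.var x = t.var x
  arr_eq : ∀ a < N, σ.arr a = t.arr a
  frame_var : ∀ x, N + 10 ≤ x → σ.var x = σ₀.var x
  frame_arr : ∀ a, N + 3 ≤ a → σ.arr a = σ₀.arr a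
  log : LogInv N (M + t.time) σ
  bits_le : ∀ a < N, ∀ i, bits (σ.arr a i) ≤ M + t.time

/-- The cost of simulating `k` time units, apart from the queries, if the initial log has bit length at
most `M`. -/
def simTime (M k : ℕ) : ℕ := 20 * k * ((M + k).size + 1)

theorem simTime_add (M k l : ℕ) : simTime M k + 20 * l * ((M + k + l).size + 1) ≤ simTime M (k + l) := by
  unfold simTime
  have : (M + k).size ≤ (M + k + l).size := Nat.size_le_size (by omega)
  rw [← add_assoc M k l]
  nlinarith [Nat.mul_le_mul_left k this]

/-- The simulation relation between a state `t` of a program with an `NWT` oracle and a state `t'` of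
the simulating program; `r₀` is the initial value of `res f`. -/
structure Sim (d : ℕ) (f : ℕ → ℕ) (N M : ℕ) (σ₀ : Mem) (r₀ : ℕ) (t t' : State) : Prop where
  mem : SimMem N M σ₀ t t'.mem
  res : t'.res f ≤ r₀ + simTime M t.time + (t.queries.map (simCost d f)).sum

section
variable {N M r₀ : ℕ} {σ₀ : Mem}

theorem SimMem.tick {t : State} {σ : Mem} (h : SimMem N M σ₀ t σ) (k : ℕ) :
    SimMem N M σ₀ (t.tick k) σ :=
  ⟨h.var_eq, h.arr_eq, h.frame_var, h.frame_arr, h.log.mono (by simp [State.tick]),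
    fun a ha i => (h.bits_le a ha i).trans (by simp [State.tick])⟩

theorem SimMem.setVar {t : State} {σ : Mem} (h : SimMem N M σ₀ t σ) {x : ℕ} (hx : x < N) (z : ℤ) :
    SimMem N M σ₀ (t.setVar x z) (σ.set x z) := by
  refine ⟨fun y hy => ?_, h.arr_eq, fun y hy => ?_, h.frame_arr, ?_, h.bits_le⟩
  · simp only [Mem.set_var, State.setVar, Function.update_apply, h.var_eq y hy]
  · rw [Mem.set_var, if_neg (by omega), h.frame_var y hy]
  · exact h.log.congr (by rw [Mem.set_var, if_neg (by omega)]) fun _ _ => rfl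

/-- The relation is preserved by a logged store. -/
theorem SimMem.setCell {t : State} {σ : Mem} (h : SimMem N M σ₀ t σ) {a : ℕ} (ha : a < N) (j z : ℤ)
    {k : ℕ} (hk : 1 + bits j ≤ k) (hz : bits z ≤ M + t.time + k) :
    SimMem N M σ₀ ((t.tick k).setCell a j z)
      (((σ.put N (σ.var N) j).set N (σ.var N + 1)).put a j z) := by
  refine ⟨fun y hy => ?_, fun b hb => ?_, fun y hy => ?_, fun b hb => ?_, ?_, fun b hb i => ?_⟩
  · have : y ≠ N := by omega
    simp [this, h.var_eq y hy, State.setCell, State.tick]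
  · have hbN : b ≠ N := by omega
    have haN : a ≠ N := by omega
    funext i
    have h1 := h.arr_eq b hb
    by_cases hba : b = a
    · subst hba
      simp [hbN, State.setCell, State.tick, h1, Function.update_apply]
    · simp [hbN, State.setCell, State.tick, h1, hba]
  · have : y ≠ N := by omega
    simp [this, h.frame_var y hy]
  · have hbN : b ≠ N := by omega
    have hba : b ≠ a := by omega
    rw [Mem.put_arr_ne _ _ _ hba, Mem.set_arr, Mem.put_arr_ne _ _ _ hbN, h.frame_arr b hb]
  · refine (h.log.put ha j z).mono ?_
    simp only [State.setCell, State.tick]; omega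
  · have hbN : b ≠ N := by omega
    have := h.bits_le b hb i
    simp only [State.setCell, State.tick]
    by_cases hij : b = a ∧ i = j
    · simp [hij]; omega
    · simp [hij, hbN]; omega

/-- A deterministic step of the simulated program is simulated by a program that surely reaches a
related state. -/
theorem exec_sim_of_sure {q : Cmd} {t s' : State} {k : ℕ} {Q : Mem → Prop}
    (h : Sure d f q s'.mem k Q)
    (hQ : ∀ t' : State, Q t'.mem → t'.res f ≤ s'.res f + k → Sim d f N M σ₀ r₀ t t') :
    ∃ μ', Exec APSP d q s' μ' ∧ ∀ F F' : State → ℝ≥0∞,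
      (∀ r ∈ (PMF.pure t).support, ∀ t', Sim d f N M σ₀ r₀ r t' → F' t' ≤ F r) →
      expect μ' F' ≤ expect (PMF.pure t) F := by
  obtain ⟨μ', h1, h2, h3⟩ := h s' rfl
  refine ⟨μ', h1, fun F F' hF => ?_⟩
  rw [expect_pure, ← expect_const μ' (F t)]
  refine expect_mono fun t' ht' => hF t (by simp) t' (hQ t' ?_ (h2 t' ht'))
  exact ind_ne_top (ne_top_of_expect (ne_top_of_le_ne_top ENNReal.zero_ne_top h3) ht')

theorem overwrite_singleton (m : ℤ → ℤ) (z : ℤ) : overwrite m [z] = Function.update m 0 z := by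
  funext i
  rcases eq_or_ne i 0 with rfl | hi
  · simp [overwrite]
  · rw [overwrite_of_ge _ _ (by simp; omega), Function.update_of_ne hi]

/-- Sequential composition of simulations. That `μ'` simulates `μ` is expressed by an inequality between
the expectations of all functions that are ordered along the simulation relation. -/
theorem sim_bind {p q : Cmd} {s' : State} {μ : PMF State} {ν : State → PMF State}
    (hp : ∃ μ', Exec APSP d p s' μ' ∧ ∀ F F' : State → ℝ≥0∞,
      (∀ r ∈ μ.support, ∀ t', Sim d f N M σ₀ r₀ r t' → F' t' ≤ F r) →
      expect μ' F' ≤ expect μ F)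
    (hq : ∀ t ∈ μ.support, ∀ t', Sim d f N M σ₀ r₀ t t' →
      ∃ ρ, Exec APSP d q t' ρ ∧ ∀ F F' : State → ℝ≥0∞,
        (∀ r ∈ (ν t).support, ∀ t', Sim d f N M σ₀ r₀ r t' → F' t' ≤ F r) →
        expect ρ F' ≤ expect (ν t) F) :
    ∃ (μ' : PMF State) (ν' : State → PMF State), Exec APSP d p s' μ' ∧
      (∀ t' ∈ μ'.support, Exec APSP d q t' (ν' t')) ∧ ∀ F F' : State → ℝ≥0∞,
        (∀ r ∈ (μ.bind ν).support, ∀ t', Sim d f N M σ₀ r₀ r t' → F' t' ≤ F r) →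
        expect (μ'.bind ν') F' ≤ expect (μ.bind ν) F := by
  classical
  obtain ⟨μ', hμ', hF⟩ := hp
  have key : ∀ t', (∃ t ∈ μ.support, Sim d f N M σ₀ r₀ t t') → ∃ ρ, Exec APSP d q t' ρ := by
    rintro t' ⟨t, ht, hs⟩
    obtain ⟨ρ, hρ, -⟩ := hq t ht t' hs
    exact ⟨ρ, hρ⟩
  choose! ν' hν' using key
  -- The function that is `⊤` off the relation has expectation zero, so only related states are
  -- reached.
  have hsup : ∀ t' ∈ μ'.support, ∃ t ∈ μ.support, Sim d f N M σ₀ r₀ t t' := by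
    have h0 := hF (fun _ => 0) (fun t' => if ∃ t ∈ μ.support, Sim d f N M σ₀ r₀ t t' then 0 else ⊤)
      (fun t ht t' hs => by rw [if_pos ⟨t, ht, hs⟩])
    rw [expect_const] at h0
    intro t' ht'
    by_contra hc
    exact ne_top_of_expect (ne_top_of_le_ne_top ENNReal.zero_ne_top h0) ht' (if_neg hc)
  refine ⟨μ', ν', hμ', fun t' ht' => hν' t' (hsup t' ht'), ?_⟩
  intro F F' hFF
  rw [expect_bind, expect_bind]
  refine hF _ _ fun t ht t' hs => ?_
  obtain ⟨ρ, hρ, hρF⟩ := hq t ht t' hs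
  obtain rfl := exec_unique (hν' t' ⟨t, ht, hs⟩) hρ
  refine hρF F F' fun r hr r' => hFF r ?_ r'
  exact (PMF.mem_support_bind_iff _ _ _).2 ⟨t, ht, hr⟩

theorem Sim.guard {s s' : State} (hs : Sim d f N M σ₀ r₀ s s') {e : Expr} (he : e.NamesLt N) :
    e.eval s = e.eval s' ∧
      Sim d f N M σ₀ r₀ (s.tick (1 + e.cost s)) (s'.tick (1 + e.cost s')) := by
  have hc := he.congr (σ := s.mem) (τ := s'.mem) hs.mem.var_eq hs.mem.arr_eq
  refine ⟨by rw [Expr.eval_eq, Expr.eval_eq, hc.1], hs.mem.tick _, ?_⟩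
  have h0 := simTime_add M s.time (1 + e.cost s)
  have h1 := hs.res
  rw [res_tick, Expr.cost_eq s' e, hc.2, ← Expr.cost_eq]
  simp only [State.tick]; nlinarith

/-- The simulating program reaches only related states, with the same probabilities. This is expressed
by the inequality for all functions `F`, `F'` that are ordered along the relation. -/
theorem exec_sim {p : Cmd} {s : State} {μ : PMF State} (h : Exec NWT d p s μ) (hN : p.NamesLt N) :
    ∀ s', Sim d f N M σ₀ r₀ s s' → ∃ μ', Exec APSP d (sim N p) s' μ' ∧ ∀ F F' : State → ℝ≥0∞,
      (∀ r ∈ μ.support, ∀ t', Sim d f N M σ₀ r₀ r t' → F' t' ≤ F r) →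
      expect μ' F' ≤ expect μ F := by
  classical
  induction h with
  | skip s =>
    intro s' hs
    refine exec_sim_of_sure (k := 1) (Q := fun τ => τ = s'.mem) (Sure.nil le_rfl rfl) ?_
    intro t' ht hres
    have := simTime_add M s.time 1
    refine ⟨ht ▸ hs.mem.tick 1, ?_⟩
    have h1 := hs.res
    simp only [State.tick]; omega
  | assign s x e =>
    intro s' hs
    have he := hN.2.congr (σ := s.mem) (τ := s'.mem) hs.mem.var_eq hs.mem.arr_eq
    refine exec_sim_of_sure (Q := fun τ => τ = s'.mem.set x (e.ev s'.mem)) (Sure.assign le_rfl rfl) ?_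
    intro t' ht hres
    have := simTime_add M s.time (1 + e.cost s)
    have h1 := hs.res
    rw [he.2, ← Expr.cost_eq] at hres
    refine ⟨?_, ?_⟩
    · rw [ht, he.1, ← Expr.eval_eq]
      exact (hs.mem.tick _).setVar hN.1 _
    · simp only [State.tick, State.setVar]; nlinarith
  | store s a i e =>
    intro s' hs
    have he := hN.2.2.congr (σ := s.mem) (τ := s'.mem) hs.mem.var_eq hs.mem.arr_eq
    have hi := hN.2.1.congr (σ := s.mem) (τ := s'.mem) hs.mem.var_eq hs.mem.arr_eq
    have aux : ∀ g : Expr, g.NamesLt N → ∀ τ : Mem, (∀ x ≠ N, τ.var x = s'.mem.var x) →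
        (∀ b ≠ N, τ.arr b = s'.mem.arr b) → g.ev τ = g.ev s'.mem ∧ g.co τ = g.co s'.mem :=
      fun g hg τ h1 h2 => hg.congr (fun x hx => h1 x (by omega)) (fun x hx => h2 x (by omega))
    refine exec_sim_of_sure (sure_logged (a := a) (aux i hN.2.1) (aux e hN.2.2)) ?_
    intro t' ht hres
    have h0 := simTime_add M s.time (1 + i.cost s + e.cost s)
    have h1 := hs.res
    obtain ⟨c, hc, hcM⟩ := hs.mem.log.var_le
    have hb : bits (s'.mem.var N) ≤ (M + s.time + (1 + i.cost s + e.cost s)).size := by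
      rw [hc]; exact Nat.size_le_size (by simp; omega)
    rw [he.2, hi.2, ← Expr.cost_eq, ← Expr.cost_eq] at hres
    have h2 := Expr.bits_ev_lt_co s.mem i
    have h3 := Expr.bits_ev_lt_co s.mem e
    rw [← Expr.cost_eq] at h2 h3
    refine ⟨?_, ?_⟩
    · rw [ht, he.1, hi.1, ← Expr.eval_eq, ← Expr.eval_eq]
      exact hs.mem.setCell hN.1 _ _ (by rw [Expr.eval_eq]; omega) (by rw [Expr.eval_eq]; omega)
    · simp only [State.tick, State.setCell]; nlinarith
  | flip s x =>
    intro s' hs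
    refine ⟨_, Exec.flip s' x, fun F F' hF => ?_⟩
    rw [expect_coin, expect_coin]
    have key : ∀ r : Bool, F' ((s'.tick 1).setVar x (if r then 1 else 0)) ≤
        F ((s.tick 1).setVar x (if r then 1 else 0)) := by
      intro r
      refine hF _ ((PMF.mem_support_map_iff _ _ _).2 ⟨r, by simp, rfl⟩) _ ⟨?_, ?_⟩
      · exact (hs.mem.tick 1).setVar hN _
      · have := simTime_add M s.time 1
        have h1 := hs.res
        have h2 : ((s'.tick 1).setVar x (if r then 1 else 0)).res f = (s'.tick 1).res f := rfl
        rw [h2, res_tick]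
        simp only [State.tick, State.setVar]; omega
    have := key false
    have := key true
    gcongr
  | query s a b I hI hh =>
    intro s' hs
    have hh' : Holds (s'.mem.arr a) I.enc := by rw [hs.mem.arr_eq a hN.1]; exact hh
    set A : ℤ := if ∃ u v x, ∃ a < 0, I.Triangle u v x a then 1 else 0 with hA
    have hbA : bits A ≤ 1 := by rw [hA]; split_ifs <;> decide
    obtain ⟨c, hc, hcM⟩ := hs.mem.log.var_le
    refine exec_sim_of_sure (k := simCost d f I.n + (9 + 4 * (M + s.time + 1).size + 2 * 1 + 2))
      (Q := fun ρ => ∃ τ, QueryFrame N s'.mem τ ∧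
        ρ = ((τ.put N (τ.var N) 0).set N (τ.var N + 1)).put b 0 A)
      (Sure.seq (sure_triangleQuery hN.1 hI hh') ?_) ?_
    · rintro τ ⟨hτ, hv6⟩
      have hcτ : τ.var N = c := (hτ.1 N (by omega)).trans hc
      have hl := sure_logged (d := d) (f := f) (N := N) (a := b) (i := 0) (e := var (N + 6)) (σ := τ)
        (fun _ _ _ => ⟨rfl, rfl⟩)
        (fun ρ hρ _ => by simp only [Expr.ev, Expr.co, hρ (N + 6) (by omega), and_self])
      refine hl.mono ?_ ?_
      · have h1 : bits (τ.var N) ≤ (M + s.time + 1).size := by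
          rw [hcτ]; exact Nat.size_le_size (by simp; omega)
        have h2 : Expr.co τ 0 = 1 := rfl
        have h3 : Expr.co τ (var (N + 6)) ≤ 2 := by
          simp only [Expr.co, hv6, ← hA]; omega
        rw [h2]; omega
      · rintro ρ rfl
        refine ⟨τ, hτ, ?_⟩
        simp [hv6, hA]
    · rintro t' ⟨τ, hτ, ht⟩ hres
      have h0 := simTime_add M s.time 1
      have h1 := hs.res
      have hτs : SimMem N M σ₀ s τ := by
        refine ⟨fun x hx => ?_, fun x hx => ?_, fun x hx => ?_, fun x hx => ?_, ?_, fun x hx i => ?_⟩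
        · rw [hτ.1 x (by omega), hs.mem.var_eq x hx]
        · rw [hτ.2 x (by omega), hs.mem.arr_eq x hx]
        · rw [hτ.1 x (by omega), hs.mem.frame_var x hx]
        · rw [hτ.2 x (by omega), hs.mem.frame_arr x hx]
        · exact hs.mem.log.congr (hτ.1 N (by omega)) fun a ha => hτ.2 a (by omega)
        · rw [hτ.2 x (by omega)]; exact hs.mem.bits_le x hx i
      have h3 := hτs.setCell hN.2 0 A (k := 1) (by simp [bits]) (by omega)
      have h4 : (s.tick 1).answer b (NWT.ans I) (NWT.size I)
          = { (s.tick 1).setCell b 0 A with queries := I.n :: s.queries } := by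
        simp only [State.answer, State.setCell, State.tick]
        change State.mk _ (Function.update _ _ (overwrite _ [_])) _ _ = _
        rw [overwrite_singleton]
        rfl
      rw [h4]
      refine ⟨?_, ?_⟩
      · rw [ht]
        exact ⟨h3.var_eq, h3.arr_eq, h3.frame_var, h3.frame_arr, h3.log, h3.bits_le⟩
      · simp only [List.map_cons, List.sum_cons, State.setCell, State.tick]
        omega
  | seq s p q μ ν hp hq ihp ihq =>
    intro s' hs
    obtain ⟨μ', ν', h1, h2, h3⟩ := sim_bind (ihp hN.1 s' hs) fun t ht t' ht' => ihq t ht hN.2 t' ht'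
    exact ⟨μ'.bind ν', Exec.seq s' _ _ μ' ν' h1 h2, h3⟩
  | condTrue s e p q μ he hp ih =>
    intro s' hs
    have hc := hs.guard hN.1
    obtain ⟨μ', h1, h2⟩ := ih hN.2.1 _ hc.2
    exact ⟨μ', Exec.condTrue s' e _ _ μ' (hc.1 ▸ he) h1, h2⟩
  | condFalse s e p q μ he hp ih =>
    intro s' hs
    have hc := hs.guard hN.1
    obtain ⟨μ', h1, h2⟩ := ih hN.2.2 _ hc.2
    exact ⟨μ', Exec.condFalse s' e _ _ μ' (hc.1 ▸ he) h1, h2⟩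
  | loopDone s e p he =>
    intro s' hs
    have hc := hs.guard hN.1
    refine ⟨_, Exec.loopDone s' e _ (hc.1 ▸ he), fun F F' hF => ?_⟩
    rw [expect_pure, expect_pure]
    exact hF _ (by simp) _ hc.2
  | loopStep s e p μ ν he hp hq ihp ihq =>
    intro s' hs
    have hc := hs.guard hN.1
    obtain ⟨μ', ν', h1, h2, h3⟩ := sim_bind (ihp hN.2 _ hc.2) fun t ht t' ht' => ihq t ht hN t' ht'
    exact ⟨μ'.bind ν', Exec.loopStep s' e _ μ' ν' (hc.1 ▸ he) h1 h2, h3⟩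

end

end FineGrained

namespace FineGrained
open scoped ENNReal
open FineGrained.Expr

/-! ### Work space discipline -/

/-- The registers and arrays used by the simulated program, and the log, are zero. -/
structure Clean (N : ℕ) (σ : Mem) : Prop where
  var : ∀ x ≤ N, σ.var x = 0
  arr : ∀ a ≤ N, ∀ i, σ.arr a i = 0

/-- All numbers outside the work space of the simulation lie in `[-b, b]`. -/
structure Bd (N b : ℕ) (σ : Mem) : Prop where
  var : ∀ x, N + 10 ≤ x → |σ.var x| ≤ b
  arr : ∀ a, N + 3 ≤ a → ∀ i, |σ.arr a i| ≤ b

/-- `τ` agrees with `σ` on the registers from `N + k` on and on the arrays from `N + l` on. -/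
structure Frame (N k l : ℕ) (σ τ : Mem) : Prop where
  var : ∀ x, N + k ≤ x → τ.var x = σ.var x
  arr : ∀ a, N + l ≤ a → τ.arr a = σ.arr a

/-- All registers and arrays that occur are outside the work space of the simulation. -/
def Expr.Own (N : ℕ) : Expr → Prop
  | .lit _ => True
  | .var x => N + 10 ≤ x
  | .op _ e f => e.Own N ∧ f.Own N
  | .get a e => N + 3 ≤ a ∧ e.Own N

section
variable (N : ℕ) (e f : Expr)
@[simp] theorem Expr.own_add : (e + f).Own N ↔ e.Own N ∧ f.Own N := Iff.rfl
@[simp] theorem Expr.own_sub : (e - f).Own N ↔ e.Own N ∧ f.Own N := Iff.rfl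
@[simp] theorem Expr.own_mul : (e * f).Own N ↔ e.Own N ∧ f.Own N := Iff.rfl
@[simp] theorem Expr.own_div : (e / f).Own N ↔ e.Own N ∧ f.Own N := Iff.rfl
@[simp] theorem Expr.own_mod : (e % f).Own N ↔ e.Own N ∧ f.Own N := Iff.rfl
@[simp] theorem Expr.own_op (o : Op) : (Expr.op o e f).Own N ↔ e.Own N ∧ f.Own N := Iff.rfl
@[simp] theorem Expr.own_ofNat (n : ℕ) : (ofNat(n) : Expr).Own N := trivial
@[simp] theorem Expr.own_zero : (0 : Expr).Own N := trivial
@[simp] theorem Expr.own_one : (1 : Expr).Own N := trivial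
@[simp] theorem Expr.own_var (x : ℕ) : (Expr.var x).Own N ↔ N + 10 ≤ x := Iff.rfl
@[simp] theorem Expr.own_get (a : ℕ) : (Expr.get a e).Own N ↔ N + 3 ≤ a ∧ e.Own N := Iff.rfl
end

theorem Bd.ok {N b : ℕ} {σ : Mem} (h : Bd N b σ) {e : Expr} (he : e.Own N) : e.Ok b σ := by
  induction e with
  | lit z => trivial
  | var x => exact h.var x he
  | op o e f ihe ihf => exact ⟨ihe he.1, ihf he.2⟩
  | get a e ih => exact ⟨ih he.2, h.arr a he.1 _⟩

theorem Bd.set {N b : ℕ} {σ : Mem} (h : Bd N b σ) {x : ℕ} {z : ℤ} (hz : |z| ≤ b) :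
    Bd N b (σ.set x z) := by
  refine ⟨fun y hy => ?_, h.arr⟩
  rw [Mem.set_var]
  split_ifs
  · exact hz
  · exact h.var y hy

theorem Bd.put {N b : ℕ} {σ : Mem} (h : Bd N b σ) {a : ℕ} {i z : ℤ} (hz : |z| ≤ b) :
    Bd N b (σ.put a i z) := by
  refine ⟨h.var, fun c hc j => ?_⟩
  rw [Mem.put_arr]
  split_ifs
  · exact hz
  · exact h.arr c hc j

theorem Clean.set {N : ℕ} {σ : Mem} (h : Clean N σ) {x : ℕ} {z : ℤ} (hx : N < x) :
    Clean N (σ.set x z) := by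
  refine ⟨fun y hy => ?_, h.arr⟩
  rw [Mem.set_var, if_neg (by omega), h.var y hy]

theorem Frame.refl (N k l : ℕ) (σ : Mem) : Frame N k l σ σ := ⟨fun _ _ => rfl, fun _ _ => rfl⟩

theorem Frame.set {N k l : ℕ} {σ τ : Mem} (h : Frame N k l σ τ) {x : ℕ} {z : ℤ} (hx : x < N + k) :
    Frame N k l σ (τ.set x z) := by
  refine ⟨fun y hy => ?_, h.arr⟩
  rw [Mem.set_var, if_neg (by omega), h.var y hy]

theorem Frame.put {N k l : ℕ} {σ τ : Mem} (h : Frame N k l σ τ) {a : ℕ} {i z : ℤ} (ha : a < N + l) :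
    Frame N k l σ (τ.put a i z) := by
  refine ⟨h.var, fun c hc => ?_⟩
  rw [Mem.put_arr_ne _ _ _ (by omega), h.arr c hc]

variable {d : ℕ} {f : ℕ → ℕ}

section Rules
variable {N b n k : ℕ} {σ : Mem} {l : List Cmd} {φ : Mem → ℝ≥0∞} {v : ℝ≥0∞}

theorem WP.assign_bd {x : ℕ} {e : Expr} (hσ : Bd N b σ) (z : ℤ) (hsz : e.sz ≤ 200) (ho : e.Own N)
    (hz : e.ev σ = z) (hzb : |z| ≤ b)
    (h : Bd N b (σ.set x z) → WP d f (Cmd.block l) (σ.set x z) k φ v) :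
    WP d f (Cmd.block (.assign x e :: l)) σ (unit b + k) φ v :=
  WP.assign_step z hsz (hσ.ok ho) hz (h (hσ.set hzb))

theorem WP.store_bd {a : ℕ} {i e : Expr} (hσ : Bd N b σ) (j z : ℤ) (hsi : i.sz ≤ 200)
    (hsz : e.sz ≤ 200) (hoi : i.Own N) (ho : e.Own N) (hj : i.ev σ = j) (hz : e.ev σ = z)
    (hzb : |z| ≤ b) (h : Bd N b (σ.put a j z) → WP d f (Cmd.block l) (σ.put a j z) k φ v) :
    WP d f (Cmd.block (.store a i e :: l)) σ (unit b + k) φ v :=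
  WP.store_step j z hsi hsz (hσ.ok hoi) (hσ.ok ho) hj hz (h (hσ.put hzb))

theorem Bd.guard {e : Expr} (hσ : Bd N b σ) (hsz : e.sz ≤ 200) (ho : e.Own N) :
    1 + e.co σ ≤ unit b := by
  have := (hσ.ok ho).co_le_unit hsz
  omega

end Rules

/-! ### Cleaning up after a simulation -/

/-- Zeroes the cells whose address is the last entry of the log. -/
def zeroCells (N : ℕ) : ℕ → Cmd
  | 0 => .skip
  | j + 1 => .seq (zeroCells N j) (.store j (get N (var N)) 0)

/-- Zeroes the registers below the argument. -/
def zeroVars : ℕ → Cmd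
  | 0 => .skip
  | j + 1 => .seq (zeroVars j) (.assign j 0)

/-- Zeroes all cells whose address has been logged, the log, and the registers below `N`. -/
def cleanup (N : ℕ) : Cmd := .seq
  (.loop (.op .lt 0 (var N)) (.block [
    .assign N (var N - 1), zeroCells N N, .store N (var N) 0]))
  (zeroVars N)

theorem sure_zeroCells {N : ℕ} (σ : Mem) (j : ℕ) (hj : j ≤ N) :
    Sure d f (zeroCells N j) σ (1 + j * (4 + bits (σ.var N) + bits (σ.arr N (σ.var N)))) fun τ =>
      τ.var = σ.var ∧ (∀ a, j ≤ a → τ.arr a = σ.arr a) ∧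
      ∀ a < j, ∀ i, τ.arr a i = if i = σ.arr N (σ.var N) then 0 else σ.arr a i := by
  induction j with
  | zero => exact Sure.nil (by omega) ⟨rfl, fun _ _ => rfl, fun a ha => by omega⟩
  | succ j ih =>
    refine WP.cost (k := _ + (4 + bits (σ.var N) + bits (σ.arr N (σ.var N))))
      (Sure.seq (ih (by omega)) ?_) (by rw [add_mul, one_mul, add_assoc])
    rintro τ ⟨hv, hge, hlt⟩
    have hN : τ.arr N = σ.arr N := hge N (by omega)
    refine Sure.store ?_ ⟨hv, fun a ha => ?_, fun a ha i => ?_⟩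
    · change 1 + (1 + bits (τ.var N) + 1 + bits (τ.arr N (τ.var N))) + 1 ≤ _
      rw [hv, hN]; omega
    · rw [Mem.put_arr_ne _ _ _ (by omega), hge a (by omega)]
    · simp only [Mem.put_arr, Expr.ev_get, Expr.ev_var, hv, hN, Expr.ev_zero]
      rcases Nat.lt_succ_iff_lt_or_eq.1 ha with h | rfl
      · rw [if_neg (by omega), hlt a h]
      · simp [hge a le_rfl]

theorem sure_zeroVars (σ : Mem) (j : ℕ) :
    Sure d f (zeroVars j) σ (1 + 2 * j) fun τ =>
      τ.arr = σ.arr ∧ (∀ x, j ≤ x → τ.var x = σ.var x) ∧ ∀ x < j, τ.var x = 0 := by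
  induction j with
  | zero => exact Sure.nil (by omega) ⟨rfl, fun _ _ => rfl, fun a ha => by omega⟩
  | succ j ih =>
    refine WP.cost (k := _ + 2) (Sure.seq ih ?_) (by omega)
    rintro τ ⟨hv, hge, hlt⟩
    refine Sure.assign (le_of_eq rfl) ⟨hv, fun a ha => ?_, fun a ha => ?_⟩
    · rw [Mem.set_var, if_neg (by omega), hge a (by omega)]
    · rw [Mem.set_var]
      split_ifs with h
      · rfl
      · exact hlt a (by omega)

/-- The cost of cleaning up when the log has total bit length at most `B`. -/
def cleanCost (N B : ℕ) : ℕ := (N + 10) * ((B + 1) * (8 * B.size + 20))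

/-- A round costs about `N` times the bit length of the logged address, and the total bit length of the
log is at most `B`. -/
theorem sure_cleanup {N B : ℕ} {σ : Mem} (h : LogInv N B σ) :
    Sure d f (cleanup N) σ (cleanCost N B) fun τ => Clean N τ ∧ Frame N 1 1 σ τ := by
  obtain ⟨c, hc⟩ := h.var_le
  obtain ⟨c', h1, h2, h3, h4⟩ := h
  obtain rfl : c = c' := by have := hc.1.symm.trans h1; exact_mod_cast this
  have hsz : ∀ k : ℕ, k ≤ c → bits (k : ℤ) ≤ B.size := fun k hk =>
    Nat.size_le_size (by simp; omega)
  have hbits1 : bits 1 = 1 := rfl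
  have hbits0 : bits 0 = 0 := rfl
  set s := B.size with hs
  set κ : ℕ → ℕ := fun i =>
    (6 + 3 * s) + ((1 + N * (4 + s + bits (σ.arr N ((c - 1 - i : ℕ) : ℤ)))) + (4 + s)) with hκ
  have hloop := Sure.loop (d := d) (f := f) (e := .op .lt 0 (var N)) (p := .block [
    .assign N (var N - 1), zeroCells N N, .store N (var N) 0]) c (fun i τ =>
      τ.var N = ((c - i : ℕ) : ℤ) ∧
      (∀ a < N, ∀ x, τ.arr a x ≠ 0 → ∃ k < c - i, σ.arr N (k : ℤ) = x) ∧
      (∀ k < c - i, τ.arr N (k : ℤ) = σ.arr N k) ∧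
      (∀ x, τ.arr N x ≠ 0 → 0 ≤ x ∧ x < ((c - i : ℕ) : ℤ)) ∧
      Frame N 1 1 σ τ) κ (4 + 2 * s) ?_ ?_ (σ := σ) ?_
  · refine WP.cost (Sure.seq (l := 1 + 2 * N) hloop ?_) ?_
    · rintro τ ⟨i1, i2, i3, i4, i5⟩
      rw [Nat.sub_self] at *
      refine (sure_zeroVars τ N).mono le_rfl ?_
      rintro ρ ⟨hv, hge, hlt⟩
      refine ⟨⟨fun x hx => ?_, fun a ha i => ?_⟩, ⟨fun x hx => ?_, fun a ha => ?_⟩⟩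
      · rcases Nat.lt_or_eq_of_le hx with h | rfl
        · exact hlt x h
        · rw [hge _ le_rfl, i1]; rfl
      · rw [hv]
        by_contra hne
        rcases Nat.lt_or_eq_of_le ha with h | rfl
        · obtain ⟨k, hk, -⟩ := i2 a h i hne
          omega
        · have := i4 i hne
          simp at this; omega
      · rw [hge x (by omega), i5.var x hx]
      · rw [hv, i5.arr a ha]
    · have hsum : ∑ i ∈ Finset.range c, (4 + 2 * s + κ i)
          = c * (15 + 6 * s + N * (3 + s)) +
            N * ∑ i ∈ Finset.range c, (1 + bits (σ.arr N (i : ℤ))) := by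
        rw [← Finset.sum_range_reflect (fun i : ℕ => 1 + bits (σ.arr N (i : ℤ))), Finset.mul_sum]
        have : c * (15 + 6 * s + N * (3 + s))
            = ∑ i ∈ Finset.range c, (15 + 6 * s + N * (3 + s)) := by simp
        rw [this, ← Finset.sum_add_distrib]
        refine Finset.sum_congr rfl fun i hi => ?_
        simp only [hκ]
        ring
      rw [hsum]
      have e1 := Nat.mul_le_mul_left N h4
      have e2 := Nat.mul_le_mul_right (15 + 6 * s + N * (3 + s)) hc.2
      unfold cleanCost
      rw [← hs]
      nlinarith [Nat.zero_le (B * s), Nat.zero_le (N * B), Nat.zero_le (N * (B * s)),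
        Nat.zero_le (N * s)]
  · rintro i hi τ ⟨i1, -⟩
    constructor
    · change 1 + ((1 + bits 0) + (1 + bits (τ.var N)) + (1 + bits 0) * (1 + bits (τ.var N))) ≤ _
      rw [i1, hbits0]
      have := hsz (c - i) (by omega)
      omega
    · simp [i1]
  · rintro i hi τ ⟨i1, i2, i3, i4, i5⟩
    have hci : ((c - i : ℕ) : ℤ) - 1 = ((c - 1 - i : ℕ) : ℤ) := by omega
    refine Sure.cons (Q := fun ρ => ρ = τ.set N ((c - 1 - i : ℕ) : ℤ)) (Sure.assign ?_ ?_) ?_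
    · change 1 + ((1 + bits (τ.var N)) + (1 + bits 1) + (1 + bits (τ.var N)) * (1 + bits 1)) ≤ _
      rw [i1, hbits1]
      have := hsz (c - i) (by omega)
      omega
    · simp [i1, hci]
    rintro _ rfl
    have hA : τ.arr N ((c - 1 - i : ℕ) : ℤ) = σ.arr N ((c - 1 - i : ℕ) : ℤ) := i3 _ (by omega)
    have hzc := sure_zeroCells (d := d) (f := f) (N := N) (τ.set N ((c - 1 - i : ℕ) : ℤ)) N le_rfl
    simp only [Mem.set_var, if_true, Mem.set_arr, hA] at hzc
    refine Sure.cons (hzc.mono (k' := 1 + N * (4 + s + bits (σ.arr N ((c - 1 - i : ℕ) : ℤ)))) ?_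
      fun _ h => h) ?_
    · have := hsz (c - 1 - i) (by omega)
      gcongr
    rintro ρ ⟨hv, hge, hlt⟩
    have hρN : ρ.var N = ((c - 1 - i : ℕ) : ℤ) := by rw [hv]; simp
    refine WP.cost (k := (3 + s) + 1) (Sure.cons (k' := 1)
      (Q := fun r => r = ρ.put N ((c - 1 - i : ℕ) : ℤ) 0) (Sure.store ?_ ?_) ?_) (by omega)
    · change 1 + (1 + bits (ρ.var N)) + (1 + bits 0) ≤ _
      rw [hρN, hbits0]
      have := hsz (c - 1 - i) (by omega)
      omega
    · simp [hρN]
    rintro _ rfl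
    have hsub : c - (i + 1) = c - 1 - i := by omega
    refine Sure.nil le_rfl ⟨by simpa [hsub] using hρN, fun a ha x hx => ?_, fun k hk => ?_,
      fun x hx => ?_, ⟨fun x hx => ?_, fun a ha => ?_⟩⟩
    · have haN : a ≠ N := by omega
      rw [Mem.put_arr_ne _ _ _ haN, hlt a ha] at hx
      split_ifs at hx with h
      · exact absurd rfl hx
      obtain ⟨k, hk, hkx⟩ := i2 a ha x hx
      refine ⟨k, ?_, hkx⟩
      by_contra hcon
      obtain rfl : k = c - 1 - i := by omega
      exact h hkx.symm
    · have : (k : ℤ) ≠ ((c - 1 - i : ℕ) : ℤ) := by omega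
      rw [Mem.put_arr, if_neg (by tauto), hge N le_rfl]
      exact i3 k (by omega)
    · rw [Mem.put_arr] at hx
      split_ifs at hx with h
      · exact absurd rfl hx
      rw [hge N le_rfl] at hx
      have := i4 x hx
      have h' : x ≠ ((c - 1 - i : ℕ) : ℤ) := by tauto
      omega
    · rw [Mem.put_var, hv, Mem.set_var, if_neg (by omega), i5.var x hx]
    · rw [Mem.put_arr_ne _ _ _ (by omega), hge a (by omega), i5.arr a ha]
  · refine ⟨by simpa using h1, by simpa using h2, fun _ _ => rfl, by simpa using h3, .refl _ _ _ _⟩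

end FineGrained

namespace FineGrained
open scoped ENNReal
open FineGrained.Expr

/-! ### One run of the simulation -/

/-- Copies the graph in array `N + 3`, of size given by register `N + 11`, to the input array `0` of
the simulated program, and logs the cells used. -/
def copyIn (N : ℕ) : List Cmd := [
  .assign (N + 10) 0,
  .loop (.op .lt (var (N + 10)) (2 * (var (N + 11) * var (N + 11)) + 1)) (.block [
    .store N (var (N + 10)) (var (N + 10)),
    .store 0 (var (N + 10)) (get (N + 3) (var (N + 10))),
    .assign (N + 10) (var (N + 10) + 1)]),
  .assign N (var (N + 10))]

theorem enc_length (G : WGraph) : G.enc.length = 2 * (G.n * G.n) + 1 := by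
  simp [WGraph.enc, encMatrix_length]; ring

variable {d : ℕ} {f : ℕ → ℕ}

/-- A bound for the bit length of the log after copying, and of the numbers copied. -/
def copyLog (b n : ℕ) : ℕ := (2 * (n * n) + 1) * (1 + b.size) + b.size

theorem sure_copyIn {N b : ℕ} (hN : 0 < N) {G : WGraph} {σ : Mem} (hc : Clean N σ) (hb : Bd N b σ)
    (hn : σ.var (N + 11) = G.n) (hG : Holds (σ.arr (N + 3)) G.enc) (hnb : 2 * (G.n * G.n) + 1 ≤ b) :
    Sure d f (.block (copyIn N)) σ ((5 * (2 * (G.n * G.n) + 1) + 4) * unit b) fun τ =>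
      Frame N 11 3 σ τ ∧ Bd N b τ ∧ SimMem N (copyLog b G.n) τ (start G.enc) τ := by
  set L := 2 * (G.n * G.n) + 1 with hL
  have hL' : (2 : ℤ) * ((G.n : ℤ) * G.n) + 1 = (L : ℤ) := by rw [hL]; push_cast; ring
  refine WP.cost (k := unit b + ((L * (unit b + 4 * unit b) + unit b) + 2 * unit b)) ?_
    (by nlinarith)
  refine WP.assign_bd hb 0 (Nat.le_of_ble_eq_true rfl) (by simp) (by simp) (by simp) fun hb1 => ?_
  refine Sure.cons (Sure.loop_const L (fun i τ => τ.var (N + 10) = i ∧ Frame N 11 3 σ τ ∧ Bd N b τ ∧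
    (∀ x ≤ N, τ.var x = 0) ∧ (∀ a ≤ N, ∀ j, τ.arr a j =
      if 0 ≤ j ∧ j < i then if a = 0 then σ.arr (N + 3) j else if a = N then j else 0 else 0))
    (4 * unit b) (unit b) ?_ ?_ ?_) ?_
  · rintro i hi τ ⟨h1, h2, h3, -⟩
    refine ⟨h3.guard (Nat.le_of_ble_eq_true rfl) (by simp), ?_⟩
    have : τ.var (N + 11) = G.n := (h2.var _ (by omega)).trans hn
    simp only [ev_lt, ev_add, ev_mul, ev_var, ev_ofNat, ev_one, h1, this, hL']
    simp
  · rintro i hi τ ⟨h1, h2, h3, h4, h5⟩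
    have hsrc : τ.arr (N + 3) = σ.arr (N + 3) := h2.arr _ (by omega)
    refine WP.cost (k := unit b + (unit b + (unit b + (0 + 1) * unit b))) ?_ (by omega)
    refine WP.store_bd h3 i i (Nat.le_of_ble_eq_true rfl) (Nat.le_of_ble_eq_true rfl)
      (by simp) (by simp) (by simp [h1]) (by simp [h1]) (by simp; omega) fun h3 => ?_
    refine WP.store_bd h3 i (σ.arr (N + 3) i) (Nat.le_of_ble_eq_true rfl) (Nat.le_of_ble_eq_true rfl)
      (by simp) (by simp) (by simp [h1]) (by simp [h1, hsrc]) (hb.arr _ (by omega) _) fun h3 => ?_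
    refine WP.assign_bd h3 (i + 1 : ℕ) (Nat.le_of_ble_eq_true rfl) (by simp) (by simp [h1])
      (by simp only [Nat.abs_cast, Nat.cast_le]; omega) fun h3 => ?_
    refine Sure.nil_unit ⟨by simp, ((h2.put (by omega)).put (by omega)).set (by omega), h3,
      fun x hx => ?_, fun a ha j => ?_⟩
    · rw [Mem.set_var, if_neg (by omega), Mem.put_var, Mem.put_var, h4 x hx]
    · simp only [Mem.set_arr, Mem.put_arr, h5 a ha j]
      have hcast : ((i + 1 : ℕ) : ℤ) = i + 1 := by push_cast; rfl
      rw [hcast]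
      by_cases hj : j = i
      · subst hj
        have e1 : ¬ ((i : ℤ) < i) := lt_irrefl _
        have e2 : (0 : ℤ) ≤ i ∧ (i : ℤ) < i + 1 := by omega
        simp only [e1, e2, and_true, and_false, if_true, if_false]
      · have e1 : (0 ≤ j ∧ j < (i : ℤ) + 1) ↔ (0 ≤ j ∧ j < (i : ℤ)) := by omega
        simp only [hj, e1, and_false, if_false]
  · refine ⟨by simp, (Frame.refl _ _ _ _).set (by omega), hb1, fun x hx => ?_, fun a ha j => ?_⟩
    · rw [Mem.set_var, if_neg (by omega), hc.var x hx]
    · rw [if_neg (by push_cast; omega)]; exact hc.arr a ha j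
  rintro τ ⟨h1, h2, h3, h4, h5⟩
  refine WP.cost (k := unit b + (0 + 1) * unit b) ?_ (by omega)
  refine WP.assign_bd h3 L (Nat.le_of_ble_eq_true rfl) (by simp) (by simp [h1])
    (by simp; omega) fun h3' => ?_
  refine Sure.nil_unit ⟨h2.set (by omega), h3', ⟨fun x hx => ?_, fun a ha => ?_, fun _ _ => rfl,
    fun _ _ => rfl, ?_, fun a ha i => ?_⟩⟩
  · rw [Mem.set_var, if_neg (by omega), h4 x (by omega)]; rfl
  · funext j
    rw [Mem.set_arr, h5 a (by omega)]
    rcases eq_or_ne a 0 with rfl | ha0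
    · simp only [if_true, start, Function.update_self]
      split_ifs with hj
      · obtain ⟨k, rfl⟩ := Int.eq_ofNat_of_zero_le hj.1
        have hk : k < G.enc.length := by rw [enc_length]; omega
        rw [hG k hk, holds_overwrite _ _ k hk]
      · rw [overwrite_of_ge]
        rw [enc_length]; omega
    · rw [if_neg ha0, if_neg (show a ≠ N by omega)]
      simp [start, ha0]
  · refine ⟨L, by simp, fun a ha j hj => ?_, fun j hj => ?_, ?_⟩
    · rw [Mem.set_arr, h5 a (by omega)] at hj
      have hj' : 0 ≤ j ∧ j < L := by by_contra hcon; rw [if_neg hcon] at hj; exact hj rfl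
      obtain ⟨k, rfl⟩ := Int.eq_ofNat_of_zero_le hj'.1
      refine ⟨k, by omega, ?_⟩
      rw [Mem.set_arr, h5 N le_rfl, if_pos hj', if_neg (show N ≠ 0 by omega), if_pos rfl]
    · rw [Mem.set_arr, h5 N le_rfl] at hj
      by_contra hcon; rw [if_neg hcon] at hj; exact hj rfl
    · calc _ ≤ ∑ k ∈ Finset.range L, (1 + b.size) := by
            refine Finset.sum_le_sum fun k hk => ?_
            have hk' := Finset.mem_range.1 hk
            rw [Mem.set_arr, h5 N le_rfl, if_pos (by omega), if_neg (show N ≠ 0 by omega), if_pos rfl]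
            have := bits_mono (z := (k : ℤ)) (b := b) (by simp; omega)
            omega
        _ ≤ _ := by
            simp only [Finset.sum_const, Finset.card_range, smul_eq_mul, copyLog, ← hL]; omega
  · rw [Mem.set_arr, h5 a (by omega)]
    have h0 : bits 0 = 0 := rfl
    have : |(if 0 ≤ i ∧ i < (L : ℤ) then
        if a = 0 then σ.arr (N + 3) i else if a = N then i else 0 else 0)| ≤ (b : ℤ) := by
      split_ifs
      · exact hb.arr _ (by omega) _
      · omega
      · simp
      · simp
    have := bits_mono this
    unfold copyLog; omega

/-- The program `p` run on a graph `G` with right answer `A`: it takes time at most `T`, its queries have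
total weight at most `B`, and it errs with probability at most `1 / 3`. -/
def GoodRun (d : ℕ) (f : ℕ → ℕ) (p : Cmd) (G : WGraph) (A : ℤ) (T B : ℕ) : Prop :=
  ∃ μ, Exec NWT d p (start G.enc) μ ∧
    expect μ (fun t => if t.arr 1 0 = A then 0 else 1) ≤ 1 / 3 ∧
    ∀ t ∈ μ.support, t.time ≤ T ∧ (t.queries.map (simCost d f)).sum ≤ B

theorem simTime_mono {M k l : ℕ} (h : k ≤ l) : simTime M k ≤ simTime M l := by
  unfold simTime
  have := Nat.size_le_size (show M + k ≤ M + l by omega)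
  gcongr

/-- If errors have probability at most `1 / 3`, doubling `x` in case of an error makes it on average at
most `4 / 3 * x`. -/
theorem expect_error {μ : PMF State} {P : State → Prop} [DecidablePred P] (x : ℝ≥0∞)
    (h : expect μ (fun t => if P t then 0 else 1) ≤ 1 / 3) :
    expect μ (fun t => if P t then x else 2 * x) ≤ 4 / 3 * x := by
  have e : (fun t => if P t then x else 2 * x) = fun t => x + x * (if P t then 0 else 1) := by
    funext t; split_ifs <;> ring
  rw [e, expect_add, expect_const, expect_mul]
  calc x + x * _ ≤ x + x * (1 / 3) := by gcongr
    _ = (1 + 1 / 3) * x := by ring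
    _ = 4 / 3 * x := by
      congr 1
      rw [← ENNReal.toReal_eq_toReal_iff' (by finiteness) (by finiteness)]
      rw [ENNReal.toReal_add (by finiteness) (by finiteness)]
      simp; norm_num

/-- A good run is simulated: the potential doubles if the answer is wrong. -/
theorem wp_sim {p : Cmd} {N M T B : ℕ} (hN : p.NamesLt N) (hN2 : 2 ≤ N) {G : WGraph} {A : ℤ}
    (hrun : GoodRun d f p G A T B) {σ : Mem} (hσ : SimMem N M σ (start G.enc) σ) (x : ℝ≥0∞)
    (hx : x ≠ ⊤) :
    WP d f (sim N p) σ (simTime M T + B) (fun τ => ind (fun τ => LogInv N (M + T) τ ∧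
      Frame N 10 3 σ τ ∧ bits (τ.arr 1 0) ≤ M + T) τ + if τ.arr 1 0 = A then x else 2 * x)
      (4 / 3 * x) := by
  classical
  rintro s rfl
  obtain ⟨μ, hμ, herr, hT⟩ := hrun
  obtain ⟨μ', hμ', hF⟩ := exec_sim (f := f) (M := M) (σ₀ := s.mem) (r₀ := s.res f) hμ hN s
    ⟨hσ, by simp [start, simTime]⟩
  set F' : State → ℝ≥0∞ := fun t => ind (fun τ => LogInv N (M + T) τ ∧
      Frame N 10 3 s.mem τ ∧ bits (τ.arr 1 0) ≤ M + T) t.mem +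
      (if t.mem.arr 1 0 = A then x else 2 * x) with hF'
  -- The bound for the cost holds on the support of `μ` only. Including it in the test function
  -- transfers it to the support of `μ'`.
  have key : expect μ' (fun t => (if t.res f ≤ s.res f + (simTime M T + B) then 0 else ⊤) + F' t)
      ≤ 4 / 3 * x := by
    refine (hF (fun t => if t.arr 1 0 = A then x else 2 * x) _ ?_).trans (expect_error x herr)
    intro t ht t' hs
    obtain ⟨h1, h2⟩ := hT t ht
    have h3 := hs.res
    have h4 := simTime_mono (M := M) h1
    have h5 : t'.mem.arr 1 = t.arr 1 := hs.mem.arr_eq 1 (by omega)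
    rw [if_pos (by omega), zero_add, hF']
    simp only
    rw [ind_of, zero_add, h5]
    refine ⟨hs.mem.log.mono (by omega), ⟨hs.mem.frame_var, hs.mem.frame_arr⟩, ?_⟩
    have := hs.mem.bits_le 1 (by omega) 0
    omega
  have hne : (4 : ℝ≥0∞) / 3 * x ≠ ⊤ := by finiteness
  refine ⟨μ', hμ', fun t ht => ?_, (expect_mono fun t _ => ?_).trans key⟩
  · have := ne_top_of_expect (ne_top_of_le_ne_top hne key) ht
    by_contra hcon
    simp [hcon] at this
  · exact le_add_self

/-- One run of `p` on the graph in array `N + 3`. Register `N + 13` counts how often the answer was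
`1`. -/
def run (N : ℕ) (p : Cmd) : Cmd := .block [
  .block (copyIn N),
  sim N p,
  .assign (N + 14) (.op .eq (get 1 0) 1),
  .assign (N + 13) (var (N + 13) + var (N + 14)),
  cleanup N]

/-- The cost of `run`. -/
def runCost (N b n T B : ℕ) : ℕ :=
  (5 * (2 * (n * n) + 1) + 4) * unit b + (simTime (copyLog b n) T + B) +
    (7 + 3 * (copyLog b n + T)) + unit b + cleanCost N (copyLog b n + T) + 1

/-- A wrong answer makes register `N + 13` deviate from the right count and doubles the potential, which
therefore grows by a factor of at most `4 / 3` on average. -/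
theorem wp_run {p : Cmd} {N b T B : ℕ} (hN : p.NamesLt N) (hN2 : 2 ≤ N) {G : WGraph} {A : ℤ}
    (hA : A = 0 ∨ A = 1)
    (hrun : GoodRun d f p G A T B) {σ : Mem} (hc : Clean N σ) (hb : Bd N b σ)
    (hn : σ.var (N + 11) = G.n) (hG : Holds (σ.arr (N + 3)) G.enc) (hnb : 2 * (G.n * G.n) + 1 ≤ b)
    {o : ℕ} (ho : σ.var (N + 13) = o) (hob : o + 1 ≤ b) (x : ℝ≥0∞) (hx : x ≠ ⊤) :
    WP d f (run N p) σ (runCost N b G.n T B) (fun τ => ind (fun τ => Clean N τ ∧ Bd N b τ ∧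
      (∀ y, N + 10 ≤ y → y ≠ N + 10 → y ≠ N + 13 → y ≠ N + 14 → τ.var y = σ.var y) ∧
      (∀ a, N + 3 ≤ a → τ.arr a = σ.arr a) ∧
      (τ.var (N + 13) = o ∨ τ.var (N + 13) = o + 1)) τ +
      if τ.var (N + 13) = o + A then x else 2 * x) (4 / 3 * x) := by
  have hbits1 : bits 1 = 1 := rfl
  unfold runCost
  refine WP.cost (k := (5 * (2 * (G.n * G.n) + 1) + 4) * unit b +
    ((simTime (copyLog b G.n) T + B) + ((7 + 3 * (copyLog b G.n + T)) + (unit b +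
    (cleanCost N (copyLog b G.n + T) + 1))))) ?_ (by omega)
  refine WP.cons (sure_copyIn (by omega) hc hb hn hG hnb) ?_
  rintro τ ⟨hfr, hbτ, hsim⟩
  refine WP.seq (by finiteness) (wp_sim hN hN2 hrun hsim x hx) ?_
  intro ρ hρ
  have hρ' := ind_ne_top (ne_top_of_le_ne_top hρ le_self_add)
  rw [ind_of hρ', zero_add]
  obtain ⟨hlog, hfρ, hbits⟩ := hρ'
  have hbρ : Bd N b ρ := ⟨fun y hy => by rw [hfρ.var y hy]; exact hbτ.var y hy,
    fun a ha i => by rw [hfρ.arr a ha]; exact hbτ.arr a ha i⟩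
  have hb1 : (1 : ℤ) ≤ b := by omega
  set e : ℤ := if ρ.arr 1 0 = 1 then 1 else 0 with he
  have he01 : e = 0 ∨ e = 1 := by rw [he]; split_ifs <;> simp
  have heb : |e| ≤ b := by rcases he01 with h | h <;> rw [h] <;> simp <;> omega
  refine WP.cons (Q := fun r => r = ρ.set (N + 14) e) (Sure.assign ?_ ?_) ?_
  · change 1 + ((1 + bits 0 + 1 + bits (ρ.arr 1 0)) + (1 + bits 1) +
      (1 + bits (ρ.arr 1 0)) * (1 + bits 1)) ≤ _
    rw [hbits1, show bits 0 = 0 from rfl]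
    omega
  · rw [he]; rfl
  rintro _ rfl
  have ho' : ρ.var (N + 13) = o := by
    rw [hfρ.var _ (by omega), hfr.var _ (by omega), ho]
  have hoe : |(o : ℤ) + e| ≤ b := by
    rw [abs_le]; rcases he01 with h | h <;> rw [h] <;> constructor <;> omega
  refine WP.assign_bd (hbρ.set heb) (o + e) (Nat.le_of_ble_eq_true rfl) (by simp) (by simp [ho'])
    hoe fun hb2 => ?_
  refine WP.cons (sure_cleanup (hlog.congr ?_ fun _ _ => rfl)) ?_
  · rw [Mem.set_var, if_neg (by omega), Mem.set_var, if_neg (by omega)]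
  rintro r ⟨hcr, hfrr⟩
  have hr13 : r.var (N + 13) = o + e := by rw [hfrr.var _ (by omega)]; simp
  refine WP.nil le_rfl ?_
  rw [ind_of, zero_add, hr13]
  · rcases hA with rfl | rfl
    · by_cases h : ρ.arr 1 0 = 1
      · rw [he, if_pos h, h]; simp
      · rw [he, if_neg h]
        split_ifs <;> simp_all
        exact le_mul_of_one_le_left zero_le one_le_two
    · by_cases h : ρ.arr 1 0 = 1
      · rw [he, if_pos h, h]; simp
      · rw [he, if_neg h, if_neg h]; simp
  · refine ⟨hcr, ⟨fun y hy => ?_, fun a ha i => ?_⟩, fun y hy h1 h2 h3 => ?_, fun a ha => ?_, ?_⟩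
    · rw [hfrr.var y (by omega)]; exact hb2.var y hy
    · rw [hfrr.arr a (by omega)]; exact hb2.arr a ha i
    · rw [hfrr.var y (by omega), Mem.set_var, if_neg h2, Mem.set_var, if_neg h3, hfρ.var y hy,
        hfr.var y (by omega)]
    · rw [hfrr.arr a (by omega), Mem.set_arr, Mem.set_arr, hfρ.arr a ha, hfr.arr a ha]
    · rw [hr13]; rcases he01 with h | h <;> simp [h]

end FineGrained

namespace FineGrained
open scoped ENNReal
open FineGrained.Expr

/-! ### Amplification by majority vote -/

variable {d : ℕ} {f : ℕ → ℕ}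

/-- Runs `p` on the graph in array `N + 3` as often as twice the number in register `N + 15`, and puts
the majority vote into register `N + 14`. -/
def call (N : ℕ) (p : Cmd) : Cmd := .block [
  .assign (N + 11) (get (N + 3) 0),
  .assign (N + 12) 0,
  .assign (N + 13) 0,
  .loop (.op .lt (var (N + 12)) (2 * var (N + 15))) (.block [
    run N p,
    .assign (N + 12) (var (N + 12) + 1)]),
  .assign (N + 14) (.op .lt (var (N + 15)) (var (N + 13)))]

/-- The cost of `call` with `2 * κ` runs. -/
def callCost (N b n T B κ : ℕ) : ℕ := (2 * κ + 1) * (runCost N b n T B + 8 * unit b)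

/-- The potential of the vote after `i` of `2 * κ` runs, `w` of which gave the wrong answer. -/
noncomputable def votePot (κ i w : ℕ) : ℝ≥0∞ := (1 / 2) ^ κ * (4 / 3) ^ (2 * κ - i) * 2 ^ w

theorem votePot_ne_top (κ i w : ℕ) : votePot κ i w ≠ ⊤ := by
  unfold votePot; finiteness

theorem votePot_zero (κ : ℕ) : votePot κ 0 0 = (8 / 9) ^ κ := by
  unfold votePot
  rw [Nat.sub_zero, pow_mul, pow_zero, mul_one, ← mul_pow]
  congr 1
  rw [← ENNReal.toReal_eq_toReal_iff' (by finiteness) (by finiteness)]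
  simp; norm_num

theorem one_le_votePot {κ w : ℕ} (h : κ ≤ w) : 1 ≤ votePot κ (2 * κ) w := by
  unfold votePot
  rw [Nat.sub_self, pow_zero, mul_one]
  calc (1 : ℝ≥0∞) = (1 / 2) ^ κ * 2 ^ κ := by
        rw [← mul_pow]; simp [ENNReal.inv_mul_cancel]
    _ ≤ _ := by gcongr; exact one_le_two

/-- The number of wrong answers among `i` runs of which `o` gave the answer `1`. -/
def wrong (A : ℤ) (i o : ℕ) : ℕ := if A = 1 then i - o else o

/-- The majority of `2 * κ` runs is wrong with probability at most `(8 / 9) ^ κ`: the expected value of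
`2 ^ w`, for `w` wrong answers, is at most `(4 / 3) ^ (2 * κ)`, and `w ≥ κ` if the majority is
wrong. A tie counts as the answer `0`. -/
theorem wp_call {p : Cmd} {N b T B κ : ℕ} (hN : p.NamesLt N) (hN2 : 2 ≤ N) {G : WGraph} {A : ℤ}
    (hA : A = 0 ∨ A = 1)
    (hrun : GoodRun d f p G A T B) {σ : Mem} (hc : Clean N σ) (hb : Bd N b σ)
    (hG : Holds (σ.arr (N + 3)) G.enc) (hnb : 2 * (G.n * G.n) + 1 ≤ b)
    (hκ : σ.var (N + 15) = κ) (hκb : 2 * κ + 1 ≤ b) :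
    WP d f (call N p) σ (callCost N b G.n T B κ) (fun τ => ind (fun τ => Clean N τ ∧ Bd N b τ ∧
      Frame N 15 3 σ τ ∧ (τ.var (N + 14) = 0 ∨ τ.var (N + 14) = 1)) τ +
      if τ.var (N + 14) = A then 0 else 1) ((8 / 9) ^ κ) := by
  set K := runCost N b G.n T B with hK
  refine WP.cost (k := unit b + (unit b + (unit b + ((2 * κ * (unit b + (K + (unit b + 1 * unit b)))
    + unit b) + (unit b + 1 * unit b))))) ?_ (by unfold callCost; rw [← hK]; nlinarith)
  have hn0 : σ.arr (N + 3) 0 = G.n := ((holds_enc _ _).1 hG).1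
  refine WP.assign_bd hb G.n (Nat.le_of_ble_eq_true rfl) (by simp) (by simp [hn0])
    (by simp; nlinarith) fun hb => ?_
  refine WP.assign_bd hb 0 (Nat.le_of_ble_eq_true rfl) (by simp) (by simp)
    (by simp) fun hb => ?_
  refine WP.assign_bd hb 0 (Nat.le_of_ble_eq_true rfl) (by simp) (by simp)
    (by simp) fun hb => ?_
  set I : ℕ → Mem → Prop := fun i τ => Clean N τ ∧ Bd N b τ ∧ Frame N 15 3 σ τ ∧
    τ.var (N + 11) = G.n ∧ τ.var (N + 12) = i ∧ ∃ o ≤ i, τ.var (N + 13) = (o : ℕ) with hI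
  set φ : ℕ → Mem → ℝ≥0∞ := fun i τ => ind (I i) τ +
    votePot κ i (wrong A i (τ.var (N + 13)).toNat) with hφ
  have hφtop : ∀ i τ, φ i τ ≠ ⊤ → I i τ := fun i τ h =>
    ind_ne_top (ne_top_of_le_ne_top h le_self_add)
  refine WP.seq (χ := φ (2 * κ)) (by finiteness) ((WP.loop_const (2 * κ) φ _ (unit b)
    (fun i hi τ hτ => ?_) (fun i hi τ hτ => ?_) ?_).mono le_rfl (fun _ => le_rfl) ?_) ?_
  · obtain ⟨-, h2, h3, -, h5, -⟩ := hφtop i τ hτ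
    refine ⟨h2.guard (Nat.le_of_ble_eq_true rfl) (by simp), ?_⟩
    have : τ.var (N + 15) = κ := by rw [h3.var _ (by omega), hκ]
    simp [h5, this]
    omega
  · have hI' := hφtop i τ hτ
    obtain ⟨h1, h2, h3, h4, h5, o, ho, h6⟩ := hI'
    have e1 : φ i τ = votePot κ i (wrong A i o) := by
      simp only [hφ]
      rw [ind_of (hφtop i τ hτ), zero_add, h6, Int.toNat_natCast]
    set x := votePot κ (i + 1) (wrong A i o) with hx
    have e2 : 4 / 3 * x = votePot κ i (wrong A i o) := by
      rw [hx, votePot, votePot, show 2 * κ - i = (2 * κ - (i + 1)) + 1 by omega, pow_succ]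
      ring
    rw [e1, ← e2]
    refine WP.seq (by have := votePot_ne_top κ (i + 1) (wrong A i o); finiteness)
      (wp_run hN hN2 hA hrun h1 h2 h4
      (by rw [h3.arr _ (by omega)]; exact hG) hnb h6 (by omega) x (votePot_ne_top _ _ _)) ?_
    intro ρ hρ
    have hρ' := ind_ne_top (ne_top_of_le_ne_top hρ le_self_add)
    rw [ind_of hρ', zero_add]
    obtain ⟨g1, g2, g3, g4, g5⟩ := hρ'
    have hρ12 : ρ.var (N + 12) = i := by
      rw [g3 _ (by omega) (by omega) (by omega) (by omega), h5]
    refine WP.assign_bd g2 (i + 1 : ℕ) (Nat.le_of_ble_eq_true rfl) (by simp) (by simp [hρ12])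
      (by simp only [Nat.abs_cast, Nat.cast_le]; omega) fun g2 => ?_
    refine WP.nil_unit (n := 0) ?_
    have hex : ∃ o' ≤ i + 1, (o' = o ∨ o' = o + 1) ∧ ρ.var (N + 13) = (o' : ℕ) := by
      rcases g5 with g5 | g5
      · exact ⟨o, by omega, Or.inl rfl, g5⟩
      · exact ⟨o + 1, by omega, Or.inr rfl, by rw [g5]; push_cast; rfl⟩
    obtain ⟨o', ho', hoo, hv⟩ := hex
    simp only [hφ]
    rw [ind_of, zero_add]
    · simp only [Mem.set_var, Nat.add_left_cancel_iff, Nat.reduceEqDiff, if_false, hv,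
        Int.toNat_natCast]
      have hmono : ∀ w w' : ℕ, w ≤ w' → votePot κ (i + 1) w ≤ votePot κ (i + 1) w' := by
        intro w w' hw
        unfold votePot
        gcongr
        exact one_le_two
      have hdouble : votePot κ (i + 1) (wrong A i o + 1) = 2 * x := by
        rw [hx, votePot, votePot, pow_succ]; ring
      split_ifs with hif
      · apply hmono
        unfold wrong
        rcases hA with rfl | rfl
        · simp at *; omega
        · simp at *; omega
      · rw [← hdouble]
        apply hmono
        unfold wrong
        split_ifs <;> omega
    · refine ⟨g1.set (by omega), g2, ⟨fun y hy => ?_, fun a ha => ?_⟩, ?_, by simp, o', ho', ?_⟩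
      · rw [Mem.set_var, if_neg (by omega), g3 y (by omega) (by omega) (by omega) (by omega),
          h3.var y hy]
      · rw [Mem.set_arr, g4 a ha, h3.arr a ha]
      · rw [Mem.set_var, if_neg (by omega), g3 _ (by omega) (by omega) (by omega) (by omega), h4]
      · simpa using hv
  · simp only [hφ]
    rw [ind_of]
    · rw [zero_add]; exact votePot_ne_top _ _ _
    · exact ⟨((hc.set (by omega)).set (by omega)).set (by omega), hb,
        (((Frame.refl _ _ _ _).set (by omega)).set (by omega)).set (by omega), by simp, by simp,
        0, by simp, by simp⟩
  · simp only [hφ]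
    rw [ind_of, zero_add, ← votePot_zero]
    · simp [wrong]
    · exact ⟨((hc.set (by omega)).set (by omega)).set (by omega), hb,
        (((Frame.refl _ _ _ _).set (by omega)).set (by omega)).set (by omega), by simp, by simp,
        0, by simp, by simp⟩
  · intro τ hτ
    have hI' := hφtop _ τ hτ
    simp only [hφ]
    rw [ind_of hI', zero_add]
    obtain ⟨h1, h2, h3, h4, h5, o, ho, h6⟩ := hI'
    have hκτ : τ.var (N + 15) = κ := by rw [h3.var _ (by omega), hκ]
    set a : ℤ := if κ < o then 1 else 0 with ha
    have ha01 : a = 0 ∨ a = 1 := by rw [ha]; split_ifs <;> simp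
    refine WP.assign_bd h2 a (Nat.le_of_ble_eq_true rfl) (by simp) (by simp [hκτ, h6, ha])
      (by rcases ha01 with h | h <;> simp [h]; omega) fun g2 => ?_
    refine WP.nil_unit (n := 0) ?_
    rw [ind_of, zero_add, h6, Int.toNat_natCast]
    · simp only [Mem.set_var, if_true]
      split_ifs with haA
      · exact zero_le
      · refine one_le_votePot ?_
        unfold wrong
        rcases hA with rfl | rfl
        · have : κ < o := by
            by_contra hcon
            exact haA (by rw [ha, if_neg hcon])
          simp; omega
        · have : ¬ κ < o := fun hcon => haA (by rw [ha, if_pos hcon])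
          simp; omega
    · exact ⟨h1.set (by omega), g2, h3.set (by omega), by simpa using ha01⟩

end FineGrained

namespace FineGrained
open scoped ENNReal
open Finset

/-! ### Random bit strings -/

/-- Average over all sets of indices below `m`, that is, over `m` independent fair bits. -/
noncomputable def avg (m : ℕ) (F : Finset ℕ → ℝ≥0∞) : ℝ≥0∞ :=
  (∑ s ∈ (range m).powerset, F s) / 2 ^ m

theorem avg_zero (F : Finset ℕ → ℝ≥0∞) : avg 0 F = F ∅ := by simp [avg]

theorem powerset_insert_sum {M : Type*} [AddCommMonoid M] (m : ℕ) (F : Finset ℕ → M) :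
    ∑ s ∈ (range (m + 1)).powerset, F s
      = ∑ s ∈ (range m).powerset, F s + ∑ s ∈ (range m).powerset, F (insert m s) := by
  rw [range_add_one, sum_powerset_insert notMem_range_self]

theorem avg_succ (m : ℕ) (F : Finset ℕ → ℝ≥0∞) :
    avg (m + 1) F = avg m fun s => (F s + F (insert m s)) / 2 := by
  unfold avg
  rw [powerset_insert_sum, ← sum_add_distrib]
  simp only [div_eq_mul_inv]
  rw [← sum_mul, pow_succ, ENNReal.mul_inv (by simp) (by simp), mul_assoc,
    mul_comm (2 ^ m)⁻¹]

theorem avg_mono {m : ℕ} {F G : Finset ℕ → ℝ≥0∞} (h : ∀ s ⊆ range m, F s ≤ G s) :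
    avg m F ≤ avg m G :=
  ENNReal.div_le_div_right (sum_le_sum fun s hs => h s (mem_powerset.1 hs)) _

theorem avg_const (m : ℕ) (c : ℝ≥0∞) : avg m (fun _ => c) = c := by
  unfold avg
  rw [sum_const, card_powerset, card_range, nsmul_eq_mul, mul_comm, mul_div_assoc]
  push_cast
  rw [ENNReal.div_self (by simp) (by finiteness), mul_one]

/-- If `F` is at most `a * x` on a fraction `1 / K` of the bit strings, and at most `x` on all of
them, then it is on average at most `(1 - (1 - a) / K) * x`. -/
theorem avg_le {m K : ℕ} {P : Finset ℕ → Prop} [DecidablePred P] (hK : 1 ≤ K)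
    (hP : 2 ^ m ≤ K * #{s ∈ (range m).powerset | P s}) {F : Finset ℕ → ℝ≥0∞} {x : ℝ≥0∞} {a : ℝ}
    (ha : 0 ≤ a) (ha1 : a ≤ 1)
    (h1 : ∀ s ⊆ range m, P s → F s ≤ ENNReal.ofReal a * x) (h2 : ∀ s ⊆ range m, F s ≤ x) :
    avg m F ≤ ENNReal.ofReal (1 - (1 - a) / K) * x := by
  set c := #{s ∈ (range m).powerset | P s} with hc
  set c' := #{s ∈ (range m).powerset | ¬ P s} with hc'
  have hcc : c + c' = 2 ^ m := by
    rw [hc, hc', card_filter_add_card_filter_not, card_powerset, card_range]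
  have hK' : (0 : ℝ) < K := by exact_mod_cast hK
  have hsum : ∑ s ∈ (range m).powerset, F s ≤ c * (ENNReal.ofReal a * x) + c' * x := by
    rw [← sum_filter_add_sum_filter_not _ P]
    refine add_le_add ?_ ?_
    · rw [← nsmul_eq_mul]
      exact sum_le_card_nsmul _ _ _ fun s hs =>
        h1 s (mem_powerset.1 (mem_filter.1 hs).1) (mem_filter.1 hs).2
    · rw [← nsmul_eq_mul]
      exact sum_le_card_nsmul _ _ _ fun s hs => h2 s (mem_powerset.1 (mem_filter.1 hs).1)
  unfold avg
  refine ENNReal.div_le_of_le_mul (hsum.trans ?_)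
  have e1 : (c : ℝ≥0∞) = ENNReal.ofReal c := by simp
  have e2 : (c' : ℝ≥0∞) = ENNReal.ofReal c' := by simp
  have e3 : (2 : ℝ≥0∞) ^ m = ENNReal.ofReal (2 ^ m) := by
    rw [ENNReal.ofReal_pow (by norm_num)]; simp
  have hr : 0 ≤ 1 - (1 - a) / K := by
    rw [sub_nonneg, div_le_one hK']
    have : (1 : ℝ) ≤ K := by exact_mod_cast hK
    linarith
  rw [e1, e2, e3, ← mul_assoc, ← add_mul, mul_right_comm, ← ENNReal.ofReal_mul (by positivity),
    ← ENNReal.ofReal_add (by positivity) (by positivity), ← ENNReal.ofReal_mul hr]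
  gcongr
  have f1 : (c : ℝ) + c' = 2 ^ m := by exact_mod_cast hcc
  have f2 : (2 : ℝ) ^ m ≤ K * c := by exact_mod_cast hP
  have f3 : (2 : ℝ) ^ m / K ≤ c := by rw [div_le_iff₀ hK']; linarith
  have : (1 - (1 - a) / K) * 2 ^ m = 2 ^ m - (1 - a) * (2 ^ m / K) := by ring
  rw [this]
  nlinarith

/-- A nonzero polynomial of degree at most `k` over the field with two elements, given by the family
`𝓕` of its monomials, does not vanish on at least a fraction `2 ^ (-k)` of all points. -/
theorem two_pow_le_card_odd (m : ℕ) : ∀ (k : ℕ) (𝓕 : Finset (Finset ℕ)), 𝓕.Nonempty →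
    (∀ F ∈ 𝓕, F ⊆ range m ∧ #F ≤ k) →
    2 ^ m ≤ 2 ^ k * #{s ∈ (range m).powerset | Odd #{F ∈ 𝓕 | F ⊆ s}} := by
  induction m with
  | zero =>
    intro k 𝓕 h𝓕 h
    have : 𝓕 = {∅} := by
      refine (h𝓕.subset_singleton_iff).1 fun F hF => ?_
      simpa using (h F hF).1
    subst this
    have : ({s ∈ (range 0).powerset | Odd #{F ∈ ({∅} : Finset (Finset ℕ)) | F ⊆ s}}) = {∅} := by
      ext s
      simp [filter_singleton]
    rw [this]
    simp [Nat.one_le_two_pow]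
  | succ m ih =>
    intro k 𝓕 h𝓕 h
    -- Write the polynomial as `A + X_m * B`, where `X_m` occurs in neither `A` nor `B`. Its values are
    -- `A` where `X_m` vanishes, and `A + B` elsewhere.
    set 𝓐 := {F ∈ 𝓕 | m ∉ F} with h𝓐
    set 𝓑 := {F ∈ 𝓕 | m ∈ F}.image (fun F => F.erase m) with h𝓑
    have hinj : Set.InjOn (fun F : Finset ℕ => F.erase m) ({F ∈ 𝓕 | m ∈ F} : Finset _) := by
      intro F hF G hG hFG
      simp only [coe_filter, Set.mem_ofPred_eq] at hF hG
      rw [← insert_erase hF.2, ← insert_erase hG.2]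
      exact congrArg _ hFG
    have e0 : ∀ s ⊆ range m, #{F ∈ 𝓕 | F ⊆ s} = #{F ∈ 𝓐 | F ⊆ s} := by
      intro s hs
      rw [h𝓐, filter_filter]
      congr 1
      ext F
      simp only [mem_filter]
      have : F ⊆ s → m ∉ F := fun h hm => notMem_range_self (hs (h hm))
      tauto
    have e1 : ∀ s ⊆ range m, #{F ∈ 𝓕 | F ⊆ insert m s} = #{F ∈ 𝓐 | F ⊆ s} + #{F ∈ 𝓑 | F ⊆ s} := by
      intro s hs
      rw [← card_filter_add_card_filter_not (s := {F ∈ 𝓕 | F ⊆ insert m s}) (fun F => m ∉ F)]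
      congr 1
      · rw [h𝓐, filter_filter, filter_filter]
        congr 1
        ext F
        simp only [mem_filter]
        refine and_congr_right fun _ => ?_
        constructor
        · rintro ⟨h1, h2⟩; exact ⟨h2, (subset_insert_iff_of_notMem h2).1 h1⟩
        · rintro ⟨h1, h2⟩; exact ⟨h2.trans (subset_insert _ _), h1⟩
      · rw [h𝓑, filter_image, card_image_of_injOn (hinj.mono (by simp +contextual [Set.subset_def]))]
        rw [filter_filter, filter_filter]
        congr 1
        ext F
        simp only [mem_filter, not_not]
        rw [subset_insert_iff]
        tauto
    have hcount : #{s ∈ (range (m + 1)).powerset | Odd #{F ∈ 𝓕 | F ⊆ s}} =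
        #{s ∈ (range m).powerset | Odd #{F ∈ 𝓐 | F ⊆ s}} +
        #{s ∈ (range m).powerset | Odd (#{F ∈ 𝓐 | F ⊆ s} + #{F ∈ 𝓑 | F ⊆ s})} := by
      simp only [card_filter]
      rw [powerset_insert_sum]
      congr 1
      · refine sum_congr rfl fun s hs => ?_
        have := e0 s (mem_powerset.1 hs)
        simp only [card_filter] at this
        rw [this]
      · refine sum_congr rfl fun s hs => ?_
        have := e1 s (mem_powerset.1 hs)
        simp only [card_filter] at this
        rw [this]
    rw [hcount]
    rcases 𝓑.eq_empty_or_nonempty with hB | hB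
    · have hA : 𝓐.Nonempty := by
        obtain ⟨F, hF⟩ := h𝓕
        refine ⟨F, mem_filter.2 ⟨hF, fun hm => ?_⟩⟩
        have : F.erase m ∈ 𝓑 := mem_image.2 ⟨F, mem_filter.2 ⟨hF, hm⟩, rfl⟩
        rw [hB] at this
        exact notMem_empty _ this
      have := ih k 𝓐 hA fun F hF => by
        obtain ⟨h1, h2⟩ := mem_filter.1 hF
        refine ⟨?_, (h F h1).2⟩
        have h3 := (h F h1).1
        rw [range_add_one] at h3
        exact (subset_insert_iff_of_notMem h2).1 h3
      simp only [hB, filter_empty, card_empty, add_zero]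
      rw [pow_succ]
      linarith
    · obtain ⟨F₀, hF₀⟩ := hB
      have hk : ∀ G ∈ 𝓑, G ⊆ range m ∧ #G + 1 ≤ k := by
        intro G hG
        obtain ⟨F, hF, rfl⟩ := mem_image.1 hG
        obtain ⟨h1, h2⟩ := mem_filter.1 hF
        have h3 := h F h1
        rw [card_erase_add_one h2]
        refine ⟨?_, h3.2⟩
        rw [← subset_insert_iff, ← range_add_one]
        exact h3.1
      obtain ⟨k, rfl⟩ : ∃ k', k = k' + 1 := ⟨k - 1, by have := (hk F₀ hF₀).2; omega⟩
      have := ih k 𝓑 ⟨F₀, hF₀⟩ fun G hG => ⟨(hk G hG).1, by have := (hk G hG).2; omega⟩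
      -- Where `B` does not vanish, one of `A` and `A + B` does not vanish; `B` has smaller degree.
      have hle : #{s ∈ (range m).powerset | Odd #{F ∈ 𝓑 | F ⊆ s}} ≤
          #{s ∈ (range m).powerset | Odd #{F ∈ 𝓐 | F ⊆ s}} +
          #{s ∈ (range m).powerset | Odd (#{F ∈ 𝓐 | F ⊆ s} + #{F ∈ 𝓑 | F ⊆ s})} := by
        refine (card_le_card fun s hs => ?_).trans (card_union_le _ _)
        simp only [mem_union, mem_filter] at hs ⊢
        by_cases ho : Odd #{F ∈ 𝓐 | F ⊆ s}
        · exact Or.inl ⟨hs.1, ho⟩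
        · exact Or.inr ⟨hs.1, (Nat.not_odd_iff_even.1 ho).add_odd hs.2⟩
      calc 2 ^ (m + 1) = 2 * 2 ^ m := by ring
        _ ≤ 2 * (2 ^ k * _) := Nat.mul_le_mul_left 2 this
        _ ≤ 2 * (2 ^ k * _) := Nat.mul_le_mul_left 2 (Nat.mul_le_mul_left _ hle)
        _ = _ := by ring

/-- At least a fraction `2 ^ (-k)` of the subsets of `range m` agree with `E` on a set `D` of at
most `k` elements. -/
theorem two_pow_le_card_inter {m k : ℕ} {D E : Finset ℕ} (hD : D ⊆ range m) (hE : E ⊆ D)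
    (hk : #D ≤ k) : 2 ^ m ≤ 2 ^ k * #{s ∈ (range m).powerset | D ∩ s = E} := by
  -- The polynomial with the monomials `F`, for `E ⊆ F ⊆ D`, is the indicator of `D ∩ s = E`: an
  -- interval of finite sets has an odd number of elements only if it is a single point.
  refine (two_pow_le_card_odd m k (Icc E D) ⟨E, by simp [hE]⟩ fun F hF => ?_).trans ?_
  · rw [mem_Icc] at hF
    exact ⟨hF.2.trans hD, (card_le_card hF.2).trans hk⟩
  · gcongr 2 ^ k * #?_
    intro s hs
    simp only [mem_filter] at hs ⊢
    refine ⟨hs.1, ?_⟩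
    have h1 : {F ∈ Icc E D | F ⊆ s} = Icc E (D ∩ s) := by
      ext F
      simp only [mem_filter, mem_Icc, subset_inter_iff]
      tauto
    have h2 := hs.2
    rw [h1] at h2
    by_cases hEs : E ⊆ D ∩ s
    · rw [card_Icc_finset hEs] at h2
      by_contra hne
      have hlt : #E < #(D ∩ s) := card_lt_card (hEs.ssubset_of_ne (Ne.symm hne))
      obtain ⟨t, ht⟩ : ∃ t, #(D ∩ s) - #E = t + 1 := ⟨#(D ∩ s) - #E - 1, by omega⟩
      rw [ht, pow_succ] at h2
      exact (Nat.not_odd_iff_even.2 (even_two.mul_left _)) h2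
    · rw [Icc_eq_empty (by simpa using hEs)] at h2
      simp at h2

/-! ### A random linear hash function -/

/-- The hash value in `[0, Q)` of `x`: the upper bits of `a * x` modulo `P * Q`. -/
def hash (P Q a : ℕ) (x : ℤ) : ℤ := (a * x % (P * Q : ℕ)) / P

theorem hash_nonneg (P Q a : ℕ) (x : ℤ) (h : 0 < P * Q) : 0 ≤ hash P Q a x :=
  Int.ediv_nonneg (Int.emod_nonneg _ (by omega)) (by omega)

theorem hash_lt (P Q a : ℕ) (x : ℤ) (h : 0 < P * Q) : hash P Q a x < Q := by
  have hP : 0 < P := Nat.pos_of_mul_pos_right h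
  have hP' : (0 : ℤ) < P := by exact_mod_cast hP
  unfold hash
  rw [Int.ediv_lt_iff_lt_mul hP']
  have := Int.emod_lt_of_pos (a * x) (b := (P * Q : ℕ)) (by exact_mod_cast h)
  push_cast at this ⊢
  linarith

/-- Hash values are linear up to a carry of at most `2`. -/
theorem exists_carry {P Q a : ℕ} (h : 0 < P * Q) {x y z : ℤ} (hxyz : x + y + z = 0) :
    ∃ o < 3, ∃ m : ℤ, hash P Q a x + hash P Q a y + hash P Q a z + (o : ℕ) = Q * m := by
  have hP : 0 < P := Nat.pos_of_mul_pos_right h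
  have hP' : (0 : ℤ) < P := by exact_mod_cast hP
  have key : ∀ x : ℤ, ∃ k ρ : ℤ, a * x = P * Q * k + (P * hash P Q a x + ρ) ∧ 0 ≤ ρ ∧ ρ < P := by
    intro x
    refine ⟨a * x / (P * Q : ℕ), a * x % (P * Q : ℕ) % P, ?_, Int.emod_nonneg _ (by omega),
      Int.emod_lt_of_pos _ hP'⟩
    unfold hash
    have h1 := Int.mul_ediv_add_emod (a * x) (P * Q : ℕ)
    have h2 := Int.mul_ediv_add_emod (a * x % (P * Q : ℕ)) P
    push_cast at h1 h2 ⊢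
    linarith
  obtain ⟨k₁, r₁, e₁, n₁, l₁⟩ := key x
  obtain ⟨k₂, r₂, e₂, n₂, l₂⟩ := key y
  obtain ⟨k₃, r₃, e₃, n₃, l₃⟩ := key z
  have hr : r₁ + r₂ + r₃ = P * (-(Q * (k₁ + k₂ + k₃)) - (hash P Q a x + hash P Q a y +
      hash P Q a z)) := by
    have : (a : ℤ) * x + a * y + a * z = 0 := by rw [← mul_add, ← mul_add, hxyz, mul_zero]
    linear_combination this - e₁ - e₂ - e₃
  set o := -(Q * (k₁ + k₂ + k₃)) - (hash P Q a x + hash P Q a y + hash P Q a z) with ho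
  have o0 : 0 ≤ o := by by_contra hcon; nlinarith
  have o3 : o < 3 := by by_contra hcon; nlinarith
  refine ⟨o.toNat, by omega, -(k₁ + k₂ + k₃), ?_⟩
  rw [Int.toNat_of_nonneg o0, ho]
  ring

/-- A number `d ≠ 0` below `2 ^ k` takes any given hash value for at most a fraction `2 ^ (-l)` of the multipliers. -/
theorem card_hash_le {k l : ℕ} {d : ℤ} (hd : d ≠ 0) (hdk : |d| < 2 ^ k) (j : ℤ) :
    #{a ∈ range (2 ^ (k + l)) | hash (2 ^ k) (2 ^ l) a d = j} ≤ 2 ^ k := by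
  -- Write `d = 2 ^ e * u` with `u` odd; `a * d` modulo `2 ^ (k + l)` runs through the multiples of
  -- `2 ^ e`, and the gap is filled with the top `e` bits of `a`.
  obtain ⟨e, u, hu, hdu⟩ : ∃ (e : ℕ) (u : ℤ), Odd u ∧ d = 2 ^ e * u := by
    obtain ⟨e, u, hu, h⟩ := Nat.exists_eq_two_pow_mul_odd (n := d.natAbs) (by omega)
    rcases Int.natAbs_eq d with h' | h'
    · exact ⟨e, u, by exact_mod_cast hu, by rw [h', h]; push_cast; ring⟩
    · exact ⟨e, -u, (by exact_mod_cast hu : Odd (u : ℤ)).neg, by rw [h', h]; push_cast; ring⟩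
  have hek : e ≤ k := by
    by_contra hcon
    have h1 : (2 : ℤ) ^ k ≤ 2 ^ e := pow_le_pow_right₀ (by norm_num) (by omega)
    have h2 : 1 ≤ |u| := Int.one_le_abs (by rintro rfl; simp at hu)
    rw [hdu, abs_mul, abs_of_pos (by positivity)] at hdk
    have h3 : (0 : ℤ) < 2 ^ e := by positivity
    nlinarith
  set M : ℕ := 2 ^ (k + l - e) with hM
  have hMW : 2 ^ e * M = 2 ^ (k + l) := by rw [hM, ← pow_add]; congr 1; omega
  have hM0 : 0 < M := by rw [hM]; positivity
  have hmod : ∀ a : ℕ, (a * d % ((2 ^ k * 2 ^ l : ℕ) : ℤ)) = 2 ^ e * (a * u % M) := by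
    intro a
    rw [← pow_add, ← hMW, hdu]
    push_cast
    rw [show (a : ℤ) * (2 ^ e * u) = 2 ^ e * (a * u) by ring, Int.mul_emod_mul_of_pos _ _ (by positivity)]
  have hcop : IsCoprime (M : ℤ) u := by
    rw [hM]
    push_cast
    refine IsCoprime.pow_left ?_
    obtain ⟨t, ht⟩ := hu
    exact ⟨-t, 1, by rw [ht]; ring⟩
  set g : ℕ → ℤ := fun a => 2 ^ e * (a * u % M) + (a / M : ℕ) with hg
  have hlt : ∀ a < 2 ^ (k + l), a / M < 2 ^ e := by
    intro a ha
    rw [Nat.div_lt_iff_lt_mul hM0, hMW]; exact ha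
  refine (card_le_card_of_injOn g (t := Ico (2 ^ k * j) (2 ^ k * j + 2 ^ k)) ?_ ?_).trans ?_
  · intro a ha
    simp only [coe_filter, mem_range, Set.mem_ofPred_eq] at ha
    obtain ⟨ha, hj⟩ := ha
    unfold hash at hj
    rw [hmod] at hj
    have h1 := hlt a ha
    obtain ⟨t, ht⟩ : ∃ t, k = e + t := ⟨k - e, by omega⟩
    have hp : (2 : ℤ) ^ k = 2 ^ e * 2 ^ t := by rw [ht, pow_add]
    push_cast at hj
    rw [hp, Int.mul_ediv_mul_of_pos _ _ (by positivity)] at hj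
    have h2 := Int.mul_ediv_add_emod (a * u % M) (2 ^ t)
    have h3 := Int.emod_lt_of_pos (a * u % M) (b := 2 ^ t) (by positivity)
    have h4 := Int.emod_nonneg (a * u % M) (b := 2 ^ t) (by positivity)
    rw [hj] at h2
    set ρ := (a * u % M : ℤ) % 2 ^ t with hρ
    have h5 : g a = 2 ^ k * j + (2 ^ e * ρ + (a / M : ℕ)) := by
      rw [hg, hp]; simp only; rw [← h2]; ring
    have h6 : ((a / M : ℕ) : ℤ) < 2 ^ e := by exact_mod_cast h1
    have h7 : (0 : ℤ) < 2 ^ e := by positivity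
    have h8 : (2 : ℤ) ^ e * ρ + 2 ^ e ≤ 2 ^ k := by
      rw [hp]; nlinarith
    simp only [coe_Ico, Set.mem_Ico]
    rw [h5]
    constructor
    · have : 0 ≤ 2 ^ e * ρ := by positivity
      linarith [Int.natCast_nonneg (a / M)]
    · linarith
  · intro a ha a' ha' haa
    simp only [coe_filter, mem_range, Set.mem_ofPred_eq] at ha ha'
    have h1 : ((a / M : ℕ) : ℤ) < 2 ^ e := by exact_mod_cast hlt a ha.1
    have h2 : ((a' / M : ℕ) : ℤ) < 2 ^ e := by exact_mod_cast hlt a' ha'.1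
    simp only [hg] at haa
    have h3 : ((a / M : ℕ) : ℤ) = (a' / M : ℕ) := by
      have := congrArg (· % (2 ^ e : ℤ)) haa
      simp only [Int.mul_add_emod_self_left] at this
      rwa [Int.emod_eq_of_lt (by positivity) h1, Int.emod_eq_of_lt (by positivity) h2] at this
    rw [h3] at haa
    have h4 : (a * u % M : ℤ) = a' * u % M := by
      have : (2 : ℤ) ^ e ≠ 0 := by positivity
      exact mul_left_cancel₀ this (by linarith)
    have h5 : (M : ℤ) ∣ (a - a') := by
      refine hcop.dvd_of_dvd_mul_right ?_
      rw [sub_mul]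
      exact (Int.ModEq.dvd (Int.ModEq.symm h4))
    have h6 : a % M = a' % M :=
      (Nat.modEq_iff_dvd.2 (by rw [← neg_sub]; exact (dvd_neg).2 h5))
    rw [← Nat.div_add_mod a M, ← Nat.div_add_mod a' M, h6]
    congr 2
    exact_mod_cast h3
  · simp

end FineGrained

namespace FineGrained
open scoped ENNReal
open Finset

/-- If `x` and `y` collide, `a * (x - y)` is congruent modulo `P * Q` to a number in `(-P, P)`, whose hash
value is `0` or `Q - 1`. -/
theorem hash_eq_imp {P Q a : ℕ} (h : 0 < P * Q) {x y : ℤ} (hxy : hash P Q a x = hash P Q a y) :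
    hash P Q a (x - y) = 0 ∨ hash P Q a (x - y) = Q - 1 := by
  have hP : 0 < P := Nat.pos_of_mul_pos_right h
  have hQ : 0 < Q := Nat.pos_of_mul_pos_left h
  have hP' : (0 : ℤ) < P := by exact_mod_cast hP
  have hQ' : (1 : ℤ) ≤ Q := by exact_mod_cast hQ
  have key : ∀ x : ℤ, ∃ k ρ : ℤ, a * x = P * Q * k + (P * hash P Q a x + ρ) ∧ 0 ≤ ρ ∧ ρ < P := by
    intro x
    refine ⟨a * x / (P * Q : ℕ), a * x % (P * Q : ℕ) % P, ?_, Int.emod_nonneg _ (by omega),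
      Int.emod_lt_of_pos _ hP'⟩
    unfold hash
    have h1 := Int.mul_ediv_add_emod (a * x) (P * Q : ℕ)
    have h2 := Int.mul_ediv_add_emod (a * x % (P * Q : ℕ)) P
    push_cast at h1 h2 ⊢
    linarith
  obtain ⟨k₁, r₁, e₁, n₁, l₁⟩ := key x
  obtain ⟨k₂, r₂, e₂, n₂, l₂⟩ := key y
  have e : (a : ℤ) * (x - y) = r₁ - r₂ + (P * Q : ℕ) * (k₁ - k₂) := by
    rw [hxy] at e₁
    push_cast
    linear_combination e₁ - e₂
  have hPQ : (P : ℤ) ≤ P * Q := by nlinarith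
  unfold hash
  rw [e, Int.add_mul_emod_self_left]
  rcases le_or_gt r₂ r₁ with hr | hr
  · left
    rw [Int.emod_eq_of_lt (by omega) (by push_cast; omega)]
    exact Int.ediv_eq_zero_of_lt (by omega) (by omega)
  · right
    rw [← Int.add_emod_right, Int.emod_eq_of_lt (by push_cast; omega) (by push_cast; omega)]
    rw [Int.ediv_eq_iff_of_pos hP']
    push_cast
    constructor <;> nlinarith

/-- Two different numbers collide for at most a fraction `2 / 2 ^ l` of the multipliers. -/
theorem card_collision_le {k l : ℕ} {x y : ℤ} (hxy : x ≠ y) (hk : |x - y| < 2 ^ k) :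
    #{a ∈ range (2 ^ (k + l)) | hash (2 ^ k) (2 ^ l) a x = hash (2 ^ k) (2 ^ l) a y}
      ≤ 2 * 2 ^ k := by
  have hd : x - y ≠ 0 := sub_ne_zero.2 hxy
  have h0 := card_hash_le (l := l) hd hk 0
  have h1 := card_hash_le (l := l) hd hk (((2 ^ l : ℕ) : ℤ) - 1)
  rw [two_mul]
  refine (card_le_card fun a ha => ?_).trans ((card_union_le _ _).trans (add_le_add h0 h1))
  simp only [mem_union, mem_filter] at ha ⊢
  rcases hash_eq_imp (by positivity) ha.2 with h | h
  · exact Or.inl ⟨ha.1, h⟩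
  · exact Or.inr ⟨ha.1, h⟩

/-- The number with the set `A` of binary digits. -/
def number (A : Finset ℕ) : ℕ := ∑ i ∈ A, 2 ^ i

theorem number_lt {L : ℕ} {A : Finset ℕ} (h : A ⊆ range L) : number A < 2 ^ L :=
  Nat.geomSum_lt le_rfl fun _ hi => mem_range.1 (h hi)

/-- For most multipliers no element of `x` collides with one of three given elements, unless they
are equal. -/
theorem card_good {n k l : ℕ} {x : ℕ → ℤ} (hk : ∀ i < n, ∀ j < n, |x i - x j| < 2 ^ k)
    (hl : 12 * n ≤ 2 ^ l) {t : Finset ℕ} (ht : t ⊆ range n) (ht3 : #t ≤ 3) :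
    2 ^ (k + l) ≤ 2 * #{A ∈ (range (k + l)).powerset | ∀ e ∈ t, ∀ m < n,
      hash (2 ^ k) (2 ^ l) (number A) (x m) = hash (2 ^ k) (2 ^ l) (number A) (x e) →
        x m = x e} := by
  set Q : ℕ → Prop := fun a => ∀ e ∈ t, ∀ m < n,
    hash (2 ^ k) (2 ^ l) a (x m) = hash (2 ^ k) (2 ^ l) a (x e) → x m = x e with hQ
  -- A union bound over at most `3 * n` pairs.
  have hbad : #{a ∈ range (2 ^ (k + l)) | ¬ Q a} ≤ 3 * n * (2 * 2 ^ k) := by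
    have hsub : {a ∈ range (2 ^ (k + l)) | ¬ Q a} ⊆ (t ×ˢ range n).biUnion fun p =>
        {a ∈ range (2 ^ (k + l)) | x p.2 ≠ x p.1 ∧
          hash (2 ^ k) (2 ^ l) a (x p.2) = hash (2 ^ k) (2 ^ l) a (x p.1)} := by
      intro a ha
      simp only [hQ, mem_filter, not_forall] at ha
      obtain ⟨ha, e, he, m, hm, h1, h2⟩ := ha
      exact mem_biUnion.2 ⟨(e, m), by simp [he, hm], by simp [mem_range.1 ha, h1, h2]⟩
    refine (card_le_card hsub).trans ((card_biUnion_le_card_mul _ _ (2 * 2 ^ k) ?_).trans ?_)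
    · rintro ⟨e, m⟩ hp
      rw [mem_product] at hp
      by_cases h : x m = x e
      · simp [h]
      · refine le_trans (card_le_card ?_) (card_collision_le (l := l) h
          (hk m (mem_range.1 hp.2) e (mem_range.1 (ht hp.1))))
        intro a ha
        simp only [mem_filter] at ha ⊢
        exact ⟨ha.1, ha.2.2⟩
    · rw [card_product, card_range]
      gcongr
  have hbad' : #{A ∈ (range (k + l)).powerset | ¬ Q (number A)} ≤ 3 * n * (2 * 2 ^ k) := by
    refine (card_le_card_of_injOn number ?_ ?_).trans hbad
    · intro A hA
      simp only [coe_filter, mem_powerset, Set.mem_ofPred_eq, mem_range] at hA ⊢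
      exact ⟨number_lt hA.1, hA.2⟩
    · exact (Finset.geomSum_injective le_rfl).injOn
  have hsum := card_filter_add_card_filter_not (s := (range (k + l)).powerset)
    (fun A => Q (number A))
  rw [card_powerset, card_range] at hsum
  have h12 : 2 * (3 * n * (2 * 2 ^ k)) ≤ 2 ^ (k + l) := by
    rw [pow_add]
    calc _ = 2 ^ k * (12 * n) := by ring
      _ ≤ _ := Nat.mul_le_mul_left _ hl
  change 2 ^ (k + l) ≤ 2 * #{A ∈ (range (k + l)).powerset | Q (number A)}
  omega

/-! ### Colours and buckets -/

/-- The colour of `i`, given by two random bits. -/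
def colour (C : Finset ℕ) (i : ℕ) : ℕ :=
  (if 2 * i ∈ C then 1 else 0) + 2 * if 2 * i + 1 ∈ C then 1 else 0

/-- Three different elements have the colours `0`, `1`, `2` with probability `1 / 64`. -/
theorem card_colour {n i j k : ℕ} (hi : i < n) (hj : j < n) (hk : k < n) (hij : i ≠ j)
    (hik : i ≠ k) (hjk : j ≠ k) :
    2 ^ (2 * n) ≤ 64 * #{C ∈ (range (2 * n)).powerset |
      colour C i = 0 ∧ colour C j = 1 ∧ colour C k = 2} := by
  set D : Finset ℕ := {2 * i, 2 * i + 1, 2 * j, 2 * j + 1, 2 * k, 2 * k + 1} with hD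
  refine (two_pow_le_card_inter (k := 6) (D := D) (E := {2 * j, 2 * k + 1}) ?_ ?_ ?_).trans ?_
  · intro y hy
    simp only [hD, mem_insert, mem_singleton] at hy
    rw [mem_range]; omega
  · intro y hy
    simp only [hD, mem_insert, mem_singleton] at hy ⊢
    tauto
  · exact card_le_six
  · refine Nat.mul_le_mul_left _ (card_le_card fun C hC => ?_)
    simp only [mem_filter] at hC ⊢
    refine ⟨hC.1, ?_⟩
    have key : ∀ y ∈ D, (y ∈ C ↔ y = 2 * j ∨ y = 2 * k + 1) := fun y hy => by
      have := Finset.ext_iff.1 hC.2 y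
      simp only [mem_inter, hy, true_and, mem_insert, mem_singleton] at this
      exact this
    unfold colour
    have h1 := key (2 * i) (by simp [hD])
    have h2 := key (2 * i + 1) (by simp [hD])
    have h3 := key (2 * j) (by simp [hD])
    have h4 := key (2 * j + 1) (by simp [hD])
    have h5 := key (2 * k) (by simp [hD])
    have h6 := key (2 * k + 1) (by simp [hD])
    rw [if_neg (by rw [h1]; omega), if_neg (by rw [h2]; omega), if_pos (by rw [h3]; omega),
      if_neg (by rw [h4]; omega), if_neg (by rw [h5]; omega), if_pos (by rw [h6]; omega)]
    omega

/-- The bucket `b` after the first `m` elements of `x` have been put into the buckets given by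
`key`; a bucket holds the last element that was put into it. -/
def bucket (key : ℕ → ℕ) (x : ℕ → ℤ) : ℕ → ℕ → Option ℤ
  | 0, _ => none
  | m + 1, b => if key m = b then some (x m) else bucket key x m b

theorem exists_of_bucket {key : ℕ → ℕ} {x : ℕ → ℤ} {m b : ℕ} {z : ℤ}
    (h : bucket key x m b = some z) : ∃ i < m, key i = b ∧ x i = z := by
  induction m with
  | zero => simp [bucket] at h
  | succ m ih =>
    rw [bucket] at h
    split_ifs at h with hk
    · exact ⟨m, by omega, hk, by simpa using h⟩
    · obtain ⟨i, hi, h⟩ := ih h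
      exact ⟨i, by omega, h⟩

theorem bucket_eq {key : ℕ → ℕ} {x : ℕ → ℤ} {m i : ℕ} (hi : i < m)
    (h : ∀ j < m, key j = key i → x j = x i) : bucket key x m (key i) = some (x i) := by
  induction m with
  | zero => omega
  | succ m ih =>
    rw [bucket]
    split_ifs with hk
    · rw [h m (by omega) hk]
    · have : i ≠ m := by rintro rfl; exact hk rfl
      exact ih (by omega) fun j hj => h j (by omega)

/-! ### The graph of a family of buckets -/

/-- The bucket that provides the weight of the edge from `u` to `v` in the graph on the three layers
`[0, S)`, `[S, 2 * S)` and `[2 * S, 4 * S)`. Along a triangle `u → v → x → u` the buckets have the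
form `S * S + h₁`, `h₀` and `2 * (S * S) + h₂`, where `h₀` is in the block number `r` of length `S`
and `h₀ + h₁ + h₂ + o` is divisible by `S * S`. -/
def edgeKey (S r o u v : ℕ) : Option ℕ :=
  if u < S ∧ S ≤ v ∧ v < 2 * S then some (S * S + (u * S + (v - S)))
  else if S ≤ u ∧ u < 2 * S ∧ u + S ≤ v ∧ v < u + 2 * S then some (r * S + (v - u - S))
  else if 2 * S ≤ u ∧ v < S then
    some (2 * (S * S) + ((-o - r * S - v * S - (u - 2 * S) : ℤ) % (S * S : ℕ)).toNat)
  else none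

theorem edgeKey_layers {S r o u v k : ℕ} (h : edgeKey S r o u v = some k) :
    (u < S ∧ S ≤ v ∧ v < 2 * S) ∨ (S ≤ u ∧ u < 2 * S ∧ 2 * S ≤ v) ∨ (2 * S ≤ u ∧ v < S) := by
  unfold edgeKey at h
  split_ifs at h with h1 h2 h3
  · exact Or.inl h1
  · exact Or.inr (Or.inl (by omega))
  · exact Or.inr (Or.inr h3)

/-- The weight of the edge from `u` to `v`: the contents of its bucket, decreased by `δ` between the
first two layers. There is no edge if the bucket is empty or if one of the nodes is not in `s`. -/
def bucketWeight (S : ℕ) (T : ℕ → Option ℤ) (r o : ℕ) (δ : ℤ) (s : Finset ℕ) (u v : ℕ) : Option ℤ :=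
  if u ∈ s ∧ v ∈ s then
    (edgeKey S r o u v).bind fun k => (T k).map fun z => z - if u < S then δ else 0 else none

/-- The three-layered graph with the nodes in `s`. -/
def bucketGraph (S : ℕ) (T : ℕ → Option ℤ) (r o : ℕ) (δ : ℤ) (s : Finset ℕ) : WGraph where
  n := 4 * S
  w u v := bucketWeight S T r o δ s u v
  loopless u := by
    have : edgeKey S r o u u = none := by
      unfold edgeKey
      rw [if_neg (by omega), if_neg (by omega), if_neg (by omega)]
    simp [bucketWeight, this]

section
variable {S : ℕ} {T : ℕ → Option ℤ} {r o : ℕ} {δ : ℤ} {s : Finset ℕ}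

theorem bucketGraph_w_eq_some {u v : Fin (4 * S)} {a : ℤ} :
    (bucketGraph S T r o δ s).w u v = some a ↔ ((u : ℕ) ∈ s ∧ (v : ℕ) ∈ s) ∧
      ∃ k z, edgeKey S r o u v = some k ∧ T k = some z ∧ a = z - if (u : ℕ) < S then δ else 0 := by
  unfold bucketGraph bucketWeight
  simp only
  split_ifs with h h'
  · simp only [Option.bind_eq_some_iff, Option.map_eq_some_iff, h, true_and, eq_comm (a := a)]
    constructor
    · rintro ⟨k, h1, z, h2, h3⟩; exact ⟨k, z, h1, h2, h3⟩
    · rintro ⟨k, z, h1, h2, h3⟩; exact ⟨k, h1, z, h2, h3⟩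
  · simp only [Option.bind_eq_some_iff, Option.map_eq_some_iff, h, true_and, eq_comm (a := a)]
    constructor
    · rintro ⟨k, h1, z, h2, h3⟩; exact ⟨k, z, h1, h2, h3⟩
    · rintro ⟨k, z, h1, h2, h3⟩; exact ⟨k, h1, z, h2, h3⟩
  · exact iff_of_false (by simp) fun h' => h h'.1
  · exact iff_of_false (by simp) fun h' => h h'.1

/-- A triangle that starts from its least node runs through the three layers in order, and its weight is
the sum of three buckets minus `δ`. -/
theorem bucketGraph_triangle_iff {u v x : Fin (4 * S)} {a : ℤ} (huv : u < v) (hux : u < x) :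
    (bucketGraph S T r o δ s).Triangle u v x a ↔ ((u : ℕ) < S ∧ (S ≤ (v : ℕ) ∧ (v : ℕ) < 2 * S) ∧
      2 * S ≤ (x : ℕ)) ∧ ((u : ℕ) ∈ s ∧ (v : ℕ) ∈ s ∧ (x : ℕ) ∈ s) ∧
      ∃ k₁ k₀ k₂ z₁ z₀ z₂, edgeKey S r o u v = some k₁ ∧ edgeKey S r o v x = some k₀ ∧
        edgeKey S r o x u = some k₂ ∧ T k₁ = some z₁ ∧ T k₀ = some z₀ ∧ T k₂ = some z₂ ∧
        a + δ = z₁ + z₀ + z₂ := by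
  rw [Fin.lt_def] at huv hux
  constructor
  · rintro ⟨p, q, t, hp, hq, ht, rfl⟩
    obtain ⟨⟨hu, hv⟩, k₁, z₁, e₁, b₁, rfl⟩ := bucketGraph_w_eq_some.1 hp
    obtain ⟨⟨-, hx⟩, k₀, z₀, e₀, b₀, rfl⟩ := bucketGraph_w_eq_some.1 hq
    obtain ⟨-, k₂, z₂, e₂, b₂, rfl⟩ := bucketGraph_w_eq_some.1 ht
    have l₁ := edgeKey_layers e₁
    have l₀ := edgeKey_layers e₀
    have l₂ := edgeKey_layers e₂
    have hl : (u : ℕ) < S ∧ (S ≤ (v : ℕ) ∧ (v : ℕ) < 2 * S) ∧ 2 * S ≤ (x : ℕ) := by omega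
    refine ⟨hl, ⟨hu, hv, hx⟩, k₁, k₀, k₂, z₁, z₀, z₂, e₁, e₀, e₂, b₁, b₀, b₂, ?_⟩
    rw [if_pos hl.1, if_neg (by omega), if_neg (by omega)]
    ring
  · rintro ⟨hl, ⟨hu, hv, hx⟩, k₁, k₀, k₂, z₁, z₀, z₂, e₁, e₀, e₂, b₁, b₀, b₂, ha⟩
    refine ⟨z₁ - δ, z₀, z₂, bucketGraph_w_eq_some.2 ⟨⟨hu, hv⟩, k₁, z₁, e₁, b₁, ?_⟩,
      bucketGraph_w_eq_some.2 ⟨⟨hv, hx⟩, k₀, z₀, e₀, b₀, ?_⟩,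
      bucketGraph_w_eq_some.2 ⟨⟨hx, hu⟩, k₂, z₂, e₂, b₂, ?_⟩, by linarith⟩
    · rw [if_pos hl.1]
    · rw [if_neg (by omega)]; ring
    · rw [if_neg (by omega)]; ring

end

open Classical in
/-- The triangles of weight zero when no node is removed, as sets of nodes. -/
noncomputable def zeroFamily (S : ℕ) (T : ℕ → Option ℤ) (r o : ℕ) : Finset (Finset ℕ) :=
  {t : Fin (4 * S) × Fin (4 * S) × Fin (4 * S) | t.1 < t.2.1 ∧ t.1 < t.2.2 ∧
    (bucketGraph S T r o 0 (range (4 * S))).Triangle t.1 t.2.1 t.2.2 0}.toFinset.image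
    fun t => {(t.1 : ℕ), (t.2.1 : ℕ), (t.2.2 : ℕ)}

theorem zeroFamily_subset {S : ℕ} {T : ℕ → Option ℤ} {r o : ℕ} {F : Finset ℕ}
    (hF : F ∈ zeroFamily S T r o) : F ⊆ range (4 * S) ∧ #F ≤ 3 := by
  obtain ⟨t, -, rfl⟩ := mem_image.1 hF
  refine ⟨fun y hy => ?_, card_le_three⟩
  simp only [mem_insert, mem_singleton] at hy
  rw [mem_range]
  omega

/-- Decreasing the weights by one makes exactly the triangles of weight zero become negative. -/
theorem numNegTriangles_shift (S : ℕ) (T : ℕ → Option ℤ) (r o : ℕ) (s : Finset ℕ) :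
    (bucketGraph S T r o 1 s).numNegTriangles =
      (bucketGraph S T r o 0 s).numNegTriangles + #{F ∈ zeroFamily S T r o | F ⊆ s} := by
  classical
  set Z : Set (Fin (4 * S) × Fin (4 * S) × Fin (4 * S)) := {t | t.1 < t.2.1 ∧ t.1 < t.2.2 ∧
    (bucketGraph S T r o 0 s).Triangle t.1 t.2.1 t.2.2 0} with hZ
  set A : Set (Fin (4 * S) × Fin (4 * S) × Fin (4 * S)) := {t | t.1 < t.2.1 ∧ t.1 < t.2.2 ∧
    ∃ a < 0, (bucketGraph S T r o 0 s).Triangle t.1 t.2.1 t.2.2 a} with hA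
  have h1 : (bucketGraph S T r o 1 s).numNegTriangles = (A ∪ Z).ncard := by
    unfold WGraph.numNegTriangles
    congr 1
    ext ⟨u, v, x⟩
    change (u < v ∧ u < x ∧ ∃ a < 0, (bucketGraph S T r o 1 s).Triangle u v x a) ↔
      (u < v ∧ u < x ∧ ∃ a < 0, (bucketGraph S T r o 0 s).Triangle u v x a) ∨
      (u < v ∧ u < x ∧ (bucketGraph S T r o 0 s).Triangle u v x 0)
    rw [← and_or_left, ← and_or_left]
    refine and_congr_right fun huv => and_congr_right fun hux => ?_
    constructor
    · rintro ⟨a, ha, h⟩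
      obtain ⟨hl, hs, k₁, k₀, k₂, z₁, z₀, z₂, e₁, e₀, e₂, b₁, b₀, b₂, hz⟩ :=
        (bucketGraph_triangle_iff huv hux).1 h
      have h' : (bucketGraph S T r o 0 s).Triangle u v x (a + 1) :=
        (bucketGraph_triangle_iff huv hux).2
          ⟨hl, hs, k₁, k₀, k₂, z₁, z₀, z₂, e₁, e₀, e₂, b₁, b₀, b₂, by rw [add_zero, hz]⟩
      rcases lt_or_eq_of_le (show a + 1 ≤ 0 by omega) with h0 | h0
      · exact Or.inl ⟨a + 1, h0, h'⟩
      · exact Or.inr (h0 ▸ h')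
    · intro h
      obtain ⟨a, ha, h⟩ : ∃ a ≤ 0, (bucketGraph S T r o 0 s).Triangle u v x a := by
        rcases h with ⟨a, ha, h⟩ | h
        · exact ⟨a, ha.le, h⟩
        · exact ⟨0, le_rfl, h⟩
      obtain ⟨hl, hs, k₁, k₀, k₂, z₁, z₀, z₂, e₁, e₀, e₂, b₁, b₀, b₂, hz⟩ :=
        (bucketGraph_triangle_iff huv hux).1 h
      exact ⟨a - 1, by omega, (bucketGraph_triangle_iff huv hux).2
        ⟨hl, hs, k₁, k₀, k₂, z₁, z₀, z₂, e₁, e₀, e₂, b₁, b₀, b₂, by rw [← hz]; ring⟩⟩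
  have h2 : Disjoint A Z := by
    rw [Set.disjoint_left]
    rintro ⟨u, v, x⟩ ⟨-, -, a, ha, p, q, t, h1, h2, h3, h4⟩ ⟨-, -, p', q', t', h1', h2', h3', h4'⟩
    obtain rfl : p = p' := Option.some.inj (h1.symm.trans h1')
    obtain rfl : q = q' := Option.some.inj (h2.symm.trans h2')
    obtain rfl : t = t' := Option.some.inj (h3.symm.trans h3')
    omega
  have h3 : (bucketGraph S T r o 0 s).numNegTriangles = A.ncard := rfl
  rw [h1, Set.ncard_union_eq h2, h3]
  congr 1
  rw [zeroFamily, filter_image, card_image_of_injOn, Set.ncard_eq_toFinset_card']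
  · congr 1
    ext ⟨u, v, x⟩
    simp only [hZ, Set.mem_toFinset, Set.mem_ofPred_eq, mem_filter, and_assoc]
    refine and_congr_right fun huv => and_congr_right fun hux => ?_
    rw [bucketGraph_triangle_iff huv hux, bucketGraph_triangle_iff huv hux]
    simp only [mem_range, Fin.is_lt, true_and, and_self, insert_subset_iff, singleton_subset_iff]
    tauto
  -- The nodes of a triangle lie in different layers, so that their set determines the triangle.
  · rintro ⟨u, v, x⟩ h ⟨u', v', x'⟩ h' heq
    simp only [coe_filter, Set.mem_toFinset, Set.mem_ofPred_eq] at h h'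
    obtain ⟨⟨a1, a2, a3⟩, -⟩ := h
    obtain ⟨⟨b1, b2, b3⟩, -⟩ := h'
    have a4 := ((bucketGraph_triangle_iff a1 a2).1 a3).1
    have b4 := ((bucketGraph_triangle_iff b1 b2).1 b3).1
    have hm : ∀ y : ℕ, y ∈ ({(u : ℕ), (v : ℕ), (x : ℕ)} : Finset ℕ) →
        y ∈ ({(u' : ℕ), (v' : ℕ), (x' : ℕ)} : Finset ℕ) := fun y hy => by
      have := Finset.ext_iff.1 heq y
      exact this.1 hy
    have m1 := hm u (by simp)
    have m2 := hm v (by simp)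
    have m3 := hm x (by simp)
    simp only [mem_insert, mem_singleton] at m1 m2 m3
    simp only [Prod.mk.injEq, Fin.ext_iff]
    omega

theorem bucketGraph_within {S : ℕ} {T : ℕ → Option ℤ} {r o : ℕ} {δ : ℤ} {s : Finset ℕ} {M : ℕ}
    (hT : ∀ k z, T k = some z → |z| ≤ M) (hδ : δ = 0 ∨ δ = 1) :
    (bucketGraph S T r o δ s).Within (M + 1) := by
  intro u v a h
  obtain ⟨-, k, z, -, hk, rfl⟩ := bucketGraph_w_eq_some.1 h
  have := hT k z hk
  rw [abs_le] at this ⊢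
  push_cast
  split_ifs <;> omega

/-! ### Zero triangles and zero sums -/

/-- For some block and some carry the number of surviving triangles of weight zero is odd. -/
def Succeeds (S : ℕ) (T : ℕ → Option ℤ) (s : Finset ℕ) : Prop :=
  ∃ q < 3 * S, Odd #{F ∈ zeroFamily S T (q % S) (q / S) | F ⊆ s}

/-- The bucket of the element `i`, which depends on its colour and its hash value. -/
def elementKey (P Q : ℕ) (x : ℕ → ℤ) (a : ℕ) (C : Finset ℕ) (i : ℕ) : ℕ :=
  colour C i * Q + (hash P Q a (x i)).toNat

theorem elementKey_div {P Q : ℕ} (h : 0 < P * Q) (x : ℕ → ℤ) (a : ℕ) (C : Finset ℕ) (i : ℕ) :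
    elementKey P Q x a C i / Q = colour C i := by
  have hQ : 0 < Q := Nat.pos_of_mul_pos_left h
  have := hash_lt P Q a (x i) h
  unfold elementKey
  rw [mul_comm, Nat.mul_add_div hQ, Nat.div_eq_of_lt (by omega), add_zero]

/-- Success is always due to a zero sum: a triangle of weight zero consists of elements of different
colours, which are at different positions. -/
theorem exists_sum_of_succeeds {P S n a : ℕ} (hP : 0 < P) (hS : 0 < S) {x : ℕ → ℤ}
    {C s : Finset ℕ} (h : Succeeds S (bucket (elementKey P (S * S) x a C) x n) s) :
    ∃ i < n, ∃ j < n, ∃ k < n, i ≠ j ∧ i ≠ k ∧ j ≠ k ∧ x i + x j + x k = 0 := by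
  obtain ⟨q, hq, ho⟩ := h
  obtain ⟨F, hF⟩ := card_pos.1 ho.pos
  obtain ⟨t, ht, -⟩ := mem_image.1 (mem_filter.1 hF).1
  simp only [Set.mem_toFinset, Set.mem_ofPred_eq] at ht
  obtain ⟨hl, -, k₁, k₀, k₂, z₁, z₀, z₂, e₁, e₀, e₂, b₁, b₀, b₂, hz⟩ :=
    (bucketGraph_triangle_iff ht.1 ht.2.1).1 ht.2.2
  have hPQ : 0 < P * (S * S) := by positivity
  have hSS : 0 < S * S := by positivity
  obtain ⟨i₁, hi₁, hk₁, rfl⟩ := exists_of_bucket b₁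
  obtain ⟨i₀, hi₀, hk₀, rfl⟩ := exists_of_bucket b₀
  obtain ⟨i₂, hi₂, hk₂, rfl⟩ := exists_of_bucket b₂
  have hq' : q % S < S := Nat.mod_lt _ hS
  have hmul : ∀ u v : ℕ, u < S → v < S → u * S + v < S * S := fun u v hu hv => by
    have : (u + 1) * S ≤ S * S := Nat.mul_le_mul_right _ hu
    linarith
  have c₁ : colour C i₁ = 1 := by
    rw [← elementKey_div hPQ x a C i₁, hk₁]
    unfold edgeKey at e₁
    rw [if_pos (by omega), Option.some.injEq] at e₁
    rw [← e₁, Nat.add_div_left _ hSS, Nat.div_eq_of_lt (hmul _ _ hl.1 (by omega))]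
  have c₀ : colour C i₀ = 0 := by
    rw [← elementKey_div hPQ x a C i₀, hk₀]
    unfold edgeKey at e₀
    split_ifs at e₀ <;> first | omega | skip
    rw [Option.some.injEq] at e₀
    rw [← e₀, Nat.div_eq_of_lt (hmul _ _ hq' (by omega))]
  have c₂ : colour C i₂ = 2 := by
    rw [← elementKey_div hPQ x a C i₂, hk₂]
    unfold edgeKey at e₂
    rw [if_neg (by omega), if_neg (by omega), if_pos (by omega), Option.some.injEq] at e₂
    rw [← e₂, mul_comm 2, Nat.mul_add_div hSS, Nat.div_eq_of_lt]
    have := Int.emod_lt_of_pos (-((q / S : ℕ) : ℤ) - ((q % S : ℕ) : ℤ) * S - (t.1 : ℕ) * S -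
      ((t.2.2 : ℕ) - 2 * S)) (b := ((S * S : ℕ) : ℤ)) (by exact_mod_cast hSS)
    omega
  refine ⟨i₁, hi₁, i₀, hi₀, i₂, hi₂, ?_, ?_, ?_, by linarith⟩
  · rintro rfl; omega
  · rintro rfl; omega
  · rintro rfl; omega

/-- If three elements of the colours `0`, `1`, `2` sum to zero and their buckets hold no other
values, then some graph has a triangle of weight zero. -/
theorem exists_zeroFamily_nonempty {P S n a : ℕ} (hP : 0 < P) (hS : 0 < S) {x : ℕ → ℤ}
    {C : Finset ℕ} {i j k : ℕ} (hi : i < n) (hj : j < n) (hk : k < n)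
    (hsum : x i + x j + x k = 0) (hC : colour C i = 0 ∧ colour C j = 1 ∧ colour C k = 2)
    (hgood : ∀ e ∈ ({i, j, k} : Finset ℕ), ∀ m < n,
      hash P (S * S) a (x m) = hash P (S * S) a (x e) → x m = x e) :
    ∃ q < 3 * S,
      (zeroFamily S (bucket (elementKey P (S * S) x a C) x n) (q % S) (q / S)).Nonempty := by
  have hPQ : 0 < P * (S * S) := by positivity
  set Q := S * S with hQ
  have hQ0 : 0 < Q := by positivity
  have h0 := fun y => hash_nonneg P Q a y hPQ
  have h1 := fun y => hash_lt P Q a y hPQ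
  have hb : ∀ e ∈ ({i, j, k} : Finset ℕ), e < n → bucket (elementKey P Q x a C) x n
      (elementKey P Q x a C e) = some (x e) := by
    intro e he hen
    refine bucket_eq hen fun m hm hkey => hgood e he m hm ?_
    have hc := congrArg (· / Q) hkey
    simp only [elementKey_div hPQ] at hc
    unfold elementKey at hkey
    rw [hc] at hkey
    have := h0 (x m)
    have := h0 (x e)
    omega
  obtain ⟨o, ho, m, hm⟩ := exists_carry (a := a) hPQ hsum
  obtain ⟨a₀, ha₀⟩ := Int.eq_ofNat_of_zero_le (h0 (x i))
  obtain ⟨a₁, ha₁⟩ := Int.eq_ofNat_of_zero_le (h0 (x j))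
  obtain ⟨a₂, ha₂⟩ := Int.eq_ofNat_of_zero_le (h0 (x k))
  have l₀ : a₀ < S * S := by have := h1 (x i); omega
  have l₁ : a₁ < S * S := by have := h1 (x j); omega
  have l₂ : a₂ < S * S := by have := h1 (x k); omega
  have b₀ := hb i (by simp) hi
  have b₁ := hb j (by simp) hj
  have b₂ := hb k (by simp) hk
  unfold elementKey at b₀ b₁ b₂
  rw [hC.1, ha₀] at b₀
  rw [hC.2.1, ha₁] at b₁
  rw [hC.2.2, ha₂] at b₂
  rw [ha₀, ha₁, ha₂] at hm
  set r := a₀ / S with hr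
  have hrS : r < S := Nat.div_lt_of_lt_mul l₀
  have hq : o * S + r < 3 * S := by
    have : (o + 1) * S ≤ 3 * S := Nat.mul_le_mul_right _ ho
    linarith
  refine ⟨o * S + r, hq, ?_⟩
  have hqd : (o * S + r) / S = o := by
    rw [mul_comm, Nat.mul_add_div hS, Nat.div_eq_of_lt hrS, add_zero]
  have hqm : (o * S + r) % S = r := by
    rw [mul_comm, Nat.mul_add_mod, Nat.mod_eq_of_lt hrS]
  rw [hqd, hqm]
  have hu : a₁ / S < S := Nat.div_lt_of_lt_mul l₁
  have hv : a₁ % S < S := Nat.mod_lt _ hS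
  have hw : a₀ % S < S := Nat.mod_lt _ hS
  have d₀ : r * S + a₀ % S = a₀ := by rw [hr, mul_comm]; exact Nat.div_add_mod _ _
  have d₁ : a₁ / S * S + a₁ % S = a₁ := by rw [mul_comm]; exact Nat.div_add_mod _ _
  -- For the hash values `a₀`, `a₁`, `a₂` of the colours `0`, `1`, `2`, the first edge encodes `a₁`,
  -- the second one the offset of `a₀` in its block `r = a₀ / S`, and the third one receives `a₂`.
  set u : Fin (4 * S) := ⟨a₁ / S, by omega⟩ with hu'
  set v : Fin (4 * S) := ⟨S + a₁ % S, by omega⟩ with hv'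
  set w : Fin (4 * S) := ⟨2 * S + a₁ % S + a₀ % S, by omega⟩ with hw'
  have huv : u < v := by rw [Fin.lt_def]; simp only [hu', hv']; omega
  have huw : u < w := by rw [Fin.lt_def]; simp only [hu', hw']; omega
  refine ⟨_, mem_image_of_mem _ (show (u, v, w) ∈ _ from ?_)⟩
  simp only [Set.mem_toFinset, Set.mem_ofPred_eq]
  refine ⟨huv, huw, (bucketGraph_triangle_iff huv huw).2 ⟨?_, by simp, 1 * Q + a₁, 0 * Q + a₀,
    2 * Q + a₂, x j, x i, x k, ?_, ?_, ?_, b₁, b₀, b₂, by linarith⟩⟩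
  · simp only [hu', hv', hw']; omega
  · unfold edgeKey
    rw [if_pos (by simp only [hu', hv']; omega)]
    simp only [hu', hv']
    rw [Option.some.injEq, Nat.add_sub_cancel_left, d₁, hQ, one_mul]
  · unfold edgeKey
    rw [if_neg (by simp only [hv', hw']; omega), if_pos (by simp only [hv', hw']; omega)]
    simp only [hv', hw']
    rw [Option.some.injEq, zero_mul, zero_add]
    omega
  · unfold edgeKey
    rw [if_neg (by simp only [hu', hw']; omega), if_neg (by simp only [hu', hw']; omega),
      if_pos (by simp only [hu', hw']; omega)]
    simp only [hu', hw']
    rw [Option.some.injEq]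
    have e : (-(o : ℤ) - (r : ℕ) * S - ((a₁ / S : ℕ) : ℤ) * S -
        (((2 * S + a₁ % S + a₀ % S : ℕ) : ℤ) - 2 * S)) = a₂ + ((Q : ℕ) : ℤ) * (-m) := by
      have e0 : ((r : ℕ) : ℤ) * S + (a₀ % S : ℕ) = a₀ := by exact_mod_cast d₀
      have e1 : ((a₁ / S : ℕ) : ℤ) * S + (a₁ % S : ℕ) = a₁ := by exact_mod_cast d₁
      push_cast at e0 e1 hm ⊢
      linear_combination -e0 - e1 - hm
    rw [e, ← hQ, Int.add_mul_emod_self_left, Int.emod_eq_of_lt (by omega) (by omega)]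
    simp

open Classical in
/-- If three of the numbers sum to zero, a trial fails with probability at most `1023 / 1024`. -/
theorem avg_trial_le {n k l : ℕ} {x : ℕ → ℤ} (hk : ∀ i < n, ∀ j < n, |x i - x j| < 2 ^ k)
    (hl : 12 * n ≤ 2 ^ l * 2 ^ l) {i j m : ℕ} (hi : i < n) (hj : j < n) (hm : m < n) (hij : i ≠ j)
    (him : i ≠ m) (hjm : j ≠ m) (hsum : x i + x j + x m = 0) (y : ℝ≥0∞) :
    avg (k + 2 * l) (fun A => avg (2 * n) fun C => avg (4 * 2 ^ l) fun s =>
      if Succeeds (2 ^ l) (bucket (elementKey (2 ^ k) (2 ^ l * 2 ^ l) x (number A) C) x n) s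
      then 0 else y) ≤ ENNReal.ofReal (1023 / 1024) * y := by
  have hQ : 2 ^ l * 2 ^ l = 2 ^ (2 * l) := by rw [← pow_add, two_mul]
  have htriv : ∀ A C, avg (4 * 2 ^ l) (fun s => if Succeeds (2 ^ l)
      (bucket (elementKey (2 ^ k) (2 ^ l * 2 ^ l) x (number A) C) x n) s then 0 else y) ≤ y := by
    intro A C
    refine (avg_mono fun s _ => ?_).trans (avg_const _ y).le
    split_ifs <;> simp
  have hA := card_good (x := x) hk (by rwa [hQ] at hl) (t := {i, j, m})
    (by intro e he; simp at he; rw [mem_range]; omega) card_le_three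
  have hC := card_colour hi hj hm hij him hjm
  -- The hash function is good with probability `1 / 2`, the colours with probability `1 / 64`, and
  -- the parity is odd with probability `1 / 8`.
  refine (avg_le (x := y) (K := 2) (a := 511 / 512) (by norm_num) hA (by norm_num) (by norm_num) ?_ ?_).trans
    (by norm_num)
  · intro A _ hgood
    refine (avg_le (x := y) (K := 64) (a := 7 / 8) (by norm_num) hC (by norm_num) (by norm_num) ?_ ?_).trans
      (by norm_num)
    · intro C _ hcol
      rw [← hQ] at hgood
      obtain ⟨q, hq, hne⟩ := exists_zeroFamily_nonempty (by positivity) (by positivity) hi hj hm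
        hsum hcol hgood
      refine (avg_le (x := y) (K := 8) (a := 0) (by norm_num) (two_pow_le_card_odd (4 * 2 ^ l) 3 _ hne
        fun F hF => zeroFamily_subset hF) (by norm_num) (by norm_num) ?_ ?_).trans (by norm_num)
      · intro s _ hs
        rw [if_pos ⟨q, hq, hs⟩]
        simp
      · intro s _
        split_ifs <;> simp
    · intro C _
      exact htriv A C
  · intro A _
    refine (avg_mono fun C _ => htriv A C).trans (avg_const _ y).le

end FineGrained

namespace FineGrained
open scoped ENNReal
open Finset
open FineGrained.Expr

variable {d : ℕ} {f : ℕ → ℕ}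

/-! ### Counting loops and random bits -/

theorem WP.add_const {p : Cmd} {σ : Mem} {k : ℕ} {φ : Mem → ℝ≥0∞} {v : ℝ≥0∞}
    (h : WP d f p σ k φ v) (c : ℝ≥0∞) : WP d f p σ k (fun τ => φ τ + c) (v + c) := by
  intro s hs
  obtain ⟨μ, h1, h2, h3⟩ := h s hs
  refine ⟨μ, h1, h2, ?_⟩
  rw [expect_add, expect_const]
  gcongr

/-- If `p` surely ends where the potential is at most `v`, then `v` bounds its expectation. -/
theorem WP.of_sure {p : Cmd} {σ : Mem} {k : ℕ} {φ : Mem → ℝ≥0∞} {v : ℝ≥0∞}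
    {Q : Mem → Prop} (hp : Sure d f p σ k Q) (h : ∀ τ, Q τ → φ τ ≤ v) : WP d f p σ k φ v := by
  intro s hs
  obtain ⟨μ, h1, h2, h3⟩ := hp s hs
  refine ⟨μ, h1, h2, ?_⟩
  refine (expect_mono fun t ht => h t.mem (ind_ne_top
    (ne_top_of_expect (ne_top_of_le_ne_top ENNReal.zero_ne_top h3) ht))).trans ?_
  rw [expect_const]

/-- If both outcomes of the coin flip are continued with the values `v` and `w`, the whole has their mean. -/
theorem WP.flip_cons {x k : ℕ} {σ : Mem} {l : List Cmd} {φ : Mem → ℝ≥0∞} {v w : ℝ≥0∞}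
    (hv : v ≠ ⊤) (hw : w ≠ ⊤) (h0 : WP d f (Cmd.block l) (σ.set x 0) k φ v)
    (h1 : WP d f (Cmd.block l) (σ.set x 1) k φ w) :
    WP d f (Cmd.block (.flip x :: l)) σ (1 + k) φ ((v + w) / 2) := by
  classical
  have hne : σ.set x 1 ≠ σ.set x 0 := fun h => by
    have := congrArg (fun τ : Mem => τ.var x) h
    simp at this
  have hflip := WP.flip (d := d) (f := f) (x := x) (σ := σ) (k := 1)
    (φ := fun τ => if τ = σ.set x 0 then v else if τ = σ.set x 1 then w else ⊤) le_rfl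
  rw [if_pos rfl, if_neg hne, if_pos rfl] at hflip
  refine WP.seq (by finiteness) hflip fun τ hτ => ?_
  by_cases e0 : τ = σ.set x 0
  · rw [if_pos e0, e0]; exact h0
  · rw [if_neg e0] at hτ ⊢
    by_cases e1 : τ = σ.set x 1
    · rw [if_pos e1, e1]; exact h1
    · rw [if_neg e1] at hτ; exact absurd rfl hτ

/-- Runs `p` with the values `0, 1, …, e - 1` of register `x`. -/
def Cmd.count (x : ℕ) (e : Expr) (p : Cmd) : Cmd := .seq (.assign x 0)
  (.loop (.op .lt (var x) e) (.block [p, .assign x (var x + 1)]))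

/-- Counting loops with a potential `φ i` when the counter is `i`. The bound `190` for `e` leaves room
for the comparison with the counter. -/
theorem WP.count {N b m κ x : ℕ} {e : Expr} {p : Cmd} {σ : Mem} (φ : ℕ → Mem → ℝ≥0∞)
    (hx : N + 10 ≤ x) (he : e.Own N) (hsz : e.sz ≤ 190) (hm : m ≤ b)
    (hI : ∀ i ≤ m, ∀ τ, φ i τ ≠ ⊤ → Bd N b τ ∧ τ.var x = i ∧ e.ev τ = m)
    (hp : ∀ i < m, ∀ τ, φ i τ ≠ ⊤ → WP d f p τ κ (fun ρ => φ (i + 1) (ρ.set x (i + 1 : ℕ)) +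
      ind (fun ρ => Bd N b ρ ∧ ρ.var x = i) ρ) (φ i τ))
    (h0 : φ 0 (σ.set x 0) ≠ ⊤) :
    WP d f (.count x e p) σ ((m + 1) * (κ + 3 * unit b)) (φ m) (φ 0 (σ.set x 0)) := by
  refine WP.cost (k := unit b + (m * (unit b + (κ + (unit b + 1 * unit b))) + unit b)) ?_
    (by have := one_le_unit b; nlinarith)
  refine Sure.seq (Q := fun τ => τ = σ.set x 0) (Sure.assign ?_ rfl) ?_
  · have : Expr.Ok b σ 0 := trivial
    have := this.co_le_unit (Nat.le_of_ble_eq_true rfl)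
    omega
  rintro _ rfl
  refine WP.loop_const m φ _ (unit b) (fun i hi τ hτ => ?_) (fun i hi τ hτ => ?_) h0
  · obtain ⟨h1, h2, h3⟩ := hI i hi τ hτ
    refine ⟨h1.guard (by simp only [Expr.sz]; omega) ⟨hx, he⟩, ?_⟩
    simp [h2, h3]
  · refine WP.seq hτ (hp i hi τ hτ) fun ρ hρ => ?_
    obtain ⟨h1, h2⟩ := ind_ne_top (ne_top_of_le_ne_top hρ le_add_self)
    refine WP.assign_bd h1 (i + 1 : ℕ) (Nat.le_of_ble_eq_true rfl) (by simpa using hx) (by simp [h2])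
      (by simp only [Nat.abs_cast, Nat.cast_le]; omega) fun _ => ?_
    exact WP.nil_unit (n := 0) le_self_add

theorem Sure.count {N b m κ x : ℕ} {e : Expr} {p : Cmd} {σ : Mem} (I : ℕ → Mem → Prop)
    (hx : N + 10 ≤ x) (he : e.Own N) (hsz : e.sz ≤ 190) (hm : m ≤ b)
    (hI : ∀ i ≤ m, ∀ τ, I i τ → Bd N b τ ∧ τ.var x = i ∧ e.ev τ = m)
    (hp : ∀ i < m, ∀ τ, I i τ → Sure d f p τ κ fun ρ => Bd N b ρ ∧ ρ.var x = i ∧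
      I (i + 1) (ρ.set x (i + 1 : ℕ)))
    (h0 : I 0 (σ.set x 0)) :
    Sure d f (.count x e p) σ ((m + 1) * (κ + 3 * unit b)) (I m) := by
  have := WP.count (d := d) (f := f) (p := p) (κ := κ) (fun i => ind (I i)) hx he hsz hm
    (fun i hi τ hτ => hI i hi τ (ind_ne_top hτ)) (fun i hi τ hτ => ?_)
    (by rw [ind_of h0]; exact ENNReal.zero_ne_top)
  · rwa [ind_of h0] at this
  · rw [ind_of (ind_ne_top hτ)]
    refine WP.of_sure (hp i hi τ (ind_ne_top hτ)) fun ρ hρ => ?_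
    rw [ind_of hρ.2.2, ind_of (Q := fun ρ => Bd N b ρ ∧ ρ.var x = i) ⟨hρ.1, hρ.2.1⟩, add_zero]

/-- Fills the cells `0, 1, …, e - 1` of array `a` with random bits, using the registers `x` and
`x + 1`. -/
def randomBits (x a : ℕ) (e : Expr) : Cmd :=
  .count x e (.block [.flip (x + 1), .store a (e - var x - 1) (var (x + 1))])

/-- The set of positions below `m` at which there is a `1`. -/
def ones (m : ℕ) (A : ℤ → ℤ) : Finset ℕ := {i ∈ range m | A (i : ℕ) = 1}

theorem avg_ne_top {m : ℕ} {F : Finset ℕ → ℝ≥0∞} (h : ∀ s, F s ≠ ⊤) : avg m F ≠ ⊤ := by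
  unfold avg
  refine ENNReal.div_ne_top (ENNReal.sum_ne_top.2 fun s _ => h s) (by simp)

theorem avg_half (m : ℕ) (F G : Finset ℕ → ℝ≥0∞) :
    avg m (fun s => (F s + G s) / 2) = (avg m F + avg m G) / 2 := by
  unfold avg
  simp only [div_eq_mul_inv, ← sum_mul, sum_add_distrib]
  ring

/-- Random bits: the final potential `F` of the set of ones is on average `avg m F`. -/
theorem wp_randomBits {N b m x a : ℕ} {e : Expr} {σ : Mem} (hx : N + 10 ≤ x) (he : e.Own N)
    (hsz : e.sz ≤ 190) (hm : m ≤ b) (hb1 : 1 ≤ b) (hb : Bd N b σ)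
    (hev : ∀ τ : Mem, (∀ y, y ≠ x → y ≠ x + 1 → τ.var y = σ.var y) →
      (∀ c, c ≠ a → τ.arr c = σ.arr c) → e.ev τ = m)
    (F : Finset ℕ → ℝ≥0∞) (hF : ∀ s, F s ≠ ⊤) :
    WP d f (randomBits x a e) σ ((m + 1) * (6 * unit b)) (fun τ => ind (fun τ => Bd N b τ ∧
      (∀ y, y ≠ x → y ≠ x + 1 → τ.var y = σ.var y) ∧ (∀ c, c ≠ a → τ.arr c = σ.arr c) ∧
      ∀ i < m, τ.arr a (i : ℕ) = if i ∈ ones m (τ.arr a) then 1 else 0) τ +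
      F (ones m (τ.arr a))) (avg m F) := by
  set I : ℕ → Mem → Prop := fun i τ => Bd N b τ ∧
      (∀ y, y ≠ x → y ≠ x + 1 → τ.var y = σ.var y) ∧ (∀ c, c ≠ a → τ.arr c = σ.arr c) ∧
      τ.var x = i ∧ ∀ j, m - i ≤ j → j < m → τ.arr a (j : ℕ) = 0 ∨ τ.arr a (j : ℕ) = 1 with hI
  -- The cells are filled from the top, since `avg_succ` splits off the largest index; the potential
  -- is the average over the cells that are not yet filled.
  set φ : ℕ → Mem → ℝ≥0∞ := fun i τ => ind (I i) τ +
    avg (m - i) (fun t => F (t ∪ {j ∈ Ico (m - i) m | τ.arr a (j : ℕ) = 1})) with hφ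
  have hφtop : ∀ i τ, φ i τ ≠ ⊤ → I i τ := fun i τ h =>
    ind_ne_top (ne_top_of_le_ne_top h le_self_add)
  have h0 : I 0 (σ.set x 0) := by
    refine ⟨hb.set (by simp), fun y hy _ => by simp [hy], fun _ _ => rfl, by simp, fun j h1 h2 => ?_⟩
    omega
  have hφ0 : φ 0 (σ.set x 0) = avg m F := by
    simp only [hφ]
    rw [ind_of h0, zero_add]
    simp
  rw [← hφ0]
  refine (WP.count (κ := 1 + (unit b + 1 * unit b)) φ hx he hsz hm (fun i hi τ hτ => ?_)
    (fun i hi τ hτ => ?_) ?_).mono ?_ (fun τ => ?_) le_rfl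
  · obtain ⟨h1, h2, h3, h4, -⟩ := hφtop i τ hτ
    exact ⟨h1, h4, hev τ h2 h3⟩
  · have hτI := hφtop i τ hτ
    have e1 : φ i τ = avg (m - i) (fun t => F (t ∪ {j ∈ Ico (m - i) m | τ.arr a (j : ℕ) = 1})) := by
      simp only [hφ]
      rw [ind_of hτI, zero_add]
    obtain ⟨h1, h2, h3, h4, h5⟩ := hτI
    have hr : m - i = (m - (i + 1)) + 1 := by omega
    rw [e1, hr, avg_succ, avg_half, ← hr]
    set r := m - (i + 1) with hr'
    have key : ∀ z : ℤ, z = 0 ∨ z = 1 → ∀ G : Finset ℕ → ℝ≥0∞,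
        (∀ t ⊆ range r, F (t ∪ {j ∈ Ico r m | (if j = r then z else τ.arr a (j : ℕ)) = 1}) = G t) →
        WP d f (.block [.store a (e - var x - 1) (var (x + 1))]) (τ.set (x + 1) z)
          (unit b + 1 * unit b) (fun ρ => φ (i + 1) (ρ.set x (i + 1 : ℕ)) +
          ind (fun ρ => Bd N b ρ ∧ ρ.var x = i) ρ) (avg r G) := by
      intro z hz G hG
      have hzb : |z| ≤ b := by rcases hz with h | h <;> simp [h]; omega
      have hev' : e.ev (τ.set (x + 1) z) = m := hev _ (fun y hy hy' => by
        rw [Mem.set_var, if_neg hy', h2 y hy hy']) h3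
      refine WP.store_bd (h1.set hzb) r z (show e.sz + 1 + 1 + (1 + 1) + 1 ≤ 200 by omega)
        (Nat.le_of_ble_eq_true rfl) ?_ ?_ ?_ ?_ hzb fun hb' => ?_
      · simp; exact ⟨he, hx⟩
      · simp; omega
      · rw [ev_sub, ev_sub, hev']; simp [h4]; omega
      · simp
      refine WP.nil_unit (n := 0) ?_
      rw [ind_of (Q := fun ρ => Bd N b ρ ∧ ρ.var x = i) ⟨hb', by simp [h4]⟩, add_zero]
      simp only [hφ]
      rw [ind_of, zero_add]
      · refine avg_mono fun t ht => ?_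
        rw [← hG t ht]
        simp only [Mem.set_arr, Mem.put_arr, true_and, Nat.cast_inj]
        exact le_rfl
      · refine ⟨hb'.set (by simp only [Nat.abs_cast, Nat.cast_le]; omega), fun y hy hy' => ?_,
          fun c hc => ?_, by simp, fun j hj1 hj2 => ?_⟩
        · simp [hy, hy', h2]
        · rw [Mem.set_arr, Mem.put_arr_ne _ _ _ hc]; exact h3 c hc
        · simp only [Mem.set_arr, Mem.put_arr, true_and, Nat.cast_inj]
          split_ifs with hjr
          · exact hz
          · exact h5 j (by omega) hj2
    refine WP.flip_cons (avg_ne_top fun s => hF _) (avg_ne_top fun s => hF _)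
      (key 0 (Or.inl rfl) _ fun t ht => ?_) (key 1 (Or.inr rfl) _ fun t ht => ?_)
    · congr 2
      ext j
      simp only [mem_filter, mem_Ico]
      constructor
      · rintro ⟨g1, g2⟩
        split_ifs at g2 with g3
        · omega
        · exact ⟨by omega, g2⟩
      · rintro ⟨g1, g2⟩
        rw [if_neg (by omega)]
        exact ⟨by omega, g2⟩
    · congr 1
      rw [insert_union, ← union_insert]
      congr 1
      ext j
      simp only [mem_filter, mem_Ico, mem_insert]
      constructor
      · rintro ⟨g1, g2⟩
        split_ifs at g2 with g3
        · exact Or.inl g3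
        · exact Or.inr ⟨by omega, g2⟩
      · rintro (g1 | ⟨g1, g2⟩)
        · rw [if_pos g1]; omega
        · rw [if_neg (by omega)]
          exact ⟨by omega, g2⟩
  · rw [hφ0]; exact avg_ne_top hF
  · have := one_le_unit b
    exact Nat.mul_le_mul_left _ (by omega)
  · simp only [hφ, Nat.sub_self, avg_zero, empty_union]
    rw [← range_eq_Ico]
    refine add_le_add ?_ le_rfl
    by_cases h : I m τ
    · obtain ⟨h1, h2, h3, h4, h5⟩ := h
      rw [ind_of]
      · exact zero_le
      refine ⟨h1, h2, h3, fun i hi => ?_⟩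
      unfold ones
      have := h5 i (by omega) hi
      simp only [mem_filter, mem_range, hi, true_and]
      split_ifs <;> tauto
    · simp [ind, h]

end FineGrained

namespace FineGrained
open scoped ENNReal
open Finset
open FineGrained.Expr

variable {d : ℕ} {f : ℕ → ℕ}

/-! ### The data of a trial -/

/-- The registers and the array that are fixed during all trials: half the number of runs per oracle
call, `κ`, the number `n` of elements, the root `S` of the number of hash values, the parameters
`P` and `P * (S * S)` of the hash function, the bit length `L` of the multiplier, and the elements
`x`. -/
structure Env (N b n S P L κ : ℕ) (x : ℕ → ℤ) (σ : Mem) : Prop where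
  clean : Clean N σ
  bd : Bd N b σ
  runs : σ.var (N + 15) = κ
  size : σ.var (N + 16) = n
  root : σ.var (N + 17) = S
  range : σ.var (N + 18) = (S * S : ℕ)
  shift : σ.var (N + 19) = P
  modulus : σ.var (N + 20) = (P * (S * S) : ℕ)
  length : σ.var (N + 21) = L
  input : ∀ i < n, σ.arr (N + 8) (i : ℕ) = x i

/-- `τ` agrees with `σ` except for the scratch registers from `N + 27` on, register `k` and
array `a`. -/
structure Same (N k a : ℕ) (σ τ : Mem) : Prop where
  var : ∀ y < N + 27, y ≠ k → τ.var y = σ.var y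
  arr : ∀ c, c ≠ a → τ.arr c = σ.arr c

theorem Same.refl (N k a : ℕ) (σ : Mem) : Same N k a σ σ := ⟨fun _ _ _ => rfl, fun _ _ => rfl⟩

theorem Same.set {N k a y : ℕ} {σ τ : Mem} (h : Same N k a σ τ) {z : ℤ} (hy : N + 27 ≤ y ∨ y = k) :
    Same N k a σ (τ.set y z) := by
  refine ⟨fun w hw hk => ?_, h.arr⟩
  rw [Mem.set_var, if_neg (by omega), h.var w hw hk]

theorem Same.put {N k a : ℕ} {σ τ : Mem} (h : Same N k a σ τ) {i z : ℤ} :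
    Same N k a σ (τ.put a i z) := by
  refine ⟨h.var, fun c hc => ?_⟩
  rw [Mem.put_arr_ne _ _ _ hc, h.arr c hc]

section
variable {N b n S P L κ : ℕ} {x : ℕ → ℤ} {σ τ : Mem}

theorem Env.congr (h : Env N b n S P L κ x σ) (hc : Clean N τ) (hb : Bd N b τ)
    (hv : ∀ y, N + 15 ≤ y → y ≤ N + 21 → τ.var y = σ.var y)
    (ha : τ.arr (N + 8) = σ.arr (N + 8)) : Env N b n S P L κ x τ where
  clean := hc
  bd := hb
  runs := (hv _ (by omega) (by omega)).trans h.runs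
  size := (hv _ (by omega) (by omega)).trans h.size
  root := (hv _ (by omega) (by omega)).trans h.root
  range := (hv _ (by omega) (by omega)).trans h.range
  shift := (hv _ (by omega) (by omega)).trans h.shift
  modulus := (hv _ (by omega) (by omega)).trans h.modulus
  length := (hv _ (by omega) (by omega)).trans h.length
  input i hi := by rw [ha]; exact h.input i hi

theorem Same.clean {k a : ℕ} (h : Same N k a σ τ) (hσ : Clean N σ) (hk : N < k) (ha : N < a) :
    Clean N τ :=
  ⟨fun y hy => by rw [h.var y (by omega) (by omega), hσ.var y hy],
    fun c hc => by rw [h.arr c (by omega)]; exact hσ.arr c hc⟩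

theorem Env.same {k a : ℕ} (h : Env N b n S P L κ x σ) (hs : Same N k a σ τ) (hb : Bd N b τ)
    (hk : N + 22 ≤ k) (ha : N < a) (ha8 : a ≠ N + 8) : Env N b n S P L κ x τ :=
  h.congr (hs.clean h.clean (by omega) ha) hb (fun y h1 h2 => hs.var y (by omega) (by omega))
    (hs.arr _ (Ne.symm ha8))

end

/-! ### The multiplier -/

/-- Puts the number with the binary digits in array `N + 4` into register `N + 22`. -/
def multiplier (N : ℕ) : Cmd := .block [
  .assign (N + 22) 0,
  .assign (N + 28) 1,
  .count (N + 27) (var (N + 21)) (.block [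
    .assign (N + 22) (var (N + 22) + var (N + 28) * get (N + 4) (var (N + 27))),
    .assign (N + 28) (2 * var (N + 28))])]

theorem number_mono {A B : Finset ℕ} (h : A ⊆ B) : number A ≤ number B :=
  sum_le_sum_of_subset h

theorem sure_multiplier {N b n S P L κ : ℕ} {x : ℕ → ℤ} {σ : Mem} (h : Env N b n S P L κ x σ)
    {A : Finset ℕ} (hA : A ⊆ Finset.range L)
    (hbits : ∀ i < L, σ.arr (N + 4) (i : ℕ) = if i ∈ A then 1 else 0) (hL : 2 ^ L ≤ b)
    {a : ℕ} (ha : N + 9 ≤ a) :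
    Sure d f (multiplier N) σ ((L + 2) * (8 * unit b)) fun τ => Bd N b τ ∧
      Same N (N + 22) a σ τ ∧ τ.var (N + 22) = number A := by
  have hLb : L ≤ b := Nat.lt_two_pow_self.le.trans hL
  have hone : 1 ≤ b := Nat.one_le_two_pow.trans hL
  have hnum : ∀ i : ℕ, number {j ∈ A | j < i} ≤ b := fun i =>
    (number_mono (filter_subset _ _)).trans ((number_lt hA).le.trans hL)
  have hpow : ∀ i ≤ L, 2 ^ i ≤ b := fun i hi => (Nat.pow_le_pow_right (by norm_num) hi).trans hL
  refine WP.cost (k := unit b + (unit b + ((L + 1) * ((unit b + (unit b + 1 * unit b)) +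
    3 * unit b) + 1))) ?_ (by have := one_le_unit b; nlinarith)
  refine WP.assign_bd h.bd 0 (Nat.le_of_ble_eq_true rfl) (by simp) (by simp) (by simp) fun hb => ?_
  refine WP.assign_bd hb 1 (Nat.le_of_ble_eq_true rfl) (by simp) (by simp) (by simp; omega)
    fun hb => ?_
  refine Sure.cons (Sure.count (N := N) (fun i τ => Bd N b τ ∧ Same N (N + 22) a σ τ ∧
    τ.var (N + 27) = i ∧ τ.var (N + 22) = number {j ∈ A | j < i} ∧ τ.var (N + 28) = (2 ^ i : ℕ))
    (by omega) (by simp) (Nat.le_of_ble_eq_true rfl) hLb (fun i hi τ hτ => ?_)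
    (fun i hi τ hτ => ?_) ?_) fun τ hτ => Sure.nil le_rfl ?_
  · obtain ⟨h1, h2, h3, -⟩ := hτ
    exact ⟨h1, h3, by rw [ev_var, h2.var _ (by omega) (by omega), h.length]⟩
  · obtain ⟨h1, h2, h3, h4, h5⟩ := hτ
    have hstep : number {j ∈ A | j < i} + 2 ^ i * (if i ∈ A then 1 else 0)
        = number {j ∈ A | j < i + 1} := by
      by_cases hi' : i ∈ A
      · rw [if_pos hi', mul_one, add_comm]
        have : {j ∈ A | j < i + 1} = insert i {j ∈ A | j < i} := by
          ext j
          simp only [mem_filter, mem_insert]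
          constructor
          · rintro ⟨g1, g2⟩
            by_cases hji : j = i
            · exact Or.inl hji
            · exact Or.inr ⟨g1, by omega⟩
          · rintro (rfl | ⟨g1, g2⟩)
            · exact ⟨hi', by omega⟩
            · exact ⟨g1, by omega⟩
        rw [this]
        unfold number
        rw [sum_insert (by simp)]
      · rw [if_neg hi', mul_zero, add_zero]
        congr 1
        ext j
        simp only [mem_filter, and_congr_right_iff]
        intro hj
        have : j ≠ i := by rintro rfl; exact hi' hj
        omega
    refine WP.assign_bd h1 (number {j ∈ A | j < i + 1}) (Nat.le_of_ble_eq_true rfl) (by simp) ?_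
      (by simpa using hnum (i + 1)) fun hb => ?_
    · rw [ev_add, ev_mul, ev_get, ev_var, ev_var, ev_var, h2.arr _ (by omega), h3, h4, h5, hbits i hi,
        ← hstep]
      push_cast
      rfl
    refine WP.assign_bd hb (2 ^ (i + 1) : ℕ) (Nat.le_of_ble_eq_true rfl) (by simp) ?_
      (by simp only [Nat.abs_cast, Nat.cast_le]; exact hpow _ hi) fun hb => ?_
    · rw [ev_mul, ev_var, Mem.set_var, if_neg (by omega), h5]; push_cast; rw [pow_succ]
      exact mul_comm _ _
    refine Sure.nil_unit (n := 0) ⟨hb, by simp [h3], hb.set ?_, ((h2.set (Or.inr rfl)).set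
      (Or.inl (by omega))).set (Or.inl (by omega)), by simp, by simp, by simp⟩
    simp only [Nat.abs_cast, Nat.cast_le]; omega
  · refine ⟨hb.set (by simp), (((Same.refl _ _ _ _).set (Or.inr rfl)).set (Or.inl (by omega))).set
      (Or.inl (by omega)), by simp, by simp [number], by simp⟩
  · refine ⟨hτ.1, hτ.2.1, ?_⟩
    rw [hτ.2.2.2.1]
    congr 2
    exact filter_true_of_mem fun j hj => mem_range.1 (hA hj)

/-! ### Filling the buckets -/

/-- Puts the elements into the buckets. Cells `2 * k` and `2 * k + 1` of array `N + 7` represent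
bucket `k`. -/
def fillBuckets (N : ℕ) : Cmd := .block [
  .count (N + 27) (8 * var (N + 18)) (.block [.store (N + 7) (var (N + 27)) 0]),
  .count (N + 27) (var (N + 16)) (.block [
    .assign (N + 28) ((get (N + 5) (2 * var (N + 27)) + 2 * get (N + 5) (2 * var (N + 27) + 1)) *
      var (N + 18) + var (N + 22) * get (N + 8) (var (N + 27)) % var (N + 20) / var (N + 19)),
    .store (N + 7) (2 * var (N + 28)) 1,
    .store (N + 7) (2 * var (N + 28) + 1) (get (N + 8) (var (N + 27)))])]

theorem elementKey_lt {P Q : ℕ} (h : 0 < P * Q) (x : ℕ → ℤ) (a : ℕ) (C : Finset ℕ) (i : ℕ) :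
    elementKey P Q x a C i < 4 * Q := by
  have h1 := hash_lt P Q a (x i) h
  have h0 := hash_nonneg P Q a (x i) h
  have hc : colour C i ≤ 3 := by unfold colour; split_ifs <;> omega
  have := Nat.mul_le_mul_right Q hc
  unfold elementKey
  omega

theorem sure_fillBuckets {N b n S P L κ : ℕ} {x : ℕ → ℤ} {σ : Mem} (h : Env N b n S P L κ x σ)
    {C : Finset ℕ} {a : ℕ} (hPS : 0 < P * (S * S))
    (hbits : ∀ i < 2 * n, σ.arr (N + 5) (i : ℕ) = if i ∈ C then 1 else 0)
    (ha : σ.var (N + 22) = a) (hn : n ≤ b) (hS : 64 * (S * S) ≤ b) :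
    Sure d f (fillBuckets N) σ ((8 * (S * S) + n + 3) * (8 * unit b)) fun τ => Bd N b τ ∧
      Same N (N + 27) (N + 7) σ τ ∧ ∀ k < 4 * (S * S),
        τ.arr (N + 7) (2 * k : ℕ) = flag (bucket (elementKey P (S * S) x a C) x n k) ∧
        τ.arr (N + 7) (2 * k + 1 : ℕ) = value (bucket (elementKey P (S * S) x a C) x n k) := by
  have hSS : 0 < S * S := Nat.pos_of_mul_pos_left hPS
  refine WP.cost (k := (8 * (S * S) + 1) * ((unit b + 1 * unit b) + 3 * unit b) +
    ((n + 1) * ((unit b + (unit b + (unit b + 1 * unit b))) + 3 * unit b) + 1)) ?_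
    (by have := one_le_unit b; nlinarith)
  refine Sure.cons (Sure.count (N := N) (fun i τ => Bd N b τ ∧ Same N (N + 27) (N + 7) σ τ ∧
    τ.var (N + 27) = i ∧ ∀ j < i, τ.arr (N + 7) (j : ℕ) = 0)
    (by omega) (by simp) (Nat.le_of_ble_eq_true rfl) (by omega) (fun i hi τ hτ => ?_)
    (fun i hi τ hτ => ?_) ?_) ?_
  · obtain ⟨h1, h2, h3, -⟩ := hτ
    refine ⟨h1, h3, ?_⟩
    rw [ev_mul, ev_var, h2.var _ (by omega) (by omega), h.range]
    push_cast; rfl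
  · obtain ⟨h1, h2, h3, h4⟩ := hτ
    refine WP.store_bd h1 i 0 (Nat.le_of_ble_eq_true rfl) (Nat.le_of_ble_eq_true rfl) (by simp)
      (by simp) (by simpa using h3) (by simp) (by simp) fun hb => ?_
    refine Sure.nil_unit (n := 0) ⟨hb, by simp [h3], hb.set ?_, h2.put.set (Or.inl (by omega)),
      by simp, fun j hj => ?_⟩
    · simp only [Nat.abs_cast, Nat.cast_le]; omega
    · simp only [Mem.set_arr, Mem.put_arr, true_and, Nat.cast_inj]
      split_ifs with hji
      · rfl
      · exact h4 j (by omega)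
  · exact ⟨h.bd.set (by simp), (Same.refl _ _ _ _).set (Or.inl (by omega)), by simp,
      fun j hj => by omega⟩
  rintro τ ⟨hb, hs, -, hz⟩
  set K := elementKey P (S * S) x a C with hK
  refine Sure.cons (Sure.count (N := N) (fun i τ => Bd N b τ ∧ Same N (N + 27) (N + 7) σ τ ∧
    τ.var (N + 27) = i ∧ ∀ k < 4 * (S * S), τ.arr (N + 7) (2 * k : ℕ) = flag (bucket K x i k) ∧
      τ.arr (N + 7) (2 * k + 1 : ℕ) = value (bucket K x i k))
    (by omega) (by simp) (Nat.le_of_ble_eq_true rfl) hn (fun i hi τ hτ => ?_)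
    (fun i hi τ hτ => ?_) ?_) fun τ hτ => Sure.nil le_rfl ⟨hτ.1, hτ.2.1, hτ.2.2.2⟩
  · obtain ⟨h1, h2, h3, -⟩ := hτ
    exact ⟨h1, h3, by rw [ev_var, h2.var _ (by omega) (by omega), h.size]⟩
  · obtain ⟨h1, h2, h3, h4⟩ := hτ
    have hKi : K i < 4 * (S * S) := elementKey_lt hPS x a C i
    have hx : τ.arr (N + 8) (i : ℕ) = x i := by rw [h2.arr _ (by omega), h.input i hi]
    have hxb : |x i| ≤ b := by rw [← hx]; exact h1.arr _ (by omega) _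
    have hv : ∀ y < N + 27, τ.var y = σ.var y := fun y hy => h2.var y hy (by omega)
    refine WP.assign_bd h1 (K i : ℕ) (Nat.le_of_ble_eq_true rfl) (by simp) ?_
      (by simp only [Nat.abs_cast, Nat.cast_le]; omega) fun hb => ?_
    · have c0 : τ.arr (N + 5) (2 * (i : ℤ)) = if 2 * i ∈ C then 1 else 0 := by
        rw [h2.arr _ (by omega)]
        exact_mod_cast hbits (2 * i) (by omega)
      have c1 : τ.arr (N + 5) (2 * (i : ℤ) + 1) = if 2 * i + 1 ∈ C then 1 else 0 := by
        rw [h2.arr _ (by omega)]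
        exact_mod_cast hbits (2 * i + 1) (by omega)
      have hKi' : ((K i : ℕ) : ℤ) = ((if 2 * i ∈ C then 1 else 0) +
          2 * (if 2 * i + 1 ∈ C then 1 else 0)) * (S * S : ℕ) + hash P (S * S) a (x i) := by
        rw [hK, elementKey, colour]
        push_cast
        rw [Int.toNat_of_nonneg (hash_nonneg P (S * S) a (x i) hPS)]
      rw [hKi']
      simp only [ev_add, ev_mul, ev_get, ev_var, ev_mod, ev_div, ev_ofNat, ev_one, h3, c0, c1, hx,
        hv (N + 18) (by omega), hv (N + 19) (by omega), hv (N + 20) (by omega),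
        hv (N + 22) (by omega), h.range, h.modulus, h.shift, ha]
      rfl
    refine WP.store_bd hb (2 * K i : ℕ) 1 (Nat.le_of_ble_eq_true rfl) (Nat.le_of_ble_eq_true rfl)
      (by simp) (by simp) (by simp) (by simp) (by simp; omega) fun hb => ?_
    refine WP.store_bd hb (2 * K i + 1 : ℕ) (x i) (Nat.le_of_ble_eq_true rfl)
      (Nat.le_of_ble_eq_true rfl) (by simp) (by simp) (by simp) (by simp [h3, hx]) hxb fun hb => ?_
    refine Sure.nil_unit (n := 0) ⟨hb, by simp [h3], hb.set ?_, ((h2.set (Or.inl (by omega))).put.put).set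
      (Or.inl (by omega)), by simp, fun k hk => ?_⟩
    · simp only [Nat.abs_cast, Nat.cast_le]; omega
    · simp only [Mem.set_arr, Mem.put_arr, true_and, Nat.cast_inj]
      rw [bucket]
      by_cases hkK : K i = k
      · subst hkK
        rw [if_pos rfl, if_neg (by omega), if_pos rfl, if_pos rfl]
        exact ⟨rfl, rfl⟩
      · rw [if_neg hkK, if_neg (by omega), if_neg (by omega), if_neg (by omega), if_neg (by omega)]
        exact h4 k hk
  · refine ⟨hb.set (by simp), hs.set (Or.inl (by omega)), by simp, fun k hk => ?_⟩
    rw [Mem.set_arr, hz _ (by omega), hz _ (by omega)]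
    exact ⟨rfl, rfl⟩

end FineGrained

namespace FineGrained
open scoped ENNReal
open Finset
open FineGrained.Expr

variable {d : ℕ} {f : ℕ → ℕ}

/-! ### Building the graph of a trial -/

/-- Writes the graph number `q`, where `q` is in register `N + 25`, into array `N + 3`. Register
`N + 26` contains the number by which the weights are decreased.

Registers `N + 29` and `N + 30` are the carry and the block, `N + 31` and `N + 32` the row and the
column of the entry, `N + 33`, `N + 34`, `N + 35` indicate the three kinds of edges, `N + 28` is the
bucket, and `N + 36` tells whether the edge is present. -/
def buildGraph (N : ℕ) : Cmd := .block [
  .store (N + 3) 0 (4 * var (N + 17)),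
  .assign (N + 29) (var (N + 25) / var (N + 17)),
  .assign (N + 30) (var (N + 25) % var (N + 17)),
  .count (N + 27) (16 * var (N + 18)) (.block [
    .assign (N + 31) (var (N + 27) / (4 * var (N + 17))),
    .assign (N + 32) (var (N + 27) % (4 * var (N + 17))),
    .assign (N + 33) (.op .lt (var (N + 31)) (var (N + 17)) *
      .op .lt (var (N + 17) - 1) (var (N + 32)) * .op .lt (var (N + 32)) (2 * var (N + 17))),
    .assign (N + 34) (.op .lt (var (N + 17) - 1) (var (N + 31)) *
      .op .lt (var (N + 31)) (2 * var (N + 17)) *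
      .op .lt (var (N + 31) + var (N + 17) - 1) (var (N + 32)) *
      .op .lt (var (N + 32)) (var (N + 31) + 2 * var (N + 17))),
    .assign (N + 35) (.op .lt (2 * var (N + 17) - 1) (var (N + 31)) *
      .op .lt (var (N + 32)) (var (N + 17))),
    .assign (N + 28)
      (var (N + 33) * (var (N + 18) + (var (N + 31) * var (N + 17) + (var (N + 32) - var (N + 17))))
      + var (N + 34) * (var (N + 30) * var (N + 17) + (var (N + 32) - var (N + 31) - var (N + 17)))
      + var (N + 35) * (2 * var (N + 18) + (0 - var (N + 29) - var (N + 30) * var (N + 17) -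
        var (N + 32) * var (N + 17) - (var (N + 31) - 2 * var (N + 17))) % var (N + 18))),
    .assign (N + 36) (get (N + 6) (var (N + 31)) * get (N + 6) (var (N + 32)) *
      (var (N + 33) + var (N + 34) + var (N + 35)) * get (N + 7) (2 * var (N + 28))),
    .store (N + 3) (2 * var (N + 27) + 1) (var (N + 36)),
    .store (N + 3) (2 * var (N + 27) + 2) (var (N + 36) *
      (get (N + 7) (2 * var (N + 28) + 1) - var (N + 33) * var (N + 26)))])]

section
variable (S r o u v : ℕ)

/-- Indicator of the edges between the first two layers. -/
def kind₁ : ℤ := if u < S ∧ S ≤ v ∧ v < 2 * S then 1 else 0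
/-- Indicator of the edges between the second and the third layer. -/
def kind₂ : ℤ := if S ≤ u ∧ u < 2 * S ∧ u + S ≤ v ∧ v < u + 2 * S then 1 else 0
/-- Indicator of the edges from the third layer to the first one. -/
def kind₃ : ℤ := if 2 * S ≤ u ∧ v < S then 1 else 0

theorem kind₁_eq : kind₁ S u v = (if (u : ℤ) < S then 1 else 0) *
    (if (S : ℤ) - 1 < v then 1 else 0) * (if (v : ℤ) < 2 * S then 1 else 0) := by
  unfold kind₁
  split_ifs <;> first | rfl | (exfalso; omega)

theorem kind₂_eq : kind₂ S u v = (if (S : ℤ) - 1 < u then 1 else 0) *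
    (if (u : ℤ) < 2 * S then 1 else 0) * (if (u : ℤ) + S - 1 < v then 1 else 0) *
    (if (v : ℤ) < u + 2 * S then 1 else 0) := by
  unfold kind₂
  split_ifs <;> first | rfl | (exfalso; omega)

theorem kind₃_eq : kind₃ S u v = (if 2 * (S : ℤ) - 1 < u then 1 else 0) *
    (if (v : ℤ) < S then 1 else 0) := by
  unfold kind₃
  split_ifs <;> first | rfl | (exfalso; omega)

/-- The program computes the bucket of an edge without case distinctions. -/
theorem edgeKey_getD (hS : 0 < S) : kind₁ S u v * ((S * S : ℕ) + ((u : ℤ) * S + (v - S))) +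
    kind₂ S u v * ((r : ℤ) * S + (v - u - S)) +
    kind₃ S u v * (2 * (S * S : ℕ) + (0 - o - r * S - v * S - (u - 2 * S)) % (S * S : ℕ)) =
    ((edgeKey S r o u v).getD 0 : ℕ) := by
  unfold edgeKey kind₁ kind₂ kind₃
  by_cases h1 : u < S ∧ S ≤ v ∧ v < 2 * S
  · rw [if_pos h1, if_neg (by omega), if_neg (by omega), if_pos h1, Option.getD_some]
    push_cast [Nat.cast_sub h1.2.1]
    ring
  · rw [if_neg h1, if_neg h1]
    by_cases h2 : S ≤ u ∧ u < 2 * S ∧ u + S ≤ v ∧ v < u + 2 * S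
    · rw [if_pos h2, if_neg (by omega), if_pos h2, Option.getD_some, Nat.sub_sub]
      push_cast [Nat.cast_sub h2.2.2.1]
      ring
    · rw [if_neg h2, if_neg h2]
      by_cases h3 : 2 * S ≤ u ∧ v < S
      · rw [if_pos h3, if_pos h3, Option.getD_some, zero_sub]
        push_cast
        rw [Int.toNat_of_nonneg (Int.emod_nonneg _ (by positivity))]
        ring
      · rw [if_neg h3, if_neg h3]
        simp

theorem kind_sum : kind₁ S u v + kind₂ S u v + kind₃ S u v =
    if (edgeKey S r o u v).isSome then 1 else 0 := by
  unfold edgeKey kind₁ kind₂ kind₃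
  split_ifs <;> first | rfl | (exfalso; omega) | simp_all

theorem kind₁_of_some {k : ℕ} (h : edgeKey S r o u v = some k) :
    kind₁ S u v = if u < S then 1 else 0 := by
  have := edgeKey_layers h
  unfold kind₁
  split_ifs <;> first | rfl | (exfalso; omega)

theorem edgeKey_getD_lt (hS : 0 < S) (hr : r < S) : (edgeKey S r o u v).getD 0 < 3 * (S * S) := by
  have hSS : 0 < S * S := by positivity
  have hmul : ∀ u v : ℕ, u < S → v < S → u * S + v < S * S := fun u v hu hv => by
    have : (u + 1) * S ≤ S * S := Nat.mul_le_mul_right _ hu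
    linarith
  unfold edgeKey
  split_ifs with h1 h2 h3
  · have := hmul u (v - S) h1.1 (by omega)
    rw [Option.getD_some]; omega
  · have := hmul r (v - u - S) hr (by omega)
    rw [Option.getD_some]; omega
  · have := Int.emod_lt_of_pos (-(o : ℤ) - r * S - v * S - (u - 2 * S)) (b := ((S * S : ℕ) : ℤ))
      (by exact_mod_cast hSS)
    rw [Option.getD_some]; omega
  · rw [Option.getD_none]; omega

variable {S r o u v} (T : ℕ → Option ℤ) (δ : ℤ) (s : Finset ℕ)

theorem flag_bucketWeight : (if u ∈ s then 1 else 0) * (if v ∈ s then 1 else 0) *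
    (kind₁ S u v + kind₂ S u v + kind₃ S u v) * flag (T ((edgeKey S r o u v).getD 0)) =
    flag (bucketWeight S T r o δ s u v) := by
  rw [kind_sum S r o]
  unfold bucketWeight
  by_cases hu : u ∈ s <;> by_cases hv : v ∈ s <;> simp only [hu, hv, and_self, and_true, and_false,
    if_true, if_false] <;> try simp [flag]
  cases h : edgeKey S r o u v with
  | none => simp
  | some k =>
    simp only [Option.isSome_some, if_true, Option.getD_some, Option.bind_some]
    cases T k <;> simp

theorem value_bucketWeight : flag (bucketWeight S T r o δ s u v) *
    (value (T ((edgeKey S r o u v).getD 0)) - kind₁ S u v * δ) =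
    value (bucketWeight S T r o δ s u v) := by
  unfold bucketWeight
  by_cases hs : u ∈ s ∧ v ∈ s
  · rw [if_pos hs]
    cases h : edgeKey S r o u v with
    | none => simp [flag, value]
    | some k =>
      rw [kind₁_of_some S r o u v h]
      simp only [Option.getD_some, Option.bind_some]
      cases T k with
      | none => simp [flag, value]
      | some z => simp [flag, value]
  · rw [if_neg hs]; simp [flag, value]

end

theorem abs_value_bucketWeight_le {S r o : ℕ} {T : ℕ → Option ℤ} {δ : ℤ} (hδ : δ = 0 ∨ δ = 1)
    {s : Finset ℕ} {b : ℕ} (hT : ∀ k z, T k = some z → |z| + 1 ≤ b) (u v : ℕ) :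
    |value (bucketWeight S T r o δ s u v)| ≤ b := by
  cases h : bucketWeight S T r o δ s u v with
  | none => simp [value]
  | some a =>
    unfold bucketWeight at h
    have hc : (u ∈ s ∧ v ∈ s) := by
      by_contra hc
      simp [hc] at h
    rw [if_pos hc] at h
    obtain ⟨k, -, h⟩ := Option.bind_eq_some_iff.1 h
    obtain ⟨z, h1, h2⟩ := Option.map_eq_some_iff.1 h
    have := hT k z h1
    simp only [value, ← h2]
    have hz := neg_abs_le z
    have hz' := le_abs_self z
    rw [abs_le]
    split_ifs <;> omega

theorem sure_buildGraph {N b n S P L κ : ℕ} {x : ℕ → ℤ} {σ : Mem} (h : Env N b n S P L κ x σ)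
    {s : Finset ℕ} {T : ℕ → Option ℤ} {δ : ℤ} {q : ℕ} (hS : 0 < S)
    (hs : ∀ i < 4 * S, σ.arr (N + 6) (i : ℕ) = if i ∈ s then 1 else 0)
    (hT : ∀ k < 4 * (S * S), σ.arr (N + 7) (2 * k : ℕ) = flag (T k) ∧
      σ.arr (N + 7) (2 * k + 1 : ℕ) = value (T k))
    (hTb : ∀ k z, T k = some z → |z| + 1 ≤ b)
    (hq : σ.var (N + 25) = q) (hqS : q < 3 * S) (hδ : σ.var (N + 26) = δ) (hδ01 : δ = 0 ∨ δ = 1)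
    (hSb : 64 * (S * S) ≤ b) :
    Sure d f (buildGraph N) σ ((16 * (S * S) + 4) * (16 * unit b)) fun τ => Bd N b τ ∧
      Same N (N + 27) (N + 3) σ τ ∧
      Holds (τ.arr (N + 3)) (bucketGraph S T (q % S) (q / S) δ s).enc := by
  have hSS : S ≤ S * S := Nat.le_mul_self S
  have hr : q % S < S := Nat.mod_lt _ hS
  have ho : q / S ≤ 3 * S := (Nat.div_le_self _ _).trans hqS.le
  set r := q % S with hr'
  set o := q / S with ho'
  refine WP.cost (k := unit b + (unit b + (unit b + ((16 * (S * S) + 1) * ((unit b + (unit b +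
    (unit b + (unit b + (unit b + (unit b + (unit b + (unit b + (unit b + 1 * unit b))))))))) +
    3 * unit b) + 1)))) ?_ (by have := one_le_unit b; nlinarith)
  refine WP.store_bd h.bd 0 (4 * S : ℕ) (Nat.le_of_ble_eq_true rfl) (Nat.le_of_ble_eq_true rfl)
    (by simp) (by simp) (by simp) (by simp [h.root])
    (by simp only [Nat.abs_cast, Nat.cast_le]; omega) fun hb => ?_
  refine WP.assign_bd hb o (Nat.le_of_ble_eq_true rfl) (by simp) (by simp [h.root, hq, ho'])
    (by simp only [Nat.abs_cast, Nat.cast_le]; omega) fun hb => ?_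
  refine WP.assign_bd hb r (Nat.le_of_ble_eq_true rfl) (by simp) (by simp [h.root, hq, hr'])
    (by simp only [Nat.abs_cast, Nat.cast_le]; omega) fun hb => ?_
  refine Sure.cons (Sure.count (N := N) (fun i τ => Bd N b τ ∧ Same N (N + 27) (N + 3) σ τ ∧
    τ.var (N + 27) = i ∧ τ.var (N + 29) = o ∧ τ.var (N + 30) = r ∧ τ.arr (N + 3) 0 = (4 * S : ℕ) ∧
    ∀ j < i,
      τ.arr (N + 3) (2 * j + 1 : ℕ) = flag (bucketWeight S T r o δ s (j / (4 * S)) (j % (4 * S))) ∧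
      τ.arr (N + 3) (2 * j + 2 : ℕ) = value (bucketWeight S T r o δ s (j / (4 * S)) (j % (4 * S))))
    (by omega) (by simp) (Nat.le_of_ble_eq_true rfl) (by omega) (fun i hi τ hτ => ?_)
    (fun i hi τ hτ => ?_) ?_) fun τ hτ => Sure.nil le_rfl ⟨hτ.1, hτ.2.1, ?_⟩
  · obtain ⟨h1, h2, h3, -⟩ := hτ
    refine ⟨h1, h3, ?_⟩
    rw [ev_mul, ev_var, h2.var _ (by omega) (by omega), h.range]
    push_cast; rfl
  · obtain ⟨h1, h2, h3, h4, h5, h6, h7⟩ := hτ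
    have hv : ∀ y < N + 27, τ.var y = σ.var y := fun y hy => h2.var y hy (by omega)
    have v17 : τ.var (N + 17) = S := by rw [hv _ (by omega), h.root]
    have v18 : τ.var (N + 18) = (S * S : ℕ) := by rw [hv _ (by omega), h.range]
    have v26 : τ.var (N + 26) = δ := by rw [hv _ (by omega), hδ]
    have hv4 : i % (4 * S) < 4 * S := Nat.mod_lt _ (by omega)
    have hu4 : i / (4 * S) < 4 * S := Nat.div_lt_of_lt_mul (by linarith)
    set u := i / (4 * S) with hu
    set v := i % (4 * S) with hv'
    set K := (edgeKey S r o u v).getD 0 with hK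
    have hKlt : K < 3 * (S * S) := edgeKey_getD_lt S r o u v hS hr
    set g := flag (bucketWeight S T r o δ s u v) with hg
    have hgb : |g| ≤ b := (abs_flag_le _).trans (by omega)
    have hk01 : ∀ c : ℤ, c = 0 ∨ c = 1 → |c| ≤ b := by rintro c (rfl | rfl) <;> simp; omega
    have a6 : ∀ y : ℕ, y < 4 * S → τ.arr (N + 6) (y : ℤ) = if y ∈ s then 1 else 0 := fun y hy => by
      rw [h2.arr _ (by omega), hs y hy]
    have a7 : τ.arr (N + 7) (2 * (K : ℤ)) = flag (T K) := by
      rw [h2.arr _ (by omega)]; exact_mod_cast (hT K (by omega)).1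
    have a7' : τ.arr (N + 7) (2 * (K : ℤ) + 1) = value (T K) := by
      rw [h2.arr _ (by omega)]; exact_mod_cast (hT K (by omega)).2
    refine WP.assign_bd h1 u (Nat.le_of_ble_eq_true rfl) (by simp) (by simp [h3, v17, hu])
      (by simp only [Nat.abs_cast, Nat.cast_le]; omega) fun hb => ?_
    refine WP.assign_bd hb v (Nat.le_of_ble_eq_true rfl) (by simp) (by simp [h3, v17, hv'])
      (by simp only [Nat.abs_cast, Nat.cast_le]; omega) fun hb => ?_
    refine WP.assign_bd hb (kind₁ S u v) (Nat.le_of_ble_eq_true rfl) (by simp)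
      (by rw [kind₁_eq]; simp [v17]) (hk01 _ (by unfold kind₁; split_ifs <;> simp)) fun hb => ?_
    refine WP.assign_bd hb (kind₂ S u v) (Nat.le_of_ble_eq_true rfl) (by simp)
      (by rw [kind₂_eq]; simp [v17]) (hk01 _ (by unfold kind₂; split_ifs <;> simp)) fun hb => ?_
    refine WP.assign_bd hb (kind₃ S u v) (Nat.le_of_ble_eq_true rfl) (by simp)
      (by rw [kind₃_eq]; simp [v17]) (hk01 _ (by unfold kind₃; split_ifs <;> simp)) fun hb => ?_
    refine WP.assign_bd hb K (Nat.le_of_ble_eq_true rfl) (by simp)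
      (by rw [hK, ← edgeKey_getD S r o u v hS]; simp [v17, v18, h4, h5])
      (by simp only [Nat.abs_cast, Nat.cast_le]; omega) fun hb => ?_
    refine WP.assign_bd hb g (Nat.le_of_ble_eq_true rfl) (by simp)
      (by rw [hg, ← flag_bucketWeight, ← hK]; simp [a6 u hu4, a6 v hv4, a7]) hgb fun hb => ?_
    refine WP.store_bd hb (2 * i + 1 : ℕ) g (Nat.le_of_ble_eq_true rfl) (Nat.le_of_ble_eq_true rfl)
      (by simp) (by simp) (by simp [h3]) (by simp) hgb fun hb => ?_
    refine WP.store_bd hb (2 * i + 2 : ℕ) (value (bucketWeight S T r o δ s u v))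
      (Nat.le_of_ble_eq_true rfl) (Nat.le_of_ble_eq_true rfl) (by simp) (by simp) (by simp [h3])
      (by rw [← value_bucketWeight, ← hK, ← hg]; simp [a7', v26])
      (abs_value_bucketWeight_le hδ01 hTb u v) fun hb => ?_
    refine Sure.nil_unit (n := 0) ⟨hb, by simp [h3], hb.set ?_, ?_, by simp, by simp [h4],
      by simp [h5], ?_, fun j hj => ?_⟩
    · simp only [Nat.abs_cast, Nat.cast_le]; omega
    · exact ((((((((((h2.set (Or.inl (by omega))).set (Or.inl (by omega))).set
        (Or.inl (by omega))).set (Or.inl (by omega))).set (Or.inl (by omega))).set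
        (Or.inl (by omega))).set (Or.inl (by omega))).put).put).set (Or.inl (by omega)))
    · simp only [Mem.set_arr, Mem.put_arr, true_and]
      rw [if_neg (by omega), if_neg (by omega), h6]
    · simp only [Mem.set_arr, Mem.put_arr, true_and, Nat.cast_inj]
      by_cases hji : j = i
      · subst hji
        rw [if_neg (by omega), if_pos rfl, if_pos rfl]
        exact ⟨rfl, rfl⟩
      · rw [if_neg (by omega), if_neg (by omega), if_neg (by omega), if_neg (by omega)]
        exact h7 j (by omega)
  · refine ⟨hb.set (by simp), ?_, by simp, by simp, by simp, by simp, fun j hj => by omega⟩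
    exact ((((Same.refl _ _ _ _).put).set (Or.inl (by omega))).set (Or.inl (by omega))).set
      (Or.inl (by omega))
  · obtain ⟨-, -, -, -, -, h6, h7⟩ := hτ
    refine (holds_enc _ _).2 ⟨h6, fun u v => ?_⟩
    have hidx := h7 ((u : ℕ) * (4 * S) + v) (by
      have := matrix_index_lt (n := 4 * S) u v
      linarith)
    rw [matrix_index_div (n := 4 * S) u v, matrix_index_mod (n := 4 * S) u v] at hidx
    refine ⟨?_, ?_⟩
    · rw [show (bucketGraph S T r o δ s).w u v = bucketWeight S T r o δ s u v from rfl, ← hidx.1]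
      congr 1
    · rw [show (bucketGraph S T r o δ s).w u v = bucketWeight S T r o δ s u v from rfl, ← hidx.2]
      congr 1

end FineGrained

namespace FineGrained
open scoped ENNReal
open Finset
open FineGrained.Expr

variable {d : ℕ} {f : ℕ → ℕ}

/-! ### A trial -/

/-- Compares the parities of the numbers of negative triangles in graph number `q`, with `q` in
register `N + 25`, before and after decreasing the weights. If they differ, register `N + 23` is set
to `1`. -/
def compare (N : ℕ) (p : Cmd) : Cmd := .block [
  .assign (N + 26) 0,
  buildGraph N,
  call N p,
  .assign (N + 22) (var (N + 14)),
  .assign (N + 26) 1,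
  buildGraph N,
  call N p,
  .assign (N + 23) (1 - (1 - var (N + 23)) * .op .eq (var (N + 22)) (var (N + 14)))]

/-- The parity of the number of negative triangles. -/
noncomputable def WGraph.parity (G : WGraph) : ℤ := ((G.numNegTriangles % 2 : ℕ) : ℤ)

theorem WGraph.parity_cases (G : WGraph) : G.parity = 0 ∨ G.parity = 1 := by
  unfold WGraph.parity; omega

theorem parity_eq_iff (S : ℕ) (T : ℕ → Option ℤ) (r o : ℕ) (s : Finset ℕ) :
    (bucketGraph S T r o 0 s).parity = (bucketGraph S T r o 1 s).parity ↔
      ¬ Odd #{F ∈ zeroFamily S T r o | F ⊆ s} := by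
  unfold WGraph.parity
  rw [numNegTriangles_shift, Nat.odd_iff]
  omega

/-- The facts about the memory that hold during the comparisons of a trial. -/
structure TrialInv (N b n S P L κ : ℕ) (x : ℕ → ℤ) (s : Finset ℕ) (T : ℕ → Option ℤ)
    (σ : Mem) : Prop where
  env : Env N b n S P L κ x σ
  sample : ∀ i < 4 * S, σ.arr (N + 6) (i : ℕ) = if i ∈ s then 1 else 0
  buckets : ∀ k < 4 * (S * S), σ.arr (N + 7) (2 * k : ℕ) = flag (T k) ∧
      σ.arr (N + 7) (2 * k + 1 : ℕ) = value (T k)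

section
variable {N b n S P L κ : ℕ} {x : ℕ → ℤ} {s : Finset ℕ} {T : ℕ → Option ℤ} {σ τ : Mem}

theorem TrialInv.set (h : TrialInv N b n S P L κ x s T σ) {y : ℕ} {z : ℤ}
    (hy : N < y ∧ y < N + 15 ∨ N + 21 < y) (hz : |z| ≤ b) :
    TrialInv N b n S P L κ x s T (σ.set y z) :=
  ⟨h.env.congr (h.env.clean.set (by omega)) (h.env.bd.set hz)
    (fun w _ _ => by rw [Mem.set_var, if_neg (by omega)]) rfl, h.sample, h.buckets⟩

theorem TrialInv.same (h : TrialInv N b n S P L κ x s T σ) (hb : Bd N b τ)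
    (hs : Same N (N + 27) (N + 3) σ τ) : TrialInv N b n S P L κ x s T τ :=
  ⟨h.env.same hs hb (by omega) (by omega) (by omega),
    by rw [hs.arr _ (by omega)]; exact h.sample, by rw [hs.arr _ (by omega)]; exact h.buckets⟩

theorem TrialInv.frame (h : TrialInv N b n S P L κ x s T σ) (hc : Clean N τ) (hb : Bd N b τ)
    (hf : Frame N 15 3 σ τ) : TrialInv N b n S P L κ x s T τ :=
  ⟨h.env.congr hc hb (fun _ h1 _ => hf.var _ h1) (hf.arr _ (by omega)),
    by rw [hf.arr _ (by omega)]; exact h.sample, by rw [hf.arr _ (by omega)]; exact h.buckets⟩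

end

/-- The cost of `buildGraph` followed by an oracle call. -/
def buildCallCost (N b S T B κ : ℕ) : ℕ :=
  (16 * (S * S) + 4) * (16 * unit b) + callCost N b (4 * S) T B κ

theorem WP.cons_wp {p : Cmd} {σ : Mem} {l : List Cmd} {k k' : ℕ} {χ φ : Mem → ℝ≥0∞} {v : ℝ≥0∞}
    (hv : v ≠ ⊤) (hp : WP d f p σ k χ v)
    (hq : ∀ τ, χ τ ≠ ⊤ → WP d f (Cmd.block l) τ k' φ (χ τ)) :
    WP d f (Cmd.block (p :: l)) σ (k + k') φ v := WP.seq hv hp hq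

/-- Building the graph and asking for its parity, with an error that is charged to the potential. -/
theorem wp_buildCall {p : Cmd} {N b n S P L κ Tm B : ℕ} {x : ℕ → ℤ} {s : Finset ℕ}
    {T : ℕ → Option ℤ} {σ : Mem} (hN : p.NamesLt N) (hN2 : 2 ≤ N) (hS : 0 < S)
    (h : TrialInv N b n S P L κ x s T σ) (hTb : ∀ k z, T k = some z → |z| + 1 ≤ b)
    {q : ℕ} (hq : σ.var (N + 25) = q) (hqS : q < 3 * S) {δ : ℤ} (hδ : σ.var (N + 26) = δ)
    (hδ01 : δ = 0 ∨ δ = 1) (hSb : 64 * (S * S) ≤ b) (hκb : 2 * κ + 1 ≤ b)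
    (hrun : ∀ δ : ℤ, δ = 0 ∨ δ = 1 → ∀ r o, GoodRun d f p (bucketGraph S T r o δ s)
      (bucketGraph S T r o δ s).parity Tm B)
    {l : List Cmd} {k' : ℕ} {φ : Mem → ℝ≥0∞} {v : ℝ≥0∞} (hv : v ≠ ⊤)
    (hright : ∀ τ, TrialInv N b n S P L κ x s T τ → (∀ y, N + 15 ≤ y → y < N + 27 →
      τ.var y = σ.var y) → τ.var (N + 14) = (bucketGraph S T (q % S) (q / S) δ s).parity →
      WP d f (Cmd.block l) τ k' φ v)
    (hwrong : ∀ τ, TrialInv N b n S P L κ x s T τ → (∀ y, N + 15 ≤ y → y < N + 27 →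
      τ.var y = σ.var y) → (τ.var (N + 14) = 0 ∨ τ.var (N + 14) = 1) →
      WP d f (Cmd.block l) τ k' φ (v + 1)) :
    WP d f (Cmd.block (buildGraph N :: call N p :: l)) σ (buildCallCost N b S Tm B κ + k') φ
      (v + (8 / 9) ^ κ) := by
  unfold buildCallCost
  rw [add_assoc]
  refine WP.cons (sure_buildGraph h.env hS h.sample h.buckets hTb hq hqS hδ hδ01 hSb) ?_
  rintro τ ⟨hb, hsame, hG⟩
  have hτ := h.same hb hsame
  refine WP.cons_wp (by finiteness) (((wp_call hN hN2 (WGraph.parity_cases _) (hrun δ hδ01 _ _)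
    hτ.env.clean hb hG ?_ hτ.env.runs hκb).add_const v).mono le_rfl (fun _ => le_rfl)
    (by rw [add_comm])) ?_
  · have : (bucketGraph S T (q % S) (q / S) δ s).n = 4 * S := rfl
    rw [this]
    nlinarith
  intro ρ hρ
  obtain ⟨hc, hb', hf, h01⟩ := ind_ne_top (ne_top_of_le_ne_top hρ (le_self_add.trans le_self_add))
  rw [ind_of ⟨hc, hb', hf, h01⟩, zero_add]
  have hρ := hτ.frame hc hb' hf
  have hv : ∀ y, N + 15 ≤ y → y < N + 27 → ρ.var y = σ.var y := fun y h1 h2 => by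
    rw [hf.var y h1, hsame.var y h2 (by omega)]
  split_ifs with hA
  · rw [zero_add]; exact hright ρ hρ hv hA
  · rw [add_comm]; exact hwrong ρ hρ hv h01

open Classical in
/-- `1` if `r` was already `1` or if `Q` holds: the value of register `N + 23` after comparisons that
ought to find `Q`, if no answer is wrong. -/
noncomputable def verdict (r : ℤ) (Q : Prop) : ℤ := if r = 1 ∨ Q then 1 else 0

open Classical in
/-- The verdict is wrong only if one of the two calls gives a wrong answer. -/
theorem wp_compare {p : Cmd} {N b n S P L κ Tm B : ℕ} {x : ℕ → ℤ} {s : Finset ℕ}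
    {T : ℕ → Option ℤ} {σ : Mem} (hN : p.NamesLt N) (hN2 : 2 ≤ N) (hS : 0 < S)
    (h : TrialInv N b n S P L κ x s T σ) (hTb : ∀ k z, T k = some z → |z| + 1 ≤ b)
    {q : ℕ} (hq : σ.var (N + 25) = q) (hqS : q < 3 * S) (hSb : 64 * (S * S) ≤ b)
    (hκb : 2 * κ + 1 ≤ b) (hres : σ.var (N + 23) = 0 ∨ σ.var (N + 23) = 1)
    (hrun : ∀ δ : ℤ, δ = 0 ∨ δ = 1 → ∀ r o, GoodRun d f p (bucketGraph S T r o δ s)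
      (bucketGraph S T r o δ s).parity Tm B) :
    WP d f (compare N p) σ (2 * buildCallCost N b S Tm B κ + 6 * unit b) (fun τ =>
      ind (fun τ => TrialInv N b n S P L κ x s T τ ∧ τ.var (N + 25) = q ∧
        τ.var (N + 24) = σ.var (N + 24) ∧ (τ.var (N + 23) = 0 ∨ τ.var (N + 23) = 1)) τ +
      if τ.var (N + 23) = verdict (σ.var (N + 23)) (Odd #{F ∈ zeroFamily S T (q % S) (q / S) | F ⊆ s})
        then 0 else 1) (2 * (8 / 9) ^ κ) := by
  have hb1 : 1 ≤ b := by nlinarith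
  set V := verdict (σ.var (N + 23)) (Odd #{F ∈ zeroFamily S T (q % S) (q / S) | F ⊆ s}) with hV
  set φ : Mem → ℝ≥0∞ := fun τ => ind (fun τ => TrialInv N b n S P L κ x s T τ ∧
    τ.var (N + 25) = q ∧ τ.var (N + 24) = σ.var (N + 24) ∧ (τ.var (N + 23) = 0 ∨ τ.var (N + 23) = 1)) τ +
    if τ.var (N + 23) = V then 0 else 1 with hφ
  have hfin : ((8 : ℝ≥0∞) / 9) ^ κ ≠ ⊤ := by finiteness
  have h01b : ∀ z : ℤ, z = 0 ∨ z = 1 → |z| ≤ b := by rintro z (rfl | rfl) <;> simp; omega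
  -- The part of the program after the second call.
  have hlast : ∀ τ, TrialInv N b n S P L κ x s T τ → τ.var (N + 25) = q → τ.var (N + 24) = σ.var (N + 24) →
      τ.var (N + 23) = σ.var (N + 23) → ∀ v : ℝ≥0∞,
      ((1 - (1 - τ.var (N + 23)) * (if τ.var (N + 22) = τ.var (N + 14) then 1 else 0) = V) ∨ 1 ≤ v) →
      WP d f (.block [.assign (N + 23) (1 - (1 - var (N + 23)) *
        .op .eq (var (N + 22)) (var (N + 14)))]) τ (unit b + 1 * unit b) φ v := by
    intro τ hτ hτq hτt hτr v hv
    set z : ℤ := 1 - (1 - τ.var (N + 23)) * (if τ.var (N + 22) = τ.var (N + 14) then 1 else 0)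
      with hz
    have hz01 : z = 0 ∨ z = 1 := by
      rw [hz, hτr]
      rcases hres with e | e <;> rw [e] <;> split_ifs <;> simp
    refine WP.assign_bd hτ.env.bd z (Nat.le_of_ble_eq_true rfl) (by simp) (by rw [hz]; rfl)
      (h01b z hz01) fun hb => ?_
    refine WP.nil_unit (n := 0) ?_
    simp only [hφ]
    rw [ind_of ⟨hτ.set (by omega) (h01b z hz01), by simp [hτq], by simp [hτt], by simpa using hz01⟩, zero_add]
    simp only [Mem.set_var, if_true]
    rcases hv with hv | hv
    · rw [if_pos hv]; exact zero_le
    · split_ifs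
      · exact zero_le
      · exact hv
  refine WP.cost (k := unit b + (buildCallCost N b S Tm B κ + (unit b + (unit b +
    (buildCallCost N b S Tm B κ + (unit b + 1 * unit b)))))) ?_ (by omega)
  refine WP.assign_bd h.env.bd 0 (Nat.le_of_ble_eq_true rfl) (by simp) (by simp) (by simp)
    fun hb => ?_
  have h' := h.set (y := N + 26) (z := 0) (by omega) (by simp)
  -- The second half of the comparison, when the first answer was `a`.
  have hhalf : ∀ a : ℤ, a = 0 ∨ a = 1 → ∀ τ, TrialInv N b n S P L κ x s T τ →
      (∀ y, N + 15 ≤ y → y < N + 27 → τ.var y = (σ.set (N + 26) 0).var y) →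
      τ.var (N + 14) = a → ∀ v : ℝ≥0∞, v ≠ ⊤ →
      (a = (bucketGraph S T (q % S) (q / S) 0 s).parity ∨ 1 ≤ v) →
      WP d f (.block [.assign (N + 22) (var (N + 14)), .assign (N + 26) 1, buildGraph N, call N p,
        .assign (N + 23) (1 - (1 - var (N + 23)) * .op .eq (var (N + 22)) (var (N + 14)))]) τ
        (unit b + (unit b + (buildCallCost N b S Tm B κ + (unit b + 1 * unit b)))) φ
        (v + (8 / 9) ^ κ) := by
    intro a ha τ hτ hvar hτa v hvt hv
    refine WP.assign_bd hτ.env.bd a (Nat.le_of_ble_eq_true rfl) (by simp) (by simp [hτa])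
      (h01b a ha) fun hb => ?_
    refine WP.assign_bd hb 1 (Nat.le_of_ble_eq_true rfl) (by simp) (by simp) (h01b 1 (Or.inr rfl))
      fun hb => ?_
    have hρ := (hτ.set (y := N + 22) (by omega) (h01b a ha)).set (y := N + 26) (by omega)
      (h01b 1 (Or.inr rfl))
    have hq' : ((τ.set (N + 22) a).set (N + 26) 1).var (N + 25) = q := by
      simp [hvar (N + 25), hq]
    have hr' : ((τ.set (N + 22) a).set (N + 26) 1).var (N + 23) = σ.var (N + 23) := by
      simp [hvar (N + 23)]
    have ht' : ((τ.set (N + 22) a).set (N + 26) 1).var (N + 24) = σ.var (N + 24) := by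
      simp [hvar (N + 24)]
    have ha' : ((τ.set (N + 22) a).set (N + 26) 1).var (N + 22) = a := by simp
    refine wp_buildCall hN hN2 hS hρ hTb hq' hqS (by simp) (Or.inr rfl) hSb hκb hrun hvt
      (fun ω hω hωv hω14 => ?_) (fun ω hω hωv hω14 => ?_)
    · refine hlast ω hω (by rw [hωv _ (by omega) (by omega), hq'])
        (by rw [hωv _ (by omega) (by omega), ht'])
        (by rw [hωv _ (by omega) (by omega), hr']) v ?_
      refine hv.imp_left fun hv => ?_
      rw [hωv (N + 23) (by omega) (by omega), hωv (N + 22) (by omega) (by omega), hr', ha', hω14, hv,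
        hV, verdict]
      have hpar := parity_eq_iff S T (q % S) (q / S) s
      by_cases ho : Odd #{F ∈ zeroFamily S T (q % S) (q / S) | F ⊆ s}
      · rw [if_neg (by rw [hpar]; exact not_not_intro ho), if_pos (Or.inr ho)]
        ring
      · rw [if_pos (hpar.2 ho)]
        rcases hres with e | e <;> simp [e, ho]
    · refine hlast ω hω (by rw [hωv _ (by omega) (by omega), hq'])
        (by rw [hωv _ (by omega) (by omega), ht'])
        (by rw [hωv _ (by omega) (by omega), hr']) _ (Or.inr le_add_self)
  rw [two_mul]
  refine wp_buildCall hN hN2 hS h' hTb (by simp [hq]) hqS (by simp) (Or.inl rfl) hSb hκb hrun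
    hfin (fun τ hτ hτv hτ14 => ?_) (fun τ hτ hτv hτ14 => ?_)
  · have := hhalf _ (WGraph.parity_cases _) τ hτ hτv hτ14 0 (by simp) (Or.inl rfl)
    rwa [zero_add] at this
  · have := hhalf _ hτ14 τ hτ hτv rfl 1 (by simp) (Or.inr le_rfl)
    rwa [add_comm (1 : ℝ≥0∞)] at this

end FineGrained

namespace FineGrained
open scoped ENNReal
open Finset
open FineGrained.Expr

variable {d : ℕ} {f : ℕ → ℕ}

/-- Draws a hash function, colours and a set of nodes, and looks for an odd number of triangles of
weight zero. -/
def trial (N : ℕ) (p : Cmd) : Cmd := .block [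
  randomBits (N + 27) (N + 4) (var (N + 21)),
  randomBits (N + 27) (N + 5) (2 * var (N + 16)),
  randomBits (N + 27) (N + 6) (4 * var (N + 17)),
  multiplier N,
  fillBuckets N,
  .count (N + 25) (3 * var (N + 17)) (compare N p)]

theorem verdict_verdict (r : ℤ) (P Q : Prop) :
    verdict (verdict r P) Q = verdict r (P ∨ Q) := by
  unfold verdict
  by_cases h1 : r = 1 <;> by_cases h2 : P <;> by_cases h3 : Q <;> simp [h1, h2, h3]

theorem avg_const_add (m : ℕ) (c : ℝ≥0∞) (F : Finset ℕ → ℝ≥0∞) :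
    avg m (fun s => c + F s) = c + avg m F := by
  conv_rhs => rw [← avg_const m c]
  unfold avg
  rw [sum_add_distrib, ENNReal.add_div]

open Classical in
/-- The comparisons of a trial: each of the `6 * S` calls adds at most `(8 / 9) ^ κ` to the error. -/
theorem wp_comparisons {p : Cmd} {N b n S P L κ Tm B : ℕ} {x : ℕ → ℤ} {s : Finset ℕ}
    {T : ℕ → Option ℤ} {σ : Mem} (hN : p.NamesLt N) (hN2 : 2 ≤ N) (hS : 0 < S)
    (h : TrialInv N b n S P L κ x s T σ) (hTb : ∀ k z, T k = some z → |z| + 1 ≤ b)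
    (hSb : 64 * (S * S) ≤ b) (hκb : 2 * κ + 1 ≤ b)
    (hres : σ.var (N + 23) = 0 ∨ σ.var (N + 23) = 1)
    (hrun : ∀ δ : ℤ, δ = 0 ∨ δ = 1 → ∀ r o, GoodRun d f p (bucketGraph S T r o δ s)
      (bucketGraph S T r o δ s).parity Tm B)
    {c y : ℝ≥0∞} (hc : c ≠ ⊤) (hy : y ≤ 1) (A : ℤ) :
    WP d f (.count (N + 25) (3 * var (N + 17)) (compare N p)) σ
      ((3 * S + 1) * (2 * buildCallCost N b S Tm B κ + 9 * unit b)) (fun τ =>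
      ind (fun τ => Env N b n S P L κ x τ ∧ τ.var (N + 24) = σ.var (N + 24) ∧
        (τ.var (N + 23) = 0 ∨ τ.var (N + 23) = 1)) τ + (c + if τ.var (N + 23) = A then 0 else y))
      (c + 6 * S * (8 / 9) ^ κ +
        if verdict (σ.var (N + 23)) (Succeeds S T s) = A then 0 else y) := by
  have hyt : y ≠ ⊤ := ne_top_of_le_ne_top ENNReal.one_ne_top hy
  set η : ℝ≥0∞ := (8 / 9) ^ κ with hη
  have hηt : η ≠ ⊤ := by rw [hη]; finiteness
  have hSS : S ≤ S * S := Nat.le_mul_self S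
  set y' : ℝ≥0∞ := if verdict (σ.var (N + 23)) (Succeeds S T s) = A then 0 else y with hy'
  have hyt' : y' ≠ ⊤ := by rw [hy']; split_ifs <;> simp [hyt]
  set O : ℕ → Prop := fun q => Odd #{F ∈ zeroFamily S T (q % S) (q / S) | F ⊆ s} with hO
  set I : ℕ → Mem → Prop := fun q τ => TrialInv N b n S P L κ x s T τ ∧ τ.var (N + 25) = q ∧
    τ.var (N + 24) = σ.var (N + 24) ∧ (τ.var (N + 23) = 0 ∨ τ.var (N + 23) = 1) with hI
  set W : ℕ → ℝ≥0∞ := fun q => c + y' + 2 * ((3 * S - q : ℕ) : ℝ≥0∞) * η with hW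
  set φ : ℕ → Mem → ℝ≥0∞ := fun q τ => ind (I q) τ + (W q +
    if τ.var (N + 23) = verdict (σ.var (N + 23)) (∃ q' < q, O q') then 0 else 1) with hφ
  have hφI : ∀ q τ, φ q τ ≠ ⊤ → I q τ := fun q τ hq =>
    ind_ne_top (ne_top_of_le_ne_top hq le_self_add)
  have hI0 : I 0 (σ.set (N + 25) 0) := ⟨h.set (by omega) (by simp), by simp, by simp, by simpa⟩
  have hφ0 : φ 0 (σ.set (N + 25) 0) = c + 6 * S * η + y' := by
    simp only [hφ, hW]
    rw [ind_of hI0, zero_add, if_pos, add_zero, Nat.sub_zero]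
    · push_cast; ring
    · simp only [verdict, Mem.set_var]
      rw [if_neg (by omega)]
      rcases hres with e | e <;> simp [e]
  rw [← hφ0]
  refine (WP.count (N := N) (b := b) (m := 3 * S)
    (κ := 2 * buildCallCost N b S Tm B κ + 6 * unit b) φ (by omega) (by simp) (Nat.le_of_ble_eq_true rfl) (by omega)
    (fun q hq τ hτ => ?_) (fun q hq τ hτ => ?_) ?_).mono ?_ (fun τ => ?_) le_rfl
  · obtain ⟨h1, h2, -⟩ := hφI q τ hτ
    exact ⟨h1.env.bd, h2, by rw [ev_mul, ev_var, h1.env.root]; push_cast; rfl⟩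
  · have hτI := hφI q τ hτ
    simp only [hφ]
    rw [ind_of hτI, zero_add]
    obtain ⟨h1, h2, h3, h4⟩ := hτI
    have hcmp := (wp_compare hN hN2 hS h1 hTb h2 hq hSb hκb h4 hrun).add_const (W (q + 1) +
      if τ.var (N + 23) = verdict (σ.var (N + 23)) (∃ q' < q, O q') then 0 else 1)
    refine hcmp.mono le_rfl (fun ρ => ?_) ?_
    · by_cases hρ : TrialInv N b n S P L κ x s T ρ ∧ ρ.var (N + 25) = q ∧
        ρ.var (N + 24) = τ.var (N + 24) ∧ (ρ.var (N + 23) = 0 ∨ ρ.var (N + 23) = 1)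
      · rw [ind_of (Q := fun τ' => TrialInv N b n S P L κ x s T τ' ∧ τ'.var (N + 25) = q ∧
          τ'.var (N + 24) = τ.var (N + 24) ∧ (τ'.var (N + 23) = 0 ∨ τ'.var (N + 23) = 1)) hρ,
          zero_add]
        obtain ⟨g1, g2, g3, g4⟩ := hρ
        have hq1 : |((q + 1 : ℕ) : ℤ)| ≤ b := by simp only [Nat.abs_cast, Nat.cast_le]; omega
        rw [ind_of (Q := I (q + 1)) ⟨g1.set (by omega) hq1, by simp, by simp [g3, h3], by simpa⟩,
          ind_of (Q := fun ρ => Bd N b ρ ∧ ρ.var (N + 25) = q) ⟨g1.env.bd, g2⟩, zero_add, add_zero,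
          add_left_comm]
        refine add_le_add le_rfl ?_
        simp only [Mem.set_var]
        rw [if_neg (show ¬ N + 23 = N + 25 by omega)]
        have hex : (∃ q' < q + 1, O q') ↔ (∃ q' < q, O q') ∨ O q := Nat.exists_lt_succ_right
        by_cases e1 : ρ.var (N + 23) = verdict (τ.var (N + 23)) (O q)
        · by_cases e2 : τ.var (N + 23) = verdict (σ.var (N + 23)) (∃ q' < q, O q')
          · rw [e1, e2, verdict_verdict, ← hex, if_pos rfl]
            exact zero_le
          · rw [if_neg e2]
            refine le_trans ?_ le_add_self
            split_ifs <;> simp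
        · rw [if_neg e1]
          refine le_trans ?_ le_self_add
          split_ifs <;> simp
      · simp [ind, hρ]
    · rw [← add_assoc]
      refine add_le_add ?_ le_rfl
      simp only [hW]
      rw [show 3 * S - q = (3 * S - (q + 1)) + 1 by omega]
      push_cast
      exact le_of_eq (by ring)
  · rw [hφ0]; finiteness
  · refine Nat.mul_le_mul_left _ (by omega)
  · simp only [hφ, hW, Nat.sub_self]
    refine add_le_add ?_ ?_
    · by_cases hτ : I (3 * S) τ
      · rw [ind_of ⟨hτ.1.env, hτ.2.2⟩]; exact zero_le
      · simp [ind, hτ]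
    · rw [Nat.cast_zero, mul_zero, zero_mul, add_zero, add_assoc]
      refine add_le_add le_rfl ?_
      change _ ≤ (if verdict (σ.var (N + 23)) (∃ q' < 3 * S, O q') = A then 0 else y) + _
      by_cases e : τ.var (N + 23) = verdict (σ.var (N + 23)) (∃ q' < 3 * S, O q')
      · rw [e, if_pos rfl, add_zero]
      · rw [if_neg e]
        refine le_trans ?_ le_add_self
        split_ifs
        · exact zero_le
        · exact hy

/-- The cost of a trial. -/
def trialCost (N b n S L T B κ : ℕ) : ℕ :=
  (L + 2 * n + 4 * S + 3) * (6 * unit b) + (L + 2) * (8 * unit b) +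
    (8 * (S * S) + n + 3) * (8 * unit b) +
    (3 * S + 1) * (2 * buildCallCost N b S T B κ + 9 * unit b) + 1

open Classical in
/-- The potential `y` is to be paid if the answer is wrong at the end. It remains to be averaged over the
random bits, up to the errors of the calls. -/
theorem wp_trial {p : Cmd} {N b n S P L κ Tm B M : ℕ} {x : ℕ → ℤ} {σ : Mem} (hN : p.NamesLt N)
    (hN2 : 2 ≤ N) (hS : 0 < S) (hP : 0 < P) (h : Env N b n S P L κ x σ)
    (hx : ∀ i < n, |x i| ≤ M) (hM : M + 1 ≤ b) (hnb : 2 * n ≤ b) (hL : 2 ^ L ≤ b)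
    (hSb : 64 * (S * S) ≤ b) (hκb : 2 * κ + 1 ≤ b)
    (hres : σ.var (N + 23) = 0 ∨ σ.var (N + 23) = 1)
    (hrun : ∀ T : ℕ → Option ℤ, (∀ k z, T k = some z → |z| ≤ M) → ∀ δ : ℤ, δ = 0 ∨ δ = 1 →
      ∀ r o s, GoodRun d f p (bucketGraph S T r o δ s) (bucketGraph S T r o δ s).parity Tm B)
    {c y : ℝ≥0∞} (hc : c ≠ ⊤) (hy : y ≤ 1) (A : ℤ) :
    WP d f (trial N p) σ (trialCost N b n S L Tm B κ) (fun τ =>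
      ind (fun τ => Env N b n S P L κ x τ ∧ τ.var (N + 24) = σ.var (N + 24) ∧
        (τ.var (N + 23) = 0 ∨ τ.var (N + 23) = 1)) τ + (c + if τ.var (N + 23) = A then 0 else y))
      (c + 6 * S * (8 / 9) ^ κ + avg L fun a => avg (2 * n) fun C => avg (4 * S) fun s =>
        if verdict (σ.var (N + 23)) (Succeeds S (bucket (elementKey P (S * S) x (number a) C) x n) s)
          = A then 0 else y) := by
  have hyt : y ≠ ⊤ := ne_top_of_le_ne_top ENNReal.one_ne_top hy
  have hSS : S ≤ S * S := Nat.le_mul_self S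
  have hL' : L ≤ b := Nat.lt_two_pow_self.le.trans hL
  set c' : ℝ≥0∞ := c + 6 * S * (8 / 9) ^ κ with hc'
  have hct : c' ≠ ⊤ := by rw [hc']; finiteness
  set v : Finset ℕ → Finset ℕ → Finset ℕ → ℝ≥0∞ := fun a C s =>
    if verdict (σ.var (N + 23)) (Succeeds S (bucket (elementKey P (S * S) x (number a) C) x n) s)
      = A then 0 else y with hv
  have hvt : ∀ a C s, v a C s ≠ ⊤ := fun a C s => by rw [hv]; simp only; split_ifs <;> simp [hyt]
  have hsame : ∀ {a : ℕ} {ρ τ : Mem}, (∀ y, y ≠ N + 27 → y ≠ N + 27 + 1 → τ.var y = ρ.var y) →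
      (∀ c, c ≠ a → τ.arr c = ρ.arr c) → Same N (N + 27) a ρ τ := fun h1 h2 =>
    ⟨fun y hy _ => h1 y (by omega) (by omega), h2⟩
  have hval : (c' + avg L fun a => avg (2 * n) fun C => avg (4 * S) fun s => v a C s) =
      avg L fun a => avg (2 * n) fun C => avg (4 * S) fun s => c' + v a C s := by
    simp only [avg_const_add]
  rw [hval]
  refine WP.cost (k := (L + 1) * (6 * unit b) + ((2 * n + 1) * (6 * unit b) +
    ((4 * S + 1) * (6 * unit b) + ((L + 2) * (8 * unit b) + ((8 * (S * S) + n + 3) * (8 * unit b) +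
    ((3 * S + 1) * (2 * buildCallCost N b S Tm B κ + 9 * unit b) + 1)))))) ?_
    (by unfold trialCost; nlinarith)
  refine WP.cons_wp (avg_ne_top fun _ => avg_ne_top fun _ => avg_ne_top fun _ =>
    ENNReal.add_ne_top.2 ⟨hct, hvt _ _ _⟩)
    (wp_randomBits (N := N) (by omega) (by simp) (Nat.le_of_ble_eq_true rfl) hL' (by omega) h.bd
    (fun τ h1 h2 => by rw [ev_var, h1 _ (by omega) (by omega), h.length])
    (fun a => avg (2 * n) fun C => avg (4 * S) fun s => c' + v a C s)
    (fun _ => avg_ne_top fun _ => avg_ne_top fun _ => ENNReal.add_ne_top.2 ⟨hct, hvt _ _ _⟩)) ?_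
  intro τ₁ hτ
  have hτ' := ind_ne_top (ne_top_of_le_ne_top hτ le_self_add)
  rw [ind_of hτ', zero_add]
  obtain ⟨hb₁, h1, h2, hbits₁⟩ := hτ'
  have hs₁ := hsame h1 h2
  have he₁ := h.same hs₁ hb₁ (by omega) (by omega) (by omega)
  set a := ones L (τ₁.arr (N + 4)) with ha
  refine WP.cons_wp (avg_ne_top fun _ => avg_ne_top fun _ =>
    ENNReal.add_ne_top.2 ⟨hct, hvt _ _ _⟩)
    (wp_randomBits (N := N) (by omega) (by simp) (Nat.le_of_ble_eq_true rfl) hnb (by omega) hb₁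
    (fun τ h1 h2 => by
      rw [ev_mul, ev_var, h1 _ (by omega) (by omega), he₁.size]; push_cast; rfl)
    (fun C => avg (4 * S) fun s => c' + v a C s)
    (fun _ => avg_ne_top fun _ => ENNReal.add_ne_top.2 ⟨hct, hvt _ _ _⟩)) ?_
  intro τ₂ hτ
  have hτ' := ind_ne_top (ne_top_of_le_ne_top hτ le_self_add)
  rw [ind_of hτ', zero_add]
  obtain ⟨hb₂, h1, h2, hbits₂⟩ := hτ'
  have hs₂ := hsame h1 h2
  have he₂ := he₁.same hs₂ hb₂ (by omega) (by omega) (by omega)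
  set C := ones (2 * n) (τ₂.arr (N + 5)) with hC
  refine WP.cons_wp (avg_ne_top fun _ => ENNReal.add_ne_top.2 ⟨hct, hvt _ _ _⟩)
    (wp_randomBits (N := N) (m := 4 * S) (by omega) (by simp) (Nat.le_of_ble_eq_true rfl) (by omega)
    (by omega) hb₂
    (fun τ h1 h2 => by
      rw [ev_mul, ev_var, h1 _ (by omega) (by omega), he₂.root]; push_cast; rfl)
    (fun s => c' + v a C s)
    (fun _ => ENNReal.add_ne_top.2 ⟨hct, hvt _ _ _⟩)) ?_
  intro τ₃ hτ
  have hτ' := ind_ne_top (ne_top_of_le_ne_top hτ le_self_add)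
  rw [ind_of hτ', zero_add]
  obtain ⟨hb₃, h1, h2, hbits₃⟩ := hτ'
  have hs₃ := hsame h1 h2
  have he₃ := he₂.same hs₃ hb₃ (by omega) (by omega) (by omega)
  set s := ones (4 * S) (τ₃.arr (N + 6)) with hs
  refine WP.cons (sure_multiplier he₃ (A := a) (filter_subset _ _) (fun i hi => ?_) hL
    (a := N + 9) le_rfl) ?_
  · rw [hs₃.arr _ (by omega), hs₂.arr _ (by omega)]
    exact hbits₁ i hi
  rintro τ₄ ⟨hb₄, hs₄, hmult⟩
  have he₄ := he₃.same hs₄ hb₄ (by omega) (by omega) (by omega)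
  refine WP.cons (sure_fillBuckets he₄ (C := C) (by positivity) (fun i hi => ?_) hmult (by omega)
    hSb) ?_
  · rw [hs₄.arr _ (by omega), hs₃.arr _ (by omega)]
    exact hbits₂ i hi
  rintro τ₅ ⟨hb₅, hs₅, hbuck⟩
  have he₅ := he₄.same hs₅ hb₅ (by omega) (by omega) (by omega)
  have hM' : ∀ k z, bucket (elementKey P (S * S) x (number a) C) x n k = some z → |z| ≤ M := by
    intro k z hk
    obtain ⟨i, hi, -, rfl⟩ := exists_of_bucket hk
    exact hx i hi
  have hinv : TrialInv N b n S P L κ x s (bucket (elementKey P (S * S) x (number a) C) x n) τ₅ := by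
    refine ⟨he₅, fun i hi => ?_, hbuck⟩
    rw [hs₅.arr _ (by omega), hs₄.arr _ (by omega)]
    exact hbits₃ i hi
  have hreg : ∀ y, N + 23 ≤ y → y < N + 25 → τ₅.var y = σ.var y := fun y hy hy' => by
    rw [hs₅.var y (by omega) (by omega), hs₄.var y (by omega) (by omega),
      hs₃.var y (by omega) (by omega), hs₂.var y (by omega) (by omega),
      hs₁.var y (by omega) (by omega)]
  have hfin := wp_comparisons hN hN2 hS hinv (fun k z hk => by have := hM' k z hk; omega) hSb hκb
    (by rw [hreg _ (by omega) (by omega)]; exact hres) (fun δ hδ r o => hrun _ hM' δ hδ r o s) hc hy A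
  rw [hreg (N + 23) (by omega) (by omega), hreg (N + 24) (by omega) (by omega)] at hfin
  refine WP.cons_wp ?_ hfin fun τ _ => WP.nil le_rfl le_rfl
  exact ENNReal.add_ne_top.2 ⟨hct, hvt a C s⟩

end FineGrained

namespace FineGrained
open scoped ENNReal
open Finset
open FineGrained.Expr

variable {d : ℕ} {f : ℕ → ℕ}

/-! ### The preparation -/

/-- Puts the `j`-th power of the number in register `N + 18` into register `N + 19`, and its bit
length into register `N + 21`. -/
def hashRange (N : ℕ) : ℕ → Cmd
  | 0 => .block [.assign (N + 19) 1, .assign (N + 21) 0]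
  | j + 1 => .seq (hashRange N j) (.block [
      .assign (N + 19) (var (N + 19) * var (N + 18)),
      .assign (N + 21) (var (N + 21) + var (N + 28))])

/-- Moves the input to array `N + 8` and computes the parameters described in `Env`; `S` is the least
power of two with `S * S ≥ 12 * n`. -/
def setup (N c : ℕ) : Cmd := .block [
  .assign (N + 16) (get 0 0),
  .count (N + 27) (var (N + 16)) (.block [
    .store (N + 8) (var (N + 27)) (get 0 (var (N + 27) + 1))]),
  .count (N + 27) (var (N + 16) + 1) (.block [.store 0 (var (N + 27)) 0]),
  .assign (N + 17) 1,
  .assign (N + 18) 1,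
  .assign (N + 15) 108,
  .assign (N + 28) 0,
  .loop (.op .lt (var (N + 18)) (12 * var (N + 16))) (.block [
    .assign (N + 17) (2 * var (N + 17)),
    .assign (N + 18) (4 * var (N + 18)),
    .assign (N + 15) (var (N + 15) + 6),
    .assign (N + 28) (var (N + 28) + 2)]),
  hashRange N (c + 1),
  .assign (N + 20) (var (N + 19) * var (N + 18)),
  .assign (N + 21) (var (N + 21) + var (N + 28))]

theorem sure_hashRange {N b l : ℕ} {σ : Mem} (hb : Bd N b σ)
    (h18 : σ.var (N + 18) = (2 ^ l * 2 ^ l : ℕ)) (h28 : σ.var (N + 28) = (2 * l : ℕ)) (j : ℕ)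
    (hj : (2 ^ l * 2 ^ l) ^ j ≤ b) (hjb : 2 * l * j ≤ b) (hb1 : 1 ≤ b) :
    Sure d f (hashRange N j) σ ((j + 1) * (4 * unit b)) fun τ => Bd N b τ ∧
      τ.var (N + 19) = ((2 ^ l * 2 ^ l) ^ j : ℕ) ∧ τ.var (N + 21) = (2 * l * j : ℕ) ∧
      (∀ y, y ≠ N + 19 → y ≠ N + 21 → τ.var y = σ.var y) ∧ τ.arr = σ.arr := by
  induction j with
  | zero =>
    refine WP.cost (k := unit b + (unit b + 1 * unit b)) ?_ (by omega)
    refine WP.assign_bd hb 1 (Nat.le_of_ble_eq_true rfl) (by simp) (by simp) (by simp; omega)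
      fun hb => ?_
    refine WP.assign_bd hb 0 (Nat.le_of_ble_eq_true rfl) (by simp) (by simp) (by simp) fun hb => ?_
    exact Sure.nil_unit (n := 0) ⟨hb, by simp, by simp, fun y h1 h2 => by simp [h1, h2], rfl⟩
  | succ j ih =>
    have hpos : 1 ≤ 2 ^ l * 2 ^ l := Nat.one_le_iff_ne_zero.2 (by positivity)
    refine WP.cost (Sure.seq (l := unit b + (unit b + 1 * unit b)) (ih ?_ ?_) ?_)
      (by have := one_le_unit b; nlinarith)
    · exact (Nat.pow_le_pow_right hpos (Nat.le_succ j)).trans hj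
    · exact (Nat.mul_le_mul_left _ (Nat.le_succ j)).trans hjb
    rintro τ ⟨h1, h2, h3, h4, h5⟩
    refine WP.assign_bd h1 ((2 ^ l * 2 ^ l) ^ (j + 1) : ℕ) (Nat.le_of_ble_eq_true rfl) (by simp) ?_
      (by simp only [Nat.abs_cast, Nat.cast_le]; exact hj) fun hb => ?_
    · rw [ev_mul, ev_var, ev_var, h2, h4 _ (by omega) (by omega), h18, pow_succ]
      push_cast; ring
    refine WP.assign_bd hb (2 * l * (j + 1) : ℕ) (Nat.le_of_ble_eq_true rfl) (by simp) ?_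
      (by simp only [Nat.abs_cast, Nat.cast_le]; exact hjb) fun hb => ?_
    · rw [ev_add, ev_var, ev_var, Mem.set_var, Mem.set_var, if_neg (by omega), if_neg (by omega), h3,
        h4 _ (by omega) (by omega), h28, mul_add, mul_one, Nat.cast_add]
    exact Sure.nil_unit (n := 0) ⟨hb, by simp, by simp, fun y g1 g2 => by simp [g1, g2, h4], h5⟩

/-- The cost of the preparation. -/
def setupCost (b n l c : ℕ) : ℕ := (n + l + c + 6) * (16 * unit b)

/-- With `S = 2 ^ l`, the parameter of the hash function is `P = (S * S) ^ (c + 1)`, so that `P` exceeds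
the differences of the numbers, and the oracle calls are repeated `2 * κ` times with
`κ = 6 * l + 108`, so that `6 * S * (8 / 9) ^ κ` is small for all `l`. -/
theorem sure_setup {N b n l c : ℕ} {x : ℕ → ℤ} {σ : Mem} (hv : ∀ y, σ.var y = 0)
    (ha : ∀ a ≠ 0, ∀ i, σ.arr a i = 0) (ha0 : σ.arr 0 0 = n)
    (hax : ∀ i < n, σ.arr 0 ((i : ℤ) + 1) = x i)
    (hout : ∀ i : ℤ, i < 0 ∨ (n : ℤ) < i → σ.arr 0 i = 0)
    (hxb : ∀ i < n, |x i| ≤ b) (hnb : n + 1 ≤ b) (hl : 12 * n ≤ 2 ^ l * 2 ^ l)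
    (hl' : ∀ i < l, 2 ^ i * 2 ^ i < 12 * n) (hb : (2 ^ l * 2 ^ l) ^ (c + 2) ≤ b)
    (hκb : 6 * l + 108 ≤ b) (hlb : 2 * l * (c + 2) ≤ b) :
    Sure d f (setup N c) σ (setupCost b n l c) fun τ =>
      Env N b n (2 ^ l) (2 ^ (2 * l * (c + 1))) (2 * l * (c + 1) + 2 * l) (6 * l + 108) x τ ∧
      τ.var (N + 23) = 0 := by
  have hQ1 : 1 ≤ 2 ^ l * 2 ^ l := Nat.one_le_iff_ne_zero.2 (by positivity)
  have hQb : 2 ^ l * 2 ^ l ≤ b := le_trans (Nat.le_self_pow (by omega) _) hb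
  have hSb : 2 ^ l ≤ b := (Nat.le_mul_self _).trans hQb
  refine WP.cost (k := unit b + ((n + 1) * ((unit b + 1 * unit b) + 3 * unit b) +
    ((n + 1 + 1) * ((unit b + 1 * unit b) + 3 * unit b) + (unit b + (unit b + (unit b + (unit b +
    ((l * (unit b + (unit b + (unit b + (unit b + (unit b + 1 * unit b))))) + unit b) +
    ((c + 1 + 1) * (4 * unit b) + (unit b + (unit b + 1 * unit b))))))))))) ?_
    (by unfold setupCost; nlinarith [one_le_unit b])
  have hbd : Bd N b σ := ⟨fun y _ => by simp [hv], fun a _ i => by rw [ha a (by omega)]; simp⟩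
  refine WP.assign_step n (Nat.le_of_ble_eq_true rfl) (by simp [ha0]; omega) (by simp [ha0]) ?_
  have hbd := hbd.set (x := N + 16) (z := n) (by simp only [Nat.abs_cast, Nat.cast_le]; omega)
  refine Sure.cons (Sure.count (N := N) (m := n) (fun i τ => Bd N b τ ∧ τ.var (N + 27) = i ∧
    τ.var (N + 16) = n ∧ (∀ y, y ≠ N + 16 → y ≠ N + 27 → τ.var y = 0) ∧
    (∀ a, a ≠ N + 8 → τ.arr a = σ.arr a) ∧ ∀ j < i, τ.arr (N + 8) (j : ℕ) = x j)
    (by omega) (by simp) (Nat.le_of_ble_eq_true rfl) (by omega) (fun i hi τ hτ => ?_)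
    (fun i hi τ hτ => ?_) ?_) ?_
  · exact ⟨hτ.1, hτ.2.1, hτ.2.2.1⟩
  · obtain ⟨h1, h2, h3, h4, h5, h6⟩ := hτ
    have hx : τ.arr 0 ((i : ℤ) + 1) = x i := by rw [h5 0 (by omega), hax i hi]
    refine WP.store_step i (x i) (Nat.le_of_ble_eq_true rfl) (Nat.le_of_ble_eq_true rfl)
      (h1.ok (by simp)) ?_ (by simp [h2]) (by simp [h2, hx]) ?_
    · refine ⟨⟨?_, trivial⟩, ?_⟩
      · exact h1.var _ (by omega)
      · rw [ev_add, ev_var, h2, ev_one, hx]; exact hxb i hi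
    have hb := h1.put (a := N + 8) (i := i) (hxb i hi)
    refine Sure.nil_unit (n := 0) ⟨hb, by simp [h2], hb.set ?_, by simp, by simp [h3],
      fun y g1 g2 => by simp [g2, h4 y g1 g2], fun a g => ?_, fun j hj => ?_⟩
    · simp only [Nat.abs_cast, Nat.cast_le]; omega
    · rw [Mem.set_arr, Mem.put_arr_ne _ _ _ g, h5 a g]
    · simp only [Mem.set_arr, Mem.put_arr, true_and, Nat.cast_inj]
      split_ifs with hji
      · rw [hji]
      · exact h6 j (by omega)
  · exact ⟨hbd.set (by simp), by simp, by simp, fun y g1 g2 => by simp [g1, g2, hv],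
      fun _ _ => rfl, fun j hj => by omega⟩
  rintro τ ⟨h1, -, h3, h4, h5, h6⟩
  refine Sure.cons (Sure.count (N := N) (m := n + 1) (fun i ρ => Bd N b ρ ∧ ρ.var (N + 27) = i ∧
    ρ.var (N + 16) = n ∧ (∀ y, y ≠ N + 16 → y ≠ N + 27 → ρ.var y = 0) ∧
    (∀ a, a ≠ 0 → ρ.arr a = τ.arr a) ∧
    ∀ j : ℤ, ρ.arr 0 j = if 0 ≤ j ∧ j < i then 0 else σ.arr 0 j)
    (by omega) (by simp) (Nat.le_of_ble_eq_true rfl) (by omega) (fun i hi ρ hρ => ?_)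
    (fun i hi ρ hρ => ?_) ?_) ?_
  · exact ⟨hρ.1, hρ.2.1, by rw [ev_add, ev_var, hρ.2.2.1]; push_cast; rfl⟩
  · obtain ⟨g1, g2, g3, g4, g5, g6⟩ := hρ
    refine WP.store_bd g1 i 0 (Nat.le_of_ble_eq_true rfl) (Nat.le_of_ble_eq_true rfl) (by simp)
      (by simp) (by simp [g2]) (by simp) (by simp) fun hb => ?_
    refine Sure.nil_unit (n := 0) ⟨hb, by simp [g2], hb.set ?_, by simp, by simp [g3],
      fun y e1 e2 => by simp [e2, g4 y e1 e2], fun a e => ?_, fun j => ?_⟩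
    · simp only [Nat.abs_cast, Nat.cast_le]; omega
    · rw [Mem.set_arr, Mem.put_arr_ne _ _ _ e, g5 a e]
    · simp only [Mem.set_arr, Mem.put_arr, true_and]
      by_cases hji : j = i
      · rw [if_pos hji, if_pos (by omega)]
      · rw [if_neg hji, g6 j]
        congr 1
        exact propext (by omega)
  · exact ⟨h1.set (by simp), by simp, by simp [h3], fun y g1 g2 => by simp [g2, h4 y g1 g2],
      fun _ _ => rfl, fun j => by
        rw [Mem.set_arr, h5 0 (by omega), if_neg (by omega)]⟩
  rintro ρ ⟨g1, -, g3, g4, g5, g6⟩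
  have harr : ∀ a, a ≠ N + 8 → ∀ i, ρ.arr a i = 0 := by
    intro a hne i
    by_cases h0 : a = 0
    · subst h0
      rw [g6]
      split_ifs with hi
      · rfl
      · exact hout i (by omega)
    · rw [g5 a h0, h5 a hne, ha a h0]
  have hinp : ∀ i < n, ρ.arr (N + 8) (i : ℕ) = x i := fun i hi => by
    rw [g5 _ (by omega), h6 i hi]
  refine WP.assign_bd g1 1 (Nat.le_of_ble_eq_true rfl) (by simp) (by simp) (by simp; omega)
    fun hb1 => ?_
  refine WP.assign_bd hb1 1 (Nat.le_of_ble_eq_true rfl) (by simp) (by simp) (by simp; omega)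
    fun hb1 => ?_
  refine WP.assign_bd hb1 108 (Nat.le_of_ble_eq_true rfl) (by simp) (by simp) (by simp; omega)
    fun hb1 => ?_
  refine WP.assign_bd hb1 0 (Nat.le_of_ble_eq_true rfl) (by simp) (by simp) (by simp)
    fun hb1 => ?_
  have hmono : ∀ i ≤ l, 2 ^ i ≤ 2 ^ l := fun i hi => Nat.pow_le_pow_right (by norm_num) hi
  refine Sure.cons (Sure.loop_const l (fun i τ => Bd N b τ ∧ τ.var (N + 16) = n ∧
    τ.var (N + 17) = (2 ^ i : ℕ) ∧ τ.var (N + 18) = (2 ^ i * 2 ^ i : ℕ) ∧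
    τ.var (N + 15) = (6 * i + 108 : ℕ) ∧ τ.var (N + 28) = (2 * i : ℕ) ∧
    (∀ y, y ≠ N + 15 → y ≠ N + 16 → y ≠ N + 17 → y ≠ N + 18 → y ≠ N + 27 → y ≠ N + 28 →
      τ.var y = 0) ∧ τ.arr = ρ.arr) _ (unit b) (fun i hi τ hτ => ?_) (fun i hi τ hτ => ?_) ?_) ?_
  · obtain ⟨e1, e2, -, e4, -⟩ := hτ
    refine ⟨e1.guard (Nat.le_of_ble_eq_true rfl) (by simp), ?_⟩
    rw [ev_lt, ev_mul, ev_var, ev_var, e2, e4]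
    constructor
    · intro hne
      by_contra hcon
      obtain rfl : i = l := by omega
      refine hne (if_neg ?_)
      change ¬ (((2 ^ i * 2 ^ i : ℕ) : ℤ) < 12 * (n : ℤ))
      omega
    · intro hlt
      have := hl' i hlt
      rw [if_pos]
      · simp
      · change (((2 ^ i * 2 ^ i : ℕ) : ℤ) < 12 * (n : ℤ))
        omega
  · obtain ⟨e1, e2, e3, e4, e5, e6, e7, e8⟩ := hτ
    have hS1 := hmono (i + 1) hi
    have hQ1 := Nat.mul_le_mul hS1 hS1
    refine WP.assign_bd e1 (2 ^ (i + 1) : ℕ) (Nat.le_of_ble_eq_true rfl) (by simp) ?_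
      (by simp only [Nat.abs_cast, Nat.cast_le]; omega) fun hb => ?_
    · rw [ev_mul, ev_var, e3, pow_succ, mul_comm (2 ^ i)]; push_cast; rfl
    refine WP.assign_bd hb (2 ^ (i + 1) * 2 ^ (i + 1) : ℕ) (Nat.le_of_ble_eq_true rfl) (by simp) ?_
      (by simp only [Nat.abs_cast, Nat.cast_le]; omega) fun hb => ?_
    · rw [ev_mul, ev_var, Mem.set_var, if_neg (by omega), e4,
        show 2 ^ (i + 1) * 2 ^ (i + 1) = 4 * (2 ^ i * 2 ^ i) by ring]
      push_cast; rfl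
    refine WP.assign_bd hb (6 * (i + 1) + 108 : ℕ) (Nat.le_of_ble_eq_true rfl) (by simp) ?_
      (by simp only [Nat.abs_cast, Nat.cast_le]; omega) fun hb => ?_
    · simp [e5]; ring
    refine WP.assign_bd hb (2 * (i + 1) : ℕ) (Nat.le_of_ble_eq_true rfl) (by simp) ?_
      (by simp only [Nat.abs_cast, Nat.cast_le]; omega) fun hb => ?_
    · simp [e6]; ring
    exact Sure.nil_unit (n := 0) ⟨hb, by simp [e2], by simp, by simp, by simp, by simp,
      fun y y1 y2 y3 y4 y5 y6 => by simp [y1, y3, y4, y6, e7 y y1 y2 y3 y4 y5 y6], by simp [e8]⟩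
  · exact ⟨hb1, by simp [g3], by simp, by simp, by simp, by simp,
      fun y y1 y2 y3 y4 y5 y6 => by simp [y1, y3, y4, y6, g4 y y2 y5], rfl⟩
  rintro ω ⟨e1, e2, e3, e4, e5, e6, e7, e8⟩
  have hpow1 : (2 ^ l * 2 ^ l) ^ (c + 1) ≤ b :=
    (Nat.pow_le_pow_right hQ1 (Nat.le_succ _)).trans hb
  refine Sure.cons (sure_hashRange e1 e4 e6 (c + 1) hpow1
    ((Nat.mul_le_mul_left _ (Nat.le_succ _)).trans hlb) (by omega)) ?_
  rintro θ ⟨t1, t2, t3, t4, t5⟩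
  have hPow : (2 ^ l * 2 ^ l) ^ (c + 1) = 2 ^ (2 * l * (c + 1)) := by
    rw [← pow_add, ← two_mul, ← pow_mul]
  refine WP.assign_bd t1 (2 ^ (2 * l * (c + 1)) * (2 ^ l * 2 ^ l) : ℕ) (Nat.le_of_ble_eq_true rfl)
    (by simp) ?_ ?_ fun hb => ?_
  · rw [ev_mul, ev_var, ev_var, t2, t4 _ (by omega) (by omega), e4, ← hPow]
    push_cast; ring
  · rw [← hPow, ← pow_succ]
    simp only [Nat.abs_cast, Nat.cast_le]
    exact hb
  refine WP.assign_bd hb (2 * l * (c + 1) + 2 * l : ℕ) (Nat.le_of_ble_eq_true rfl) (by simp) ?_ ?_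
    fun hb => ?_
  · simp [t3, t4, e6]
  · simp only [Nat.abs_cast, Nat.cast_le]
    refine le_trans (le_of_eq ?_) hlb
    ring
  refine Sure.nil_unit (n := 0) ⟨⟨⟨fun y hy => ?_, fun a hy i => ?_⟩, hb, ?_, ?_, ?_, ?_, ?_, by simp,
    by simp, fun i hi => ?_⟩, ?_⟩
  · simp only [Mem.set_var]
    rw [if_neg (by omega), if_neg (by omega), t4 y (by omega) (by omega),
      e7 y (by omega) (by omega) (by omega) (by omega) (by omega) (by omega)]
  · rw [Mem.set_arr, Mem.set_arr, t5, e8]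
    exact harr a (by omega) i
  · simp [t4, e5]
  · simp [t4, e2]
  · simp [t4, e3]
  · simp [t4, e4]
  · simp [t2, hPow.symm]
  · rw [Mem.set_arr, Mem.set_arr, t5, e8]
    exact hinp i hi
  · simp [t4, e7]

end FineGrained

namespace FineGrained
open scoped ENNReal
open Finset
open FineGrained.Expr

variable {d : ℕ} {f : ℕ → ℕ}

/-! ### The whole program -/

/-- All trials. Their number is written as a product because the size of an expression counts a literal
by its value. -/
def trials (N : ℕ) (p : Cmd) : Cmd := .count (N + 24) (64 * 96) (trial N p)

/-- Solves 3SUM for numbers bounded by `n ^ c`, where `p` computes the parity of the number of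
negative triangles. -/
def solve (N c : ℕ) (p : Cmd) : Cmd := .block [
  setup N c,
  trials N p,
  .store 1 0 (var (N + 23))]

open Classical in
/-- The hypothesis `hstep` says that a trial leaves a wrong answer wrong with probability at most
`ρ`, and a correct one correct. -/
theorem wp_trials {p : Cmd} {e : Expr} {K N b n S P L κ Tm B M : ℕ} {x : ℕ → ℤ} {σ : Mem} (hN : p.NamesLt N)
    (hN2 : 2 ≤ N) (hS : 0 < S) (hP : 0 < P) (h : Env N b n S P L κ x σ)
    (hx : ∀ i < n, |x i| ≤ M) (hM : M + 1 ≤ b) (hnb : 2 * n ≤ b) (hL : 2 ^ L ≤ b)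
    (hSb : 64 * (S * S) ≤ b) (hκb : 2 * κ + 1 ≤ b) (hb : K ≤ b) (hres : σ.var (N + 23) = 0)
    (hrun : ∀ T : ℕ → Option ℤ, (∀ k z, T k = some z → |z| ≤ M) → ∀ δ : ℤ, δ = 0 ∨ δ = 1 →
      ∀ r o s, GoodRun d f p (bucketGraph S T r o δ s) (bucketGraph S T r o δ s).parity Tm B)
    {ρ : ℝ≥0∞} (hρ : ρ ≤ 1) (he : e.Own N)
    (hsz : e.sz ≤ 190) (he' : ∀ τ, e.ev τ = K) {A : ℤ}
    (hstep : ∀ r : ℤ, r = 0 ∨ r = 1 → ∀ y ≤ (1 : ℝ≥0∞),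
      (avg L fun a => avg (2 * n) fun C => avg (4 * S) fun s => if verdict r
        (Succeeds S (bucket (elementKey P (S * S) x (number a) C) x n) s) = A then 0 else y) ≤
      if r = A then 0 else ρ * y) :
    WP d f (.count (N + 24) e (trial N p)) σ ((K + 1) * (trialCost N b n S L Tm B κ + 3 * unit b)) (fun τ =>
      ind (fun τ => Env N b n S P L κ x τ ∧ (τ.var (N + 23) = 0 ∨ τ.var (N + 23) = 1)) τ +
        if τ.var (N + 23) = A then 0 else 1)
      (K * (6 * S * (8 / 9) ^ κ) + if 0 = A then 0 else ρ ^ K) := by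
  set η : ℝ≥0∞ := 6 * S * (8 / 9) ^ κ with hη
  have hηt : η ≠ ⊤ := by rw [hη]; finiteness
  have hρt : ρ ≠ ⊤ := ne_top_of_le_ne_top ENNReal.one_ne_top hρ
  set I : ℕ → Mem → Prop := fun t τ => Env N b n S P L κ x τ ∧ τ.var (N + 24) = t ∧
    (τ.var (N + 23) = 0 ∨ τ.var (N + 23) = 1) with hI
  set φ : ℕ → Mem → ℝ≥0∞ := fun t τ => ind (I t) τ + (((K - t : ℕ) : ℝ≥0∞) * η +
    if τ.var (N + 23) = A then 0 else ρ ^ (K - t)) with hφ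
  have hφI : ∀ t τ, φ t τ ≠ ⊤ → I t τ := fun t τ hq =>
    ind_ne_top (ne_top_of_le_ne_top hq le_self_add)
  have hset : ∀ {τ : Mem} {z : ℤ}, Env N b n S P L κ x τ → |z| ≤ b →
      Env N b n S P L κ x (τ.set (N + 24) z) := fun hτ hz =>
    hτ.same ((Same.refl N (N + 24) (N + 9) _).set (Or.inr rfl)) (hτ.bd.set hz) (by omega) (by omega)
      (by omega)
  have hI0 : I 0 (σ.set (N + 24) 0) := ⟨hset h (by simp), by simp, by simp [hres]⟩
  have hφ0 : φ 0 (σ.set (N + 24) 0) = K * η + if 0 = A then 0 else ρ ^ K := by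
    simp only [hφ, Mem.set_var]
    rw [ind_of hI0, zero_add, Nat.sub_zero, if_neg (show ¬ N + 23 = N + 24 by omega), hres]
  have hφ0t : φ 0 (σ.set (N + 24) 0) ≠ ⊤ := by
    rw [hφ0]; split_ifs <;> finiteness
  refine (WP.count (N := N) (b := b) (m := K) (κ := trialCost N b n S L Tm B κ) φ (by omega)
    he hsz hb (fun t ht τ hτ => ?_) (fun t ht τ hτ => ?_) hφ0t).mono
    le_rfl (fun τ => ?_) hφ0.le
  · obtain ⟨h1, h2, -⟩ := hφI t τ hτ
    exact ⟨h1.bd, h2, he' τ⟩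
  · have hτI := hφI t τ hτ
    simp only [hφ]
    rw [ind_of hτI, zero_add]
    obtain ⟨h1, h2, h3⟩ := hτI
    have hstep' := hstep _ h3 (ρ ^ (K - (t + 1))) (pow_le_one' hρ _)
    refine (wp_trial hN hN2 hS hP h1 hx hM hnb hL hSb hκb h3 hrun
      (c := ((K - (t + 1) : ℕ) : ℝ≥0∞) * η) (y := ρ ^ (K - (t + 1))) (by finiteness)
      (pow_le_one' hρ _) A).mono le_rfl (fun θ => ?_) ?_
    · by_cases hθ : Env N b n S P L κ x θ ∧ θ.var (N + 24) = τ.var (N + 24) ∧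
        (θ.var (N + 23) = 0 ∨ θ.var (N + 23) = 1)
      · rw [ind_of (Q := fun θ => Env N b n S P L κ x θ ∧ θ.var (N + 24) = τ.var (N + 24) ∧
          (θ.var (N + 23) = 0 ∨ θ.var (N + 23) = 1)) hθ]
        obtain ⟨g1, g2, g3⟩ := hθ
        rw [ind_of (Q := I (t + 1)) ⟨hset g1 (by simp only [Nat.abs_cast, Nat.cast_le]; omega),
          by simp, by simpa⟩, ind_of (Q := fun ρ => Bd N b ρ ∧ ρ.var (N + 24) = t)
          ⟨g1.bd, g2.trans h2⟩]
        simp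
      · simp [ind, hθ]
    · rw [show K - t = (K - (t + 1)) + 1 by omega, ← hη]
      push_cast
      rw [add_mul, one_mul, pow_succ']
      exact add_le_add le_rfl hstep'
  · simp only [hφ, Nat.sub_self, Nat.cast_zero, zero_mul, zero_add, pow_zero]
    refine add_le_add ?_ le_rfl
    by_cases hτ : I K τ
    · rw [ind_of ⟨hτ.1, hτ.2.2⟩]; exact zero_le
    · simp [ind, hτ]

/-- The total error of `6144` trials: calls are wrong with probability at most `6144 * 6 / 2 ^ 18`, as
`(8 / 9) ^ 6 ≤ 1 / 2`, and all trials fail with probability at most `1 / 7`. -/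
theorem trials_error (l : ℕ) : 6144 * (6 * ((2 ^ l : ℕ) : ℝ≥0∞) * (8 / 9) ^ (6 * l + 108)) +
    ENNReal.ofReal (1023 / 1024) ^ 6144 ≤ 1 / 3 := by
  have h1 : (6144 : ℝ) * (6 * 2 ^ l * (8 / 9) ^ (6 * l + 108)) ≤ 6144 * 6 / 2 ^ 18 := by
    have h6 : ((8 / 9 : ℝ)) ^ 6 ≤ 1 / 2 := by norm_num
    have : ((8 / 9 : ℝ)) ^ (6 * l + 108) ≤ (1 / 2) ^ (l + 18) := by
      rw [show 6 * l + 108 = 6 * (l + 18) by ring, pow_mul]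
      exact pow_le_pow_left₀ (by positivity) h6 _
    calc (6144 : ℝ) * (6 * 2 ^ l * (8 / 9) ^ (6 * l + 108))
        ≤ 6144 * (6 * 2 ^ l * (1 / 2) ^ (l + 18)) := by gcongr
      _ = 6144 * 6 / 2 ^ 18 := by
        rw [pow_add, div_pow, one_pow]; field_simp
  have h2 : ((1023 / 1024 : ℝ)) ^ 6144 ≤ 1 / 7 := by
    have hb := one_add_mul_le_pow (a := (1 / 1023 : ℝ)) (by norm_num) 6144
    have h7 : (7 : ℝ) ≤ (1024 / 1023) ^ 6144 := by
      refine le_trans (by norm_num) (hb.trans (le_of_eq ?_)); norm_num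
    have : ((1023 / 1024 : ℝ)) ^ 6144 = ((1024 / 1023 : ℝ) ^ 6144)⁻¹ := by
      rw [← inv_pow]; norm_num
    rw [this, one_div]
    exact inv_anti₀ (by norm_num) h7
  have e : 6144 * (6 * ((2 ^ l : ℕ) : ℝ≥0∞) * (8 / 9) ^ (6 * l + 108)) +
      ENNReal.ofReal (1023 / 1024) ^ 6144 = ENNReal.ofReal (6144 * (6 * 2 ^ l *
        (8 / 9) ^ (6 * l + 108)) + (1023 / 1024) ^ 6144) := by
    rw [ENNReal.ofReal_add (by positivity) (by positivity), ENNReal.ofReal_pow (by norm_num),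
      ENNReal.ofReal_mul (by norm_num), ENNReal.ofReal_mul (by positivity),
      ENNReal.ofReal_mul (by norm_num), ENNReal.ofReal_pow (by norm_num),
      ENNReal.ofReal_pow (by norm_num), show ENNReal.ofReal (8 / 9) = 8 / 9 by
        rw [ENNReal.ofReal_div_of_pos (by norm_num)]; norm_num]
    norm_num
  rw [e, show (1 / 3 : ℝ≥0∞) = ENNReal.ofReal (1 / 3) by
    rw [ENNReal.ofReal_div_of_pos (by norm_num)]; norm_num]
  refine ENNReal.ofReal_le_ofReal ?_
  refine (add_le_add h1 h2).trans ?_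
  norm_num

/-- The numbers of an instance as a function on the natural numbers. -/
def Numbers.elem (X : Numbers) (i : ℕ) : ℤ := if h : i < X.n then X.x ⟨i, h⟩ else 0

theorem Numbers.exists_sum_iff (X : Numbers) :
    (∃ i j k, i < j ∧ j < k ∧ X.x i + X.x j + X.x k = 0) ↔ ∃ i < X.n, ∃ j < X.n, ∃ k < X.n,
      i ≠ j ∧ i ≠ k ∧ j ≠ k ∧ X.elem i + X.elem j + X.elem k = 0 := by
  constructor
  · rintro ⟨i, j, k, hij, hjk, h⟩
    have h1 : (i : ℕ) < j := hij
    have h2 : (j : ℕ) < k := hjk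
    exact ⟨i, i.2, j, j.2, k, k.2, by omega, by omega, by omega, by simpa [Numbers.elem] using h⟩
  · have key : ∀ i j k : Fin X.n, X.x i + X.x j + X.x k = 0 → i ≠ j → i ≠ k → j ≠ k →
        ∃ i j k, i < j ∧ j < k ∧ X.x i + X.x j + X.x k = 0 := by
      intro i j k h hij hik hjk
      rcases lt_or_gt_of_ne hij with h1 | h1 <;> rcases lt_or_gt_of_ne hik with h2 | h2 <;>
        rcases lt_or_gt_of_ne hjk with h3 | h3
      · exact ⟨i, j, k, h1, h3, h⟩
      · exact ⟨i, k, j, h2, h3, by rw [← h]; ring⟩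
      · exact ⟨i, j, k, h1, h3, h⟩
      · exact ⟨k, i, j, h2, h1, by rw [← h]; ring⟩
      · exact ⟨j, i, k, h1, h2, by rw [← h]; ring⟩
      · exact ⟨i, k, j, h2, h3, by rw [← h]; ring⟩
      · exact ⟨j, k, i, h3, h2, by rw [← h]; ring⟩
      · exact ⟨k, j, i, h3, h1, by rw [← h]; ring⟩
    rintro ⟨i, hi, j, hj, k, hk, hij, hik, hjk, h⟩
    refine key ⟨i, hi⟩ ⟨j, hj⟩ ⟨k, hk⟩ (by simpa [Numbers.elem, hi, hj, hk] using h) ?_ ?_ ?_ <;>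
      simpa [Fin.ext_iff]

/-- The cost of the whole program. -/
def solveCost (N b n l c T B : ℕ) : ℕ := setupCost b n l c +
  (6145 * (trialCost N b n (2 ^ l) (2 * l * (c + 1) + 2 * l) T B (6 * l + 108) + 3 * unit b) +
    (unit b + 1 * unit b))

open Classical in
/-- The program errs with probability at most `1 / 3`. -/
theorem wp_solve {p : Cmd} {N b l c Tm B : ℕ} {X : Numbers} (hN : p.NamesLt N) (hN2 : 2 ≤ N)
    (hn : 1 ≤ X.n) (hX : ∀ i, |X.x i| ≤ ((X.n ^ c : ℕ) : ℤ)) (hl : 12 * X.n ≤ 2 ^ l * 2 ^ l)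
    (hl' : ∀ i < l, 2 ^ i * 2 ^ i < 12 * X.n) (hb : 6144 * (2 ^ l * 2 ^ l) ^ (c + 2) ≤ b)
    (hrun : ∀ T : ℕ → Option ℤ, (∀ k z, T k = some z → |z| ≤ ((X.n ^ c : ℕ) : ℤ)) →
      ∀ δ : ℤ, δ = 0 ∨ δ = 1 → ∀ r o s,
      GoodRun d f p (bucketGraph (2 ^ l) T r o δ s) (bucketGraph (2 ^ l) T r o δ s).parity Tm B) :
    WP d f (solve N c p) (start (ThreeSUM.enc X)).mem (solveCost N b X.n l c Tm B) (fun τ =>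
      if τ.arr 1 0 = (if ∃ i j k, i < j ∧ j < k ∧ X.x i + X.x j + X.x k = 0 then 1 else 0)
        then 0 else 1) (1 / 3) := by
  set n := X.n with hnX
  set x := X.elem with hx
  set Q := 2 ^ l * 2 ^ l with hQ
  have hQ1 : 1 ≤ Q := by omega
  have hpow : ∀ k, k ≤ c + 2 → Q ^ k ≤ Q ^ (c + 2) := fun k hk => Nat.pow_le_pow_right hQ1 hk
  have hQ2 := hpow 1 (by omega)
  rw [pow_one] at hQ2
  have hnc : n ^ c ≤ Q ^ c := Nat.pow_le_pow_left (by omega) c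
  have hQc := hpow c (by omega)
  have hl2 : l < 2 ^ l := Nat.lt_two_pow_self
  have hlQ : 2 ^ l ≤ Q := Nat.le_mul_self _
  have hQpow : ∀ k, Q ^ k = 2 ^ (2 * l * k) := fun k => by
    rw [hQ, ← pow_add, ← two_mul, ← pow_mul]
  have hLb : 2 * l * (c + 2) < Q ^ (c + 2) := by rw [hQpow]; exact Nat.lt_two_pow_self
  have hxb : ∀ i < n, |x i| ≤ ((n ^ c : ℕ) : ℤ) := fun i hi => by
    rw [hx, Numbers.elem, dif_pos hi]; exact hX _
  have hk : ∀ i < n, ∀ j < n, |x i - x j| < 2 ^ (2 * l * (c + 1)) := by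
    intro i hi j hj
    have h1 := (abs_sub (x i) (x j)).trans (add_le_add (hxb i hi) (hxb j hj))
    have h2 : 2 * n ^ c < Q ^ (c + 1) := by
      have : 1 ≤ n ^ c := Nat.one_le_pow _ _ hn
      rw [pow_succ]; nlinarith
    rw [hQpow] at h2
    have h3 : ((2 * n ^ c : ℕ) : ℤ) < ((2 ^ (2 * l * (c + 1)) : ℕ) : ℤ) := by exact_mod_cast h2
    push_cast at h1 h3
    linarith
  set A : ℤ := if ∃ i j k, i < j ∧ j < k ∧ X.x i + X.x j + X.x k = 0 then 1 else 0 with hA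
  have henc : ThreeSUM.enc X = (n : ℤ) :: List.ofFn X.x := rfl
  have hlen : (ThreeSUM.enc X).length = n + 1 := by simp [henc, hnX]
  have harr0 : (start (ThreeSUM.enc X)).mem.arr 0 = overwrite (fun _ => 0) (ThreeSUM.enc X) := by
    simp [start]
  have hholds := holds_overwrite (fun _ => 0) (ThreeSUM.enc X)
  rw [henc, holds_cons] at hholds
  refine Sure.seq (sure_setup (n := n) (x := x) (b := b) (fun y => rfl) (fun a ha i => ?_) ?_
    (fun i hi => ?_) (fun i hi => ?_) (fun i hi => (hxb i hi).trans ?_) (by omega) hl hl'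
    (le_trans (Nat.le_mul_of_pos_left _ (by norm_num)) hb) (by omega) (by omega)) ?_
  · simp [start, ha]
  · rw [harr0, henc]; exact hholds.1
  · have := hholds.2 i (by simpa using hi)
    rw [harr0, henc]
    simpa [hx, Numbers.elem, hi, ← hnX] using this
  · rw [harr0, overwrite_of_ge _ _ (by rw [hlen]; push_cast; omega)]
  · simp only [Nat.cast_le]; omega
  rintro σ ⟨hσ, hres⟩
  have hA01 : A = 0 ∨ A = 1 := by rw [hA]; split_ifs <;> simp
  have htr := wp_trials (d := d) (f := f) (e := 64 * 96) (K := 6144) (ρ := if A = 1 then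
      ENNReal.ofReal (1023 / 1024) else 1) (A := A) hN hN2 (by positivity) (by positivity) hσ hxb
    (M := n ^ c) (by omega) (by omega)
    (by rw [show 2 * l * (c + 1) + 2 * l = 2 * l * (c + 2) by ring, ← hQpow]; omega) (by omega)
    (by omega) (by omega) hres hrun ?_ (by simp) (Nat.le_of_ble_eq_true rfl)
    (fun τ => by simp) ?_
  · refine WP.cons_wp (by finiteness) (htr.mono le_rfl (fun _ => le_rfl) ?_) fun τ hτ => ?_
    · refine le_trans (add_le_add (le_of_eq (by push_cast; rfl)) ?_) (trials_error l)
      rcases hA01 with e | e <;> simp [e]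
    have hτ' := ind_ne_top (ne_top_of_le_ne_top hτ le_self_add)
    rw [ind_of hτ', zero_add]
    refine WP.store_bd hτ'.1.bd 0 (τ.var (N + 23)) (Nat.le_of_ble_eq_true rfl)
      (Nat.le_of_ble_eq_true rfl) (by simp) (by simp) (by simp) (by simp)
      (hτ'.1.bd.var _ (by omega)) fun _ => ?_
    refine WP.nil_unit (n := 0) (le_of_eq ?_)
    simp
  · split_ifs
    · exact ENNReal.ofReal_le_one.2 (by norm_num)
    · exact le_rfl
  · intro r hr y hy
    by_cases hsum : ∃ i j k, i < j ∧ j < k ∧ X.x i + X.x j + X.x k = 0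
    · have hA1 : A = 1 := by rw [hA, if_pos hsum]
      obtain ⟨i, hi, j, hj, m, hm, hij, him, hjm, h0⟩ := X.exists_sum_iff.1 hsum
      rw [hA1, if_pos rfl]
      rcases hr with rfl | rfl
      · rw [if_neg (by norm_num)]
        refine le_trans (le_of_eq ?_) (avg_trial_le hk hl hi hj hm hij him hjm h0 y)
        simp [verdict]
      · simp [verdict, avg_const]
    · have hA0 : A = 0 := by rw [hA, if_neg hsum]
      have hno : ∀ a C s, ¬ Succeeds (2 ^ l)
          (bucket (elementKey (2 ^ (2 * l * (c + 1))) Q x a C) x n) s := fun a C s hs =>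
        hsum (X.exists_sum_iff.2 (exists_sum_of_succeeds (by positivity) (by positivity) hs))
      simp only [verdict, ← hQ, hno, or_false]
      rw [hA0]
      rcases hr with rfl | rfl <;> simp [avg_const]

end FineGrained

namespace FineGrained
open scoped ENNReal
open FineGrained.Expr

/-! ### Growth rates -/

/-- `g` grows at most like `m ^ (e + o(1))`, that is, for every `δ > 0` it is `O(m ^ (e + δ))`. The
arguments at which the base `m` vanishes are disregarded. -/
def Soft {α : Type*} (m : α → ℕ) (e : ℝ) (g : α → ℕ) : Prop :=
  ∀ δ > (0 : ℝ), ∃ C : ℝ, ∀ a, 1 ≤ m a → (g a : ℝ) ≤ C * (m a : ℝ) ^ (e + δ)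

namespace Soft
variable {α : Type*} {m : α → ℕ} {e e' : ℝ} {g g' : α → ℕ}

theorem of_le_rpow {C : ℝ} (h : ∀ a, 1 ≤ m a → (g a : ℝ) ≤ C * (m a : ℝ) ^ e) : Soft m e g := by
  intro δ hδ
  refine ⟨max C 0, fun a ha => (h a ha).trans ?_⟩
  have h1 : (1 : ℝ) ≤ m a := by exact_mod_cast ha
  gcongr
  · exact le_max_left _ _
  · linarith

theorem base : Soft m 1 m := of_le_rpow (C := 1) fun a _ => by simp

theorem const (k : ℕ) : Soft m 0 fun _ => k := of_le_rpow (C := k) fun a _ => by simp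

theorem of_le (h : Soft m e g') (hg : ∀ a, 1 ≤ m a → g a ≤ g' a) : Soft m e g := by
  intro δ hδ
  obtain ⟨C, hC⟩ := h δ hδ
  exact ⟨C, fun a ha => le_trans (by exact_mod_cast hg a ha) (hC a ha)⟩

theorem mono (h : Soft m e g) (he : e ≤ e') : Soft m e' g := by
  intro δ hδ
  obtain ⟨C, hC⟩ := h (δ + (e' - e)) (by linarith)
  refine ⟨C, fun a ha => (hC a ha).trans (le_of_eq ?_)⟩
  rw [show e + (δ + (e' - e)) = e' + δ by ring]

theorem add (h : Soft m e g) (h' : Soft m e g') : Soft m e fun a => g a + g' a := by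
  intro δ hδ
  obtain ⟨C, hC⟩ := h δ hδ
  obtain ⟨C', hC'⟩ := h' δ hδ
  refine ⟨C + C', fun a ha => ?_⟩
  push_cast
  rw [add_mul]
  exact add_le_add (hC a ha) (hC' a ha)

theorem mul (h : Soft m e g) (h' : Soft m e' g') : Soft m (e + e') fun a => g a * g' a := by
  intro δ hδ
  obtain ⟨C, hC⟩ := h (δ / 2) (by linarith)
  obtain ⟨C', hC'⟩ := h' (δ / 2) (by linarith)
  refine ⟨C * C', fun a ha => ?_⟩
  have h1 : (0 : ℝ) < m a := by exact_mod_cast ha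
  have := mul_le_mul (hC a ha) (hC' a ha) (Nat.cast_nonneg _) ((Nat.cast_nonneg _).trans (hC a ha))
  push_cast
  refine this.trans (le_of_eq ?_)
  rw [show e + e' + δ = (e + δ / 2) + (e' + δ / 2) by ring, Real.rpow_add h1 (e + δ / 2)]
  ring

theorem pow (h : Soft m e g) (k : ℕ) : Soft m (k * e) fun a => g a ^ k := by
  induction k with
  | zero => simpa using const (m := m) 1
  | succ k ih =>
    have := ih.mul h
    simp only [pow_succ]
    refine this.mono (le_of_eq ?_)
    push_cast; ring

theorem const_mul (h : Soft m e g) (k : ℕ) : Soft m e fun a => k * g a :=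
  ((const k).mul h).mono (by simp)

theorem add_const (h : Soft m e g) (he : 0 ≤ e) (k : ℕ) : Soft m e fun a => g a + k :=
  h.add ((const k).mono he)

/-- Bit lengths grow more slowly than any power. -/
theorem size (h : Soft m e g) : Soft m 0 fun a => (g a).size := by
  intro δ hδ
  obtain ⟨C, hC⟩ := h 1 one_pos
  set r := |e + 1| + 1 with hr
  have hr0 : 0 < r := by positivity
  set η := δ / r with hη
  have hη0 : 0 < η := by positivity
  set C₁ := max C 1 with hC₁
  have hC₁0 : 1 ≤ C₁ := le_max_right _ _
  refine ⟨C₁ ^ η / η / Real.log 2 + 1, fun a ha => ?_⟩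
  have h1 : (1 : ℝ) ≤ m a := by exact_mod_cast ha
  have hmδ : (1 : ℝ) ≤ (m a : ℝ) ^ δ := Real.one_le_rpow h1 hδ.le
  have hlog := Real.log_pos one_lt_two
  rw [zero_add]
  beta_reduce
  rcases Nat.eq_zero_or_pos (g a) with h0 | h0
  · rw [h0, Nat.size_zero, Nat.cast_zero]; positivity
  obtain ⟨s, hs⟩ : ∃ s, (g a).size = s + 1 :=
    Nat.exists_eq_succ_of_ne_zero (Nat.size_pos.2 h0).ne'
  have h2 : 2 ^ s ≤ g a := Nat.lt_size.1 (by omega)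
  have h3 : (2 : ℝ) ^ s ≤ g a := by exact_mod_cast h2
  have h4 : s * Real.log 2 ≤ Real.log (g a) := by
    rw [← Real.log_pow]; exact Real.log_le_log (by positivity) h3
  have h5 : (g a : ℝ) ≤ C₁ * (m a : ℝ) ^ r := by
    refine (hC a ha).trans ?_
    gcongr
    · exact le_max_left _ _
    · rw [hr]; linarith [le_abs_self (e + 1)]
  have h6 : Real.log (g a) ≤ C₁ ^ η / η * (m a : ℝ) ^ δ := by
    refine (Real.log_le_rpow_div (Nat.cast_nonneg _) hη0).trans ?_
    have := Real.rpow_le_rpow (Nat.cast_nonneg _) h5 hη0.le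
    rw [Real.mul_rpow (by positivity) (by positivity), ← Real.rpow_mul (by positivity),
      show r * η = δ by rw [hη]; field_simp] at this
    rw [div_mul_eq_mul_div]
    gcongr
  rw [hs, add_mul, div_mul_eq_mul_div]
  push_cast
  refine add_le_add ?_ (by linarith)
  rw [le_div_iff₀ hlog]
  exact h4.trans h6

theorem unit (h : Soft m e g) : Soft m 0 fun a => FineGrained.unit (g a) := by
  unfold FineGrained.unit
  have h1 := (h.size.add_const le_rfl 1).const_mul 200
  have h2 := ((h1.pow 2).mono (e' := 0) (by simp)).const_mul 2
  refine ((const 1).add h2)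

/-- A function of lower growth is bounded by a power with a smaller exponent. -/
theorem exists_le (h : Soft m e g) (he : e < e') :
    ∃ C : ℝ, 0 ≤ C ∧ ∀ a, 1 ≤ m a → (g a : ℝ) ≤ C * (m a : ℝ) ^ e' := by
  obtain ⟨C, hC⟩ := h (e' - e) (by linarith)
  refine ⟨max C 0, le_max_right _ _, fun a ha => (hC a ha).trans ?_⟩
  rw [show e + (e' - e) = e' by ring]
  gcongr
  exact le_max_left _ _

end Soft

/-! ### Probabilities and queries of executions -/

theorem expect_add_toOuterMeasure (μ : PMF State) (P : State → Prop) [DecidablePred P] :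
    expect μ (fun t => if P t then 0 else 1) + μ.toOuterMeasure {t | P t} = 1 := by
  rw [PMF.toOuterMeasure_apply, expect, ← ENNReal.tsum_add, ← μ.tsum_coe]
  refine tsum_congr fun t => ?_
  by_cases h : P t <;> simp [h]

/-- The two ways to say that an event has probability at least `2 / 3`. -/
theorem expect_le_iff (μ : PMF State) (P : State → Prop) [DecidablePred P] :
    expect μ (fun t => if P t then 0 else 1) ≤ 1 / 3 ↔ 2 / 3 ≤ μ.toOuterMeasure {t | P t} := by
  have h := expect_add_toOuterMeasure μ P
  have h3 : (1 / 3 : ℝ≥0∞) + 2 / 3 = 1 := by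
    rw [ENNReal.div_add_div_same, show (1 + 2 : ℝ≥0∞) = 3 by norm_num]
    exact ENNReal.div_self (by simp) (by simp)
  constructor
  · intro hle
    by_contra hlt
    exact absurd (ENNReal.add_lt_add_of_le_of_lt (ne_top_of_le_ne_top (by finiteness) hle) hle
      (not_le.1 hlt)) (by rw [h, h3]; exact lt_irrefl _)
  · intro hle
    by_contra hlt
    exact absurd (ENNReal.add_lt_add_of_lt_of_le (by finiteness) (not_le.1 hlt) hle)
      (by rw [h, h3]; exact lt_irrefl _)

theorem Exec.one_le_queries {P : Problem} {c : ℕ} {p : Cmd} {s : State} {μ : PMF State}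
    (h : Exec P c p s μ) (hs : ∀ q ∈ s.queries, 1 ≤ q) {t : State} (ht : t ∈ μ.support) :
    ∀ q ∈ t.queries, 1 ≤ q := by
  induction h generalizing t with
  | skip | assign | store | loopDone =>
    rw [PMF.support_pure, Set.mem_singleton_iff] at ht
    subst ht; exact hs
  | flip =>
    obtain ⟨r, -, rfl⟩ := (PMF.mem_support_map_iff _ _ _).1 ht
    exact hs
  | query s a b I hI =>
    rw [PMF.support_pure, Set.mem_singleton_iff] at ht
    subst ht
    intro q hq
    rcases List.mem_cons.1 hq with rfl | hq
    · exact hI.1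
    · exact hs q hq
  | seq s p q μ ν _ _ ih1 ih2 | loopStep s e p μ ν _ _ _ ih1 ih2 =>
    obtain ⟨r, hr, ht⟩ := (PMF.mem_support_bind_iff _ _ _).1 ht
    exact ih2 r hr (ih1 hs hr) ht
  | condTrue _ _ _ _ _ _ _ ih | condFalse _ _ _ _ _ _ _ ih => exact ih hs ht

end FineGrained

namespace FineGrained
open scoped ENNReal
open FineGrained.Expr

/-! ### The growth of the cost -/

namespace Soft
variable {α : Type*} {m : α → ℕ} {e e' : ℝ} {g g' : α → ℕ}

theorem mul_zero (h : Soft m e g) (h' : Soft m 0 g') : Soft m e fun a => g a * g' a :=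
  (h.mul h').mono (by simp)

theorem zero_mul (h : Soft m 0 g) (h' : Soft m e g') : Soft m e fun a => g a * g' a :=
  (h.mul h').mono (by simp)

theorem const_le (he : 0 ≤ e) (k : ℕ) : Soft m e fun _ => k := (const k).mono he

theorem queryCost (d : ℕ) : Soft id 2 (queryCost d) := by
  unfold FineGrained.queryCost FineGrained.queryBound
  have h1 : Soft id 1 fun n => n := base
  have h2 : Soft id 2 fun n : ℕ => n * n := (h1.mul h1).mono (by norm_num)
  exact (((h2.const_mul 144).add ((h1.const_mul 4).mono (by norm_num))).add_const (by norm_num)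
    20).mul_zero ((h1.pow (d + 2)).const_mul 40).unit

theorem simTime {M k : α → ℕ} (hM : Soft m e M) (hk : Soft m e k) :
    Soft m e fun a => simTime (M a) (k a) := by
  unfold FineGrained.simTime
  exact (hk.const_mul 20).mul_zero ((hM.add hk).size.add_const le_rfl 1)

theorem cleanCost (he : 0 ≤ e) (N : ℕ) (h : Soft m e g) : Soft m e fun a => cleanCost N (g a) := by
  unfold FineGrained.cleanCost
  exact ((h.add_const he 1).mul_zero ((h.size.const_mul 8).add_const le_rfl 20)).const_mul (N + 10)

variable {b n T κ : α → ℕ}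

theorem copyLog (hb : Soft m e' b) (hn : Soft m 1 n) : Soft m 2 fun a => copyLog (b a) (n a) := by
  unfold FineGrained.copyLog
  have h2 : Soft m 2 fun a => n a * n a := (hn.mul hn).mono (by norm_num)
  exact (((h2.const_mul 2).add_const (by norm_num) 1).mul_zero ((const 1).add hb.size)).add
    (hb.size.mono (by norm_num))

/-- Calling the oracle costs as much as a run, up to lower factors, as soon as a run may take the time
to write the graph. -/
theorem callCost (he : 2 ≤ e) (N : ℕ) (hb : Soft m e' b) (hn : Soft m 1 n) (hT : Soft m e T)
    (hκ : Soft m 0 κ) : Soft m e fun a => callCost N (b a) (n a) (T a) (T a) (κ a) := by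
  unfold FineGrained.callCost runCost
  have he0 : 0 ≤ e := by linarith
  have h2 : Soft m e fun a => n a * n a := (hn.mul hn).mono (by linarith)
  have hu := hb.unit
  have hc : Soft m e _ := (copyLog hb hn).mono he
  refine ((hκ.const_mul 2).add_const le_rfl 1).zero_mul (Soft.add ?_ ((hu.const_mul 8).mono he0))
  refine (((((Soft.mul_zero ?_ hu).add ((simTime hc hT).add hT)).add ?_).add (hu.mono he0)).add
    (cleanCost he0 N (hc.add hT))).add_const he0 1
  · exact (((h2.const_mul 2).add_const he0 1).const_mul 5).add_const he0 4
  · exact (const_le he0 7).add ((hc.add hT).const_mul 3)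

/-- The cost of the whole program, if the simulated runs have cost `T` and work on graphs of size
`4 * 2 ^ l`. -/
theorem solveCost (he : 2 ≤ e) (N c : ℕ) {b T : ℕ → ℕ} (hb : Soft (fun l => 4 * 2 ^ l) e' b)
    (hT : Soft (fun l => 4 * 2 ^ l) e T) : Soft (fun l => 4 * 2 ^ l) (1 + e) fun l =>
      solveCost N (b l) (2 ^ l * 2 ^ l) l c (T l) (T l) := by
  set m : ℕ → ℕ := fun l => 4 * 2 ^ l with hm
  have h4 : Soft m 1 fun l => 4 * 2 ^ l := base
  have hS : Soft m 1 fun l => 2 ^ l := h4.of_le fun l _ => by omega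
  have hl : Soft m 0 fun l => l := hS.size.of_le fun l _ => by rw [Nat.size_pow]; omega
  have hQ : Soft m 2 fun l => 2 ^ l * 2 ^ l := (hS.mul hS).mono (by norm_num)
  have hu := hb.unit
  have hL : Soft m 0 fun l => 2 * l * (c + 1) + 2 * l :=
    ((hl.const_mul 2).mul_zero (const (c + 1))).add (hl.const_mul 2)
  have hκ : Soft m 0 fun l => 6 * l + 108 := (hl.const_mul 6).add_const le_rfl 108
  have hu' : ∀ k, Soft m 0 fun l => k * FineGrained.unit (b l) := fun k => hu.const_mul k
  have z2 : (0 : ℝ) ≤ 2 := by norm_num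
  have z1 : (0 : ℝ) ≤ 1 := by norm_num
  have hset : Soft m 2 fun l => setupCost (b l) (2 ^ l * 2 ^ l) l c := by
    unfold setupCost
    exact (((hQ.add (hl.mono z2)).add_const z2 c).add_const z2 6).mul_zero (hu' 16)
  have hbuild : Soft m e fun l => buildCallCost N (b l) (2 ^ l) (T l) (T l) (6 * l + 108) := by
    unfold buildCallCost
    exact ((((hQ.const_mul 16).add_const z2 4).mul_zero (hu' 16)).mono he).add
      (callCost he N hb h4 hT hκ)
  have htrial : Soft m (1 + e) fun l => trialCost N (b l) (2 ^ l * 2 ^ l) (2 ^ l)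
      (2 * l * (c + 1) + 2 * l) (T l) (T l) (6 * l + 108) := by
    unfold trialCost
    have h1 : Soft m 2 fun l => (2 * l * (c + 1) + 2 * l + 2 * (2 ^ l * 2 ^ l) + 4 * 2 ^ l + 3) *
        (6 * FineGrained.unit (b l)) :=
      ((((hL.mono z2).add (hQ.const_mul 2)).add (h4.mono (by norm_num))).add_const z2 3).mul_zero
        (hu' 6)
    have h2 : Soft m 0 fun l => (2 * l * (c + 1) + 2 * l + 2) * (8 * FineGrained.unit (b l)) :=
      (hL.add_const le_rfl 2).mul_zero (hu' 8)
    have h3 : Soft m 2 fun l => (8 * (2 ^ l * 2 ^ l) + 2 ^ l * 2 ^ l + 3) *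
        (8 * FineGrained.unit (b l)) :=
      (((hQ.const_mul 8).add hQ).add_const z2 3).mul_zero (hu' 8)
    have h5 : Soft m (1 + e) fun l => (3 * 2 ^ l + 1) *
        (2 * buildCallCost N (b l) (2 ^ l) (T l) (T l) (6 * l + 108) +
          9 * FineGrained.unit (b l)) :=
      ((hS.const_mul 3).add_const z1 1).mul ((hbuild.const_mul 2).add ((hu' 9).mono (by linarith)))
    exact ((((h1.add (h2.mono z2)).add h3).mono (by linarith)).add h5).add_const (by linarith) 1
  unfold FineGrained.solveCost
  exact (hset.mono (by linarith)).add (((htrial.add ((hu' 3).mono (by linarith))).const_mul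
    6145).add ((hu.add (hu' 1)).mono (by linarith)))

end Soft

theorem solveCost_mono {N b n n' l c T B : ℕ} (h : n ≤ n') :
    solveCost N b n l c T B ≤ solveCost N b n' l c T B := by
  unfold solveCost setupCost trialCost
  gcongr

/-! ### Good runs from a reduction -/

/-- The coercion of a list of natural numbers to a list of real numbers, as it is inserted by the
elaborator into sums of powers of query sizes, is the map of the casts. -/
theorem map_coe_list (F : ℝ → ℝ) (l : List ℕ) :
    List.map F (do let a ← l; pure (a : ℝ)) = l.map fun q : ℕ => F q := by
  induction l <;> simp_all [List.bind_eq_flatMap]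

theorem sum_map_le {g : ℕ → ℕ} {F : ℕ → ℝ} {K : ℝ} {l : List ℕ} (hl : ∀ q ∈ l, 1 ≤ q)
    (h : ∀ q, 1 ≤ q → (g q : ℝ) ≤ K * F q) : (((l.map g).sum : ℕ) : ℝ) ≤ K * (l.map F).sum := by
  induction l with
  | nil => simp
  | cons q l ih =>
    rw [List.map_cons, List.map_cons, List.sum_cons, List.sum_cons, mul_add, Nat.cast_add]
    exact add_le_add (h q (hl q (by simp))) (ih fun q hq => hl q (by simp [hq]))

/-- The cost of simulating a query is subcubic if the weight is: the layered graph is built in quadratic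
time. -/
theorem exists_simCost_le {f : ℕ → ℕ} {ε K : ℝ} (hε : 0 < ε)
    (hf : ∀ q, 1 ≤ q → (f q : ℝ) ≤ K * (q : ℝ) ^ (3 - ε)) (d : ℕ) : ∃ ε' > (0 : ℝ), ∃ K' : ℝ, 0 ≤ K' ∧
      ∀ q, 1 ≤ q → (simCost d f q : ℝ) ≤ K' * (q : ℝ) ^ (3 - ε') := by
  obtain ⟨K₁, hK₁, h1⟩ := (Soft.queryCost d).exists_le (e' := 3 - min ε (1 / 2))
    (by have := min_le_right ε (1 / 2); linarith)
  refine ⟨min ε (1 / 2), by positivity, K₁ + |K| * 4 ^ (3 - ε), by positivity, fun q hq => ?_⟩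
  have hq1 : (1 : ℝ) ≤ q := by exact_mod_cast hq
  have h2 := hf (4 * q) (by omega)
  rw [Nat.cast_mul, Real.mul_rpow (by positivity) (by positivity), ← mul_assoc] at h2
  unfold simCost
  rw [Nat.cast_add, add_mul]
  refine add_le_add (h1 q hq) (h2.trans ?_)
  push_cast
  gcongr
  · exact le_abs_self K
  · exact min_le_left _ _

/-- A subcubic reduction from the parity problem provides runs whose cost remains subcubic when
every query of size `q` is charged with the cost of its simulation. -/
theorem exists_goodRun {c d : ℕ} {p : Cmd}
    (htime : ∃ γ > (0 : ℝ), ∃ C : ℝ, ∀ G : WGraph, NWTParity.Admissible c G →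
      ∃ μ : PMF State, Exec NWT d p (start G.enc) μ ∧
        2 / 3 ≤ μ.toOuterMeasure {s | Holds (s.arr 1) (NWTParity.ans G)} ∧
        ∀ s ∈ μ.support, (s.time : ℝ) ≤ C * (G.n : ℝ) ^ (3 - γ))
    (hquery : ∀ ε > (0 : ℝ), ∃ ε' > (0 : ℝ), ∃ C : ℝ, ∀ G : WGraph, NWTParity.Admissible c G →
      ∀ μ : PMF State, Exec NWT d p (start G.enc) μ → ∀ s ∈ μ.support,
        (s.queries.map fun m => (m : ℝ) ^ (3 - ε)).sum ≤ C * (G.n : ℝ) ^ (3 - ε'))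
    {f : ℕ → ℕ} {ε K : ℝ} (hε : 0 < ε) (hf : ∀ q, 1 ≤ q → (f q : ℝ) ≤ K * (q : ℝ) ^ (3 - ε)) :
    ∃ γ : ℝ, 0 < γ ∧ γ ≤ 1 ∧ ∃ C : ℝ, 0 ≤ C ∧ ∀ G : WGraph, NWTParity.Admissible c G →
      GoodRun d f p G G.parity ⌊C * (G.n : ℝ) ^ (3 - γ)⌋₊ ⌊C * (G.n : ℝ) ^ (3 - γ)⌋₊ := by
  obtain ⟨γ, hγ, C, htime⟩ := htime
  obtain ⟨ε₁, hε₁, K₁, hK₁, hsim⟩ := exists_simCost_le hε hf d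
  obtain ⟨ε₂, hε₂, C₂, hquery⟩ := hquery ε₁ hε₁
  refine ⟨min γ (min ε₂ 1), by positivity, (min_le_right _ _).trans (min_le_right _ _),
    |C| + K₁ * |C₂|, by positivity, fun G hG => ?_⟩
  obtain ⟨μ, h1, h2, h3⟩ := htime G hG
  have hn : (1 : ℝ) ≤ G.n := by exact_mod_cast hG.1
  refine ⟨μ, h1, ?_, fun s hs => ⟨Nat.le_floor ?_, Nat.le_floor ?_⟩⟩
  · rw [expect_le_iff]
    refine h2.trans (le_of_eq ?_)
    congr 1
    ext s
    exact holds_singleton _ _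
  · refine (h3 s hs).trans ?_
    gcongr
    · exact (le_abs_self C).trans (le_add_of_nonneg_right (by positivity))
    · exact min_le_left _ _
  · have hq := h1.one_le_queries (by simp [start]) hs
    refine (sum_map_le (F := fun q => (q : ℝ) ^ (3 - ε₁)) hq hsim).trans
      ((mul_le_mul_of_nonneg_left ?_ hK₁).trans (b := K₁ * (C₂ * (G.n : ℝ) ^ (3 - ε₂))) ?_)
    · have := hquery G hG μ h1 s hs
      rwa [map_coe_list] at this
    rw [← mul_assoc]
    gcongr
    · exact (mul_le_mul_of_nonneg_left (le_abs_self C₂) hK₁).trans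
        (le_add_of_nonneg_left (abs_nonneg _))
    · exact (min_le_right _ _).trans (min_le_left _ _)

end FineGrained

namespace FineGrained
open scoped ENNReal
open FineGrained.Expr

/-! ### The reduction from 3SUM -/

/-- The least `l` with `4 ^ l` at least `12 * n` satisfies `4 ^ l ≤ 48 * n`. -/
theorem exists_root {n : ℕ} (hn : 1 ≤ n) : ∃ l, 12 * n ≤ 2 ^ l * 2 ^ l ∧
    (∀ i < l, 2 ^ i * 2 ^ i < 12 * n) ∧ 2 ^ l * 2 ^ l ≤ 48 * n := by
  classical
  have hex : ∃ l, 12 * n ≤ 2 ^ l * 2 ^ l :=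
    ⟨12 * n, Nat.lt_two_pow_self.le.trans (Nat.le_mul_self _)⟩
  have hmin : ∀ i < Nat.find hex, 2 ^ i * 2 ^ i < 12 * n := fun i hi => not_le.1 (Nat.find_min hex hi)
  refine ⟨Nat.find hex, Nat.find_spec hex, hmin, ?_⟩
  rcases h : Nat.find hex with _ | k
  · simp; omega
  · have := hmin k (by omega)
    rw [show 2 ^ (k + 1) * 2 ^ (k + 1) = 4 * (2 ^ k * 2 ^ k) by ring]
    omega

/-- The graphs have about `√n` nodes, so that `n ^ c` is at most the power `2 * c` of the size; the
decrease of the weights by one costs another factor. -/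
theorem bucketGraph_admissible {c n l r o : ℕ} {T : ℕ → Option ℤ} {δ : ℤ} {s : Finset ℕ}
    (hl : 12 * n ≤ 2 ^ l * 2 ^ l) (hT : ∀ k z, T k = some z → |z| ≤ ((n ^ c : ℕ) : ℤ))
    (hδ : δ = 0 ∨ δ = 1) : NWTParity.Admissible (2 * c + 1) (bucketGraph (2 ^ l) T r o δ s) := by
  have hn : (bucketGraph (2 ^ l) T r o δ s).n = 4 * 2 ^ l := rfl
  have hl1 : 1 ≤ 2 ^ l := Nat.one_le_two_pow
  refine ⟨?_, trivial, ?_⟩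
  · change 1 ≤ (bucketGraph (2 ^ l) T r o δ s).n
    omega
  · intro u v a h
    refine (bucketGraph_within hT hδ u v a h).trans ?_
    change _ ≤ (((bucketGraph (2 ^ l) T r o δ s).n ^ (2 * c + 1) : ℕ) : ℤ)
    rw [hn, Nat.cast_le, pow_succ, pow_mul]
    have h1 : n ^ c ≤ ((4 * 2 ^ l) ^ 2) ^ c := Nat.pow_le_pow_left (by nlinarith) c
    have h2 : 1 ≤ ((4 * 2 ^ l) ^ 2) ^ c := Nat.one_le_pow _ _ (by positivity)
    nlinarith

open Classical in
/-- For every weight `f` of the queries that is subcubic, `solve` has subquadratic cost. The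
program does not depend on `f`. -/
theorem exists_solve_le {c d N : ℕ} {p : Cmd} (hN : p.NamesLt N) (hN2 : 2 ≤ N) {f : ℕ → ℕ}
    (hrun : ∃ γ : ℝ, 0 < γ ∧ γ ≤ 1 ∧ ∃ C : ℝ, 0 ≤ C ∧ ∀ G : WGraph, NWTParity.Admissible (2 * c + 1) G →
      GoodRun d f p G G.parity ⌊C * (G.n : ℝ) ^ (3 - γ)⌋₊ ⌊C * (G.n : ℝ) ^ (3 - γ)⌋₊) :
    ∃ γ' > (0 : ℝ), ∃ C' : ℝ, ∀ X : Numbers, ThreeSUM.Admissible c X → ∃ k : ℕ,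
      (k : ℝ) ≤ C' * (X.n : ℝ) ^ (2 - γ') ∧ WP d f (solve N c p) (start (ThreeSUM.enc X)).mem k
      (fun τ => if τ.arr 1 0 = (if ∃ i j k, i < j ∧ j < k ∧ X.x i + X.x j + X.x k = 0 then 1 else 0)
        then 0 else 1) (1 / 3) := by
  obtain ⟨γ, hγ, hγ1, C, hC, hrun⟩ := hrun
  set m : ℕ → ℕ := fun l => 4 * 2 ^ l with hm
  set T : ℕ → ℕ := fun l => ⌊C * (m l : ℝ) ^ (3 - γ)⌋₊ with hT
  obtain ⟨b, hb⟩ : ∃ b : ℕ → ℕ, ∀ l, b l = 6144 * (2 ^ l * 2 ^ l) ^ (c + 2) :=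
    ⟨_, fun _ => rfl⟩
  have hTs : Soft m (3 - γ) T :=
    Soft.of_le_rpow (C := C) fun l _ => Nat.floor_le (by positivity)
  have hS : Soft m 1 fun l => 2 ^ l := Soft.base.of_le fun l _ => by simp only [hm]; omega
  have hbs := (((hS.mul hS).pow (c + 2)).const_mul 6144).of_le fun l _ => (hb l).le
  -- The cost is of order `m ^ (4 - γ + o(1))`, and `m ^ 2` is at most `768 * n`.
  obtain ⟨K, hK, hle⟩ := (Soft.solveCost (by linarith) N c hbs hTs).exists_le
    (e' := 4 - γ / 2) (by linarith)
  refine ⟨γ / 4, by positivity, K * 768 ^ (2 - γ / 4), fun X hX => ?_⟩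
  have hn : 1 ≤ X.n := hX.1
  obtain ⟨l, hl, hl', hl''⟩ := exists_root hn
  refine ⟨solveCost N (b l) X.n l c (T l) (T l), ?_, wp_solve (b := b l) hN hN2 hn
    hX.2.2 hl hl' (hb l).ge fun T hT δ hδ r o s => hrun _ (bucketGraph_admissible hl hT hδ)⟩
  have h1 : solveCost N (b l) X.n l c (T l) (T l) ≤
      solveCost N (b l) (2 ^ l * 2 ^ l) l c (T l) (T l) := solveCost_mono (by omega)
  have h2 : (m l : ℝ) ^ (4 - γ / 2) ≤ (768 * X.n : ℝ) ^ (2 - γ / 4) := by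
    have h3 : ((m l : ℕ) : ℝ) ^ (2 : ℝ) ≤ 768 * X.n := by
      rw [Real.rpow_two]
      have e : m l ^ 2 = 16 * (2 ^ l * 2 ^ l) := by rw [hm]; ring
      have : m l ^ 2 ≤ 768 * X.n := by rw [e]; omega
      exact_mod_cast this
    rw [show 4 - γ / 2 = 2 * (2 - γ / 4) by ring, Real.rpow_mul (by positivity)]
    exact Real.rpow_le_rpow (by positivity) h3 (by linarith)
  have hm1 : 1 ≤ m l := Nat.mul_pos (by norm_num) (by positivity)
  refine (Nat.cast_le.2 h1).trans ((hle l hm1).trans ?_)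
  rw [Real.mul_rpow (by norm_num) (by positivity)] at h2
  rw [mul_assoc]
  gcongr

/-- Only the reduction from the parity problem to Negative Weight Triangle is needed. -/
theorem fgReduction_threeSUM (h : FGReduction 3 3 NWTParity NWT) : FGReduction 2 3 ThreeSUM APSP := by
  classical
  intro c
  obtain ⟨d, p, htime, hquery⟩ := h (2 * c + 1)
  obtain ⟨N₀, hN₀⟩ := p.exists_namesLt
  have hN : p.NamesLt (max N₀ 2) := hN₀.mono (le_max_left _ _)
  have hN2 : 2 ≤ max N₀ 2 := le_max_right _ _
  -- The time is bounded with queries of weight zero, and the queries with `⌈q ^ (3 - ε)⌉` as the weight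
  -- of a query of size `q`; replacing `ε` by `min ε 1` keeps the exponent positive.
  refine ⟨d, solve (max N₀ 2) c p, ?_, fun ε hε => ?_⟩
  · obtain ⟨γ, hγ, C, hwp⟩ := exists_solve_le hN hN2
      (exists_goodRun htime hquery (f := fun _ => 0) (K := 0) one_pos (by simp))
    refine ⟨γ, hγ, C, fun X hX => ?_⟩
    obtain ⟨k, hk, hwp⟩ := hwp X hX
    obtain ⟨μ, h1, h2, h3⟩ := hwp _ rfl
    refine ⟨μ, h1, ?_, fun s hs => le_trans ?_ hk⟩
    · refine ((expect_le_iff μ _).1 h3).trans (le_of_eq ?_)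
      congr 1
      ext s
      exact (holds_singleton _ _).symm
    · have := h2 s hs
      simp only [State.res, start] at this
      exact_mod_cast (Nat.le_add_right _ _).trans (this.trans (by simp))
  · set ε₀ := min ε 1 with hε₀
    have hceil : ∀ q : ℕ, 1 ≤ q → ((⌈(q : ℝ) ^ (3 - ε₀)⌉₊ : ℕ) : ℝ) ≤ 2 * (q : ℝ) ^ (3 - ε₀) := by
      intro q hq
      have h1 : (1 : ℝ) ≤ (q : ℝ) ^ (3 - ε₀) := Real.one_le_rpow (by exact_mod_cast hq) (by
        have := min_le_right ε 1; linarith)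
      have := Nat.ceil_lt_add_one (zero_le_one.trans h1)
      linarith
    obtain ⟨γ, hγ, C, hwp⟩ := exists_solve_le hN hN2
      (exists_goodRun htime hquery (show 0 < ε₀ by positivity) hceil)
    refine ⟨γ, hγ, C, fun X hX μ hμ s hs => ?_⟩
    obtain ⟨k, hk, hwp⟩ := hwp X hX
    obtain ⟨μ', h1, h2, -⟩ := hwp _ rfl
    rw [exec_unique hμ h1] at hs
    have hq := h1.one_le_queries (by simp [start]) hs
    have hres := h2 s hs
    simp only [State.res, start, List.map_nil, List.sum_nil, add_zero, zero_add] at hres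
    refine le_trans ?_ ((Nat.cast_le.2 ((Nat.le_add_left _ _).trans hres)).trans hk)
    rw [map_coe_list, Nat.cast_list_sum, List.map_map]
    refine List.sum_le_sum fun q hqs => ?_
    refine le_trans ?_ (Nat.le_ceil _)
    exact Real.rpow_le_rpow_of_exponent_le (by exact_mod_cast hq q hqs)
      (by have := min_le_left ε 1; linarith)

end FineGrained

theorem mainTheorem3
    (h : FineGrained.SubcubicEquivalent FineGrained.NWTParity FineGrained.NWT) :
    FineGrained.ThreeSUMHard 3 FineGrained.APSP :=
  FineGrained.fgReduction_threeSUM h.1
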